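/- **Setting.** A *Gauss diagram* $G$ is an oriented line $\uparrow$ together with finitely many signed arrows whose $2n$ endpoints are distinct points of the line; the arrows are the crossings, an arrow points from the upper to the lower strand, and the sign of the crossing $i$ is $s_i=\pm1$. A *(long) w-knot* $K$ is an equivalence class of Gauss diagrams (long virtual knot diagrams) under the Reidemeister moves R2 and R3, the weak move R1$^s$ (an isolated arrow of sign $s$ may be replaced by the oppositely directed isolated arrow of sign $s$), and OC ("overcrossings commute": two neighbouring tails may be exchanged). The self-linking number is $sl(K)=\sum_i s_i$. $\mathcal A^{sw}(\uparrow)$ is the graded $\mathbb Q$-algebra (completed with respect to the degree, i.e. the number of arrows; the product is concatenation) of formal linear combinations of unsigned arrow diagrams on $\uparrow$ modulo the relations TC (neighbouring tails commute), directed 4T (for an arrow head $h$ and an arrow $c$: the difference of the diagrams with $h$ just before and just after one end of $c$, plus the same difference at the other end of $c$, is $0$), and RI (an isolated arrow may be reversed). $D_A$ is the diagram with one arrow. For $k\ge1$ the $k$-wheel is the w-Jacobi diagram that consists of an oriented cycle of $k$ internal vertices and $k$ spokes that point from the skeleton to these vertices; resolving its internal vertices by the directed STU relations gives the element $$w_k=t_0t_1\cdots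 t_{k-2}\cdot\bigl[\,[h_0,[h_1,\dots,[h_{k-2},h_{k-1}]\dots]],\;t_{k-1}\bigr]\in\mathcal A^{sw}(\uparrow),$$ where $t_i$ and $h_i$ stand for the tail and the head of the arrow $i$ placed along the line, and $w_0=1$. The *expansion* $Z(K)\in\mathcal A^{sw}(\uparrow)$ is obtained from any Gauss diagram of $K$ by replacing each arrow $a$ of sign $\pm$ by the exponential reservoir $e^{\pm a}=\sum_m\frac{(\pm1)^m}{m!}\,(m\text{ parallel copies of }a)$; this is an invariant of w-knots. For a Gauss diagram of $K$ let $T_{ij}=1$ if the lower strand of the crossing $j$ lies in the open interval between the two visits of the line to the crossing $i$, and $T_{ij}=0$ otherwise; let $d_i=1$ if the upper strand of $i$ is visited before its lower strand, and $d_i=-1$ otherwise; let $S=\mathrm{diag}(s_id_i)$, $X^{-S}=\mathrm{diag}(X^{-s_id_i})$, and $$A(K)=\det\bigl(I+T(I-X^{-S})\bigr)\in\mathbb Z[X,X^{-1}].$$ **Theorem.** Let $w\colon\mathbb Q[[x]]\to\mathcal A^{sw}(\uparrow)$ be the linear map $x^k\mapsto w_k$. 1. For every long w-knot $K$, and $A(K)$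 computed from any Gauss diagram of $K$, $$Z(K)=\exp\bigl(sl(K)\,D_A\bigr)\cdot\exp\bigl(-w(\log A(K)(e^x))\bigr),$$ where the logarithm and $e^x$ are taken in $\mathbb Q[[x]]$ and the two outer exponentials in $\mathcal A^{sw}(\uparrow)$. 2. Let $\mathcal A^{\mathrm{reduced}}$ be the quotient of $\mathcal A^{sw}(\uparrow)$ by the relations $D_A=0$ and $w_kw_l=w_{k+l}$ for $k,l\ne1$, completed with respect to the degree. Then $x^k\mapsto w_k$ identifies, linearly and multiplicatively, the space of power series in $\mathbb Q[[x]]$ without linear term with $\mathcal A^{\mathrm{reduced}}$. 3. For every long w-knot $K$, and $A(K)$ computed from any Gauss diagram of $K$, the power series $A(K)(e^x)$ has constant term $1$ and no linear term, and with the identification of part 2 the image of $Z(K)$ in $\mathcal A^{\mathrm{reduced}}$ is $$Z(K)=A(K)^{-1}(e^x).$$ -/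

import Mathlib

namespace WKnots

/-! ### Arrow diagrams on the line and the algebra `𝒜ˢʷ(↑)` -/

/-- One end of an arrow, as met while walking along the skeleton line: `tail a` is the starting point
and `head a` is the end point (the arrowhead) of the arrow named `a`. -/
inductive Leg where
  | tail (a : ℕ) : Leg
  | head (a : ℕ) : Leg
  deriving DecidableEq

namespace Leg
/-- The name of the arrow to which a leg belongs. -/
def label : Leg → ℕ
  | tail a => a
  | head a => a
/-- Renames arrows. -/
def map (f : ℕ → ℕ) : Leg → Leg
  | tail a => tail (f a)
  | head a => head (f a)

@[simp] theorem map_tail (f : ℕ → ℕ) (a : ℕ) : map f (tail a) = tail (f a) := rfl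
@[simp] theorem map_head (f : ℕ → ℕ) (a : ℕ) : map f (head a) = head (f a) := rfl
@[simp] theorem label_tail (a : ℕ) : label (tail a) = a := rfl
@[simp] theorem label_head (a : ℕ) : label (head a) = a := rfl

theorem map_injective {f : ℕ → ℕ} (hf : Function.Injective f) : Function.Injective (map f) := by
  rintro (a | a) (b | b) h <;> simp_all [map, hf.eq_iff]
end Leg

open Leg

/-- A word of legs describes an arrow diagram on the line when every leg occurs at most once, and an
arrow has its tail in the word exactly when it has its head there. -/
def WF (w : List Leg) : Prop :=
  w.Nodup ∧ ∀ a, tail a ∈ w ↔ head a ∈ w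

theorem WF.perm {w w' : List Leg} (h : w.Perm w') : WF w ↔ WF w' := by
  simp [WF, h.nodup_iff, h.mem_iff]

theorem WF.nil : WF [] := by simp [WF]

theorem wf_map {f : ℕ → ℕ} (hf : Function.Injective f) (w : List Leg) :
    WF (w.map (Leg.map f)) ↔ WF w := by
  unfold WF
  rw [List.nodup_map_iff (map_injective hf)]
  refine and_congr_right fun _ => ⟨fun h a => ?_, fun h a => ?_⟩
  · have h1 : tail a ∈ w ↔ tail (f a) ∈ w.map (Leg.map f) :=
      (List.mem_map_of_injective (map_injective hf) (a := tail a)).symm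
    have h2 : head a ∈ w ↔ head (f a) ∈ w.map (Leg.map f) :=
      (List.mem_map_of_injective (map_injective hf) (a := head a)).symm
    rw [h1, h2, h]
  · by_cases ha : ∃ b, f b = a
    · obtain ⟨b, rfl⟩ := ha
      rw [← map_tail, ← map_head, List.mem_map_of_injective (map_injective hf),
        List.mem_map_of_injective (map_injective hf), h]
    · push Not at ha
      constructor <;> intro h' <;> obtain ⟨x, -, hx⟩ := List.mem_map.1 h' <;> cases x <;>
        simp_all [Leg.map]

theorem WF.append {u v : List Leg} (hu : WF u) (hv : WF v)
    (huv : ∀ x ∈ u, ∀ y ∈ v, x.label ≠ y.label) : WF (u ++ v) := by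
  refine ⟨List.nodup_append.2 ⟨hu.1, hv.1, fun x hx y hy h => huv x hx y hy (h ▸ rfl)⟩, fun a => ?_⟩
  simp [hu.2, hv.2]

/-- Arrow diagrams on the line with named arrows. -/
def ArrowWord : Type := {w : List Leg // WF w}

/-- Two words that differ only by the names of the arrows. -/
def ArrowWord.Relabel (w w' : ArrowWord) : Prop :=
  ∃ f : ℕ → ℕ, Function.Injective f ∧ w'.1 = w.1.map (Leg.map f)

/-- Arrow diagrams on the long line `↑`. The names of the arrows do not matter. -/
def ArrowDiagram : Type := Quot ArrowWord.Relabel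

def evenLabel (a : ℕ) : ℕ := 2 * a
def oddLabel (a : ℕ) : ℕ := 2 * a + 1

theorem evenLabel_injective : Function.Injective evenLabel := fun a b h => by
  simp only [evenLabel] at h; omega
theorem oddLabel_injective : Function.Injective oddLabel := fun a b h => by
  simp only [oddLabel] at h; omega

/-- Concatenation, after making the names of the arrows different. -/
def ArrowWord.concat (u v : ArrowWord) : ArrowWord :=
  ⟨u.1.map (Leg.map evenLabel) ++ v.1.map (Leg.map oddLabel),
    ((wf_map evenLabel_injective _).2 u.2).append ((wf_map oddLabel_injective _).2 v.2) (by
      simp only [List.mem_map]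
      rintro _ ⟨x, -, rfl⟩ _ ⟨y, -, rfl⟩
      cases x <;> cases y <;> simp [evenLabel, oddLabel] <;> omega)⟩

/-- Acts by `f` on even labels and by `g` on odd labels. -/
def interleave (f g : ℕ → ℕ) (a : ℕ) : ℕ :=
  if a % 2 = 0 then f (a / 2) else g (a / 2)

theorem interleave_even (f g : ℕ → ℕ) (a : ℕ) : interleave f g (evenLabel a) = f a := by
  simp [interleave, evenLabel]
theorem interleave_odd (f g : ℕ → ℕ) (a : ℕ) : interleave f g (oddLabel a) = g a := by
  have h1 : (2 * a + 1) % 2 ≠ 0 := by omega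
  have h2 : (2 * a + 1) / 2 = a := by omega
  simp only [interleave, oddLabel, h2]
  simp

theorem interleave_comp_even (f g : ℕ → ℕ) : interleave f g ∘ evenLabel = f :=
  funext (interleave_even f g)
theorem interleave_comp_odd (f g : ℕ → ℕ) : interleave f g ∘ oddLabel = g :=
  funext (interleave_odd f g)

theorem interleave_injective {f g : ℕ → ℕ} (hf : Function.Injective f) (hg : Function.Injective g)
    (h : ∀ a b, f a ≠ g b) : Function.Injective (interleave f g) := by
  intro a b hab
  unfold interleave at hab
  split_ifs at hab with h1 h2 h2
  · have := hf hab; omega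
  · exact absurd hab (h _ _)
  · exact absurd hab.symm (h _ _)
  · have := hg hab; omega

@[simp] theorem map_comp_map (f g : ℕ → ℕ) : Leg.map f ∘ Leg.map g = Leg.map (f ∘ g) := by
  funext x; cases x <;> rfl

theorem Relabel.of_concat {u v : ArrowWord} {w : ArrowWord} {p q : ℕ → ℕ}
    (hp : Function.Injective p) (hq : Function.Injective q) (hpq : ∀ a b, p a ≠ q b)
    (hw : w.1 = u.1.map (Leg.map p) ++ v.1.map (Leg.map q)) :
    ArrowWord.Relabel (u.concat v) w := by
  refine ⟨interleave p q, interleave_injective hp hq hpq, ?_⟩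
  rw [hw]
  simp only [ArrowWord.concat, List.map_append, List.map_map, map_comp_map]
  congr 3 <;> funext a <;> simp [interleave_even, interleave_odd, Function.comp]

/-- The second diagram is placed after the first one on the line. -/
def ArrowDiagram.mul : ArrowDiagram → ArrowDiagram → ArrowDiagram :=
  Quot.map₂ ArrowWord.concat
    (fun u v v' ⟨f, hf, h⟩ => Relabel.of_concat (p := evenLabel) (q := oddLabel ∘ f)
      evenLabel_injective (oddLabel_injective.comp hf)
      (fun a b => by simp only [evenLabel, oddLabel, Function.comp]; omega)
      (by simp [ArrowWord.concat, h]))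
    (fun u u' v ⟨f, hf, h⟩ => Relabel.of_concat (p := evenLabel ∘ f) (q := oddLabel)
      (evenLabel_injective.comp hf) oddLabel_injective
      (fun a b => by simp only [evenLabel, oddLabel, Function.comp]; omega)
      (by simp [ArrowWord.concat, h]))

instance : Monoid ArrowDiagram where
  mul := ArrowDiagram.mul
  one := Quot.mk _ ⟨[], WF.nil⟩
  mul_assoc := by
    rintro ⟨u⟩ ⟨v⟩ ⟨w⟩
    refine Quot.sound ⟨interleave (interleave evenLabel (oddLabel ∘ evenLabel)) (oddLabel ∘ oddLabel),
      interleave_injective (interleave_injective evenLabel_injective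
        (oddLabel_injective.comp evenLabel_injective) ?_)
        (oddLabel_injective.comp oddLabel_injective) ?_, ?_⟩
    · intro a b; simp only [evenLabel, oddLabel, Function.comp]; omega
    · intro a b; unfold interleave
      split_ifs <;> simp only [evenLabel, oddLabel, Function.comp] <;> omega
    · simp only [ArrowWord.concat, List.map_append, List.map_map, map_comp_map, List.append_assoc,
        interleave_comp_even, interleave_comp_odd, ← Function.comp_assoc]
  one_mul := by
    rintro ⟨u⟩
    exact (Quot.sound ⟨oddLabel, oddLabel_injective, by simp [ArrowWord.concat]⟩).symm
  mul_one := by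
    rintro ⟨u⟩
    exact (Quot.sound ⟨evenLabel, evenLabel_injective, by simp [ArrowWord.concat]⟩).symm

/-- The algebra `𝒟ᵛ(↑)` of formal linear combinations of arrow diagrams. Its product is concatenation. -/
abbrev Dv : Type := MonoidAlgebra ℚ ArrowDiagram

open Classical in
/-- The arrow diagram that a word of legs describes, and `0` for a word that describes none. -/
noncomputable def diagram (w : List Leg) : Dv :=
  if h : WF w then MonoidAlgebra.of ℚ ArrowDiagram (Quot.mk _ ⟨w, h⟩) else 0

/-- The relations of `𝒜ˢʷ(↑)`: `tc` (tails commute), `ri` (the rotation number independence relation: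
an isolated arrow may be reversed) and `fourT` (the directed 4T relation: pushing the head of the
arrow `a` across the arrow `c`, once at each of the two ends of `c`, adds up to zero). All terms of
a relation use the same legs, so that either all of them or none of them are diagrams. -/
inductive SwRel : Dv → Dv → Prop
  | tc (P Q : List Leg) (a b : ℕ) :
      SwRel (diagram (P ++ [tail a, tail b] ++ Q)) (diagram (P ++ [tail b, tail a] ++ Q))
  | ri (P Q : List Leg) (a : ℕ) :
      SwRel (diagram (P ++ [tail a, head a] ++ Q)) (diagram (P ++ [head a, tail a] ++ Q))
  | fourT (P Q R : List Leg) (a c : ℕ) (x y : Leg)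
      (hxy : (x = tail c ∧ y = head c) ∨ (x = head c ∧ y = tail c)) :
      SwRel (diagram (P ++ [head a, x] ++ Q ++ [y] ++ R)
          + diagram (P ++ [x] ++ Q ++ [head a, y] ++ R))
        (diagram (P ++ [x, head a] ++ Q ++ [y] ++ R)
          + diagram (P ++ [x] ++ Q ++ [y, head a] ++ R))

/-- The algebra `𝒜ˢʷ(↑)`: arrow diagrams on the line modulo TC, directed 4T and RI. Since the relations
are local, the ideal that they generate is just their linear span. The completion, in which
expansions live, is modelled by power series: the element `∑ aₙ`, with `aₙ` of degree `n`
(`n` arrows), is the power series `∑ aₙ ℏⁿ` over `𝒜ˢʷ(↑)`. -/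
def Asw : Type := RingQuot SwRel

noncomputable instance : Ring Asw := inferInstanceAs (Ring (RingQuot SwRel))

noncomputable instance : Algebra ℚ Asw := inferInstanceAs (Algebra ℚ (RingQuot SwRel))

/-- The projection of diagrams to `𝒜ˢʷ(↑)`. -/
noncomputable def toAsw : Dv →ₐ[ℚ] Asw := RingQuot.mkAlgHom ℚ SwRel

/-- The single arrow `D_A = D_L = D_R`. -/
noncomputable def D_A : Asw := toAsw (diagram [tail 0, head 0])

/-! ### Wheels -/

/-- Formal linear combinations of words of legs, with concatenation as the product. -/
abbrev LegAlgebra : Type := MonoidAlgebra ℚ (FreeMonoid Leg)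

/-- A word of legs as an element of the word algebra. -/
noncomputable def legWord (w : List Leg) : LegAlgebra :=
  MonoidAlgebra.of ℚ (FreeMonoid Leg) (FreeMonoid.ofList w)

/-- Reads words of legs as arrow diagrams. -/
noncomputable def close : LegAlgebra →ₗ[ℚ] Dv :=
  Finsupp.linearCombination ℚ (fun w : FreeMonoid Leg => diagram w.toList) ∘ₗ
    (MonoidAlgebra.coeffLinearEquiv ℚ).toLinearMap

/-- The nested commutator `[h₀, [h₁, …, [hₗ, h_b]…]]` of arrowheads, for the list of names `0, …, l`. -/
noncomputable def nestedBracket : List ℕ → ℕ → LegAlgebra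
  | [], b => legWord [head b]
  | a :: l, b => ⁅legWord [head a], nestedBracket l b⁆

/-- The `(m+1)`-wheel with its internal vertices resolved by the STU relations:
`t₀ t₁ ⋯ t_{m-1} · [[h₀, [h₁, …, [h_{m-1}, h_m]…]], t_m]`, where `tᵢ`, `hᵢ` are the tail and head of
the arrow `i`. The theorem `arrowToAswt_wheelSum` below identifies it with the wheel itself, the
w-Jacobi diagram that consists of an oriented cycle of `m + 1` internal vertices and one spoke from
the skeleton to each of them. -/
noncomputable def wheelSum (m : ℕ) : Dv :=
  close (legWord ((List.range m).map tail) * ⁅nestedBracket (List.range m) m, legWord [tail m]⁆)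

/-- The `k`-wheel `w_k` as an element of `𝒜ˢʷ(↑)`, with `w_0 = 1`. -/
noncomputable def wheel : ℕ → Asw
  | 0 => 1
  | m + 1 => toAsw (wheelSum m)

/-! ### Gauss diagrams, long w-knots, and the weights of the expansion -/

/-- The indices that are mapped to the arrow `a`, in increasing order. -/
def strands {n : ℕ} (f : Fin n → ℕ) (a : ℕ) : List ℕ :=
  ((List.finRange n).filter (fun i => f i = a)).map Fin.val

/-- Replaces each arrow `a` of `w` by a bundle of parallel arrows, one for each `i` with `f i = a`.
(Arrows to which nothing is mapped are deleted.) -/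
def blowup {n : ℕ} (f : Fin n → ℕ) (w : List Leg) : List Leg :=
  w.flatMap fun
    | tail a => (strands f a).map tail
    | head a => (strands f a).map head

/-- The arrows of a word. -/
def labels (w : List Leg) : Finset ℕ := (w.map Leg.label).toFinset

/-- The degree `n` part of the expansion of the Gauss diagram with word `w` and signs `s`, which replaces
each arrow `a` of sign `±` by an exponential reservoir `e^{±a} = ∑ₘ (±1)ᵐ/m! (m parallel arrows)`.
As `n! / ∏ₐ mₐ!` functions `f` on `n` points have `mₐ` points over each arrow `a`, summing over all
functions with the weight `1/n!` gives the coefficients `∏ₐ (±1)^{mₐ}/mₐ!`. -/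
noncomputable def expansionCoeff (w : List Leg) (s : ℕ → ℤˣ) (n : ℕ) : Asw :=
  ∑ f ∈ Fintype.piFinset (fun _ : Fin n => labels w),
    ((n.factorial : ℚ)⁻¹ * ∏ i, ((s (f i) : ℤ) : ℚ)) • toAsw (diagram (blowup f w))

/-- Gauss diagrams of long virtual knots: an arrow diagram on the line whose arrows are the (non-virtual)
crossings, pointing from the upper strand to the lower strand, with a sign for each crossing. Only
the signs of the arrows in `word` matter. -/
structure GaussDiagram where
  word : List Leg
  wf : WF word
  sign : ℕ → ℤˣ

namespace GaussDiagram

/-- A strand traversed forwards (`1`) or backwards (`-1`). -/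
def orient (o : ℤˣ) (l : List Leg) : List Leg := if o = 1 then l else l.reverse

/-- The strands that take part in a third Reidemeister move, from top to bottom: strand `0` crosses over
strand `1` at `a` and over strand `2` at `b`, and strand `1` crosses over strand `2` at `c`. -/
def strand (a b c : ℕ) : Fin 3 → List Leg :=
  ![[tail a, tail b], [head a, tail c], [head b, head c]]

/-- The moves that define long w-knots. The virtual moves and the mixed move do not change the Gauss
diagram. `r1s`: the weak (spun) first Reidemeister move, replacing a kink by the kink of the same
sign with the other order of over and under. `r2`: two adjacent arrows of opposite signs, with
arbitrary orientations of the two strands. `r3`: the three strands have arbitrary orientations `o`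
and are met along the line in an arbitrary order `p`; the conditions on the signs are those that
hold for three strands in the plane. `oc`: overcrossings commute. -/
inductive Move : GaussDiagram → GaussDiagram → Prop
  | relabel (G G' : GaussDiagram) (f : ℕ → ℕ) (hf : Function.Injective f)
      (hw : G'.word = G.word.map (Leg.map f))
      (hs : ∀ a ∈ labels G.word, G'.sign (f a) = G.sign a) : Move G G'
  | r1s (G G' : GaussDiagram) (P Q : List Leg) (a : ℕ)
      (hw : G.word = P ++ [tail a, head a] ++ Q)
      (hw' : G'.word = P ++ [head a, tail a] ++ Q)
      (hs : G'.sign = G.sign) : Move G G'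
  | r2 (G G' : GaussDiagram) (P Q R X Y : List Leg) (a b : ℕ)
      (hw : G.word = P ++ X ++ Q ++ Y ++ R)
      (hw' : G'.word = P ++ Q ++ R)
      (hs : G'.sign = G.sign)
      (hab : G.sign a = - G.sign b)
      (hXY : (X = [tail a, tail b] ∧ (Y = [head a, head b] ∨ Y = [head b, head a])) ∨
        (Y = [tail a, tail b] ∧ (X = [head a, head b] ∨ X = [head b, head a]))) : Move G G'
  | r3 (G G' : GaussDiagram) (P Q R S : List Leg) (a b c : ℕ) (o : Fin 3 → ℤˣ)
      (p : Equiv.Perm (Fin 3))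
      (hw : G.word = P ++ orient (o (p 0)) (strand a b c (p 0)) ++ Q
        ++ orient (o (p 1)) (strand a b c (p 1)) ++ R
        ++ orient (o (p 2)) (strand a b c (p 2)) ++ S)
      (hw' : G'.word = P ++ (orient (o (p 0)) (strand a b c (p 0))).reverse ++ Q
        ++ (orient (o (p 1)) (strand a b c (p 1))).reverse ++ R
        ++ (orient (o (p 2)) (strand a b c (p 2))).reverse ++ S)
      (hs : G'.sign = G.sign)
      (hab : G.sign a * G.sign b = o 1 * o 2)
      (hac : G.sign a * G.sign c = o 0 * o 2) : Move G G'
  | oc (G G' : GaussDiagram) (P Q : List Leg) (a b : ℕ)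
      (hw : G.word = P ++ [tail a, tail b] ++ Q)
      (hw' : G'.word = P ++ [tail b, tail a] ++ Q)
      (hs : G'.sign = G.sign) : Move G G'

end GaussDiagram

/-- Long w-knots: Gauss diagrams up to the equivalence relation that the moves generate. -/
def WKnot : Type := Quot GaussDiagram.Move

/-- The long w-knot of a Gauss diagram. -/
def GaussDiagram.knot (G : GaussDiagram) : WKnot := Quot.mk _ G

/-! ### Wheels as w-Jacobi diagrams

This part only justifies the explicit formula for the wheels. -/

/-- An internal vertex of a w-Jacobi diagram, given by the names of the left incoming, the right
incoming, and the outgoing edge. -/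
@[ext] structure Vertex where
  left : ℕ
  right : ℕ
  out : ℕ

/-- Renames edges. -/
def Vertex.map (f : ℕ → ℕ) (v : Vertex) : Vertex := ⟨f v.left, f v.right, f v.out⟩

/-- The edges that start on the skeleton. -/
def tailLabels (w : List Leg) : List ℕ :=
  w.filterMap fun
    | tail a => some a
    | head _ => none

/-- The edges that end on the skeleton. -/
def headLabels (w : List Leg) : List ℕ :=
  w.filterMap fun
    | tail _ => none
    | head a => some a

/-- All starting points of edges. -/
def starts (w : List Leg) (V : Multiset Vertex) : Multiset ℕ :=
  ↑(tailLabels w) + V.map Vertex.out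

/-- All end points of edges. -/
def ends (w : List Leg) (V : Multiset Vertex) : Multiset ℕ :=
  ↑(headLabels w) + (V.map Vertex.left + V.map Vertex.right)

/-- The data of a w-Jacobi diagram on the line: a word of skeleton vertices `w` and internal vertices
`V` such that every edge starts exactly once and ends exactly once. As an internal vertex has two
incoming edges and one outgoing edge, each component of the complement of the skeleton has to touch
the skeleton, so that connectedness is automatic. -/
def JWF (w : List Leg) (V : Multiset Vertex) : Prop :=
  (starts w V).Nodup ∧ starts w V = ends w V

/-- w-Jacobi diagrams with named edges. -/
def JacobiWord : Type := {p : List Leg × Multiset Vertex // JWF p.1 p.2}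

/-- Two w-Jacobi diagrams that differ only by the names of their edges. -/
def JacobiWord.Relabel (p q : JacobiWord) : Prop :=
  ∃ f : ℕ → ℕ, Function.Injective f ∧ q.1.1 = p.1.1.map (Leg.map f) ∧
    q.1.2 = p.1.2.map (Vertex.map f)

/-- w-Jacobi diagrams on the long line. -/
def JacobiDiagram : Type := Quot JacobiWord.Relabel

open Classical in
/-- The w-Jacobi diagram with the given data, and `0` for data that describe none. -/
noncomputable def jacobi (w : List Leg) (V : Multiset Vertex) : JacobiDiagram →₀ ℚ :=
  if h : JWF w V then Finsupp.single (Quot.mk _ ⟨(w, V), h⟩) 1 else 0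

/-- The relations of `𝒜ˢʷᵗ(↑)`: the two directed STU relations (an edge `e` from an internal vertex to
the skeleton, or from the skeleton to an internal vertex), TC and RI. -/
inductive JacobiRel : (JacobiDiagram →₀ ℚ) → Prop
  | stu1 (P Q : List Leg) (V : Multiset Vertex) (l r e : ℕ)
      (h : JWF (P ++ [head e] ++ Q) (⟨l, r, e⟩ ::ₘ V)) :
      JacobiRel (jacobi (P ++ [head e] ++ Q) (⟨l, r, e⟩ ::ₘ V)
        - (jacobi (P ++ [head l, head r] ++ Q) V - jacobi (P ++ [head r, head l] ++ Q) V))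
  | stu2_left (P Q : List Leg) (V : Multiset Vertex) (e f g : ℕ)
      (h : JWF (P ++ [tail e] ++ Q) (⟨e, f, g⟩ ::ₘ V)) :
      JacobiRel (jacobi (P ++ [tail e] ++ Q) (⟨e, f, g⟩ ::ₘ V)
        - (jacobi (P ++ [head f, tail g] ++ Q) V - jacobi (P ++ [tail g, head f] ++ Q) V))
  | stu2_right (P Q : List Leg) (V : Multiset Vertex) (e f g : ℕ)
      (h : JWF (P ++ [tail e] ++ Q) (⟨f, e, g⟩ ::ₘ V)) :
      JacobiRel (jacobi (P ++ [tail e] ++ Q) (⟨f, e, g⟩ ::ₘ V)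
        - (jacobi (P ++ [tail g, head f] ++ Q) V - jacobi (P ++ [head f, tail g] ++ Q) V))
  | tc (P Q : List Leg) (V : Multiset Vertex) (a b : ℕ) :
      JacobiRel (jacobi (P ++ [tail a, tail b] ++ Q) V - jacobi (P ++ [tail b, tail a] ++ Q) V)
  | ri (P Q : List Leg) (V : Multiset Vertex) (a : ℕ) :
      JacobiRel (jacobi (P ++ [tail a, head a] ++ Q) V - jacobi (P ++ [head a, tail a] ++ Q) V)

/-- The space of w-Jacobi diagrams on the line modulo the directed STU relations, TC and RI. -/
abbrev Aswt : Type := (JacobiDiagram →₀ ℚ) ⧸ Submodule.span ℚ {x | JacobiRel x}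

/-- The projection of w-Jacobi diagrams to their quotient space. -/
noncomputable def toAswt : (JacobiDiagram →₀ ℚ) →ₗ[ℚ] Aswt := Submodule.mkQ _

/-- The internal vertices of the `k`-wheel: spoke `i`, and the edges `k + i` of the rim. -/
def wheelVertices (k : ℕ) : Multiset Vertex :=
  (Multiset.range k).map fun i => ⟨i, k + (i + 1) % k, k + i⟩

/-- The spokes of the `k`-wheel, which start on the skeleton. -/
def wheelLegs (k : ℕ) : List Leg := (List.range k).map tail

theorem tailLabels_append (u v : List Leg) :
    tailLabels (u ++ v) = tailLabels u ++ tailLabels v := by simp [tailLabels]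
theorem headLabels_append (u v : List Leg) :
    headLabels (u ++ v) = headLabels u ++ headLabels v := by simp [headLabels]

theorem mem_tailLabels {w : List Leg} {a : ℕ} : a ∈ tailLabels w ↔ tail a ∈ w := by
  simp only [tailLabels, List.mem_filterMap]
  constructor
  · rintro ⟨x | x, h, h'⟩ <;> simp_all
  · intro h; exact ⟨_, h, rfl⟩

theorem mem_headLabels {w : List Leg} {a : ℕ} : a ∈ headLabels w ↔ head a ∈ w := by
  simp only [headLabels, List.mem_filterMap]
  constructor
  · rintro ⟨x | x, h, h'⟩ <;> simp_all
  · intro h; exact ⟨_, h, rfl⟩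

theorem nodup_legs (w : List Leg) : w.Nodup ↔ (tailLabels w).Nodup ∧ (headLabels w).Nodup := by
  induction w with
  | nil => simp [tailLabels, headLabels]
  | cons x w ih =>
    rcases x with x | x
    · have h1 : tailLabels (tail x :: w) = x :: tailLabels w := rfl
      have h2 : headLabels (tail x :: w) = headLabels w := rfl
      rw [h1, h2, List.nodup_cons, List.nodup_cons, mem_tailLabels, ih, and_assoc]
    · have h1 : tailLabels (head x :: w) = tailLabels w := rfl
      have h2 : headLabels (head x :: w) = x :: headLabels w := rfl
      rw [h1, h2, List.nodup_cons, List.nodup_cons, mem_headLabels, ih]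
      tauto

theorem jwf_zero {w : List Leg} : JWF w 0 ↔ WF w := by
  simp only [JWF, starts, ends, WF, Multiset.map_zero, add_zero, Multiset.coe_nodup,
    Multiset.coe_eq_coe, nodup_legs]
  constructor
  · rintro ⟨h1, h2⟩
    refine ⟨⟨h1, h2.nodup_iff.1 h1⟩, fun a => ?_⟩
    rw [← mem_tailLabels, ← mem_headLabels, h2.mem_iff]
  · rintro ⟨⟨h1, h2⟩, h3⟩
    refine ⟨h1, (List.perm_ext_iff_of_nodup h1 h2).2 fun a => ?_⟩
    rw [mem_tailLabels, mem_headLabels, h3]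

/-- Arrow diagrams are w-Jacobi diagrams without internal vertices. -/
def ArrowDiagram.toJacobi : ArrowDiagram → JacobiDiagram :=
  Quot.map (fun w => ⟨(w.1, 0), jwf_zero.2 w.2⟩) fun _ _ ⟨f, hf, h⟩ => ⟨f, hf, h, by simp⟩

/-- The inclusion of arrow diagrams into w-Jacobi diagrams, followed by the projection. It induces the
identification of `𝒜ˢʷ(↑)` with `𝒜ˢʷᵗ(↑)`. -/
noncomputable def arrowToAswt : Dv →ₗ[ℚ] Aswt :=
  toAswt ∘ₗ Finsupp.linearCombination ℚ
    (fun D : ArrowDiagram => Finsupp.single D.toJacobi (1 : ℚ)) ∘ₗ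
      (MonoidAlgebra.coeffLinearEquiv ℚ).toLinearMap

/-- The class of a w-Jacobi diagram. -/
noncomputable def J (w : List Leg) (V : Multiset Vertex) : Aswt := toAswt (jacobi w V)

theorem toAswt_rel {x : JacobiDiagram →₀ ℚ} (h : JacobiRel x) : toAswt x = 0 :=
  (Submodule.Quotient.mk_eq_zero _).2 (Submodule.subset_span h)

theorem arrowToAswt_of (D : ArrowDiagram) :
    arrowToAswt (MonoidAlgebra.of ℚ ArrowDiagram D) = toAswt (Finsupp.single D.toJacobi 1) := by
  simp [arrowToAswt, MonoidAlgebra.of_apply]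

theorem arrowToAswt_diagram (w : List Leg) : arrowToAswt (diagram w) = J w 0 := by
  unfold J jacobi diagram
  by_cases h : WF w
  · rw [dif_pos h, dif_pos (jwf_zero.2 h)]
    exact arrowToAswt_of _
  · rw [dif_neg h, dif_neg (fun h' => h (jwf_zero.1 h'))]
    simp

/-- Puts a leg word between `P` and `Q` and takes its class. -/
noncomputable def insertLegs (P Q : List Leg) : LegAlgebra →ₗ[ℚ] Aswt :=
  Finsupp.linearCombination ℚ (fun w : FreeMonoid Leg => J (P ++ w.toList ++ Q) 0) ∘ₗ
    (MonoidAlgebra.coeffLinearEquiv ℚ).toLinearMap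

theorem insertLegs_legWord (P Q w : List Leg) : insertLegs P Q (legWord w) = J (P ++ w ++ Q) 0 := by
  simp [insertLegs, legWord, MonoidAlgebra.of_apply]

theorem insertLegs_word_mul (P Q u : List Leg) (x : LegAlgebra) :
    insertLegs P Q (legWord u * x) = insertLegs (P ++ u) Q x := by
  induction x using MonoidAlgebra.induction_linear with
  | zero => simp
  | add x y hx hy => rw [mul_add, map_add, map_add, hx, hy]
  | single m r => simp [insertLegs, legWord, MonoidAlgebra.of_apply, MonoidAlgebra.single_mul_single]

theorem insertLegs_mul_word (P Q u : List Leg) (x : LegAlgebra) :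
    insertLegs P Q (x * legWord u) = insertLegs P (u ++ Q) x := by
  induction x using MonoidAlgebra.induction_linear with
  | zero => simp
  | add x y hx hy => rw [add_mul, map_add, map_add, hx, hy]
  | single m r => simp [insertLegs, legWord, MonoidAlgebra.of_apply, MonoidAlgebra.single_mul_single]

theorem arrowToAswt_close (x : LegAlgebra) : arrowToAswt (close x) = insertLegs [] [] x := by
  induction x using MonoidAlgebra.induction_linear with
  | zero => simp
  | add x y hx hy => rw [map_add, map_add, map_add, hx, hy]
  | single m r => simp [insertLegs, close, arrowToAswt_diagram]

/-- The first hub edge of a chain of vertices with (spoke, outgoing edge) pairs `l`. -/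
def chainOut : List (ℕ × ℕ) → ℕ → ℕ
  | [], b => b
  | p :: _, _ => p.2

/-- A chain of vertices that ends with the edge `b`. -/
def chainVertices : List (ℕ × ℕ) → ℕ → List Vertex
  | [], _ => []
  | p :: l, b => ⟨p.1, chainOut l b, p.2⟩ :: chainVertices l b

theorem jwf_remove_head {P Q : List Leg} {V : Multiset Vertex} {l r e : ℕ}
    (h : JWF (P ++ [head e] ++ Q) (⟨l, r, e⟩ ::ₘ V)) :
    JWF (P ++ [head l, head r] ++ Q) V ∧ JWF (P ++ [head r, head l] ++ Q) V := by
  have s0 : starts (P ++ [head e] ++ Q) (⟨l, r, e⟩ ::ₘ V)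
      = e ::ₘ starts (P ++ [head l, head r] ++ Q) V := by
    simp [starts, tailLabels]
  have s1 : starts (P ++ [head r, head l] ++ Q) V = starts (P ++ [head l, head r] ++ Q) V := by
    simp [starts, tailLabels]
  have e0 : ends (P ++ [head e] ++ Q) (⟨l, r, e⟩ ::ₘ V)
      = e ::ₘ ends (P ++ [head l, head r] ++ Q) V := by
    simp only [ends, headLabels_append, ← Multiset.coe_add, Multiset.map_cons]
    ext a
    simp only [headLabels, List.filterMap_cons, List.filterMap_nil, Multiset.count_add,
      Multiset.coe_count, Multiset.count_cons, List.count_cons, List.count_nil, beq_iff_eq,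
      eq_comm (a := a)]
    omega
  have e1 : ends (P ++ [head r, head l] ++ Q) V = ends (P ++ [head l, head r] ++ Q) V := by
    simp only [ends, headLabels_append, ← Multiset.coe_add]
    congr 3
    exact Multiset.coe_eq_coe.2 (List.Perm.swap _ _ _)
  obtain ⟨h1, h2⟩ := h
  rw [s0] at h1
  rw [s0, e0, Multiset.cons_inj_right] at h2
  have h1 := (Multiset.nodup_cons.1 h1).2
  exact ⟨⟨h1, h2⟩, ⟨s1 ▸ h1, by rw [s1, e1, h2]⟩⟩

theorem jwf_remove_tail {P Q : List Leg} {V : Multiset Vertex} {e f g : ℕ}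
    (h : JWF (P ++ [tail e] ++ Q) (⟨e, f, g⟩ ::ₘ V)) :
    JWF (P ++ [head f, tail g] ++ Q) V ∧ JWF (P ++ [tail g, head f] ++ Q) V := by
  have s0 : starts (P ++ [tail e] ++ Q) (⟨e, f, g⟩ ::ₘ V)
      = e ::ₘ starts (P ++ [head f, tail g] ++ Q) V := by
    simp only [starts, tailLabels_append, ← Multiset.coe_add, Multiset.map_cons]
    ext a
    simp only [tailLabels, List.filterMap_cons, List.filterMap_nil, Multiset.count_add,
      Multiset.coe_count, Multiset.count_cons, List.count_cons, List.count_nil, beq_iff_eq,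
      eq_comm (a := a)]
    omega
  have s1 : starts (P ++ [tail g, head f] ++ Q) V = starts (P ++ [head f, tail g] ++ Q) V := by
    simp [starts, tailLabels]
  have e0 : ends (P ++ [tail e] ++ Q) (⟨e, f, g⟩ ::ₘ V)
      = e ::ₘ ends (P ++ [head f, tail g] ++ Q) V := by
    simp only [ends, headLabels_append, ← Multiset.coe_add, Multiset.map_cons]
    ext a
    simp only [headLabels, List.filterMap_cons, List.filterMap_nil, Multiset.count_add,
      Multiset.coe_count, Multiset.count_cons, List.count_cons, List.count_nil, beq_iff_eq,
      eq_comm (a := a)]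
    omega
  have e1 : ends (P ++ [tail g, head f] ++ Q) V = ends (P ++ [head f, tail g] ++ Q) V := by
    simp [ends, headLabels]
  obtain ⟨h1, h2⟩ := h
  rw [s0] at h1
  rw [s0, e0, Multiset.cons_inj_right] at h2
  have h1 := (Multiset.nodup_cons.1 h1).2
  exact ⟨⟨h1, h2⟩, ⟨s1 ▸ h1, by rw [s1, e1, h2]⟩⟩

theorem J_chain (l : List (ℕ × ℕ)) (b : ℕ) (P Q : List Leg)
    (h : JWF (P ++ [head (chainOut l b)] ++ Q) (chainVertices l b)) :
    J (P ++ [head (chainOut l b)] ++ Q) (chainVertices l b)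
      = insertLegs P Q (nestedBracket (l.map Prod.fst) b) := by
  induction l generalizing P Q with
  | nil => exact (insertLegs_legWord P Q [head b]).symm
  | cons p l ih =>
    have h' : JWF (P ++ [head p.2] ++ Q)
        (⟨p.1, chainOut l b, p.2⟩ ::ₘ (chainVertices l b : Multiset Vertex)) := h
    have hrel := toAswt_rel (JacobiRel.stu1 P Q (chainVertices l b) p.1 (chainOut l b) p.2 h')
    rw [map_sub, map_sub, sub_eq_zero] at hrel
    obtain ⟨h1, h2⟩ := jwf_remove_head h'
    have i1 := ih (P ++ [head p.1]) Q (by simpa using h1)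
    have i2 := ih P ([head p.1] ++ Q) (by simpa using h2)
    change toAswt _ = _
    refine hrel.trans ?_
    rw [List.map_cons, nestedBracket, Ring.lie_def, map_sub, insertLegs_word_mul,
      insertLegs_mul_word, ← i1, ← i2]
    simp [J]

theorem jacobi_map {f : ℕ → ℕ} (hf : Function.Injective f) (w : List Leg) (V : Multiset Vertex)
    (h : JWF w V) (h' : JWF (w.map (Leg.map f)) (V.map (Vertex.map f))) :
    jacobi (w.map (Leg.map f)) (V.map (Vertex.map f)) = jacobi w V := by
  unfold jacobi
  rw [dif_pos h, dif_pos h']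
  congr 1
  exact (Quot.sound ⟨f, hf, rfl, rfl⟩).symm

theorem tailLabels_map (f : ℕ → ℕ) (w : List Leg) :
    tailLabels (w.map (Leg.map f)) = (tailLabels w).map f := by
  induction w with
  | nil => rfl
  | cons x w ih => cases x <;> simp_all [tailLabels]

theorem headLabels_map (f : ℕ → ℕ) (w : List Leg) :
    headLabels (w.map (Leg.map f)) = (headLabels w).map f := by
  induction w with
  | nil => rfl
  | cons x w ih => cases x <;> simp_all [headLabels]

theorem JWF.map {f : ℕ → ℕ} (hf : Function.Injective f) {w : List Leg} {V : Multiset Vertex}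
    (h : JWF w V) : JWF (w.map (Leg.map f)) (V.map (Vertex.map f)) := by
  have s : starts (w.map (Leg.map f)) (V.map (Vertex.map f)) = (starts w V).map f := by
    simp [starts, tailLabels_map, Multiset.map_map, Function.comp_def, Vertex.map]
  have e : ends (w.map (Leg.map f)) (V.map (Vertex.map f)) = (ends w V).map f := by
    simp [ends, headLabels_map, Multiset.map_map, Function.comp_def, Vertex.map]
  exact ⟨s ▸ h.1.map hf, by rw [s, e, h.2]⟩

theorem wheel_rights (m : ℕ) :
    (Multiset.range (m + 1)).map (fun i => m + 1 + (i + 1) % (m + 1))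
      = (Multiset.range (m + 1)).map (fun i => m + 1 + i) := by
  rw [Multiset.range_succ, Multiset.map_cons, ← Multiset.range_succ]
  change _ = ((List.range (m + 1) : Multiset ℕ)).map _
  rw [List.range_succ_eq_map, ← Multiset.cons_coe, Multiset.map_cons]
  have h0 : m + 1 + (m + 1) % (m + 1) = m + 1 + 0 := by simp
  rw [h0]
  congr 1
  change ((List.range m : Multiset ℕ)).map _ = _
  simp only [Multiset.map_coe, List.map_map]
  congr 1
  refine List.map_congr_left fun i hi => ?_
  have : (i + 1) % (m + 1) = i + 1 := Nat.mod_eq_of_lt (by have := List.mem_range.1 hi; omega)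
  simp [this]

theorem tailLabels_tails (l : List ℕ) : tailLabels (l.map tail) = l := by
  induction l with
  | nil => rfl
  | cons x l ih => simp_all [tailLabels]

theorem headLabels_tails (l : List ℕ) : headLabels (l.map tail) = [] := by
  induction l with
  | nil => rfl
  | cons x l ih => simp_all [headLabels]

theorem wheel_jwf (k : ℕ) : JWF (wheelLegs k) (wheelVertices k) := by
  have s : starts (wheelLegs k) (wheelVertices k)
      = Multiset.range k + (Multiset.range k).map (fun i => k + i) := by
    simp only [starts, wheelLegs, tailLabels_tails, wheelVertices, Multiset.map_map,
      Function.comp_def]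
    rfl
  refine ⟨?_, ?_⟩
  · rw [s]
    refine Multiset.nodup_add.2 ⟨Multiset.nodup_range k,
      (Multiset.nodup_range k).map fun a b h => by simpa using h, ?_⟩
    rw [Multiset.disjoint_left]
    intro a ha hb
    simp only [Multiset.mem_range, Multiset.mem_map] at ha hb
    omega
  · rw [s]
    cases k with
    | zero => rfl
    | succ m =>
      simp only [ends, wheelLegs, headLabels_tails, wheelVertices, Multiset.map_map,
        Function.comp_def, wheel_rights, Multiset.map_id']
      simp

theorem chainVertices_range (k b s j : ℕ) :
    chainVertices ((List.range' s j).map fun i => (i, k + i)) b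
      = (List.range' s j).map fun i => ⟨i, if i + 1 = s + j then b else k + (i + 1), k + i⟩ := by
  induction j generalizing s with
  | zero => rfl
  | succ j ih =>
    rw [List.range'_succ, List.map_cons, List.map_cons, chainVertices, ih]
    congr 1
    · cases j with
      | zero => simp [chainOut]
      | succ j => simp [chainOut, List.range'_succ]
    · refine List.map_congr_left fun i _ => ?_
      have : i + 1 = s + 1 + j ↔ i + 1 = s + (j + 1) := by omega
      simp [this]

/-- The element `wheelSum m` is the `(m+1)`-wheel, via the STU relations. -/
theorem arrowToAswt_wheelSum (m : ℕ) :
    arrowToAswt (wheelSum m) = toAswt (jacobi (wheelLegs (m + 1)) (wheelVertices (m + 1))) := by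
  obtain ⟨σ, hsw, hfix, hm, hm'⟩ : ∃ σ : ℕ → ℕ, Function.Injective σ ∧
      (∀ i, i ≠ m → i ≠ 2 * m + 1 → σ i = i) ∧ σ m = 2 * m + 1 ∧ σ (2 * m + 1) = m :=
    ⟨Equiv.swap m (2 * m + 1), (Equiv.swap m (2 * m + 1)).injective,
      fun i h1 h2 => Equiv.swap_apply_of_ne_of_ne h1 h2, Equiv.swap_apply_left _ _,
      Equiv.swap_apply_right _ _⟩
  set l : List (ℕ × ℕ) := (List.range m).map fun i => (i, m + 1 + i) with hl
  have hfst : l.map Prod.fst = List.range m := by simp [hl, Function.comp_def]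
  have hlegs : (wheelLegs (m + 1)).map (Leg.map σ)
      = (List.range m).map tail ++ [tail (2 * m + 1)] ++ [] := by
    simp only [wheelLegs, List.range_succ, List.map_append, List.map_map, List.map_cons,
      List.map_nil, List.append_nil, map_tail, hm]
    congr 1
    refine List.map_congr_left fun i hi => ?_
    have := List.mem_range.1 hi
    simp [hfix i (by omega) (by omega)]
  have hverts : (wheelVertices (m + 1)).map (Vertex.map σ)
      = ⟨2 * m + 1, chainOut l m, m⟩ ::ₘ (chainVertices l m : Multiset Vertex) := by
    rw [wheelVertices, Multiset.range_succ, Multiset.map_cons, Multiset.map_cons]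
    congr 1
    · have e1 : σ (m + 1 + (m + 1) % (m + 1)) = chainOut l m := by
        rw [Nat.mod_self, hl]
        cases m with
        | zero => simpa [chainOut] using hm'
        | succ m => simpa [chainOut, List.range_succ_eq_map] using hfix _ (by omega) (by omega)
      have e2 : σ (m + 1 + m) = m := by rw [← hm']; congr 1; omega
      simp only [Vertex.map, hm, e1, e2]
    · rw [hl, List.range_eq_range', chainVertices_range, ← List.range_eq_range']
      change ((List.range m : Multiset ℕ).map _).map _ = _
      rw [Multiset.map_coe, Multiset.map_coe, List.map_map]
      congr 1
      refine List.map_congr_left fun i hi => ?_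
      have hi := List.mem_range.1 hi
      have hmod : (i + 1) % (m + 1) = i + 1 := Nat.mod_eq_of_lt (by omega)
      simp only [Function.comp, Vertex.map, hmod, zero_add]
      rw [hfix i (by omega) (by omega), hfix (m + 1 + i) (by omega) (by omega)]
      congr 1
      split_ifs with h
      · rw [← hm']; congr 1; omega
      · exact hfix _ (by omega) (by omega)
  have hj := (wheel_jwf (m + 1)).map hsw
  have hjm := jacobi_map hsw _ _ (wheel_jwf (m + 1)) hj
  rw [hlegs, hverts] at hj hjm
  rw [← hjm]
  have hrel := toAswt_rel (JacobiRel.stu2_left _ _ _ _ _ _ hj)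
  rw [map_sub, map_sub, sub_eq_zero] at hrel
  rw [hrel]
  obtain ⟨h1, h2⟩ := jwf_remove_tail hj
  have i1 := J_chain l m ((List.range m).map tail) [tail m] (by simpa using h1)
  have i2 := J_chain l m ((List.range m).map tail ++ [tail m]) [] (by simpa using h2)
  rw [wheelSum, arrowToAswt_close, Ring.lie_def, insertLegs_word_mul, map_sub, insertLegs_mul_word,
    insertLegs_word_mul, ← hfst, List.nil_append]
  rw [hfst] at i1 i2 ⊢
  simp only [List.append_nil] at i1 i2 ⊢
  rw [← i1, ← i2]
  simp [J]

/-! ### Invariance of the expansion under the moves -/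

/-- The class of an arrow diagram. -/
noncomputable def cl (w : List Leg) : Asw := toAsw (diagram w)

theorem toAsw_eq {x y : Dv} (h : SwRel x y) : toAsw x = toAsw y := RingQuot.mkAlgHom_rel ℚ h

theorem cl_zero {w : List Leg} (h : ¬ WF w) : cl w = 0 := by simp [cl, diagram, h]

theorem diagram_map {f : ℕ → ℕ} (hf : Function.Injective f) (w : List Leg) :
    diagram (w.map (Leg.map f)) = diagram w := by
  unfold diagram
  by_cases h : WF w
  · rw [dif_pos h, dif_pos ((wf_map hf w).2 h)]
    congr 1
    exact (Quot.sound ⟨f, hf, rfl⟩).symm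
  · rw [dif_neg h, dif_neg (fun h' => h ((wf_map hf w).1 h'))]

theorem cl_map {f : ℕ → ℕ} (hf : Function.Injective f) (w : List Leg) :
    cl (w.map (Leg.map f)) = cl w := by rw [cl, diagram_map hf, cl]

theorem cl_tc {T T' : List ℕ} (h : T.Perm T') (P Q : List Leg) :
    cl (P ++ T.map tail ++ Q) = cl (P ++ T'.map tail ++ Q) := by
  induction h generalizing P with
  | nil => rfl
  | cons x _ ih => simpa using ih (P ++ [tail x])
  | swap x y l => simpa [cl] using toAsw_eq (SwRel.tc P (l.map tail ++ Q) y x)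
  | trans _ _ h1 h2 => rw [h1, h2]

theorem exists_perm_of_perm {H H' : List ℕ} (h : H.Perm H') (hn : H.Nodup) :
    ∃ σ : Equiv.Perm ℕ, H.map σ = H' ∧ ∀ x ∉ H, σ x = x := by
  induction h with
  | nil => exact ⟨1, rfl, fun _ _ => rfl⟩
  | @cons x l l' _ ih =>
    obtain ⟨σ, h1, h2⟩ := ih (List.nodup_cons.1 hn).2
    refine ⟨σ, by simp [h1, h2 x (List.nodup_cons.1 hn).1], fun y hy => h2 y ?_⟩
    simp at hy; tauto
  | swap x y l =>
    have hx : x ∉ l ∧ y ∉ l ∧ y ≠ x := by simp at hn; tauto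
    refine ⟨Equiv.swap x y, ?_, fun z hz => ?_⟩
    · simp only [List.map_cons, Equiv.swap_apply_right, Equiv.swap_apply_left, List.cons.injEq,
        true_and]
      conv_rhs => rw [← List.map_id l]
      refine List.map_congr_left fun z hz => ?_
      exact Equiv.swap_apply_of_ne_of_ne (fun h => hx.1 (h ▸ hz)) (fun h => hx.2.1 (h ▸ hz))
    · simp at hz
      exact Equiv.swap_apply_of_ne_of_ne hz.2.1 hz.1
  | @trans l1 l2 l3 h12 h23 ih1 ih2 =>
    obtain ⟨σ, h1, h2⟩ := ih1 hn
    obtain ⟨τ, h3, h4⟩ := ih2 (h12.nodup_iff.1 hn)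
    refine ⟨τ * σ, by rw [← h3, ← h1]; simp [List.map_map], fun x hx => ?_⟩
    rw [Equiv.Perm.mul_apply, h2 x hx, h4 x (fun h => hx (h12.mem_iff.2 h))]

/-- Concatenation contexts with two holes. -/
def Ctx2 (K : List Leg → List Leg → List Leg) : Prop :=
  ∃ P Q R, (∀ x y, K x y = P ++ x ++ Q ++ y ++ R) ∨ (∀ x y, K x y = P ++ y ++ Q ++ x ++ R)

theorem Ctx2.extend {K : List Leg → List Leg → List Leg} (hK : Ctx2 K) (A B C D : List Leg) :
    Ctx2 (fun x y => K (A ++ x ++ B) (C ++ y ++ D)) := by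
  obtain ⟨P, Q, R, h | h⟩ := hK
  · exact ⟨P ++ A, B ++ Q ++ C, D ++ R, Or.inl fun x y => by simp [h]⟩
  · exact ⟨P ++ C, D ++ Q ++ A, B ++ R, Or.inr fun x y => by simp [h]⟩

theorem Ctx2.perm {K : List Leg → List Leg → List Leg} (hK : Ctx2 K) :
    ∃ r, ∀ x y, (K x y).Perm (x ++ y ++ r) := by
  obtain ⟨P, Q, R, h | h⟩ := hK <;> refine ⟨P ++ Q ++ R, fun x y => ?_⟩ <;> rw [h] <;>
    refine List.perm_iff_count.2 fun a => ?_ <;> simp <;> omega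

theorem Ctx2.map {K : List Leg → List Leg → List Leg} (hK : Ctx2 K) (ρ : Leg → Leg)
    {r : List Leg} (hr : ∀ x y, (K x y).Perm (x ++ y ++ r)) (hρ : ∀ z ∈ r, ρ z = z)
    (x y : List Leg) : (K x y).map ρ = K (x.map ρ) (y.map ρ) := by
  have key : ∀ P Q R : List Leg, (P ++ Q ++ R).Perm r →
      P.map ρ = P ∧ Q.map ρ = Q ∧ R.map ρ = R := by
    intro P Q R h
    have aux : ∀ L : List Leg, (∀ z ∈ L, z ∈ r) → L.map ρ = L := fun L hL => by
      conv_rhs => rw [← List.map_id L]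
      exact List.map_congr_left fun z hz => hρ z (hL z hz)
    refine ⟨aux _ fun z hz => ?_, aux _ fun z hz => ?_, aux _ fun z hz => ?_⟩ <;>
      exact h.mem_iff.1 (by simp [hz])
  obtain ⟨P, Q, R, h | h⟩ := hK <;>
  · obtain ⟨h1, h2, h3⟩ := key P Q R (by simpa [h] using hr [] [])
    simp [h, h1, h2, h3]

theorem cl_tc2 {K : List Leg → List Leg → List Leg} (hK : Ctx2 K) {T T' : List ℕ}
    (h : T.Perm T') (y : List Leg) : cl (K (T.map tail) y) = cl (K (T'.map tail) y) := by
  obtain ⟨P, Q, R, hh | hh⟩ := hK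
  · have := cl_tc h P (Q ++ y ++ R); simpa [hh] using this
  · have := cl_tc h (P ++ y ++ Q) R; simpa [hh] using this

theorem cl_heads {K : List Leg → List Leg → List Leg} (hK : Ctx2 K) {T H H' : List ℕ}
    (hsub : ∀ x ∈ H, x ∈ T) (h : H.Perm H') :
    cl (K (T.map tail) (H.map head)) = cl (K (T.map tail) (H'.map head)) := by
  obtain ⟨r, hr⟩ := hK.perm
  by_cases hw : WF (K (T.map tail) (H.map head))
  · have hn := hw.1
    rw [(hr _ _).nodup_iff, List.nodup_append, List.nodup_append] at hn
    obtain ⟨⟨hT, hH, -⟩, -, hd⟩ := hn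
    have hT := hT.of_map
    have hH := hH.of_map
    obtain ⟨σ, hσ, hfix⟩ := exists_perm_of_perm h hH
    have hσT : (T.map σ).Perm T := by
      refine (List.perm_ext_iff_of_nodup (hT.map σ.injective) hT).2 fun a => ?_
      have hmem : ∀ b, b ∈ H ↔ σ b ∈ H := fun b => by
        rw [h.mem_iff (a := σ b), ← hσ, List.mem_map_of_injective σ.injective]
      have aux : ∀ b, b ∈ T ↔ σ b ∈ T := fun b => by
        by_cases hb : b ∈ H
        · exact ⟨fun _ => hsub _ ((hmem b).1 hb), fun _ => hsub _ hb⟩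
        · rw [hfix b hb]
      rw [← σ.apply_symm_apply a, List.mem_map_of_injective σ.injective, aux]
    rw [← cl_map σ.injective, hK.map _ hr]
    · simp only [List.map_map]
      have e1 : Leg.map σ ∘ tail = tail ∘ σ := rfl
      have e2 : Leg.map σ ∘ head = head ∘ σ := rfl
      rw [e1, e2, ← List.map_map, ← List.map_map, hσ]
      exact cl_tc2 hK hσT _
    · rintro (a | a) ha
      · have : a ∉ H := fun h' => hd (tail a) (by simp [hsub a h']) (tail a) ha rfl
        simp [hfix a this]
      · have : a ∉ H := fun h' => hd (head a) (by simp [h']) (head a) ha rfl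
        simp [hfix a this]
  · have : ¬ WF (K (T.map tail) (H'.map head)) := fun h' => hw <| by
      refine (WF.perm ?_).1 h'
      refine (hr _ _).trans (((List.Perm.append_right _ (List.Perm.append_left _
        (h.symm.map head)))).trans (hr _ _).symm)
    rw [cl_zero hw, cl_zero this]

theorem cl_fourT {K : List Leg → List Leg → List Leg} (hK : Ctx2 K) (a c : ℕ) :
    cl (K [head a, tail c] [head c]) - cl (K [tail c, head a] [head c])
      + (cl (K [tail c] [head a, head c]) - cl (K [tail c] [head c, head a])) = 0 := by
  obtain ⟨P, Q, R, h | h⟩ := hK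
  · have := toAsw_eq (SwRel.fourT P Q R a c (tail c) (head c) (Or.inl ⟨rfl, rfl⟩))
    simp only [map_add] at this
    simp only [h, cl]
    rw [← sub_eq_zero] at this
    rw [← this]; abel
  · have := toAsw_eq (SwRel.fourT P Q R a c (head c) (tail c) (Or.inr ⟨rfl, rfl⟩))
    simp only [map_add] at this
    simp only [h, cl]
    rw [← sub_eq_zero] at this
    rw [← this]; abel

theorem mem_labels {w : List Leg} {a : ℕ} : a ∈ labels w ↔ tail a ∈ w ∨ head a ∈ w := by
  simp only [labels, List.mem_toFinset, List.mem_map]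
  constructor
  · rintro ⟨_ | _, h, rfl⟩ <;> simp [h]
  · rintro (h | h)
    · exact ⟨_, h, rfl⟩
    · exact ⟨_, h, rfl⟩

theorem labels_perm {w w' : List Leg} (h : w.Perm w') : labels w = labels w' := by
  ext a; simp [mem_labels, h.mem_iff]

@[simp] theorem blowup_nil {n : ℕ} (f : Fin n → ℕ) : blowup f [] = [] := rfl
@[simp] theorem blowup_append {n : ℕ} (f : Fin n → ℕ) (u v : List Leg) :
    blowup f (u ++ v) = blowup f u ++ blowup f v := by simp [blowup]
@[simp] theorem blowup_tail {n : ℕ} (f : Fin n → ℕ) (a : ℕ) (v : List Leg) :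
    blowup f (tail a :: v) = (strands f a).map tail ++ blowup f v := rfl
@[simp] theorem blowup_head {n : ℕ} (f : Fin n → ℕ) (a : ℕ) (v : List Leg) :
    blowup f (head a :: v) = (strands f a).map head ++ blowup f v := rfl

theorem blowup_congr {n : ℕ} {f g : Fin n → ℕ} {w : List Leg}
    (h : ∀ x ∈ w, strands f x.label = strands g x.label) : blowup f w = blowup g w := by
  induction w with
  | nil => rfl
  | cons x w ih =>
    have h1 := h x (by simp)
    have h2 := ih (fun y hy => h y (by simp [hy]))
    cases x <;> simp_all

theorem strands_nodup {n : ℕ} (f : Fin n → ℕ) (a : ℕ) : (strands f a).Nodup :=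
  ((List.nodup_finRange n).filter _).map Fin.val_injective

theorem strands_comp {n : ℕ} {σ : ℕ → ℕ} (hσ : Function.Injective σ) (f : Fin n → ℕ) (a : ℕ) :
    strands (σ ∘ f) (σ a) = strands f a := by simp [strands, hσ.eq_iff]

theorem blowup_comp {n : ℕ} {σ : ℕ → ℕ} (hσ : Function.Injective σ) (f : Fin n → ℕ)
    (w : List Leg) : blowup (σ ∘ f) (w.map (Leg.map σ)) = blowup f w := by
  induction w with
  | nil => rfl
  | cons x w ih => cases x <;> simp [ih, strands_comp hσ]

theorem labels_map {σ : ℕ → ℕ} (w : List Leg) :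
    labels (w.map (Leg.map σ)) = (labels w).image σ := by
  ext a
  simp only [labels, List.map_map, List.mem_toFinset, List.mem_map, Finset.mem_image]
  constructor
  · rintro ⟨x, hx, rfl⟩; exact ⟨_, ⟨x, hx, rfl⟩, by cases x <;> rfl⟩
  · rintro ⟨_, ⟨x, hx, rfl⟩, rfl⟩; exact ⟨x, hx, by cases x <;> rfl⟩

theorem expansionCoeff_relabel {σ : ℕ → ℕ} (hσ : Function.Injective σ) (w : List Leg)
    (s s' : ℕ → ℤˣ) (hs : ∀ a ∈ labels w, s' (σ a) = s a) (n : ℕ) :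
    expansionCoeff (w.map (Leg.map σ)) s' n = expansionCoeff w s n := by
  unfold expansionCoeff
  symm
  refine Finset.sum_bij (fun f _ => σ ∘ f) ?_ ?_ ?_ ?_
  · intro f hf
    simp only [Fintype.mem_piFinset] at hf ⊢
    intro i
    rw [labels_map]
    exact Finset.mem_image_of_mem _ (hf i)
  · intro f _ g _ h
    exact hσ.comp_left h
  · intro g hg
    simp only [Fintype.mem_piFinset, labels_map, Finset.mem_image] at hg
    choose f hf hfg using hg
    exact ⟨f, by simpa using hf, funext hfg⟩
  · intro f hf
    simp only [Fintype.mem_piFinset] at hf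
    rw [blowup_comp hσ]
    congr 2
    exact Finset.prod_congr rfl fun i _ => by simp [hs _ (hf i)]

theorem cl_slide_block (H : List ℕ) (P Q : List Leg) (c : ℕ) :
    cl (P ++ H.map head ++ [tail c, head c] ++ Q)
      = cl (P ++ [tail c, head c] ++ H.map head ++ Q) := by
  induction H generalizing P with
  | nil => simp
  | cons a H ih =>
    have h1 := ih (P ++ [head a])
    have h2 := cl_fourT (K := fun x y => P ++ x ++ [] ++ y ++ (H.map head ++ Q))
      ⟨P, [], _, Or.inl fun _ _ => rfl⟩ a c
    simp only [List.append_assoc, List.cons_append, List.nil_append, List.map_cons] at h1 h2 ⊢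
    rw [h1, ← sub_eq_zero, ← h2]; abel

theorem cl_slide_over (T : List ℕ) (P X Q : List Leg) (a : ℕ) :
    cl (P ++ [head a] ++ T.map tail ++ X ++ T.map head ++ Q)
      - cl (P ++ T.map tail ++ [head a] ++ X ++ T.map head ++ Q)
      + (cl (P ++ T.map tail ++ X ++ [head a] ++ T.map head ++ Q)
      - cl (P ++ T.map tail ++ X ++ T.map head ++ [head a] ++ Q)) = 0 := by
  induction T generalizing P X with
  | nil => simp
  | cons c T ih =>
    have h1 := ih (P ++ [tail c]) (X ++ [head c])
    have h2 := cl_fourT (K := fun x y => P ++ x ++ (T.map tail ++ X) ++ y ++ (T.map head ++ Q))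
      ⟨P, _, _, Or.inl fun _ _ => rfl⟩ a c
    simp only [List.append_assoc, List.cons_append, List.nil_append, List.map_cons] at h1 h2 ⊢
    rw [← add_zero (0 : Asw)]
    nth_rewrite 1 [← h1]
    rw [← h2]; abel

theorem cl_kink (T : List ℕ) (P Q : List Leg) :
    cl (P ++ T.map tail ++ T.map head ++ Q) = cl (P ++ T.map head ++ T.map tail ++ Q) := by
  induction T generalizing P Q with
  | nil => rfl
  | cons c T ih =>
    have hc : Ctx2 (fun x y => P ++ x ++ y ++ Q) := ⟨P, [], Q, Or.inl fun _ _ => by simp⟩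
    have hc' : Ctx2 (fun x y => P ++ y ++ x ++ Q) := ⟨P, [], Q, Or.inr fun _ _ => by simp⟩
    have hp : (c :: T).Perm (T ++ [c]) := (List.perm_append_singleton c T).symm
    have e1 := cl_heads hc (T := c :: T) (H := c :: T) (H' := T ++ [c]) (fun _ h => h) hp
    have e2 := cl_heads hc' (T := c :: T) (H := c :: T) (H' := T ++ [c]) (fun _ h => h) hp
    have e3 := cl_slide_over T (P ++ [tail c]) [] Q c
    have e4 := toAsw_eq (SwRel.ri (P ++ T.map head) (T.map tail ++ Q) c)
    have e5 := cl_slide_block T P (T.map tail ++ Q) c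
    have e6 := ih (P ++ [tail c, head c]) Q
    simp only [List.append_assoc, List.cons_append, List.nil_append, List.map_cons,
      List.map_append, List.map_nil] at e1 e2 e3 e4 e5 e6 ⊢
    rw [e1, e2]
    change cl _ = cl _ at e4
    rw [← e4, e5, ← e6]
    symm
    rw [← sub_eq_zero, ← e3]; abel

/-- All lifts of a colouring along the map that merges `b` into `a`. -/
def lifts {n : ℕ} (a b : ℕ) (g : Fin n → ℕ) : Finset (Fin n → ℕ) :=
  Fintype.piFinset fun i => if g i = a then {a, b} else {g i}

theorem mem_lifts {n : ℕ} {a b : ℕ} {g f : Fin n → ℕ} :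
    f ∈ lifts a b g ↔ ∀ i, (g i = a ∧ (f i = a ∨ f i = b)) ∨ (g i ≠ a ∧ f i = g i) := by
  simp only [lifts, Fintype.mem_piFinset]
  refine forall_congr' fun i => ?_
  split_ifs with h <;> simp [h]

theorem sum_merge {n : ℕ} {M : Type*} [AddCommMonoid M] {a b : ℕ} (hab : a ≠ b) (L : Finset ℕ)
    (ha : a ∈ L) (hb : b ∈ L) (F : (Fin n → ℕ) → M) :
    ∑ f ∈ Fintype.piFinset (fun _ : Fin n => L), F f
      = ∑ g ∈ Fintype.piFinset (fun _ : Fin n => L.erase b), ∑ f ∈ lifts a b g, F f := by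
  rw [← Finset.sum_fiberwise_of_maps_to
    (t := Fintype.piFinset (fun _ : Fin n => L.erase b))
    (g := fun f i => if f i = b then a else f i)]
  · refine Finset.sum_congr rfl fun g hg => Finset.sum_congr ?_ fun _ _ => rfl
    ext f
    simp only [Fintype.mem_piFinset, Finset.mem_erase] at hg
    simp only [Finset.mem_filter, Fintype.mem_piFinset, mem_lifts, funext_iff]
    constructor
    · rintro ⟨-, h⟩ i
      have := h i
      split_ifs at this with h'
      · exact Or.inl ⟨this.symm, Or.inr h'⟩
      · by_cases hga : g i = a
        · exact Or.inl ⟨hga, Or.inl (this.trans hga)⟩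
        · exact Or.inr ⟨hga, this⟩
    · intro h
      refine ⟨fun i => ?_, fun i => ?_⟩
      · rcases h i with ⟨h1, h2 | h2⟩ | ⟨h1, h2⟩ <;> simp_all
      · rcases h i with ⟨h1, h2 | h2⟩ | ⟨h1, h2⟩ <;> simp_all
  · intro f hf
    simp only [Fintype.mem_piFinset, Finset.mem_erase] at hf ⊢
    intro i
    split_ifs with h
    · exact ⟨hab, ha⟩
    · exact ⟨h, hf i⟩

theorem strands_lift {n : ℕ} {a b : ℕ} {g f : Fin n → ℕ} (hf : f ∈ lifts a b g) {c : ℕ}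
    (hca : c ≠ a) (hcb : c ≠ b) : strands f c = strands g c := by
  rw [mem_lifts] at hf
  unfold strands
  congr 1
  refine List.filter_congr fun i _ => ?_
  rcases hf i with ⟨h1, h2 | h2⟩ | ⟨h1, h2⟩ <;> simp [h1, h2, hca.symm, hcb.symm]

theorem strands_merge {n : ℕ} {a b : ℕ} (hab : a ≠ b) {g f : Fin n → ℕ} (hf : f ∈ lifts a b g)
    (hg : ∀ i, g i ≠ b) : (strands f a ++ strands f b).Perm (strands g a) := by
  rw [mem_lifts] at hf
  refine (List.perm_ext_iff_of_nodup ?_ (strands_nodup _ _)).2 fun x => ?_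
  · refine List.nodup_append.2 ⟨strands_nodup _ _, strands_nodup _ _, ?_⟩
    simp only [strands, List.mem_map, List.mem_filter, List.mem_finRange, true_and,
      decide_eq_true_eq]
    rintro _ ⟨i, hi, rfl⟩ _ ⟨j, hj, rfl⟩ h
    rw [Fin.val_injective h, hj] at hi
    exact hab hi.symm
  · simp only [strands, List.mem_append, List.mem_map, List.mem_filter, List.mem_finRange,
      true_and, decide_eq_true_eq]
    constructor
    · rintro (⟨i, hi, rfl⟩ | ⟨i, hi, rfl⟩) <;> refine ⟨i, ?_, rfl⟩ <;>
        rcases hf i with ⟨h1, h2⟩ | ⟨h1, h2⟩ <;> simp_all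
    · rintro ⟨i, hi, rfl⟩
      rcases hf i with ⟨h1, h2 | h2⟩ | ⟨h1, h2⟩
      · exact Or.inl ⟨i, h2, rfl⟩
      · exact Or.inr ⟨i, h2, rfl⟩
      · exact absurd hi h1

theorem Ctx2.blowup {K : List Leg → List Leg → List Leg} (hK : Ctx2 K) {n : ℕ} (f : Fin n → ℕ) :
    ∃ K', Ctx2 K' ∧ (∀ x y, blowup f (K x y) = K' (blowup f x) (blowup f y)) ∧
      ∀ g : Fin n → ℕ, (∀ ℓ ∈ K [] [], strands g ℓ.label = strands f ℓ.label) →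
        ∀ x y, WKnots.blowup g (K x y) = K' (WKnots.blowup g x) (WKnots.blowup g y) := by
  obtain ⟨P, Q, R, h | h⟩ := hK
  · refine ⟨fun x y => WKnots.blowup f P ++ x ++ WKnots.blowup f Q ++ y ++ WKnots.blowup f R,
      ⟨_, _, _, Or.inl fun _ _ => rfl⟩, fun x y => by simp [h], fun g hg x y => ?_⟩
    rw [h] at hg
    rw [h, ← blowup_congr (w := P) fun ℓ hℓ => hg ℓ (by simp [hℓ]),
      ← blowup_congr (w := Q) fun ℓ hℓ => hg ℓ (by simp [hℓ]),
      ← blowup_congr (w := R) fun ℓ hℓ => hg ℓ (by simp [hℓ])]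
    simp
  · refine ⟨fun x y => WKnots.blowup f P ++ y ++ WKnots.blowup f Q ++ x ++ WKnots.blowup f R,
      ⟨_, _, _, Or.inr fun _ _ => rfl⟩, fun x y => by simp [h], fun g hg x y => ?_⟩
    rw [h] at hg
    rw [h, ← blowup_congr (w := P) fun ℓ hℓ => hg ℓ (by simp [hℓ]),
      ← blowup_congr (w := Q) fun ℓ hℓ => hg ℓ (by simp [hℓ]),
      ← blowup_congr (w := R) fun ℓ hℓ => hg ℓ (by simp [hℓ])]
    simp

theorem WF.not_mem_of_two {K : List Leg → List Leg → List Leg} (hK : Ctx2 K) {X Y : List Leg}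
    (h : WF (K X Y)) {ℓ : Leg} (hl : ℓ ∈ X ∨ ℓ ∈ Y) : ℓ ∉ K [] [] := by
  obtain ⟨r, hr⟩ := hK.perm
  have hn := h.1
  rw [(hr _ _).nodup_iff, List.nodup_append] at hn
  intro hm
  rw [(hr _ _).mem_iff] at hm
  exact hn.2.2 ℓ (by simpa using hl) ℓ (by simpa using hm) rfl

theorem expansionCoeff_r2 {K : List Leg → List Leg → List Leg} (hK : Ctx2 K) (s : ℕ → ℤˣ)
    {a b : ℕ} (hs : s a = - s b) {Y : List Leg} (hY : Y = [head a, head b] ∨ Y = [head b, head a])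
    (hw : WF (K [tail a, tail b] Y)) (n : ℕ) :
    expansionCoeff (K [tail a, tail b] Y) s n = expansionCoeff (K [] []) s n := by
  obtain ⟨r, hr⟩ := hK.perm
  have hYm : head a ∈ Y ∧ head b ∈ Y := by rcases hY with rfl | rfl <;> simp
  have hab : a ≠ b := by
    rintro rfl
    have hn := hw.1
    rw [(hr _ _).nodup_iff] at hn
    simp at hn
  have hna : ∀ ℓ ∈ K [] [], ℓ.label ≠ a ∧ ℓ.label ≠ b := by
    have t1 := WF.not_mem_of_two hK hw (ℓ := tail a) (by simp)
    have t2 := WF.not_mem_of_two hK hw (ℓ := tail b) (by simp)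
    have t3 := WF.not_mem_of_two hK hw (ℓ := head a) (by simp [hYm])
    have t4 := WF.not_mem_of_two hK hw (ℓ := head b) (by simp [hYm])
    rintro (x | x) hx <;> constructor <;> rintro h <;> simp only [label_tail, label_head] at h <;>
      subst h <;> contradiction
  have hL : ∀ x, x ∈ labels (K [tail a, tail b] Y) ↔ x = a ∨ x = b ∨ x ∈ labels (K [] []) := by
    intro x
    rw [labels_perm (hr _ _), labels_perm (hr [] [])]
    rcases hY with rfl | rfl <;> simp [mem_labels] <;> tauto
  have hLa : a ∉ labels (K [] []) := fun h => by
    rcases mem_labels.1 h with h | h <;> exact (hna _ h).1 rfl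
  have hLb : b ∉ labels (K [] []) := fun h => by
    rcases mem_labels.1 h with h | h <;> exact (hna _ h).2 rfl
  unfold expansionCoeff
  rw [sum_merge hab _ ((hL a).2 (by simp)) ((hL b).2 (by simp))]
  symm
  refine Finset.sum_subset_zero_on_sdiff ?_ ?_ ?_
  · intro g hg
    simp only [Fintype.mem_piFinset, Finset.mem_erase, hL] at hg ⊢
    exact fun i => ⟨fun h => hLb (h ▸ hg i), Or.inr (Or.inr (hg i))⟩
  · intro g hg
    simp only [Finset.mem_sdiff, Fintype.mem_piFinset, Finset.mem_erase, hL] at hg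
    obtain ⟨hg1, hg2⟩ := hg
    push Not at hg2
    obtain ⟨i0, hi0⟩ := hg2
    have hi : g i0 = a := by
      rcases (hg1 i0).2 with h | h | h
      · exact h
      · exact absurd h (hg1 i0).1
      · exact absurd h hi0
    obtain ⟨K', hK', -, hKg⟩ := hK.blowup g
    have key : ∀ f ∈ lifts a b g, toAsw (diagram (blowup f (K [tail a, tail b] Y)))
        = cl (K' ((strands g a).map tail) ((strands g a).map head)) := by
      intro f hf
      have hp := strands_merge hab hf (fun i => (hg1 i).1)
      rw [hKg f (fun ℓ hℓ => strands_lift hf (hna ℓ hℓ).1 (hna ℓ hℓ).2)]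
      change cl _ = _
      have e1 : blowup f [tail a, tail b] = (strands f a ++ strands f b).map tail := by simp
      rw [e1, cl_tc2 hK' hp]
      rcases hY with rfl | rfl
      · have e2 : blowup f [head a, head b] = (strands f a ++ strands f b).map head := by simp
        rw [e2, cl_heads hK' (fun x hx => hp.mem_iff.1 hx) hp]
      · have e2 : blowup f [head b, head a] = (strands f b ++ strands f a).map head := by simp
        have hp' := List.perm_append_comm.trans hp
        rw [e2, cl_heads hK' (fun x hx => hp'.mem_iff.1 hx) hp']
    rw [Finset.sum_congr rfl fun f hf => by rw [key f hf], ← Finset.sum_smul, ← Finset.mul_sum]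
    have hz : ∑ f ∈ lifts a b g, ∏ i, ((s (f i) : ℤ) : ℚ) = 0 := by
      unfold lifts
      rw [← Finset.prod_univ_sum (fun i => if g i = a then {a, b} else {g i})
        (fun _ x => ((s x : ℤ) : ℚ))]
      refine Finset.prod_eq_zero (Finset.mem_univ i0) ?_
      rw [if_pos hi, Finset.sum_pair hab, hs]
      push_cast
      ring
    rw [hz]; simp
  · intro g hg
    simp only [Fintype.mem_piFinset] at hg
    have hga : ∀ i, g i ≠ a := fun i h => hLa (h ▸ hg i)
    have hgb : ∀ i, g i ≠ b := fun i h => hLb (h ▸ hg i)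
    have : lifts a b g = {g} := by
      ext f
      simp [mem_lifts, hga, funext_iff]
    rw [this, Finset.sum_singleton]
    obtain ⟨K', -, hKg, -⟩ := hK.blowup g
    have sa : strands g a = [] := by simp [strands, hga]
    have sb : strands g b = [] := by simp [strands, hgb]
    rw [hKg, hKg]
    rcases hY with rfl | rfl <;> simp [sa, sb]

/-- Concatenation contexts with three holes. -/
def Ctx3 (K : List Leg → List Leg → List Leg → List Leg) : Prop :=
  ∃ P Q R S, (∀ x y z, K x y z = P ++ x ++ Q ++ y ++ R ++ z ++ S) ∨
    (∀ x y z, K x y z = P ++ x ++ Q ++ z ++ R ++ y ++ S) ∨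
    (∀ x y z, K x y z = P ++ y ++ Q ++ x ++ R ++ z ++ S) ∨
    (∀ x y z, K x y z = P ++ y ++ Q ++ z ++ R ++ x ++ S) ∨
    (∀ x y z, K x y z = P ++ z ++ Q ++ x ++ R ++ y ++ S) ∨
    (∀ x y z, K x y z = P ++ z ++ Q ++ y ++ R ++ x ++ S)

theorem Ctx3.fix1 {K : List Leg → List Leg → List Leg → List Leg} (hK : Ctx3 K) (x : List Leg) :
    Ctx2 (K x) := by
  obtain ⟨P, Q, R, S, h | h | h | h | h | h⟩ := hK
  · exact ⟨P ++ x ++ Q, R, S, Or.inl fun y z => by simp [h]⟩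
  · exact ⟨P ++ x ++ Q, R, S, Or.inr fun y z => by simp [h]⟩
  · exact ⟨P, Q ++ x ++ R, S, Or.inl fun y z => by simp [h]⟩
  · exact ⟨P, Q, R ++ x ++ S, Or.inl fun y z => by simp [h]⟩
  · exact ⟨P, Q ++ x ++ R, S, Or.inr fun y z => by simp [h]⟩
  · exact ⟨P, Q, R ++ x ++ S, Or.inr fun y z => by simp [h]⟩

theorem Ctx3.fix2 {K : List Leg → List Leg → List Leg → List Leg} (hK : Ctx3 K) (y : List Leg) :
    Ctx2 (fun x z => K x y z) := by
  obtain ⟨P, Q, R, S, h | h | h | h | h | h⟩ := hK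
  · exact ⟨P, Q ++ y ++ R, S, Or.inl fun y z => by simp [h]⟩
  · exact ⟨P, Q, R ++ y ++ S, Or.inl fun y z => by simp [h]⟩
  · exact ⟨P ++ y ++ Q, R, S, Or.inl fun y z => by simp [h]⟩
  · exact ⟨P ++ y ++ Q, R, S, Or.inr fun y z => by simp [h]⟩
  · exact ⟨P, Q, R ++ y ++ S, Or.inr fun y z => by simp [h]⟩
  · exact ⟨P, Q ++ y ++ R, S, Or.inr fun y z => by simp [h]⟩

theorem Ctx3.perm {K : List Leg → List Leg → List Leg → List Leg} (hK : Ctx3 K) :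
    ∃ r, ∀ x y z, (K x y z).Perm (x ++ y ++ z ++ r) := by
  obtain ⟨P, Q, R, S, h | h | h | h | h | h⟩ := hK <;>
    refine ⟨P ++ Q ++ R ++ S, fun x y z => ?_⟩ <;> rw [h] <;>
    refine List.perm_iff_count.2 fun a => ?_ <;> simp <;> omega

theorem Ctx3.blowup {K : List Leg → List Leg → List Leg → List Leg} (hK : Ctx3 K) {n : ℕ}
    (f : Fin n → ℕ) : ∃ K', Ctx3 K' ∧
      ∀ g : Fin n → ℕ, (∀ ℓ ∈ K [] [] [], strands g ℓ.label = strands f ℓ.label) →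
        ∀ x y z, WKnots.blowup g (K x y z)
          = K' (WKnots.blowup g x) (WKnots.blowup g y) (WKnots.blowup g z) := by
  have key : ∀ P Q R S : List Leg, (∀ ℓ ∈ P ++ Q ++ R ++ S, ℓ ∈ K [] [] []) →
      ∀ g : Fin n → ℕ, (∀ ℓ ∈ K [] [] [], strands g ℓ.label = strands f ℓ.label) →
      WKnots.blowup g P = WKnots.blowup f P ∧ WKnots.blowup g Q = WKnots.blowup f Q ∧
      WKnots.blowup g R = WKnots.blowup f R ∧ WKnots.blowup g S = WKnots.blowup f S := by
    intro P Q R S h g hg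
    refine ⟨blowup_congr fun ℓ hℓ => hg ℓ (h ℓ ?_), blowup_congr fun ℓ hℓ => hg ℓ (h ℓ ?_),
      blowup_congr fun ℓ hℓ => hg ℓ (h ℓ ?_), blowup_congr fun ℓ hℓ => hg ℓ (h ℓ ?_)⟩ <;>
      simp [hℓ]
  obtain ⟨P, Q, R, S, h⟩ := hK
  let p := WKnots.blowup f P
  let q := WKnots.blowup f Q
  let r := WKnots.blowup f R
  let t := WKnots.blowup f S
  rcases h with h | h | h | h | h | h
  · refine ⟨fun x y z => p ++ x ++ q ++ y ++ r ++ z ++ t, ⟨p, q, r, t, by simp⟩,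
      fun g hg x y z => ?_⟩
    obtain ⟨h1, h2, h3, h4⟩ := key P Q R S (by simp [h]) g hg
    simp [h, h1, h2, h3, h4, p, q, r, t]
  · refine ⟨fun x y z => p ++ x ++ q ++ z ++ r ++ y ++ t, ⟨p, q, r, t, by simp⟩,
      fun g hg x y z => ?_⟩
    obtain ⟨h1, h2, h3, h4⟩ := key P Q R S (by simp [h]) g hg
    simp [h, h1, h2, h3, h4, p, q, r, t]
  · refine ⟨fun x y z => p ++ y ++ q ++ x ++ r ++ z ++ t, ⟨p, q, r, t, by simp⟩,
      fun g hg x y z => ?_⟩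
    obtain ⟨h1, h2, h3, h4⟩ := key P Q R S (by simp [h]) g hg
    simp [h, h1, h2, h3, h4, p, q, r, t]
  · refine ⟨fun x y z => p ++ y ++ q ++ z ++ r ++ x ++ t, ⟨p, q, r, t, by simp⟩,
      fun g hg x y z => ?_⟩
    obtain ⟨h1, h2, h3, h4⟩ := key P Q R S (by simp [h]) g hg
    simp [h, h1, h2, h3, h4, p, q, r, t]
  · refine ⟨fun x y z => p ++ z ++ q ++ x ++ r ++ y ++ t, ⟨p, q, r, t, by simp⟩,
      fun g hg x y z => ?_⟩
    obtain ⟨h1, h2, h3, h4⟩ := key P Q R S (by simp [h]) g hg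
    simp [h, h1, h2, h3, h4, p, q, r, t]
  · refine ⟨fun x y z => p ++ z ++ q ++ y ++ r ++ x ++ t, ⟨p, q, r, t, by simp⟩,
      fun g hg x y z => ?_⟩
    obtain ⟨h1, h2, h3, h4⟩ := key P Q R S (by simp [h]) g hg
    simp [h, h1, h2, h3, h4, p, q, r, t]

theorem swap_blocks {α M : Type*} (E : List α → M) (p q : α → Prop)
    (h : ∀ U V i j, p i → q j → (U ++ i :: j :: V).Nodup →
      E (U ++ i :: j :: V) = E (U ++ j :: i :: V))
    (T C U V : List α) (hT : ∀ i ∈ T, p i) (hC : ∀ j ∈ C, q j) (hn : (U ++ T ++ C ++ V).Nodup) :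
    E (U ++ T ++ C ++ V) = E (U ++ C ++ T ++ V) := by
  have move : ∀ (C U V : List α) (i : α), p i → (∀ j ∈ C, q j) → (U ++ i :: C ++ V).Nodup →
      E (U ++ i :: C ++ V) = E (U ++ C ++ i :: V) := by
    intro C
    induction C with
    | nil => intro U V i _ _ _; simp
    | cons j C ih =>
      intro U V i hi hC hn
      have h1 := h U (C ++ V) i j hi (hC j (by simp)) (by simpa using hn)
      have hn' : (U ++ [j] ++ i :: C ++ V).Nodup := by
        refine (List.Perm.nodup_iff ?_).1 hn
        simpa using List.Perm.append_left U (List.Perm.swap j i (C ++ V))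
      have h2 := ih (U ++ [j]) V i hi (fun k hk => hC k (by simp [hk])) hn'
      simp only [List.append_assoc, List.cons_append, List.nil_append] at h1 h2 ⊢
      rw [h1, h2]
  induction T generalizing U with
  | nil => simp
  | cons i T ih =>
    have h1 := ih (U ++ [i]) (fun k hk => hT k (by simp [hk])) (by simpa using hn)
    have hn' : (U ++ i :: C ++ (T ++ V)).Nodup := by
      refine (List.Perm.nodup_iff ?_).1 hn
      simp only [List.append_assoc, List.cons_append]
      refine List.Perm.append_left _ (List.Perm.cons _ ?_)
      rw [← List.append_assoc, ← List.append_assoc]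
      exact List.Perm.append_right _ List.perm_append_comm
    have h2 := move C U (T ++ V) i (hT i (by simp)) hC hn'
    simp only [List.append_assoc, List.cons_append, List.nil_append] at h1 h2 ⊢
    rw [h1, h2]

section R3

variable {n : ℕ}

/-- The reservoir legs on the middle strand, in the order given by `π`. -/
def midWord (a c : ℕ) (f : Fin n → ℕ) (π : List (Fin n)) : List Leg :=
  π.flatMap fun i => if f i = a then [head i] else if f i = c then [tail i] else []

/-- The reservoir legs on the lowest strand, in the order given by `π`. -/
def lowWord (b c : ℕ) (f : Fin n → ℕ) (π : List (Fin n)) : List Leg :=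
  π.flatMap fun i => if f i = b then [head i] else if f i = c then [head i] else []

theorem midWord_congr {a c : ℕ} {f f' : Fin n → ℕ} {π : List (Fin n)}
    (h : ∀ i ∈ π, f i = f' i) : midWord a c f π = midWord a c f' π := by
  induction π with
  | nil => rfl
  | cons x l ih =>
    have := ih fun i hi => h i (by simp [hi])
    have h1 := h x (by simp)
    simp only [midWord, List.flatMap_cons] at this ⊢
    rw [this, h1]

theorem lowWord_congr {a c : ℕ} {f f' : Fin n → ℕ} {π : List (Fin n)}
    (h : ∀ i ∈ π, f i = f' i) : lowWord a c f π = lowWord a c f' π := by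
  induction π with
  | nil => rfl
  | cons x l ih =>
    have := ih fun i hi => h i (by simp [hi])
    have h1 := h x (by simp)
    simp only [lowWord, List.flatMap_cons] at this ⊢
    rw [this, h1]

@[simp] theorem midWord_append (a c : ℕ) (f : Fin n → ℕ) (π ρ : List (Fin n)) :
    midWord a c f (π ++ ρ) = midWord a c f π ++ midWord a c f ρ := by simp [midWord]
@[simp] theorem lowWord_append (a c : ℕ) (f : Fin n → ℕ) (π ρ : List (Fin n)) :
    lowWord a c f (π ++ ρ) = lowWord a c f π ++ lowWord a c f ρ := by simp [lowWord]

def revIf (rv : Bool) (π : List (Fin n)) : List (Fin n) := if rv then π.reverse else π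

theorem r3_adjacent {K : List Leg → List Leg → List Leg} (hK : Ctx2 K) {a b c : ℕ}
    (hab : a ≠ b) (hac : a ≠ c) (hbc : b ≠ c) (s : ℕ → ℤˣ) (rv : Bool)
    (hs : s b = if rv then - s a else s a) (g : Fin n → ℕ) (U V : List (Fin n)) (i j : Fin n)
    (hi : g i = a) (hj : g j = c) (hn : (U ++ i :: j :: V).Nodup) :
    ∑ f ∈ lifts a b g, (∏ k, ((s (f k) : ℤ) : ℚ)) •
        cl (K (midWord a c f (U ++ i :: j :: V)) (lowWord b c f (revIf rv (U ++ i :: j :: V))))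
      = ∑ f ∈ lifts a b g, (∏ k, ((s (f k) : ℤ) : ℚ)) •
        cl (K (midWord a c f (U ++ j :: i :: V)) (lowWord b c f (revIf rv (U ++ j :: i :: V)))) := by
  rw [← sub_eq_zero, ← Finset.sum_sub_distrib]
  have hij : i ≠ j := by
    rintro rfl; exact hac (hi.symm.trans hj)
  have hiU : ∀ k ∈ U, k ≠ i := by
    rintro k hk rfl
    exact (List.nodup_append.1 hn).2.2 _ hk _ (by simp) rfl
  have hiV : ∀ k ∈ V, k ≠ i := by
    rintro k hk rfl
    have := (List.nodup_append.1 hn).2.1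
    simp [hk] at this
  -- pairing of the two lifts that differ at `i`
  have key : ∀ f ∈ lifts a b g, f i = a →
      ((∏ k, ((s (f k) : ℤ) : ℚ)) •
          cl (K (midWord a c f (U ++ i :: j :: V)) (lowWord b c f (revIf rv (U ++ i :: j :: V))))
        - (∏ k, ((s (f k) : ℤ) : ℚ)) •
          cl (K (midWord a c f (U ++ j :: i :: V)) (lowWord b c f (revIf rv (U ++ j :: i :: V)))))
      + ((∏ k, ((s (Function.update f i b k) : ℤ) : ℚ)) •
          cl (K (midWord a c (Function.update f i b) (U ++ i :: j :: V))
            (lowWord b c (Function.update f i b) (revIf rv (U ++ i :: j :: V))))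
        - (∏ k, ((s (Function.update f i b k) : ℤ) : ℚ)) •
          cl (K (midWord a c (Function.update f i b) (U ++ j :: i :: V))
            (lowWord b c (Function.update f i b) (revIf rv (U ++ j :: i :: V))))) = 0 := by
    intro f hf hfi
    set f' := Function.update f i b with hf'
    have hfj : f j = c := by
      rcases mem_lifts.1 hf j with ⟨h1, -⟩ | ⟨-, h2⟩
      · exact absurd (h1.symm.trans hj) hac
      · exact h2.trans hj
    have hf'i : f' i = b := by simp [hf']
    have hf'j : f' j = c := by simp [hf', hij.symm, hfj]
    have hU : ∀ k ∈ U, f' k = f k := fun k hk => by simp [hf', hiU k hk]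
    have hV : ∀ k ∈ V, f' k = f k := fun k hk => by simp [hf', hiV k hk]
    have m1 : midWord a c f [i, j] = [head i, tail j] := by
      simp [midWord, hfi, hfj, hac.symm]
    have m2 : midWord a c f [j, i] = [tail j, head i] := by
      simp [midWord, hfi, hfj, hac.symm]
    have m3 : midWord a c f' [i, j] = [tail j] := by
      simp [midWord, hf'i, hf'j, hac.symm, hbc, hab.symm]
    have m4 : midWord a c f' [j, i] = [tail j] := by
      simp [midWord, hf'i, hf'j, hac.symm, hbc, hab.symm]
    have l1 : lowWord b c f [i, j] = [head j] := by
      simp [lowWord, hfi, hfj, hac, hab]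
    have l2 : lowWord b c f [j, i] = [head j] := by
      simp [lowWord, hfi, hfj, hac, hab]
    have l3 : lowWord b c f' [i, j] = [head i, head j] := by
      simp [lowWord, hf'i, hf'j]
    have l4 : lowWord b c f' [j, i] = [head j, head i] := by
      simp [lowWord, hf'i, hf'j]
    have mU : midWord a c f' U = midWord a c f U := midWord_congr hU
    have mV : midWord a c f' V = midWord a c f V := midWord_congr hV
    have lU : lowWord b c f' U = lowWord b c f U := lowWord_congr hU
    have lV : lowWord b c f' V = lowWord b c f V := lowWord_congr hV
    have lU' : lowWord b c f' U.reverse = lowWord b c f U.reverse :=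
      lowWord_congr fun k hk => hU k (by simpa using hk)
    have lV' : lowWord b c f' V.reverse = lowWord b c f V.reverse :=
      lowWord_congr fun k hk => hV k (by simpa using hk)
    have hprod : (∏ k, ((s (f' k) : ℤ) : ℚ)) =
        (if rv then (-1 : ℚ) else 1) * ∏ k, ((s (f k) : ℤ) : ℚ) := by
      rw [← Finset.mul_prod_erase _ _ (Finset.mem_univ i),
        ← Finset.mul_prod_erase _ (fun k => ((s (f k) : ℤ) : ℚ)) (Finset.mem_univ i),
        hf'i, hfi, hs]
      have : ∏ k ∈ Finset.univ.erase i, ((s (f' k) : ℤ) : ℚ)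
          = ∏ k ∈ Finset.univ.erase i, ((s (f k) : ℤ) : ℚ) := by
        refine Finset.prod_congr rfl fun k hk => ?_
        rw [hf', Function.update_of_ne (Finset.ne_of_mem_erase hk)]
      rw [this]
      cases rv <;> simp
    have split1 : U ++ i :: j :: V = U ++ [i, j] ++ V := by simp
    have split2 : U ++ j :: i :: V = U ++ [j, i] ++ V := by simp
    rw [split1, split2, hprod]
    cases rv
    · have h4 := cl_fourT (hK.extend (midWord a c f U) (midWord a c f V)
        (lowWord b c f U) (lowWord b c f V)) i j
      simp only [revIf, Bool.false_eq_true, if_false, midWord_append, lowWord_append, m1, m2, m3, m4,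
        l1, l2, l3, l4, mU, mV, lU, lV, one_mul]
      rw [← smul_sub, ← smul_sub, ← smul_add, h4, smul_zero]
    · have h4 := cl_fourT (hK.extend (midWord a c f U) (midWord a c f V)
        (lowWord b c f V.reverse) (lowWord b c f U.reverse)) i j
      have r1 : (U ++ [i, j] ++ V).reverse = V.reverse ++ [j, i] ++ U.reverse := by simp
      have r2 : (U ++ [j, i] ++ V).reverse = V.reverse ++ [i, j] ++ U.reverse := by simp
      simp only [revIf, if_true, r1, r2, midWord_append, lowWord_append, m1, m2, m3, m4,
        l1, l2, l3, l4, mU, mV, lU', lV', neg_mul, one_mul, neg_smul]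
      rw [← smul_zero (∏ k, ((s (f k) : ℤ) : ℚ)), ← h4]
      simp only [smul_add, smul_sub]
      abel
  refine Finset.sum_involution (fun f _ => Function.update f i (Equiv.swap a b (f i))) ?_ ?_ ?_ ?_
  · intro f hf
    rcases mem_lifts.1 hf i with ⟨-, h | h⟩ | ⟨h, -⟩
    · rw [h, Equiv.swap_apply_left]
      exact key f hf h
    · rw [h, Equiv.swap_apply_right]
      have hmem : Function.update f i a ∈ lifts a b g := by
        rw [mem_lifts] at hf ⊢
        intro k
        by_cases hk : k = i
        · subst hk; simp [hi]
        · simpa [hk] using hf k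
      have := key (Function.update f i a) hmem (by simp)
      have e : Function.update (Function.update f i a) i b = f := by
        rw [Function.update_idem, ← h, Function.update_eq_self]
      rw [e] at this
      rw [add_comm]
      exact this
    · exact absurd hi h
  · intro f hf _ h
    have := congrFun h i
    rw [Function.update_self] at this
    rcases mem_lifts.1 hf i with ⟨-, h | h⟩ | ⟨h, -⟩
    · rw [h, Equiv.swap_apply_left] at this; exact hab this.symm
    · rw [h, Equiv.swap_apply_right] at this; exact hab this
    · exact absurd hi h
  · intro f hf
    rw [mem_lifts] at hf ⊢
    intro k
    by_cases hk : k = i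
    · subst hk
      rcases hf k with ⟨-, h | h⟩ | ⟨h, -⟩
      · simp [hi, h]
      · simp [hi, h]
      · exact absurd hi h
    · simpa [hk] using hf k
  · intro f hf
    simp

end R3

section R3b

variable {n : ℕ}

def colorList (g : Fin n → ℕ) (a : ℕ) : List (Fin n) :=
  (List.finRange n).filter (fun i => g i = a)

theorem mem_colorList {g : Fin n → ℕ} {a : ℕ} {i : Fin n} : i ∈ colorList g a ↔ g i = a := by
  simp [colorList]

theorem flatMap_if_filter {α : Type} (l : List (Fin n)) (p : Fin n → Prop) [DecidablePred p]
    (u : Fin n → α) :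
    (l.flatMap fun i => if p i then [u i] else []) = (l.filter (fun i => p i)).map u := by
  induction l with
  | nil => rfl
  | cons x l ih => by_cases h : p x <;> simp [h, ih]

theorem midWord_T {a b c : ℕ} (hbc : b ≠ c) {g f : Fin n → ℕ} (hf : f ∈ lifts a b g) :
    midWord a c f (colorList g a) = (strands f a).map head := by
  rw [mem_lifts] at hf
  have h1 : midWord a c f (colorList g a)
      = (colorList g a).flatMap fun i => if f i = a then [head i] else [] := by
    unfold midWord
    refine List.flatMap_congr fun i hi => ?_
    rw [mem_colorList] at hi
    rcases hf i with ⟨-, h | h⟩ | ⟨h, -⟩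
    · simp [h]
    · simp [h, hbc]
    · exact absurd hi h
  rw [h1, flatMap_if_filter]
  simp only [strands, List.map_map, colorList, List.filter_filter]
  congr 1
  refine List.filter_congr fun i _ => ?_
  rcases hf i with ⟨h0, h | h⟩ | ⟨h, h'⟩ <;> simp_all

theorem midWord_C {a b c : ℕ} (hac : a ≠ c) (hbc : b ≠ c) {g f : Fin n → ℕ} (hf : f ∈ lifts a b g) :
    midWord a c f (colorList g c) = (strands f c).map tail := by
  rw [strands_lift hf hac.symm hbc.symm]
  rw [mem_lifts] at hf
  have h1 : midWord a c f (colorList g c)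
      = (colorList g c).flatMap fun i : Fin n => [tail i.1] := by
    unfold midWord
    refine List.flatMap_congr fun i hi => ?_
    rw [mem_colorList] at hi
    rcases hf i with ⟨h, -⟩ | ⟨-, h⟩
    · exact absurd (h.symm.trans hi) hac
    · simp [h, hi, hac.symm]
  rw [h1]
  simp [strands, colorList, Function.comp_def, ← List.map_eq_flatMap]

theorem lowWord_T {a b c : ℕ} (hab : a ≠ b) (hac : a ≠ c) (_hbc : b ≠ c) {g f : Fin n → ℕ}
    (hf : f ∈ lifts a b g) (hg : ∀ i, g i ≠ b) :
    lowWord b c f (colorList g a) = (strands f b).map head := by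
  rw [mem_lifts] at hf
  have h1 : lowWord b c f (colorList g a)
      = (colorList g a).flatMap fun i => if f i = b then [head i] else [] := by
    unfold lowWord
    refine List.flatMap_congr fun i hi => ?_
    rw [mem_colorList] at hi
    rcases hf i with ⟨-, h | h⟩ | ⟨h, -⟩
    · simp [h, hab, hac]
    · simp [h]
    · exact absurd hi h
  rw [h1, flatMap_if_filter]
  simp only [strands, List.map_map, colorList, List.filter_filter]
  congr 1
  refine List.filter_congr fun i _ => ?_
  rcases hf i with ⟨h0, h | h⟩ | ⟨h, h'⟩ <;> simp_all

theorem lowWord_C {a b c : ℕ} (hac : a ≠ c) (hbc : b ≠ c) {g f : Fin n → ℕ} (hf : f ∈ lifts a b g) :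
    lowWord b c f (colorList g c) = (strands f c).map head := by
  rw [strands_lift hf hac.symm hbc.symm]
  rw [mem_lifts] at hf
  have h1 : lowWord b c f (colorList g c)
      = (colorList g c).flatMap fun i : Fin n => [head i.1] := by
    unfold lowWord
    refine List.flatMap_congr fun i hi => ?_
    rw [mem_colorList] at hi
    rcases hf i with ⟨h, -⟩ | ⟨-, h⟩
    · exact absurd (h.symm.trans hi) hac
    · simp [h, hi]
  rw [h1]
  simp [strands, colorList, Function.comp_def, ← List.map_eq_flatMap]

theorem lowWord_reverse_perm (b c : ℕ) (f : Fin n → ℕ) (π : List (Fin n)) :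
    (lowWord b c f π.reverse).Perm (lowWord b c f π) :=
  (List.reverse_perm π).flatMap_right _

theorem lowWord_eq_map (b c : ℕ) (f : Fin n → ℕ) (π : List (Fin n)) :
    ∃ l : List ℕ, lowWord b c f π = l.map head := by
  induction π with
  | nil => exact ⟨[], rfl⟩
  | cons x π ih =>
    obtain ⟨l, hl⟩ := ih
    refine ⟨(if f x = b then [x.1] else if f x = c then [x.1] else []) ++ l, ?_⟩
    rw [List.map_append, ← hl]
    simp only [lowWord, List.flatMap_cons]
    split_ifs <;> rfl

theorem head_injective : Function.Injective head := fun a b h => by injection h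

theorem r3_core {K : List Leg → List Leg → List Leg → List Leg} (hK : Ctx3 K) {a b c : ℕ}
    (hab : a ≠ b) (hac : a ≠ c) (hbc : b ≠ c) (s : ℕ → ℤˣ) (g : Fin n → ℕ) (hg : ∀ i, g i ≠ b) :
    (s b = s a → ∑ f ∈ lifts a b g, (∏ k, ((s (f k) : ℤ) : ℚ)) •
        cl (K ((strands g a).map tail) ((strands f a).map head ++ (strands f c).map tail)
          ((strands f b).map head ++ (strands f c).map head))
      = ∑ f ∈ lifts a b g, (∏ k, ((s (f k) : ℤ) : ℚ)) •
        cl (K ((strands g a).map tail) ((strands f c).map tail ++ (strands f a).map head)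
          ((strands f c).map head ++ (strands f b).map head))) ∧
    (s b = - s a → ∑ f ∈ lifts a b g, (∏ k, ((s (f k) : ℤ) : ℚ)) •
        cl (K ((strands g a).map tail) ((strands f a).map head ++ (strands f c).map tail)
          ((strands f c).map head ++ (strands f b).map head))
      = ∑ f ∈ lifts a b g, (∏ k, ((s (f k) : ℤ) : ℚ)) •
        cl (K ((strands g a).map tail) ((strands f c).map tail ++ (strands f a).map head)
          ((strands f b).map head ++ (strands f c).map head))) := by
  have hn : ([] ++ colorList g a ++ colorList g c ++ []).Nodup := by
    rw [List.nil_append, List.append_nil]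
    refine List.nodup_append.2 ⟨(List.nodup_finRange n).filter _, (List.nodup_finRange n).filter _,
      ?_⟩
    rintro i hi j hj rfl
    exact hac ((mem_colorList.1 hi).symm.trans (mem_colorList.1 hj))
  have main : ∀ rv : Bool, (s b = if rv then - s a else s a) →
      ∑ f ∈ lifts a b g, (∏ k, ((s (f k) : ℤ) : ℚ)) •
        cl (K ((strands g a).map tail) (midWord a c f (colorList g a ++ colorList g c))
          (lowWord b c f (revIf rv (colorList g a ++ colorList g c))))
      = ∑ f ∈ lifts a b g, (∏ k, ((s (f k) : ℤ) : ℚ)) •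
        cl (K ((strands g a).map tail) (midWord a c f (colorList g c ++ colorList g a))
          (lowWord b c f (revIf rv (colorList g c ++ colorList g a)))) := by
    intro rv hrv
    have := swap_blocks (fun π => ∑ f ∈ lifts a b g, (∏ k, ((s (f k) : ℤ) : ℚ)) •
        cl (K ((strands g a).map tail) (midWord a c f π) (lowWord b c f (revIf rv π))))
      (fun i => g i = a) (fun i => g i = c)
      (fun U V i j hi hj hn => r3_adjacent (hK.fix1 _) hab hac hbc s rv hrv g U V i j hi hj hn)
      (colorList g a) (colorList g c) [] [] (fun i hi => mem_colorList.1 hi)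
      (fun i hi => mem_colorList.1 hi) hn
    simpa using this
  refine ⟨fun hs => ?_, fun hs => ?_⟩
  · have := main false (by simpa using hs)
    refine Eq.trans (Finset.sum_congr rfl fun f hf => ?_)
      (this.trans (Finset.sum_congr rfl fun f hf => ?_)) <;>
      simp [revIf, midWord_T hbc hf, midWord_C hac hbc hf, lowWord_T hab hac hbc hf hg,
        lowWord_C hac hbc hf]
  · have := main true (by simpa using hs)
    have hrevC : ∀ f ∈ lifts a b g, ∀ y A B,
        cl (K ((strands g a).map tail) (y ++ (strands f c).map tail ++ [])
          (A ++ lowWord b c f (colorList g c).reverse ++ B))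
        = cl (K ((strands g a).map tail) (y ++ (strands f c).map tail ++ [])
          (A ++ (strands f c).map head ++ B)) := by
      intro f hf y A B
      obtain ⟨l, hl⟩ := lowWord_eq_map b c f (colorList g c).reverse
      have hp : l.Perm (strands f c) := by
        have := lowWord_reverse_perm b c f (colorList g c)
        rw [hl, lowWord_C hac hbc hf] at this
        exact (List.map_perm_map_iff head_injective).1 this
      rw [hl]
      exact cl_heads (((hK.fix1 _)).extend y [] A B) (fun x hx => hp.mem_iff.1 hx) hp
    have hrevC' : ∀ f ∈ lifts a b g, ∀ y A B,
        cl (K ((strands g a).map tail) ([] ++ (strands f c).map tail ++ y)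
          (A ++ lowWord b c f (colorList g c).reverse ++ B))
        = cl (K ((strands g a).map tail) ([] ++ (strands f c).map tail ++ y)
          (A ++ (strands f c).map head ++ B)) := by
      intro f hf y A B
      obtain ⟨l, hl⟩ := lowWord_eq_map b c f (colorList g c).reverse
      have hp : l.Perm (strands f c) := by
        have := lowWord_reverse_perm b c f (colorList g c)
        rw [hl, lowWord_C hac hbc hf] at this
        exact (List.map_perm_map_iff head_injective).1 this
      rw [hl]
      exact cl_heads (((hK.fix1 _)).extend [] y A B) (fun x hx => hp.mem_iff.1 hx) hp
    have hrevT : ∀ f ∈ lifts a b g, ∀ y A B,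
        cl (K ((strands g a).map tail) y (A ++ lowWord b c f (colorList g a).reverse ++ B))
        = cl (K ((strands g a).map tail) y (A ++ (strands f b).map head ++ B)) := by
      intro f hf y A B
      obtain ⟨l, hl⟩ := lowWord_eq_map b c f (colorList g a).reverse
      have hp : l.Perm (strands f b) := by
        have := lowWord_reverse_perm b c f (colorList g a)
        rw [hl, lowWord_T hab hac hbc hf hg] at this
        exact (List.map_perm_map_iff head_injective).1 this
      rw [hl]
      have := cl_heads ((hK.fix2 y).extend [] [] A B) (T := strands g a) (H := l)
        (H' := strands f b) (fun x hx => (strands_merge hab hf hg).mem_iff.1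
          (List.mem_append_right _ (hp.mem_iff.1 hx))) hp
      simpa using this
    refine Eq.trans (Finset.sum_congr rfl fun f hf => ?_)
      (this.trans (Finset.sum_congr rfl fun f hf => ?_))
    · have e1 := hrevC f hf ((strands f a).map head) [] (lowWord b c f (colorList g a).reverse)
      have e2 := hrevT f hf ((strands f a).map head ++ (strands f c).map tail)
        ((strands f c).map head) []
      simp only [revIf, if_true, List.reverse_append, midWord_append, lowWord_append,
        midWord_T hbc hf, midWord_C hac hbc hf, List.append_nil, List.nil_append] at e1 e2 ⊢
      rw [e1, e2]
    · have e1 := hrevC' f hf ((strands f a).map head) (lowWord b c f (colorList g a).reverse) []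
      have e2 := hrevT f hf ((strands f c).map tail ++ (strands f a).map head)
        [] ((strands f c).map head)
      simp only [revIf, if_true, List.reverse_append, midWord_append, lowWord_append,
        midWord_T hbc hf, midWord_C hac hbc hf, List.append_nil, List.nil_append] at e1 e2 ⊢
      rw [e1, e2]

theorem WF.not_mem_of_three {K : List Leg → List Leg → List Leg → List Leg} (hK : Ctx3 K)
    {X Y Z : List Leg} (h : WF (K X Y Z)) {ℓ : Leg} (hl : ℓ ∈ X ∨ ℓ ∈ Y ∨ ℓ ∈ Z) :
    ℓ ∉ K [] [] [] := by
  obtain ⟨r, hr⟩ := hK.perm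
  have hn := h.1
  rw [(hr _ _ _).nodup_iff, List.nodup_append] at hn
  intro hm
  rw [(hr _ _ _).mem_iff] at hm
  exact hn.2.2 ℓ (by simpa using hl) ℓ (by simpa using hm) rfl

theorem expansionCoeff_r3 {K : List Leg → List Leg → List Leg → List Leg} (hK : Ctx3 K)
    (s : ℕ → ℤˣ) {a b c : ℕ} {X Y Z : List Leg}
    (hX : X = [tail a, tail b] ∨ X = [tail b, tail a])
    (h : (s b = s a ∧ ((Y = [head a, tail c] ∧ Z = [head b, head c]) ∨
          (Y = [tail c, head a] ∧ Z = [head c, head b]))) ∨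
      (s b = - s a ∧ ((Y = [head a, tail c] ∧ Z = [head c, head b]) ∨
          (Y = [tail c, head a] ∧ Z = [head b, head c]))))
    (hw : WF (K X Y Z)) (n : ℕ) :
    expansionCoeff (K X Y Z) s n = expansionCoeff (K X.reverse Y.reverse Z.reverse) s n := by
  obtain ⟨r, hr⟩ := hK.perm
  have hXm : tail a ∈ X ∧ tail b ∈ X := by rcases hX with rfl | rfl <;> simp
  have hYm : head a ∈ Y ∧ tail c ∈ Y := by
    rcases h with ⟨-, ⟨rfl, -⟩ | ⟨rfl, -⟩⟩ | ⟨-, ⟨rfl, -⟩ | ⟨rfl, -⟩⟩ <;> simp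
  have hZm : head b ∈ Z ∧ head c ∈ Z := by
    rcases h with ⟨-, ⟨-, rfl⟩ | ⟨-, rfl⟩⟩ | ⟨-, ⟨-, rfl⟩ | ⟨-, rfl⟩⟩ <;> simp
  have hnd := hw.1
  rw [(hr _ _ _).nodup_iff, List.nodup_append, List.nodup_append, List.nodup_append] at hnd
  have hab : a ≠ b := by
    rintro rfl
    have := hnd.1.1.1
    rcases hX with rfl | rfl <;> simp at this
  have hbc : b ≠ c := by
    rintro rfl
    have := hnd.1.2.1
    rcases h with ⟨-, ⟨-, rfl⟩ | ⟨-, rfl⟩⟩ | ⟨-, ⟨-, rfl⟩ | ⟨-, rfl⟩⟩ <;> simp at this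
  have hac : a ≠ c := by
    rintro rfl
    exact hnd.1.1.2.2 _ hXm.1 _ hYm.2 rfl
  have t1 := WF.not_mem_of_three hK hw (ℓ := tail a) (by simp [hXm])
  have t2 := WF.not_mem_of_three hK hw (ℓ := tail b) (by simp [hXm])
  have t3 := WF.not_mem_of_three hK hw (ℓ := head a) (by simp [hYm])
  have t4 := WF.not_mem_of_three hK hw (ℓ := head b) (by simp [hZm])
  have hna : ∀ ℓ ∈ K [] [] [], ℓ.label ≠ a ∧ ℓ.label ≠ b := by
    rintro (x | x) hx <;> constructor <;> rintro h <;> simp only [label_tail, label_head] at h <;>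
      subst h <;> contradiction
  have hla : a ∈ labels (K X Y Z) := mem_labels.2 (Or.inl ((hr _ _ _).mem_iff.2 (by simp [hXm])))
  have hlb : b ∈ labels (K X Y Z) := mem_labels.2 (Or.inl ((hr _ _ _).mem_iff.2 (by simp [hXm])))
  have hlab : labels (K X.reverse Y.reverse Z.reverse) = labels (K X Y Z) := by
    refine labels_perm ((hr _ _ _).trans (List.Perm.trans ?_ (hr _ _ _).symm))
    exact List.Perm.append_right _ (((List.reverse_perm X).append (List.reverse_perm Y)).append
      (List.reverse_perm Z))
  unfold expansionCoeff
  rw [hlab, sum_merge hab _ hla hlb, sum_merge hab _ hla hlb]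
  refine Finset.sum_congr rfl fun g hg => ?_
  simp only [Fintype.mem_piFinset, Finset.mem_erase] at hg
  have hg : ∀ i, g i ≠ b := fun i => (hg i).1
  simp only [mul_smul, ← Finset.smul_sum]
  congr 1
  obtain ⟨K', hK', hKg⟩ := hK.blowup g
  have key : ∀ f ∈ lifts a b g, ∀ X', (X' = [tail a, tail b] ∨ X' = [tail b, tail a]) → ∀ Y Z,
      toAsw (diagram (blowup f (K X' Y Z)))
        = cl (K' ((strands g a).map tail) (blowup f Y) (blowup f Z)) := by
    intro f hf X' hX' Y Z
    have hp := strands_merge hab hf hg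
    rw [hKg f (fun ℓ hℓ => strands_lift hf (hna ℓ hℓ).1 (hna ℓ hℓ).2)]
    change cl _ = _
    rcases hX' with rfl | rfl
    · have e1 : blowup f [tail a, tail b] = (strands f a ++ strands f b).map tail := by simp
      rw [e1]
      exact cl_tc2 (hK'.fix2 _) hp _
    · have e1 : blowup f [tail b, tail a] = (strands f b ++ strands f a).map tail := by simp
      rw [e1]
      exact cl_tc2 (hK'.fix2 _) (List.perm_append_comm.trans hp) _
  have hX' : X.reverse = [tail a, tail b] ∨ X.reverse = [tail b, tail a] := by
    rcases hX with rfl | rfl <;> simp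
  have k1 := fun f hf => key f hf X hX Y Z
  have k2 := fun f hf => key f hf X.reverse hX' Y.reverse Z.reverse
  refine Eq.trans (Finset.sum_congr rfl fun f hf => by rw [k1 f hf])
    (Eq.trans ?_ (Finset.sum_congr rfl fun f hf => by rw [k2 f hf]))
  obtain ⟨c1, c2⟩ := r3_core hK' hab hac hbc s g hg
  rcases h with ⟨hs, ⟨rfl, rfl⟩ | ⟨rfl, rfl⟩⟩ | ⟨hs, ⟨rfl, rfl⟩ | ⟨rfl, rfl⟩⟩
  · simpa using c1 hs
  · simpa using (c1 hs).symm
  · simpa using c2 hs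
  · simpa using (c2 hs).symm

end R3b

/-- The diagrams in `expansionCoeff w s n` are diagrams with exactly `n` arrows. -/
theorem wf_blowup {w : List Leg} (hw : WF w) {n : ℕ} {f : Fin n → ℕ} (hf : ∀ i, f i ∈ labels w) :
    WF (blowup f w) ∧ (blowup f w).length = 2 * n := by
  have hmem : ∀ {a x}, x ∈ strands f a ↔ ∃ i, f i = a ∧ (i : ℕ) = x := by
    simp [strands]
  have ht : ∀ x, tail x ∈ blowup f w ↔ x < n := fun x => by
    simp only [blowup, List.mem_flatMap]
    constructor
    · rintro ⟨a | a, -, h⟩ <;> simp [hmem] at h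
      obtain ⟨i, -, rfl⟩ := h; exact i.2
    · intro h
      have h1 : tail (f ⟨x, h⟩) ∈ w := by
        rcases mem_labels.1 (hf ⟨x, h⟩) with h' | h'
        · exact h'
        · exact (hw.2 _).2 h'
      exact ⟨_, h1, by simpa [hmem] using ⟨⟨x, h⟩, rfl, rfl⟩⟩
  have hh : ∀ x, head x ∈ blowup f w ↔ x < n := fun x => by
    simp only [blowup, List.mem_flatMap]
    constructor
    · rintro ⟨a | a, -, h⟩ <;> simp [hmem] at h
      obtain ⟨i, -, rfl⟩ := h; exact i.2
    · intro h
      have h1 : head (f ⟨x, h⟩) ∈ w := by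
        rcases mem_labels.1 (hf ⟨x, h⟩) with h' | h'
        · exact (hw.2 _).1 h'
        · exact h'
      exact ⟨_, h1, by simpa [hmem] using ⟨⟨x, h⟩, rfl, rfl⟩⟩
  have hn : (blowup f w).Nodup := by
    rw [blowup, List.nodup_flatMap]
    refine ⟨fun x _ => ?_, hw.1.imp fun {x y} hxy => ?_⟩
    · rcases x with a | a
      · exact (strands_nodup f a).map fun _ _ h => by injection h
      · exact (strands_nodup f a).map fun _ _ h => by injection h
    · intro z hz hz'
      rcases x with a | a <;> rcases y with b | b <;> rcases z with c | c <;>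
        simp [hmem] at hz hz' <;> obtain ⟨i, hi, hi'⟩ := hz <;> obtain ⟨j, hj, hj'⟩ := hz' <;>
        (have : i = j := Fin.ext (hi'.trans hj'.symm)) <;> simp_all
  refine ⟨⟨hn, fun a => by rw [ht, hh]⟩, ?_⟩
  have hp : (blowup f w).Perm ((List.range n).map tail ++ (List.range n).map head) := by
    refine (List.perm_ext_iff_of_nodup hn ?_).2 fun z => ?_
    · refine List.nodup_append.2 ⟨List.nodup_range.map fun _ _ h => by injection h,
        List.nodup_range.map fun _ _ h => by injection h, ?_⟩
      rintro x hx y hy rfl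
      simp only [List.mem_map] at hx hy
      obtain ⟨a, -, rfl⟩ := hx
      obtain ⟨b, -, h⟩ := hy
      cases h
    · rcases z with x | x
      · simp [ht]
      · simp [hh]
  rw [hp.length_eq]
  simp; omega

namespace GaussDiagram

theorem orient_eq (o : ℤˣ) (l : List Leg) :
    (o = 1 ∧ orient o l = l) ∨ (o = -1 ∧ orient o l = l.reverse) := by
  rcases Int.units_eq_one_or o with h | h
  · exact Or.inl ⟨h, by simp [orient, h]⟩
  · exact Or.inr ⟨h, by rw [orient, if_neg (by rw [h]; decide)]⟩

theorem perm3_cases (p : Equiv.Perm (Fin 3)) :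
    (p 0 = 0 ∧ p 1 = 1 ∧ p 2 = 2) ∨ (p 0 = 0 ∧ p 1 = 2 ∧ p 2 = 1) ∨
    (p 0 = 1 ∧ p 1 = 0 ∧ p 2 = 2) ∨ (p 0 = 1 ∧ p 1 = 2 ∧ p 2 = 0) ∨
    (p 0 = 2 ∧ p 1 = 0 ∧ p 2 = 1) ∨ (p 0 = 2 ∧ p 1 = 1 ∧ p 2 = 0) := by
  revert p; decide

/-- Places three strands along the line in the order prescribed by `p`. -/
theorem exists_ctx3 (P Q R S : List Leg) (p : Equiv.Perm (Fin 3)) :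
    ∃ K, Ctx3 K ∧ ∀ F : Fin 3 → List Leg,
      P ++ F (p 0) ++ Q ++ F (p 1) ++ R ++ F (p 2) ++ S = K (F 0) (F 1) (F 2) := by
  rcases perm3_cases p with h | h | h | h | h | h <;> obtain ⟨h0, h1, h2⟩ := h <;>
    simp only [h0, h1, h2]
  · exact ⟨fun x y z => P ++ x ++ Q ++ y ++ R ++ z ++ S, ⟨P, Q, R, S, by simp⟩, fun _ => rfl⟩
  · exact ⟨fun x y z => P ++ x ++ Q ++ z ++ R ++ y ++ S, ⟨P, Q, R, S, by simp⟩, fun _ => rfl⟩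
  · exact ⟨fun x y z => P ++ y ++ Q ++ x ++ R ++ z ++ S, ⟨P, Q, R, S, by simp⟩, fun _ => rfl⟩
  · exact ⟨fun x y z => P ++ y ++ Q ++ z ++ R ++ x ++ S,
      ⟨P, Q, R, S, by simp⟩, fun _ => rfl⟩
  · exact ⟨fun x y z => P ++ z ++ Q ++ x ++ R ++ y ++ S,
      ⟨P, Q, R, S, by simp⟩, fun _ => rfl⟩
  · exact ⟨fun x y z => P ++ z ++ Q ++ y ++ R ++ x ++ S, ⟨P, Q, R, S, by simp⟩, fun _ => rfl⟩

theorem expansionCoeff_move {G G' : GaussDiagram} (h : Move G G') (n : ℕ) :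
    expansionCoeff G.word G.sign n = expansionCoeff G'.word G'.sign n := by
  cases h with
  | relabel f hf hw hs =>
    rw [hw, expansionCoeff_relabel hf _ _ _ hs]
  | r1s P Q a hw hw' hs =>
    rw [hw, hw', hs]
    have hp : (P ++ [tail a, head a] ++ Q).Perm (P ++ [head a, tail a] ++ Q) :=
      ((List.Perm.swap _ _ _).append_left P).append_right Q
    rw [expansionCoeff, expansionCoeff, labels_perm hp]
    refine Finset.sum_congr rfl fun f _ => ?_
    congr 1
    simpa [cl] using cl_kink (strands f a) (blowup f P) (blowup f Q)
  | r2 P Q R X Y a b hw hw' hs hab hXY =>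
    have hwf := G.wf
    rw [hs, hw, hw']
    rw [hw] at hwf
    rcases hXY with ⟨rfl, hY⟩ | ⟨rfl, hX⟩
    · have := expansionCoeff_r2 (K := fun x y => P ++ x ++ Q ++ y ++ R)
        ⟨P, Q, R, Or.inl fun _ _ => rfl⟩ G.sign hab hY hwf n
      simpa using this
    · have := expansionCoeff_r2 (K := fun x y => P ++ y ++ Q ++ x ++ R)
        ⟨P, Q, R, Or.inr fun _ _ => rfl⟩ G.sign hab hX hwf n
      simpa using this
  | oc P Q a b hw hw' hs =>
    rw [hw, hw', hs]
    have hp : (P ++ [tail a, tail b] ++ Q).Perm (P ++ [tail b, tail a] ++ Q) :=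
      ((List.Perm.swap _ _ _).append_left P).append_right Q
    rw [expansionCoeff, expansionCoeff, labels_perm hp]
    refine Finset.sum_congr rfl fun f _ => ?_
    congr 1
    have := cl_tc (List.perm_append_comm (l₁ := strands f a) (l₂ := strands f b))
      (blowup f P) (blowup f Q)
    simpa [cl] using this
  | r3 P Q R S a b c o p hw hw' hs hab hac =>
    obtain ⟨K, hK, hF⟩ := exists_ctx3 P Q R S p
    have hwf := G.wf
    rw [hs, hw, hw']
    rw [hw] at hwf
    have e := hF (fun i => orient (o i) (strand a b c i))
    have e' := hF (fun i => (orient (o i) (strand a b c i)).reverse)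
    rw [e] at hwf ⊢
    rw [e']
    have hb : G.sign b = G.sign a * (o 1 * o 2) := by
      rw [← hab, ← mul_assoc, Int.units_mul_self, one_mul]
    refine expansionCoeff_r3 (a := a) (b := b) (c := c) hK G.sign ?_ ?_ hwf n
    · rcases orient_eq (o 0) (strand a b c 0) with ⟨-, h⟩ | ⟨-, h⟩ <;> rw [h] <;> simp [strand]
    · rcases orient_eq (o 1) (strand a b c 1) with ⟨h1, h1'⟩ | ⟨h1, h1'⟩ <;>
      rcases orient_eq (o 2) (strand a b c 2) with ⟨h2, h2'⟩ | ⟨h2, h2'⟩ <;>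
      · rw [h1', h2', hb, h1, h2]; simp [strand]

/-- The sum of the signs of all crossings. -/
def writhe (G : GaussDiagram) : ℤ := ∑ a ∈ labels G.word, (G.sign a : ℤ)

theorem writhe_move {G G' : GaussDiagram} (h : Move G G') : G.writhe = G'.writhe := by
  have hperm : ∀ {G G' : GaussDiagram}, G.word.Perm G'.word → G'.sign = G.sign →
      G.writhe = G'.writhe := fun hp hs => by rw [writhe, writhe, labels_perm hp, hs]
  cases h with
  | relabel f hf hw hs =>
    rw [writhe, writhe, hw, labels_map, Finset.sum_image fun x _ y _ h => hf h]
    exact Finset.sum_congr rfl fun a ha => by rw [hs a ha]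
  | r1s P Q a hw hw' hs =>
    refine hperm ?_ hs
    rw [hw, hw']
    exact ((List.Perm.swap _ _ _).append_left P).append_right Q
  | oc P Q a b hw hw' hs =>
    refine hperm ?_ hs
    rw [hw, hw']
    exact ((List.Perm.swap _ _ _).append_left P).append_right Q
  | r3 P Q R S a b c o p hw hw' hs hab hac =>
    refine hperm ?_ hs
    rw [hw, hw']
    exact ((((((List.reverse_perm _).symm.append_left P).append_right Q).append
      (List.reverse_perm _).symm).append_right R).append (List.reverse_perm _).symm).append_right S
  | r2 P Q R X Y a b hw hw' hs hab hXY =>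
    have hp : G.word.Perm (tail a :: tail b :: head a :: head b :: G'.word) := by
      rw [hw, hw']
      rcases hXY with ⟨rfl, rfl | rfl⟩ | ⟨rfl, rfl | rfl⟩ <;>
        refine List.perm_iff_count.2 fun x => ?_ <;> simp [List.count_cons] <;> omega
    have hn := hp.nodup_iff.1 G.wf.1
    have hl : labels G.word = insert a (insert b (labels G'.word)) := by
      rw [labels_perm hp]; ext x; simp [labels]
    have ha : a ∉ insert b (labels G'.word) := by
      rw [Finset.mem_insert, mem_labels]
      simp at hn; tauto
    have hb : b ∉ labels G'.word := by
      rw [mem_labels]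
      simp at hn; tauto
    rw [writhe, writhe, hl, Finset.sum_insert ha, Finset.sum_insert hb, hs, hab]
    simp

end GaussDiagram

namespace WKnot

/-- The self-linking number of a long w-knot: the sum of the signs of its crossings. -/
def sl : WKnot → ℤ := Quot.lift GaussDiagram.writhe fun _ _ h => GaussDiagram.writhe_move h

/-- The expansion `Z` of a long w-knot, as an element of the completed algebra `𝒜ˢʷ(↑)`. -/
noncomputable def expansion : WKnot → PowerSeries Asw :=
  Quot.lift (fun G => PowerSeries.mk (expansionCoeff G.word G.sign))
    fun _ _ h => congrArg PowerSeries.mk (funext (GaussDiagram.expansionCoeff_move h))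

end WKnot

/-! ### The Alexander polynomial, exponentials, and the reduced algebra -/

namespace GaussDiagram

variable (G : GaussDiagram)

/-- The position of a leg on the line. -/
def pos (ℓ : Leg) : ℕ := G.word.idxOf ℓ

/-- The lower strand of the crossing `j` lies in the span of the crossing `i`, the open interval between
the two visits of the line to `i`. -/
def InSpan (i j : ℕ) : Prop :=
  min (G.pos (tail i)) (G.pos (head i)) < G.pos (head j) ∧
    G.pos (head j) < max (G.pos (tail i)) (G.pos (head i))

/-- The crossings of a Gauss diagram. -/
abbrev Crossing : Type := {a : ℕ // a ∈ labels G.word}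

open Classical in
/-- The trapping matrix `T`. -/
noncomputable def spanMatrix : Matrix G.Crossing G.Crossing (LaurentPolynomial ℤ) :=
  Matrix.of fun i j => if G.InSpan i j then 1 else 0

/-- The sign `dᵢ`, which is `1` if the upper strand of `i` is visited before the lower one. -/
def direction (i : ℕ) : ℤ := if G.pos (tail i) < G.pos (head i) then 1 else -1

/-- The Alexander polynomial `A(K) = det (I + T (I - X^{-S}))`, with `S = diag (sᵢ dᵢ)`. -/
noncomputable def alexander : LaurentPolynomial ℤ :=
  (1 + G.spanMatrix * (1 - Matrix.diagonal fun i : G.Crossing =>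
    LaurentPolynomial.T (-((G.sign i : ℤ) * G.direction i)))).det

/-- The power series `A(K)(eˣ)`. -/
noncomputable def alexanderExp : PowerSeries ℚ :=
  LaurentPolynomial.eval₂ (Int.castRingHom (PowerSeries ℚ)) (PowerSeries.isUnit_exp ℚ).unit
    G.alexander

end GaussDiagram

/-- The exponential `∑ₖ Fᵏ/k!` of a power series without constant term. -/
noncomputable def expSeries {A : Type*} [Ring A] [Algebra ℚ A] (F : PowerSeries A) :
    PowerSeries A :=
  PowerSeries.mk fun n =>
    ∑ k ∈ Finset.range (n + 1), (k.factorial : ℚ)⁻¹ • PowerSeries.coeff n (F ^ k)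

/-- The linear map `w` with `xᵏ ↦ w_k`. -/
noncomputable def wheelSeries : PowerSeries ℚ →ₗ[ℚ] PowerSeries Asw where
  toFun f := PowerSeries.mk fun n => PowerSeries.coeff n f • wheel n
  map_add' f g := by ext n; simp [add_smul]
  map_smul' c f := by ext n; simp [mul_smul]

/-- The arrow `D_A` as an element of degree `1` of the completed algebra. -/
noncomputable def arrowSeries : PowerSeries Asw := PowerSeries.monomial 1 D_A

/-- The additional relations of the reduced algebra. -/
inductive RedRel : Asw → Asw → Prop
  | arrow : RedRel D_A 0
  | wheels (k l : ℕ) (hk : k ≠ 1) (hl : l ≠ 1) : RedRel (wheel k * wheel l) (wheel (k + l))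

/-- The reduced algebra: `𝒜ˢʷ(↑)` modulo `D_A = 0` and `w_k w_l = w_{k+l}` for `k, l ≠ 1`. -/
def Ared : Type := RingQuot RedRel

noncomputable instance : Ring Ared := inferInstanceAs (Ring (RingQuot RedRel))

noncomputable instance : Algebra ℚ Ared := inferInstanceAs (Algebra ℚ (RingQuot RedRel))

/-- The projection to the reduced algebra. -/
noncomputable def toRed : Asw →ₐ[ℚ] Ared := RingQuot.mkAlgHom ℚ RedRel

/-- The part of degree `n` of the reduced algebra, spanned by the diagrams with `n` arrows. -/
noncomputable def Ared.degree (n : ℕ) : Submodule ℚ Ared :=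
  Submodule.span ℚ {x | ∃ w, WF w ∧ w.length = 2 * n ∧ x = toRed (toAsw (diagram w))}

/-- The linear map with `xᵏ ↦ w_k` into the completed reduced algebra. -/
noncomputable def reducedWheels : PowerSeries ℚ →ₗ[ℚ] PowerSeries Ared where
  toFun f := PowerSeries.map toRed.toRingHom (wheelSeries f)
  map_add' f g := by simp
  map_smul' c f := by ext n; simp [PowerSeries.coeff_map]

end WKnots

/-!
The proof compares both sides of the formula for `Z(K)` by means of weight systems.

Let `M` be the signed trapping matrix of an arrow diagram: `M a b` is `0` unless the arrow `a` spans the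
head of `b`, then it is `∓ 1` according to the direction of `a`, and `M a a = 1`. For arbitrary elements
`y₁, y₂, …` of a commutative `ℚ`-algebra, the sum over all permutations `π` of the arrows of
`∏ M a (π a)`, weighted by a factor `y_k` for each cycle of `π` of length `k`, respects TC, RI and the
directed 4T relation. For 4T the surviving permutations are exchanged in pairs by the conjugation with the
transposition of the two arrows of the relation (`cycleSum_fourT`). As these sums are multiplicative, they
define an algebra homomorphism `weightSystem y` on `𝒜ˢʷ(↑)`. It sends `D_A` to `y₁` and the wheel `w_k`
to `y_k` for `k ≥ 2` (`weightSystem_wheel`), while `w₁ = 0` by RI.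

These homomorphisms separate the elements of `𝒜ˢʷ(↑)` (`weightSystem_X_injective`), because every diagram
is a combination of products of arrows and wheels (`cl_mem_wheelSpan`), and arrows and wheels are central.
To see this, all tails are moved to the left end of the line. A tail that has to be exchanged with its own
arrowhead leaves a term with a commutator `[x, t_a]` of a Lie word `x` of heads and a tail; such a
commutator commutes with tails (`LieIn.clMap_tail`), and moving the tails of its arrows next to it splits
off a wheel, up to terms with more heads in the commutator (`LieIn.bracket_mem_wheelSpan`). A diagram with
all tails in front of all heads is a power of `D_A`.

For the expansion, the sum over the permutations of all arrows of all bundles is the exponential of its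
part from single cycles: `weightSystem y` maps `Z(K)` to `exp (∑ c_k y_k x^k / k!)` with rational numbers
`c_k` that do not depend on `y` (`bundleSum_succ`, `mk_bundleSum`), and `c₁ = sl(K)`. For `y₁ = 0` and
`y_k = -1` for `k ≥ 2` the sums over permutations are determinants. The rows and columns of a bundle of
parallel arrows then collapse to one (`det_bundle`), and summing over the sizes of the bundles gives
`A(K)(e^x)` (`GaussDiagram.alexanderExp_eq`). Therefore `log A(K)(e^x) = -∑ c_k x^k / k!`, summed over
`k ≥ 2`, and the formula for `Z(K)` follows from the values of the weight systems on `D_A` and `w_k`.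

In the reduced algebra the products of arrows and wheels of degree `n` are `0` or `w_n`. The weight system
with `y₁ = 0` and `y_k = 1` for `k ≥ 2` respects the additional relations and shows that `w_n ≠ 0` for
`n ≠ 1`. This gives the identification with power series without linear term (`bijOn_reducedWheels`,
`reducedWheels_mul`). It turns the wheel part of the formula into `exp (-log A(K)(e^x))`, and the arrow part
becomes trivial.
-/

namespace WKnots

open Leg

/-! ### Sums over permutations weighted by their cycles -/

section CycleSum

open Equiv Equiv.Perm

variable {ι κ R : Type*} [Fintype ι] [DecidableEq ι] [Fintype κ]
  [CommRing R]

/-- The permutations that move only elements of `s`. -/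
def permsOn (s : Finset ι) : Finset (Perm ι) := Finset.univ.filter fun π => π.support ⊆ s

theorem mem_permsOn {s : Finset ι} {π : Perm ι} : π ∈ permsOn s ↔ ∀ i, i ∉ s → π i = i := by
  simp only [permsOn, Finset.mem_filter, Finset.mem_univ, true_and, Finset.subset_iff, mem_support]
  exact forall_congr' fun i => by rw [not_imp_comm]

theorem permsOn.apply_mem {s : Finset ι} {π : Perm ι} (h : π ∈ permsOn s) {i : ι} (hi : i ∈ s) :
    π i ∈ s := by
  by_contra hc
  have := mem_permsOn.1 h _ hc
  exact hc ((π.injective this).symm ▸ hi)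

/-- The permutations that permute `C` cyclically and fix everything else. -/
noncomputable def cyclesOn (C : Finset ι) : Finset (Perm ι) :=
  open Classical in (permsOn C).filter fun π => ∀ i ∈ C, ∀ j ∈ C, π.SameCycle i j

theorem mem_cyclesOn {C : Finset ι} {π : Perm ι} :
    π ∈ cyclesOn C ↔ π ∈ permsOn C ∧ ∀ i ∈ C, ∀ j ∈ C, π.SameCycle i j := by
  simp [cyclesOn]

/-- Permutations of `κ` correspond to permutations on the image of an embedding of `κ`. -/
theorem exists_viaEmbedding (e : κ ↪ ι) {π : Perm ι} (hπ : π ∈ permsOn (Finset.univ.map e)) :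
    ∃ τ : Perm κ, τ.viaEmbedding e = π := by
  have hp : ∀ i, i ∈ Set.range e ↔ π i ∈ Set.range e := fun i => by
    constructor
    · intro hi
      have := permsOn.apply_mem hπ (i := i) (by simpa using hi)
      simpa using this
    · intro hi
      by_contra hc
      have := mem_permsOn.1 hπ i (by simpa using hc)
      exact hc (this ▸ hi)
  refine ⟨(e.toEquivRange.permCongr).symm
    (π.subtypePerm (p := (· ∈ Set.range e)) fun i => (hp i).symm), ?_⟩
  ext i
  by_cases hi : i ∈ Set.range e
  · obtain ⟨j, rfl⟩ := hi
    rw [viaEmbedding_apply]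
    exact congrArg Subtype.val (e.toEquivRange.apply_symm_apply ⟨π (e j), (hp _).1 ⟨j, rfl⟩⟩)
  · rw [viaEmbedding_apply_of_notMem _ _ _ hi, mem_permsOn.1 hπ i (by simpa using hi)]

theorem viaEmbedding_mem_permsOn (e : κ ↪ ι) (τ : Perm κ) :
    τ.viaEmbedding e ∈ permsOn (Finset.univ.map e) := by
  rw [mem_permsOn]
  intro i hi
  exact viaEmbedding_apply_of_notMem _ _ _ (by simpa using hi)

variable [DecidableEq κ]

/-- The product of `y k` over all cycles of a permutation of `s`, where `k` is the length of the
cycle; fixed points in `s` count as cycles of length `1`. -/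
def cycleWeight (y : ℕ → R) (s : Finset ι) (π : Perm ι) : R :=
  (π.cycleType.map y).prod * y 1 ^ (s.card - π.support.card)

theorem cycleWeight_of_mem_cyclesOn (y : ℕ → R) {C : Finset ι} {c : Perm ι} {x : ι} (hx : x ∈ C)
    (hc : c ∈ cyclesOn C) : cycleWeight y C c = y C.card := by
  rw [mem_cyclesOn] at hc
  obtain ⟨h1, h2⟩ := hc
  by_cases hC : ∃ z ∈ C, z ≠ x
  · obtain ⟨z, hz, hzx⟩ := hC
    have hsupp : c.support = C := by
      refine Finset.Subset.antisymm (by simpa [permsOn] using h1) fun i hi => ?_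
      rw [mem_support]
      intro hfix
      have hix : ∀ j ∈ C, j = i := fun j hj => by
        obtain ⟨k, hk⟩ := h2 i hi j hj
        rw [← hk, zpow_apply_eq_self_of_apply_eq_self hfix]
      exact hzx ((hix z hz).trans (hix x hx).symm)
    have hcyc : c.IsCycle := by
      refine ⟨x, ?_, fun j hj => h2 x hx j ?_⟩
      · rw [← mem_support, hsupp]; exact hx
      · rw [← hsupp, mem_support]; exact hj
    simp [cycleWeight, hcyc.cycleType, hsupp]
  · push Not at hC
    have hCx : C = {x} := Finset.eq_singleton_iff_unique_mem.2 ⟨hx, hC⟩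
    have hc1 : c = 1 := by
      ext i
      by_cases hi : i ∈ C
      · have := permsOn.apply_mem h1 hi
        rw [hCx, Finset.mem_singleton] at hi this
        rw [this, hi]; rfl
      · exact mem_permsOn.1 h1 i hi
    simp [cycleWeight, hc1, hCx]

theorem cycleWeight_mul (y : ℕ → R) {s C : Finset ι} (hCs : C ⊆ s) {c ρ : Perm ι}
    (hc : c ∈ permsOn C) (hρ : ρ ∈ permsOn (s \ C)) :
    cycleWeight y s (c * ρ) = cycleWeight y C c * cycleWeight y (s \ C) ρ := by
  have h1 : c.support ⊆ C := by simpa [permsOn] using hc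
  have h2 : ρ.support ⊆ s \ C := by simpa [permsOn] using hρ
  have hd : c.Disjoint ρ := by
    rw [disjoint_iff_disjoint_support]
    exact Finset.disjoint_of_subset_left h1
      (Finset.disjoint_of_subset_right h2 Finset.disjoint_sdiff)
  have e1 := Finset.card_le_card h1
  have e2 := Finset.card_le_card h2
  have e3 := Finset.card_sdiff_add_card_eq_card hCs
  simp only [cycleWeight, hd.cycleType_mul, hd.card_support_mul, Multiset.map_add,
    Multiset.prod_add]
  have : s.card - (c.support.card + ρ.support.card)
      = (C.card - c.support.card) + ((s \ C).card - ρ.support.card) := by omega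
  rw [this, pow_add]
  ring

theorem cycleWeight_viaEmbedding (y : ℕ → R) (e : κ ↪ ι) (τ : Perm κ) :
    cycleWeight y (Finset.univ.map e) (τ.viaEmbedding e) = cycleWeight y Finset.univ τ := by
  have h1 : (τ.viaEmbedding e).cycleType = τ.cycleType :=
    @cycleType_extendDomain _ _ _ _ _ _ _ (fun _ => Classical.propDecidable _) _ _
  have h2 : (τ.viaEmbedding e).support.card = τ.support.card :=
    @card_support_extend_domain _ _ _ _ _ _ _ (fun _ => Classical.propDecidable _) _ _
  rw [cycleWeight, cycleWeight, h1, h2, Finset.card_map]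

variable [Algebra ℚ R]

/-- The sum of `∏ i, M i (π i)` over all permutations `π` of `s`, each weighted by its cycles. -/
noncomputable def cycleSum (y : ℕ → R) (M : ι → ι → ℚ) (s : Finset ι) : R :=
  ∑ π ∈ permsOn s, (∏ i ∈ s, M i (π i)) • cycleWeight y s π

/-- The part of the sum `cycleSum` that comes from the cyclic permutations of `C`. -/
noncomputable def cyclicSum (M : ι → ι → ℚ) (C : Finset ι) : ℚ :=
  ∑ π ∈ cyclesOn C, ∏ i ∈ C, M i (π i)

open Classical in
/-- Splits a permutation into the cycle through `x` and a permutation of the remaining elements. -/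
theorem cycleSum_eq_sum_cycle (y : ℕ → R) (M : ι → ι → ℚ) {s : Finset ι} {x : ι} (hx : x ∈ s) :
    cycleSum y M s = ∑ C ∈ s.powerset.filter (x ∈ ·),
      cyclicSum M C • (y C.card * cycleSum y M (s \ C)) := by
  -- `C` is the set of elements of the cycle of `π` through `x`
  have hmaps : ∀ π ∈ permsOn s, (Finset.univ.filter fun i => π.SameCycle x i)
      ∈ s.powerset.filter (x ∈ ·) := fun π hπ => by
    simp only [Finset.mem_filter, Finset.mem_powerset, Finset.mem_univ, SameCycle.refl,
      and_true]
    intro i hi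
    simp only [Finset.mem_filter, Finset.mem_univ, true_and] at hi
    by_contra his
    have h1 := mem_permsOn.1 hπ i his
    obtain ⟨k, hk⟩ := hi.symm
    rw [zpow_apply_eq_self_of_apply_eq_self h1] at hk
    exact his (hk ▸ hx)
  rw [cycleSum, ← Finset.sum_fiberwise_of_maps_to hmaps]
  refine Finset.sum_congr rfl fun C hC => ?_
  simp only [Finset.mem_filter, Finset.mem_powerset] at hC
  obtain ⟨hCs, hxC⟩ := hC
  rw [cyclicSum, cycleSum, Finset.mul_sum, Finset.sum_smul_sum, ← Finset.sum_product']
  symm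
  -- for a given `C`, the permutations `π` are the products of a cyclic permutation `c` of `C` and a
  -- permutation `ρ` of the complement
  refine Finset.sum_bij (fun p _ => p.1 * p.2) ?_ ?_ ?_ ?_
  · rintro ⟨c, ρ⟩ h
    simp only [Finset.mem_product] at h
    obtain ⟨hc, hρ⟩ := h
    rw [mem_cyclesOn] at hc
    obtain ⟨hc, hcyc⟩ := hc
    have hρC : ∀ i ∈ C, ρ i = i := fun i hi => mem_permsOn.1 hρ i (by simp [hi])
    have hcomm : Commute c ρ := by
      refine Disjoint.commute fun i => ?_
      by_cases hi : i ∈ C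
      · exact Or.inr (hρC i hi)
      · exact Or.inl (mem_permsOn.1 hc i hi)
    have hpow : ∀ k : ℤ, ((c * ρ) ^ k) x = (c ^ k) x := fun k => by
      rw [hcomm.mul_zpow, Perm.mul_apply, zpow_apply_eq_self_of_apply_eq_self (hρC x hxC)]
    simp only [Finset.mem_filter, mem_permsOn]
    refine ⟨fun i hi => ?_, ?_⟩
    · rw [Perm.mul_apply, mem_permsOn.1 hρ i (by simp [hi]), mem_permsOn.1 hc i (fun h => hi (hCs h))]
    · ext i
      simp only [Finset.mem_filter, Finset.mem_univ, true_and]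
      constructor
      · rintro ⟨k, rfl⟩
        rw [hpow]
        have hcC : ∀ k : ℕ, ∀ z ∈ C, (c ^ k) z ∈ C := fun k => by
          induction k with
          | zero => simp
          | succ k ih =>
            intro z hz
            rw [pow_succ', Perm.mul_apply]
            exact permsOn.apply_mem hc (ih z hz)
        have hsame : c.SameCycle x ((c ^ k) x) := ⟨k, rfl⟩
        obtain ⟨m, -, hm⟩ := hsame.exists_pow_eq'
        rw [← hm]
        exact hcC m x hxC
      · intro hi
        obtain ⟨k, hk⟩ := hcyc x hxC i hi
        exact ⟨k, by rw [hpow, hk]⟩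
  · rintro ⟨c, ρ⟩ h ⟨c', ρ'⟩ h' heq
    simp only [Finset.mem_product, mem_cyclesOn] at h h'
    have hcc : c = c' := by
      ext i
      by_cases hi : i ∈ C
      · have e := congrArg (fun σ : Perm ι => σ i) heq
        simpa [Perm.mul_apply, mem_permsOn.1 h.2 i (by simp [hi]),
          mem_permsOn.1 h'.2 i (by simp [hi])] using e
      · rw [mem_permsOn.1 h.1.1 i hi, mem_permsOn.1 h'.1.1 i hi]
    subst hcc
    simpa using heq
  · intro π hπ
    simp only [Finset.mem_filter] at hπ
    obtain ⟨hπ, rfl⟩ := hπ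
    set c := π.cycleOf x with hcdef
    have hcin : ∀ i, π.SameCycle x i → c i = π i := fun i hi => hi.cycleOf_apply
    have hcout : ∀ i, ¬ π.SameCycle x i → c i = i := fun i hi => cycleOf_apply_of_not_sameCycle hi
    refine ⟨(c, c⁻¹ * π), ?_, by simp⟩
    simp only [Finset.mem_product, mem_cyclesOn, mem_permsOn, Finset.mem_filter, Finset.mem_univ,
      true_and, Finset.mem_sdiff, not_and, not_not]
    refine ⟨⟨fun i hi => hcout i hi, fun i hi j hj => ?_⟩, fun i hi => ?_⟩
    · have key : ∀ i, π.SameCycle x i → c.SameCycle x i := by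
        rintro i ⟨k, rfl⟩
        exact ⟨k, cycleOf_zpow_apply_self π x k⟩
      exact (key i hi).symm.trans (key j hj)
    · rw [Perm.mul_apply, inv_eq_iff_eq]
      by_cases h : π.SameCycle x i
      · exact (hcin i h).symm
      · by_cases his : i ∈ s
        · exact absurd (hi his) h
        · rw [hcout i h, mem_permsOn.1 hπ i his]
  · rintro ⟨c, ρ⟩ h
    simp only [Finset.mem_product] at h
    obtain ⟨hc, hρ⟩ := h
    have hc' := (mem_cyclesOn.1 hc).1
    rw [cycleWeight_mul y hCs hc' hρ, cycleWeight_of_mem_cyclesOn y hxC hc,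
      ← Finset.prod_sdiff hCs]
    have e1 : ∏ i ∈ s \ C, M i ((c * ρ) i) = ∏ i ∈ s \ C, M i (ρ i) := by
      refine Finset.prod_congr rfl fun i hi => ?_
      have := permsOn.apply_mem hρ hi
      rw [Perm.mul_apply, mem_permsOn.1 hc' _ (Finset.mem_sdiff.1 this).2]
    have e2 : ∏ i ∈ C, M i ((c * ρ) i) = ∏ i ∈ C, M i (c i) := by
      refine Finset.prod_congr rfl fun i hi => ?_
      rw [Perm.mul_apply, mem_permsOn.1 hρ i (by simp [hi])]
    rw [e1, e2, mul_comm (∏ i ∈ s \ C, _), mul_smul, mul_smul_comm]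

theorem cycleSum_empty (y : ℕ → R) (M : ι → ι → ℚ) : cycleSum y M ∅ = 1 := by
  have : permsOn (∅ : Finset ι) = {1} := by
    ext π
    simp [permsOn, Finset.subset_empty]
  simp [cycleSum, this, cycleWeight]

theorem cycleSum_congr (y : ℕ → R) {M M' : ι → ι → ℚ} {s : Finset ι}
    (h : ∀ i ∈ s, ∀ j ∈ s, M i j = M' i j) : cycleSum y M s = cycleSum y M' s := by
  refine Finset.sum_congr rfl fun π hπ => ?_
  rw [Finset.prod_congr rfl fun i hi => h i hi _ (permsOn.apply_mem hπ hi)]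

theorem cycleSum_map (y : ℕ → R) (M : ι → ι → ℚ) (e : κ ↪ ι) :
    cycleSum y M (Finset.univ.map e) = cycleSum y (fun i j => M (e i) (e j)) Finset.univ := by
  symm
  refine Finset.sum_bij (fun τ _ => τ.viaEmbedding e) ?_ ?_ ?_ ?_
  · exact fun τ _ => viaEmbedding_mem_permsOn e τ
  · exact fun τ _ τ' _ h => viaEmbeddingHom_injective e h
  · intro π hπ
    obtain ⟨τ, rfl⟩ := exists_viaEmbedding e hπ
    exact ⟨τ, by simp [permsOn], rfl⟩
  · intro τ _
    rw [cycleWeight_viaEmbedding, Finset.prod_map]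
    simp only [viaEmbedding_apply]

theorem cyclicSum_map (M : ι → ι → ℚ) (e : κ ↪ ι) :
    cyclicSum M (Finset.univ.map e) = cyclicSum (fun i j => M (e i) (e j)) Finset.univ := by
  have hsame : ∀ (τ : Perm κ) i j, (τ.viaEmbedding e).SameCycle (e i) (e j) ↔ τ.SameCycle i j :=
    fun τ i j => by
      have := @sameCycle_extendDomain _ _ τ i j _ (fun a => Classical.propDecidable _)
        (Equiv.ofInjective e e.injective)
      simpa [viaEmbedding] using this
  symm
  refine Finset.sum_bij (fun τ _ => τ.viaEmbedding e) ?_ ?_ ?_ ?_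
  · intro τ hτ
    rw [mem_cyclesOn] at hτ ⊢
    refine ⟨viaEmbedding_mem_permsOn e τ, fun i hi j hj => ?_⟩
    obtain ⟨i, -, rfl⟩ := Finset.mem_map.1 hi
    obtain ⟨j, -, rfl⟩ := Finset.mem_map.1 hj
    exact (hsame τ i j).2 (hτ.2 i (Finset.mem_univ _) j (Finset.mem_univ _))
  · exact fun τ _ τ' _ h => viaEmbeddingHom_injective e h
  · intro π hπ
    rw [mem_cyclesOn] at hπ
    obtain ⟨τ, rfl⟩ := exists_viaEmbedding e hπ.1
    refine ⟨τ, ?_, rfl⟩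
    rw [mem_cyclesOn]
    refine ⟨by simp [permsOn], fun i _ j _ => ?_⟩
    exact (hsame τ i j).1 (hπ.2 _ (by simp) _ (by simp))
  · intro τ _
    rw [Finset.prod_map]
    simp only [viaEmbedding_apply]

theorem cycleSum_equiv (y : ℕ → R) (M : ι → ι → ℚ) (e : κ ≃ ι) :
    cycleSum y M Finset.univ = cycleSum y (fun i j => M (e i) (e j)) Finset.univ := by
  have h := cycleSum_map y M e.toEmbedding
  rwa [Finset.map_univ_equiv] at h

/-- A cycle cannot contain elements of both `s` and `t` if no step leads from `s` to `t`. -/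
theorem cyclicSum_eq_zero (M : ι → ι → ℚ) {s t C : Finset ι} (hM : ∀ i ∈ s, ∀ j ∈ t, M i j = 0)
    (hC : C ⊆ s ∪ t) (hst : Disjoint s t) {x z : ι} (hx : x ∈ C) (hxs : x ∈ s) (hz : z ∈ C)
    (hzt : z ∈ t) : cyclicSum M C = 0 := by
  refine Finset.sum_eq_zero fun c hc => ?_
  rw [mem_cyclesOn] at hc
  -- a cycle that starts in `s` and reaches `t` has a step from `s` to `t`
  obtain ⟨i, hiC, his, hit⟩ : ∃ i ∈ C, i ∈ s ∧ c i ∈ t := by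
    by_contra hcon
    push Not at hcon
    have hpow : ∀ k : ℕ, (c ^ k) x ∈ C ∧ (c ^ k) x ∈ s := fun k => by
      induction k with
      | zero => exact ⟨hx, hxs⟩
      | succ k ih =>
        rw [pow_succ', Perm.mul_apply]
        have h1 := permsOn.apply_mem hc.1 ih.1
        exact ⟨h1, (Finset.mem_union.1 (hC h1)).resolve_right (hcon _ ih.1 ih.2)⟩
    obtain ⟨m, -, hm⟩ := (hc.2 x hx z hz).exists_pow_eq'
    exact Finset.disjoint_left.1 hst (hm ▸ (hpow m).2) hzt
  exact Finset.prod_eq_zero hiC (hM i his _ hit)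

/-- The sum over permutations is multiplicative on block triangular matrices. The weights of the cycles play
no role here, as each cycle stays in one of the two blocks. -/
theorem cycleSum_union (y : ℕ → R) (M : ι → ι → ℚ) {s t : Finset ι}
    (hM : ∀ i ∈ s, ∀ j ∈ t, M i j = 0) (hst : Disjoint s t) :
    cycleSum y M (s ∪ t) = cycleSum y M s * cycleSum y M t := by
  induction s using Finset.strongInduction with
  | H s ih =>
    obtain rfl | ⟨x, hx⟩ := s.eq_empty_or_nonempty
    · simp [cycleSum_empty]
    rw [cycleSum_eq_sum_cycle y M (Finset.mem_union_left t hx), cycleSum_eq_sum_cycle y M hx,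
      Finset.sum_mul]
    symm
    refine Finset.sum_subset_zero_on_sdiff ?_ ?_ ?_
    · intro C
      simp only [Finset.mem_filter, Finset.mem_powerset]
      exact fun h => ⟨h.1.trans Finset.subset_union_left, h.2⟩
    · intro C
      simp only [Finset.mem_sdiff, Finset.mem_filter, Finset.mem_powerset, not_and]
      rintro ⟨⟨h1, h2⟩, h3⟩
      obtain ⟨z, hz, hzs⟩ : ∃ z ∈ C, z ∉ s := by
        by_contra hcon
        push Not at hcon
        exact h3 hcon h2
      rw [cyclicSum_eq_zero M hM h1 hst h2 hx hz ((Finset.mem_union.1 (h1 hz)).resolve_left hzs),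
        zero_smul]
    · intro C
      simp only [Finset.mem_filter, Finset.mem_powerset]
      rintro ⟨h1, h2⟩
      have e : (s ∪ t) \ C = (s \ C) ∪ t := by
        rw [Finset.union_sdiff_distrib, Finset.sdiff_eq_self_of_disjoint
          (Finset.disjoint_of_subset_right h1 hst.symm)]
      rw [e, ih (s \ C) (Finset.sdiff_ssubset h1 ⟨x, h2⟩)
        (fun i hi j hj => hM i (Finset.sdiff_subset hi) j hj)
        (Finset.disjoint_of_subset_left Finset.sdiff_subset hst), smul_mul_assoc, mul_assoc]

/-- For the weights `-1` of cycles of length at least `2` and `0` of fixed points, the sum over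
permutations is a determinant. -/
theorem cycleSum_eq_det (M : ι → ι → ℚ) :
    cycleSum (fun k => if k = 1 then (0 : ℚ) else -1) M Finset.univ
      = (Matrix.of fun i j => if i = j then 0 else -M i j).det := by
  rw [← Matrix.det_transpose, Matrix.det_apply, cycleSum]
  refine Finset.sum_congr (by ext; simp [permsOn]) fun π _ => ?_
  simp only [Matrix.transpose_apply, Matrix.of_apply]
  -- a permutation with a fixed point contributes to neither side
  by_cases h : ∃ i, π i = i
  · obtain ⟨i, hi⟩ := h
    have h1 : i ∉ π.support := by simp [hi]
    have h2 : (Finset.univ : Finset ι).card - π.support.card ≠ 0 := by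
      have := Finset.card_lt_card ((Finset.ssubset_univ_iff).2 fun h : π.support = Finset.univ =>
        h1 (h.symm ▸ Finset.mem_univ i))
      omega
    have h3 : ∏ i, (if i = π i then (0 : ℚ) else -M i (π i)) = 0 :=
      Finset.prod_eq_zero (Finset.mem_univ i) (by simp [hi])
    rw [h3, cycleWeight, if_pos rfl, zero_pow h2, mul_zero, smul_zero, smul_zero]
  · push Not at h
    have hsupp : π.support = Finset.univ := by ext; simp [h]
    have h1 : ∀ k ∈ π.cycleType, (if k = 1 then (0 : ℚ) else -1) = -1 := fun k hk => by
      have := two_le_of_mem_cycleType hk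
      rw [if_neg (by omega)]
    have hsum := π.sum_cycleType
    rw [hsupp] at hsum
    have h2 : ∏ i, (if i = π i then (0 : ℚ) else -M i (π i))
        = (-1) ^ (Finset.univ (α := ι)).card * ∏ i, M i (π i) := by
      rw [← Finset.prod_const, ← Finset.prod_mul_distrib]
      refine Finset.prod_congr rfl fun i _ => ?_
      rw [if_neg (fun h' => h i h'.symm)]; ring
    rw [h2, cycleWeight, Multiset.map_congr rfl h1, hsupp, sign_of_cycleType, hsum]
    simp only [Multiset.map_const', Multiset.prod_replicate, Nat.sub_self, pow_zero, mul_one,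
      smul_eq_mul, Units.smul_def, pow_add, Units.val_mul, Units.val_pow_eq_pow_val, Units.val_neg,
      Units.val_one, zsmul_eq_mul]
    push_cast
    have h3 : ((-1 : ℚ) ^ (Finset.univ (α := ι)).card) ^ 2 = 1 := by
      rw [← pow_mul, mul_comm, pow_mul]; simp
    linear_combination (-(∏ i, M i (π i)) * (-1) ^ (Multiset.card π.cycleType)) * h3

end CycleSum

section CycleSumFourT

open Equiv Equiv.Perm

variable {ι R : Type*} [Fintype ι] [DecidableEq ι] [CommRing R] [Algebra ℚ R]

theorem cycleWeight_univ_conj {R : Type*} [CommRing R] (y : ℕ → R) (σ π : Perm ι) :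
    cycleWeight y Finset.univ (σ * π * σ⁻¹) = cycleWeight y Finset.univ π := by
  rw [cycleWeight, cycleWeight, cycleType_conj, card_support_conj]

/-- The directed 4T relation for sums over permutations. The matrices `T` and `T'` belong to the
positions of the head of `a` just before and just after the tail of `c`, the matrices `H` and `H'` to
its positions just before and just after the head of `c`. The surviving permutations send `c` to
`a` or `a` to `c`, and conjugation by the transposition of `a` and `c` exchanges them. -/
theorem cycleSum_fourT (y : ℕ → R) {a c : ι} (hac : a ≠ c) {T T' H H' : ι → ι → ℚ}
    (hT : ∀ i j, ¬ (i = c ∧ j = a) → T i j = T' i j) (hTca : T c a = T' c a + 1)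
    (hH : ∀ i j, ¬ (i = c ∧ j = a) → ¬ (i = a ∧ j = c) → H i j = H' i j)
    (hHca : H' c a = H c a + 1) (hHac : H a c = H' a c + 1)
    (hTH : ∀ i j, i ≠ a → i ≠ c → j ≠ a → T i j = H i j)
    (hcol : ∀ i, i ≠ a → i ≠ c → H i a = H i c)
    (hrow : ∀ j, j ≠ a → j ≠ c → H a j = T a j + H c j)
    (htwo : T a c + (H a c * H c a - H' a c * H' c a) = 0) :
    cycleSum y T Finset.univ - cycleSum y T' Finset.univ
      + (cycleSum y H Finset.univ - cycleSum y H' Finset.univ) = 0 := by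
  set r : Finset ι := (Finset.univ.erase a).erase c with hr
  have hmem : ∀ {i}, i ∈ r → i ≠ a ∧ i ≠ c := fun {i} hi => by
    simp only [hr, Finset.mem_erase, Finset.mem_univ, and_true] at hi
    exact ⟨hi.2, hi.1⟩
  have hprod : ∀ (N : ι → ι → ℚ) (π : Perm ι),
      ∏ i, N i (π i) = N a (π a) * (N c (π c) * ∏ i ∈ r, N i (π i)) := fun N π => by
    rw [← Finset.mul_prod_erase Finset.univ _ (Finset.mem_univ a),
      ← Finset.mul_prod_erase (Finset.univ.erase a) _
        (Finset.mem_erase.2 ⟨hac.symm, Finset.mem_univ c⟩)]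
  -- `f π` is the sum of the four products for a permutation `π` that sends `c` to `a` but not `a` to `c`,
  -- up to the sign; for those that send `a` to `c` but not `c` to `a` the sum is `f` of the conjugate
  let f : Perm ι → ℚ := fun π =>
    if π c = a ∧ π a ≠ c then H c (π a) * ∏ i ∈ r, H i (π i) else 0
  let σ : Perm ι := swap a c
  have hTr : ∀ π : Perm ι, ∏ i ∈ r, T' i (π i) = ∏ i ∈ r, T i (π i) := fun π =>
    Finset.prod_congr rfl fun i hi => (hT _ _ fun h => (hmem hi).2 h.1).symm
  have hHr : ∀ π : Perm ι, ∏ i ∈ r, H' i (π i) = ∏ i ∈ r, H i (π i) := fun π =>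
    Finset.prod_congr rfl fun i hi =>
      (hH _ _ (fun h => (hmem hi).2 h.1) fun h => (hmem hi).1 h.1).symm
  -- the four cases: `π` exchanges `a` and `c` (this is the condition `htwo`), only sends `c` to `a`, only
  -- sends `a` to `c`, or does neither, in which case the matrices of each pair agree
  have hpt : ∀ π : Perm ι, (∏ i, T i (π i)) - (∏ i, T' i (π i))
      + ((∏ i, H i (π i)) - ∏ i, H' i (π i)) = f (σ * π * σ⁻¹) - f π := fun π => by
    have hσ : f (σ * π * σ⁻¹)
        = if π a = c ∧ π c ≠ a then H c (π c) * ∏ i ∈ r, H i (π i) else 0 := by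
      have e1 : (σ * π * σ⁻¹) c = σ (π a) := by simp [σ, Perm.mul_apply]
      have e2 : (σ * π * σ⁻¹) a = σ (π c) := by simp [σ, Perm.mul_apply]
      have i1 : (σ * π * σ⁻¹) c = a ↔ π a = c := by
        rw [e1, ← swap_apply_right a c, σ.injective.eq_iff]
      have i2 : (σ * π * σ⁻¹) a = c ↔ π c = a := by
        rw [e2, ← swap_apply_left a c, σ.injective.eq_iff]
      simp only [f, ne_eq, i1, i2]
      split_ifs with h
      · have h3 : π c ≠ c := fun h' => hac (π.injective (h.1.trans h'.symm))
        rw [e2, swap_apply_of_ne_of_ne h.2 h3]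
        congr 1
        refine Finset.prod_congr rfl fun i hi => ?_
        obtain ⟨hia, hic⟩ := hmem hi
        have e3 : (σ * π * σ⁻¹) i = σ (π i) := by
          simp [σ, Perm.mul_apply, swap_apply_of_ne_of_ne hia hic]
        rw [e3]
        by_cases h4 : π i = a
        · simp only [σ]
          rw [h4, swap_apply_left, hcol i hia hic]
        · have h5 : π i ≠ c := fun h' => hia (π.injective (h'.trans h.1.symm))
          rw [swap_apply_of_ne_of_ne h4 h5]
      · rfl
    have hfπ : f π = if π c = a ∧ π a ≠ c then H c (π a) * ∏ i ∈ r, H i (π i) else 0 := rfl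
    rw [hσ, hfπ, hprod T, hprod T', hprod H, hprod H', hTr, hHr]
    have hTHr : π c = a → ∏ i ∈ r, T i (π i) = ∏ i ∈ r, H i (π i) := fun h =>
      Finset.prod_congr rfl fun i hi =>
        hTH _ _ (hmem hi).1 (hmem hi).2 fun h' => (hmem hi).2 (π.injective (h'.trans h.symm))
    by_cases h1 : π c = a
    · rw [hTHr h1]
      by_cases h2 : π a = c
      · rw [h1, h2, if_neg (by simp), if_neg (by simp), hT a c (fun h => hac h.1)]
        rw [hT a c (fun h => hac h.1)] at htwo
        linear_combination (∏ i ∈ r, H i (π i)) * htwo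
          + T' a c * (∏ i ∈ r, H i (π i)) * hTca
      · have h3 : π a ≠ a := fun h' => hac (π.injective (h'.trans h1.symm))
        rw [if_neg (by simp [h1]), if_pos ⟨h1, h2⟩, h1, ← hT a (π a) (fun h => hac h.1),
          ← hH a (π a) (fun h => hac h.1) (fun h => h2 h.2), hrow _ h3 h2]
        linear_combination (∏ i ∈ r, H i (π i)) * T a (π a) * hTca
          - (∏ i ∈ r, H i (π i)) * (T a (π a) + H c (π a)) * hHca
    · rw [hT c (π c) (fun h => h1 h.2), hT a (π a) (fun h => hac h.1)]
      by_cases h2 : π a = c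
      · rw [if_pos ⟨h2, h1⟩, if_neg (by simp [h1]), h2,
          hH c (π c) (fun h => h1 h.2) (fun h => hac h.1.symm)]
        linear_combination (H' c (π c)) * (∏ i ∈ r, H i (π i)) * hHac
      · rw [if_neg (by simp [h2]), if_neg (by simp [h1]),
          hH c (π c) (fun h => h1 h.2) (fun h => hac h.1.symm),
          hH a (π a) (fun h => hac h.1) (fun h => h2 h.2)]
        ring
  have huniv : permsOn (Finset.univ : Finset ι) = Finset.univ := by ext; simp [permsOn]
  simp only [cycleSum, huniv]
  rw [← Finset.sum_sub_distrib, ← Finset.sum_sub_distrib, ← Finset.sum_add_distrib]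
  have h1 : ∀ π : Perm ι, ((∏ i, T i (π i)) • cycleWeight y Finset.univ π
      - (∏ i, T' i (π i)) • cycleWeight y Finset.univ π)
      + ((∏ i, H i (π i)) • cycleWeight y Finset.univ π
      - (∏ i, H' i (π i)) • cycleWeight y Finset.univ π)
      = f (σ * π * σ⁻¹) • cycleWeight y Finset.univ (σ * π * σ⁻¹)
        - f π • cycleWeight y Finset.univ π := fun π => by
    rw [cycleWeight_univ_conj, ← sub_smul, ← sub_smul, ← sub_smul, ← add_smul, hpt]
  rw [Finset.sum_congr rfl fun π _ => h1 π, Finset.sum_sub_distrib, sub_eq_zero]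
  -- conjugation by `σ` permutes the summands and preserves the lengths of the cycles
  exact Equiv.sum_comp (MulAut.conj σ).toEquiv fun π => f π • cycleWeight y Finset.univ π

end CycleSumFourT

/-! ### The weight systems of `𝒜ˢʷ(↑)` -/

/-- The leg `u` is met before the leg `v` on the line. -/
def Before (w : List Leg) (u v : Leg) : Prop := w.idxOf u < w.idxOf v

instance (w : List Leg) (u v : Leg) : Decidable (Before w u v) :=
  inferInstanceAs (Decidable (w.idxOf u < w.idxOf v))

/-- The signed trapping matrix of an arrow diagram: outside the diagonal the entry at `(a, b)` is `0`
unless the head of `b` lies in the span of `a`, and then it is `-1` if the tail of `a` comes first and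
`1` otherwise. -/
def crossingMatrix (w : List Leg) (a b : ℕ) : ℚ :=
  if a = b then 1 else
    (if Before w (head a) (head b) then 1 else 0) - (if Before w (tail a) (head b) then 1 else 0)

theorem before_map {f : ℕ → ℕ} (hf : Function.Injective f) (w : List Leg) (u v : Leg) :
    Before (w.map (Leg.map f)) (u.map f) (v.map f) ↔ Before w u v := by
  have h : ∀ x, (w.map (Leg.map f)).idxOf (x.map f) = w.idxOf x := fun x => by
    induction w with
    | nil => rfl
    | cons y w ih =>
      simp only [List.map_cons, List.idxOf_cons, ih]
      have : (Leg.map f y == Leg.map f x) = (y == x) := by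
        rw [Bool.eq_iff_iff, beq_iff_eq, beq_iff_eq, (map_injective hf).eq_iff]
      rw [this]
  rw [Before, Before, h, h]

theorem crossingMatrix_map {f : ℕ → ℕ} (hf : Function.Injective f) (w : List Leg) (a b : ℕ) :
    crossingMatrix (w.map (Leg.map f)) (f a) (f b) = crossingMatrix w a b := by
  have h1 := before_map hf w (head a) (head b)
  have h2 := before_map hf w (tail a) (head b)
  simp only [map_head, map_tail] at h1 h2
  simp only [crossingMatrix, h1, h2, hf.eq_iff]

theorem before_append_of_mem {A B : List Leg} {u v : Leg} (hu : u ∈ A) (hv : v ∉ A) :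
    Before (A ++ B) u v := by
  have := List.idxOf_lt_length_of_mem hu
  simp only [Before, List.idxOf_append, hu, hv, if_true, if_false]
  omega

theorem before_append_left {A B : List Leg} {u v : Leg} (hu : u ∈ A) (hv : v ∈ A) :
    Before (A ++ B) u v ↔ Before A u v := by
  simp only [Before, List.idxOf_append, hu, hv, if_true]

theorem before_append_right {A B : List Leg} {u v : Leg} (hu : u ∉ A) (hv : v ∉ A) :
    Before (A ++ B) u v ↔ Before B u v := by
  simp only [Before, List.idxOf_append, hu, hv, if_false]
  omega

theorem idxOf_insert {A B : List Leg} {h u : Leg} (hu : u ≠ h) :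
    (A ++ h :: B).idxOf u = (A ++ B).idxOf u + if u ∈ A then 0 else 1 := by
  have : (h == u) = false := by simpa using hu.symm
  simp only [List.idxOf_append, List.idxOf_cons, this, cond_false]
  split_ifs <;> omega

theorem mem_iff_idxOf_lt {A B : List Leg} {u : Leg} :
    u ∈ A ↔ (A ++ B).idxOf u < A.length := by
  rw [List.idxOf_append]
  split_ifs with h
  · exact iff_of_true h (List.idxOf_lt_length_of_mem h)
  · simp [h]

theorem idxOf_self {A B : List Leg} {h : Leg} (hA : h ∉ A) :
    (A ++ h :: B).idxOf h = A.length := by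
  simp [List.idxOf_append, hA]

/-- The signed trapping matrix in terms of the positions of the tails and of the heads. -/
def posMatrix {ι : Type*} [DecidableEq ι] (pt ph : ι → ℤ) (a b : ι) : ℚ :=
  if a = b then 1 else (if ph a < ph b then 1 else 0) - (if pt a < ph b then 1 else 0)

/-- Inserting the head of `a` after the part `A` of a word gives it the position `|A| - 1/2`; all
positions are doubled. -/
theorem crossingMatrix_insert {A B : List Leg} {a : ℕ} (ha : head a ∉ A) (i j : ℕ) :
    crossingMatrix (A ++ head a :: B) i j
      = posMatrix (fun b => 2 * ((A ++ B).idxOf (tail b) : ℤ))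
        (Function.update (fun b => 2 * ((A ++ B).idxOf (head b) : ℤ)) a (2 * A.length - 1)) i j := by
  have key : ∀ u v, u ≠ head a → v ≠ head a →
      (Before (A ++ head a :: B) u v ↔
        2 * ((A ++ B).idxOf u : ℤ) < 2 * ((A ++ B).idxOf v : ℤ)) := fun u v hu hv => by
    have h1 := mem_iff_idxOf_lt (A := A) (B := B) (u := u)
    have h2 := mem_iff_idxOf_lt (A := A) (B := B) (u := v)
    rw [Before, idxOf_insert hu, idxOf_insert hv]
    split_ifs <;> simp_all <;> omega
  have key1 : ∀ u, u ≠ head a → (Before (A ++ head a :: B) u (head a) ↔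
        2 * ((A ++ B).idxOf u : ℤ) < 2 * A.length - 1) := fun u hu => by
    have h1 := mem_iff_idxOf_lt (A := A) (B := B) (u := u)
    rw [Before, idxOf_insert hu, idxOf_self ha]
    split_ifs <;> simp_all <;> omega
  have key2 : ∀ u, u ≠ head a → (Before (A ++ head a :: B) (head a) u ↔
        2 * (A.length : ℤ) - 1 < 2 * ((A ++ B).idxOf u : ℤ)) := fun u hu => by
    have h1 := mem_iff_idxOf_lt (A := A) (B := B) (u := u)
    rw [Before, idxOf_insert hu, idxOf_self ha]
    split_ifs <;> simp_all; omega
  unfold crossingMatrix posMatrix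
  by_cases hij : i = j
  · simp [hij]
  rw [if_neg hij, if_neg hij]
  by_cases hi : i = a
  · subst hi
    have hj : head j ≠ head i := fun h => hij (by injection h with h; exact h.symm)
    simp only [key2 _ hj, key (tail i) _ (by simp) hj, Function.update_self,
      Function.update_of_ne (Ne.symm hij)]
  · have hi' : head i ≠ head a := fun h => hi (by injection h)
    by_cases hj : j = a
    · subst hj
      simp only [key1 _ hi', key1 (tail i) (by simp), Function.update_self,
        Function.update_of_ne hi]
    · have hj' : head j ≠ head a := fun h => hj (by injection h)
      simp only [key _ _ hi' hj', key (tail i) _ (by simp) hj', Function.update_of_ne hi,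
        Function.update_of_ne hj]

section Weight

variable {ι R : Type*} [Fintype ι] [DecidableEq ι] [CommRing R] [Algebra ℚ R]

/-- The directed 4T relation in terms of positions: the head of `a` is placed just before and just after
the tail of `c`, and just before and just after the head of `c`. -/
theorem cycleSum_posMatrix_fourT (y : ℕ → R) {a c : ι} (hac : a ≠ c) (pt ph : ι → ℤ)
    (hpt : Function.Injective pt) (hph : Function.Injective ph) (hne : ∀ i j, pt i ≠ ph j) :
    cycleSum y (posMatrix (fun i => 2 * pt i)
        (Function.update (fun i => 2 * ph i) a (2 * pt c - 1))) Finset.univ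
      - cycleSum y (posMatrix (fun i => 2 * pt i)
        (Function.update (fun i => 2 * ph i) a (2 * pt c + 1))) Finset.univ
      + (cycleSum y (posMatrix (fun i => 2 * pt i)
        (Function.update (fun i => 2 * ph i) a (2 * ph c - 1))) Finset.univ
      - cycleSum y (posMatrix (fun i => 2 * pt i)
        (Function.update (fun i => 2 * ph i) a (2 * ph c + 1))) Finset.univ) = 0 := by
  have hpt' : ∀ i j, i ≠ j → pt i ≠ pt j := fun i j h => hpt.ne h
  have hph' : ∀ i j, i ≠ j → ph i ≠ ph j := fun i j h => hph.ne h
  have hca := hac.symm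
  refine cycleSum_fourT y hac ?_ ?_ ?_ ?_ ?_ ?_ ?_ ?_ ?_
  · intro i j hij
    unfold posMatrix
    by_cases h1 : i = j
    · simp [h1]
    have h3 := hne c j
    have h4 := hne c i
    have h5 := hpt' i c
    by_cases h2 : i = a
    · subst h2
      have : (2 * pt c - 1 < 2 * ph j) ↔ (2 * pt c + 1 < 2 * ph j) := by omega
      simp [Function.update_of_ne (Ne.symm h1), this]
    · by_cases h6 : j = a
      · subst h6
        have h5 := h5 (fun h => hij ⟨h, rfl⟩)
        have e1 : (2 * ph i < 2 * pt c - 1) ↔ (2 * ph i < 2 * pt c + 1) := by omega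
        have e2 : (2 * pt i < 2 * pt c - 1) ↔ (2 * pt i < 2 * pt c + 1) := by omega
        simp [Function.update_of_ne h2, e1, e2]
      · simp [Function.update_of_ne h2, Function.update_of_ne h6]
  · have h4 := hne c c
    have e1 : (2 * ph c < 2 * pt c - 1) ↔ (2 * ph c < 2 * pt c + 1) := by omega
    have e2 : ¬ (2 * pt c < 2 * pt c - 1) := by omega
    have e3 : 2 * pt c < 2 * pt c + 1 := by omega
    simp [posMatrix, hca, e1, e3]
  · intro i j hij hij'
    unfold posMatrix
    by_cases h1 : i = j
    · simp [h1]
    have h3 := hph' c j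
    have h4 := hph' c i
    have h5 := hne i c
    by_cases h2 : i = a
    · subst h2
      have h3 := h3 (fun h => hij' ⟨rfl, h.symm⟩)
      have : (2 * ph c - 1 < 2 * ph j) ↔ (2 * ph c + 1 < 2 * ph j) := by omega
      simp [Function.update_of_ne (Ne.symm h1), this]
    · by_cases h6 : j = a
      · subst h6
        have h4 := h4 (fun h => hij ⟨h.symm, rfl⟩)
        have e1 : (2 * ph i < 2 * ph c - 1) ↔ (2 * ph i < 2 * ph c + 1) := by omega
        have e2 : (2 * pt i < 2 * ph c - 1) ↔ (2 * pt i < 2 * ph c + 1) := by omega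
        simp [Function.update_of_ne h2, e1, e2]
      · simp [Function.update_of_ne h2, Function.update_of_ne h6]
  · have h4 := hne c c
    have e1 : (2 * pt c < 2 * ph c - 1) ↔ (2 * pt c < 2 * ph c + 1) := by omega
    have e2 : ¬ (2 * ph c < 2 * ph c - 1) := by omega
    have e3 : 2 * ph c < 2 * ph c + 1 := by omega
    simp only [posMatrix, hca, if_false, if_true, Function.update_self,
      Function.update_of_ne hca, e1, e2, e3]
    ring
  · have e1 : ¬ (2 * ph c + 1 < 2 * ph c) := by omega
    simp [posMatrix, hac, Function.update_of_ne hca]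
    ring
  · intro i j hia hic hja
    simp [posMatrix, Function.update_of_ne hia, Function.update_of_ne hja]
  · intro i hia hic
    have h4 := hph' c i hic.symm
    have h5 := hne i c
    have e1 : (2 * ph i < 2 * ph c - 1) ↔ (2 * ph i < 2 * ph c) := by omega
    have e2 : (2 * pt i < 2 * ph c - 1) ↔ (2 * pt i < 2 * ph c) := by omega
    simp only [posMatrix, hia, hic, if_false, Function.update_of_ne hia, Function.update_self,
      Function.update_of_ne hca, e1, e2]
  · intro j hja hjc
    have h4 := hph' c j hjc.symm
    have h5 := hne c j
    have e1 : (2 * ph c - 1 < 2 * ph j) ↔ (2 * ph c < 2 * ph j) := by omega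
    have e2 : (2 * pt c - 1 < 2 * ph j) ↔ (2 * pt c < 2 * ph j) := by omega
    simp only [posMatrix, hja.symm, hjc.symm, if_false, Function.update_of_ne hja,
      Function.update_self, Function.update_of_ne hca, e1, e2]
    ring
  · have h5 := hne c c
    have e1 : ¬ (2 * ph c + 1 < 2 * ph c) := by omega
    have e2 : (2 * pt c - 1 < 2 * ph c) ↔ (2 * pt c < 2 * ph c) := by omega
    have e3 : (2 * pt c < 2 * ph c - 1) ↔ (2 * pt c < 2 * ph c) := by omega
    have e4 : (2 * pt c < 2 * ph c + 1) ↔ (2 * pt c < 2 * ph c) := by omega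
    have e5 : (2 * ph c - 1 < 2 * ph c) := by omega
    have e6 : ¬ (2 * ph c < 2 * ph c - 1) := by omega
    have e7 : (2 * ph c < 2 * ph c + 1) := by omega
    simp only [posMatrix, hac, hca, if_false, if_true, Function.update_self,
      Function.update_of_ne hca, e1, e2, e3, e4, e5, e6, e7]
    ring

variable (y : ℕ → R)

/-- The weight of an arrow diagram: a sum over the permutations `π` of its arrows of the product of
the entries `M a (π a)` of the signed trapping matrix, with a factor `y k` for each cycle of `π` of
length `k`. For `y = 0` at `1` and `-1` elsewhere it is a determinant. -/
noncomputable def weight (w : List Leg) : R :=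
  cycleSum y (fun a b : {a // a ∈ labels w} => crossingMatrix w a b) Finset.univ

/-- The weight of a diagram whose arrows are indexed by an arbitrary finite type. -/
theorem weight_eq {w : List Leg} {e : ι → ℕ} (he : Function.Injective e)
    (hr : ∀ a, a ∈ labels w ↔ ∃ k, e k = a) :
    weight y w = cycleSum y (fun i j => crossingMatrix w (e i) (e j)) Finset.univ :=
  cycleSum_equiv y _ (Equiv.ofBijective (fun k => (⟨e k, (hr _).2 ⟨k, rfl⟩⟩ : {a // a ∈ labels w}))
    ⟨fun _ _ h => he (Subtype.ext_iff.1 h), fun ⟨a, ha⟩ => by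
      obtain ⟨k, rfl⟩ := (hr a).1 ha; exact ⟨k, rfl⟩⟩)

end Weight

section WeightSystem

variable {R : Type*} [CommRing R] [Algebra ℚ R] (y : ℕ → R)

theorem weight_map {f : ℕ → ℕ} (hf : Function.Injective f) (w : List Leg) :
    weight y (w.map (Leg.map f)) = weight y w := by
  rw [weight_eq y (e := fun a : {a // a ∈ labels w} => f a)
    (fun a b h => Subtype.ext (hf h)) (fun a => by simp [labels_map])]
  simp only [crossingMatrix_map hf]
  rfl

theorem weight_congr {w w' : List Leg} (hl : labels w = labels w')
    (h : ∀ a b, a ≠ b → crossingMatrix w a b = crossingMatrix w' a b) : weight y w = weight y w' := by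
  rw [weight_eq y (w := w) (e := fun a : {a // a ∈ labels w'} => (a : ℕ))
    (fun a b h => Subtype.ext h) (fun a => by simp [hl])]
  refine cycleSum_congr y fun a _ b _ => ?_
  by_cases hab : (a : ℕ) = b
  · simp [crossingMatrix, hab]
  · exact h a b hab

theorem before_swap {P Q : List Leg} {x z u v : Leg} (h : ¬ (u = x ∧ v = z))
    (h' : ¬ (u = z ∧ v = x)) :
    Before (P ++ [x, z] ++ Q) u v ↔ Before (P ++ [z, x] ++ Q) u v := by
  by_cases hxz : x = z
  · rw [hxz]
  by_cases huv : u = v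
  · simp [huv, Before]
  have b1 : ∀ s t : Leg, s ≠ t → (s == t) = false := fun s t h => by simpa using h
  have b2 : ∀ s : Leg, (s == s) = true := fun s => by simp
  unfold Before
  simp only [List.append_assoc, List.cons_append, List.nil_append, List.idxOf_append,
    List.idxOf_cons]
  by_cases h1 : u = x
  · subst h1
    have h2 : v ≠ z := fun e => h ⟨rfl, e⟩
    simp only [b1 _ _ huv, b1 _ _ h2.symm, b2, b1 _ _ (Ne.symm hxz), cond_true, cond_false]
    split_ifs <;> first | omega | grind
  by_cases h2 : u = z
  · subst h2
    have h2 : v ≠ x := fun e => h' ⟨rfl, e⟩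
    simp only [b1 _ _ hxz, b1 _ _ huv, b1 _ _ h2.symm, b2, cond_true, cond_false]
    split_ifs <;> first | omega | grind
  simp only [b1 _ _ (Ne.symm h1), b1 _ _ (Ne.symm h2), cond_false]
  have := fun h => List.idxOf_lt_length_of_mem (l := P) (a := u) h
  have := fun h => List.idxOf_lt_length_of_mem (l := P) (a := v) h
  by_cases h3 : v = x
  · subst h3
    simp only [b2, b1 _ _ (Ne.symm hxz), cond_true, cond_false]
    split_ifs <;> first | omega | grind
  by_cases h4 : v = z
  · subst h4
    simp only [b1 _ _ hxz, b2, cond_true, cond_false]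
    split_ifs <;> first | omega | grind
  simp only [b1 _ _ (Ne.symm h3), b1 _ _ (Ne.symm h4), cond_false]

theorem labels_swap (P Q : List Leg) (x z : Leg) :
    labels (P ++ [x, z] ++ Q) = labels (P ++ [z, x] ++ Q) :=
  labels_perm (((List.Perm.swap _ _ _).append_left P).append_right Q)

/-- The matrix only compares tails with heads and heads with heads. -/
theorem weight_tc (P Q : List Leg) (a b : ℕ) :
    weight y (P ++ [tail a, tail b] ++ Q) = weight y (P ++ [tail b, tail a] ++ Q) :=
  weight_congr y (labels_swap _ _ _ _) fun i j _ => by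
    have h1 := before_swap (P := P) (Q := Q) (x := tail a) (z := tail b) (u := head i) (v := head j)
      (by simp) (by simp)
    have h2 := before_swap (P := P) (Q := Q) (x := tail a) (z := tail b) (u := tail i) (v := head j)
      (by simp) (by simp)
    simp only [crossingMatrix, h1, h2]

/-- Reversing an isolated arrow only affects the comparison of its own tail and head, which the matrix does
not use. -/
theorem weight_ri (P Q : List Leg) (a : ℕ) :
    weight y (P ++ [tail a, head a] ++ Q) = weight y (P ++ [head a, tail a] ++ Q) :=
  weight_congr y (labels_swap _ _ _ _) fun i j hij => by
    have h1 := before_swap (P := P) (Q := Q) (x := tail a) (z := head a) (u := head i) (v := head j)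
      (by simp) (by simp)
    have h2 := before_swap (P := P) (Q := Q) (x := tail a) (z := head a) (u := tail i) (v := head j)
      (by simp; omega) (by simp)
    simp only [crossingMatrix, h1, h2]

theorem weight_fourT {P Q R' : List Leg} {a c : ℕ} {x z : Leg}
    (hxz : (x = tail c ∧ z = head c) ∨ (x = head c ∧ z = tail c))
    (hw : WF (P ++ [head a, x] ++ Q ++ [z] ++ R')) :
    weight y (P ++ [head a, x] ++ Q ++ [z] ++ R') + weight y (P ++ [x] ++ Q ++ [head a, z] ++ R')
      = weight y (P ++ [x, head a] ++ Q ++ [z] ++ R')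
        + weight y (P ++ [x] ++ Q ++ [z, head a] ++ R') := by
  set W := P ++ [head a, x] ++ Q ++ [z] ++ R' with hW
  have hn : (head a :: (P ++ x :: Q ++ z :: R')).Nodup := by
    refine (List.Perm.nodup_iff ?_).1 hw.1
    rw [hW]
    simp only [List.append_assoc, List.cons_append, List.nil_append]
    exact List.perm_middle
  rw [List.nodup_cons] at hn
  obtain ⟨ha, hn⟩ := hn
  -- the common word of the four diagrams without the head of `a`
  set B := P ++ x :: Q ++ z :: R' with hB
  have hW1 : W = P ++ head a :: (x :: Q ++ z :: R') := by simp [hW]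
  have hB1 : P ++ (x :: Q ++ z :: R') = B := by simp [hB]
  have hB2 : (P ++ [x]) ++ (Q ++ z :: R') = B := by simp [hB]
  have hB3 : (P ++ x :: Q) ++ (z :: R') = B := by simp [hB]
  have hB4 : (P ++ x :: Q ++ [z]) ++ R' = B := by simp [hB]
  have key : ∀ C D, C ++ D = B → weight y (C ++ head a :: D)
      = cycleSum y (posMatrix (fun i : {b // b ∈ labels W} => 2 * (B.idxOf (tail i.1) : ℤ))
        (Function.update (fun i : {b // b ∈ labels W} => 2 * (B.idxOf (head i.1) : ℤ))
          ⟨a, by simp [hW, labels]⟩ (2 * C.length - 1))) Finset.univ := fun C D h => by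
    have hl : labels (C ++ head a :: D) = labels W := by
      refine labels_perm (List.perm_middle.trans ?_)
      rw [h, hW1]
      refine List.Perm.trans ?_ List.perm_middle.symm
      rw [hB1]
    rw [weight_eq y (e := fun i : {b // b ∈ labels W} => (i : ℕ)) (fun a b h => Subtype.ext h)
      (fun a => by simp [hl])]
    refine cycleSum_congr y fun i _ j _ => ?_
    have ha' : head a ∉ C := fun hc => ha (by rw [← h]; exact List.mem_append_left _ hc)
    rw [crossingMatrix_insert ha', h]
    simp only [posMatrix, Subtype.ext_iff, Function.update_apply]
  have hac : a ≠ c := by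
    rintro rfl
    rcases hxz with ⟨-, rfl⟩ | ⟨rfl, -⟩ <;> exact ha (by simp [hB])
  have hcW : c ∈ labels W := by
    rcases hxz with ⟨rfl, -⟩ | ⟨rfl, -⟩ <;> simp [hW, labels]
  have hmem : ∀ u, u ≠ head a → u ∈ W → u ∈ B := fun u hu h => by
    rw [hW1] at h
    rw [hB]
    simp only [List.mem_append, List.mem_cons] at h ⊢
    tauto
  have hlab : ∀ b ∈ labels W, tail b ∈ W ∧ head b ∈ W := fun b hb => by
    have := hw.2 b
    rcases mem_labels.1 hb with h | h <;> tauto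
  have hinj : ∀ u v, u ∈ B → B.idxOf u = B.idxOf v → u = v := fun u v hu h =>
    (List.idxOf_inj hu).1 h
  have main := cycleSum_posMatrix_fourT y (ι := {b // b ∈ labels W})
    (a := ⟨a, by simp [hW, labels]⟩) (c := ⟨c, hcW⟩) (by simpa using hac)
    (fun i => (B.idxOf (tail i.1) : ℤ)) (fun i => (B.idxOf (head i.1) : ℤ)) ?_ ?_ ?_
  · have hx : B.idxOf x = P.length := by
      rw [← hB1]
      refine idxOf_self fun h => ?_
      rw [← hB1] at hn
      exact (List.nodup_append.1 hn).2.2 _ h _ (by simp) rfl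
    have hz : B.idxOf z = (P ++ x :: Q).length := by
      rw [← hB3]
      refine idxOf_self fun h => ?_
      rw [← hB3] at hn
      exact (List.nodup_append.1 hn).2.2 _ h _ (by simp) rfl
    have k1 := key _ _ hB1
    have k2 := key _ _ hB2
    have k3 := key _ _ hB3
    have k4 := key _ _ hB4
    have l2 : 2 * ((P ++ [x]).length : ℤ) - 1 = 2 * P.length + 1 := by
      simp; ring
    have l4 : 2 * ((P ++ x :: Q ++ [z]).length : ℤ) - 1 = 2 * (P ++ x :: Q).length + 1 := by
      simp; ring
    rw [l2] at k2
    rw [l4] at k4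
    rw [show W = P ++ head a :: (x :: Q ++ z :: R') from hW1,
      show P ++ [x] ++ Q ++ [head a, z] ++ R' = P ++ x :: Q ++ head a :: (z :: R') by simp,
      show P ++ [x, head a] ++ Q ++ [z] ++ R' = P ++ [x] ++ head a :: (Q ++ z :: R') by simp,
      show P ++ [x] ++ Q ++ [z, head a] ++ R' = P ++ x :: Q ++ [z] ++ head a :: R' by simp,
      k1, k2, k3, k4, ← hx, ← hz]
    rcases hxz with ⟨rfl, rfl⟩ | ⟨rfl, rfl⟩
    · linear_combination main
    · linear_combination main
  · intro i j h
    have h' := hinj _ _ (hmem _ (by simp) (hlab i i.2).1) (Int.natCast_inj.1 h)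
    exact Subtype.ext (by injection h')
  · intro i j h
    by_cases hi : head i.1 = head a
    · by_cases hj : head j.1 = head a
      · have h' := hi.trans hj.symm
        exact Subtype.ext (by injection h')
      · have h' := hinj _ _ (hmem _ hj (hlab j j.2).2) (Int.natCast_inj.1 h.symm)
        exact Subtype.ext (by injection h'.symm)
    · have h' := hinj _ _ (hmem _ hi (hlab i i.2).2) (Int.natCast_inj.1 h)
      exact Subtype.ext (by injection h')
  · intro i j h
    have h' := hinj _ _ (hmem _ (by simp) (hlab i i.2).1) (Int.natCast_inj.1 h)
    cases h'

/-- The weight of a juxtaposition is the product of the weights: no span of an arrow of the first part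
contains a head of the second one, so that the matrix is block triangular. -/
theorem weight_append {u v : List Leg} (hu : WF u) (hv : WF v)
    (huv : ∀ x ∈ u, ∀ y ∈ v, x.label ≠ y.label) : weight y (u ++ v) = weight y u * weight y v := by
  have hmu : ∀ a ∈ labels u, tail a ∈ u ∧ head a ∈ u := fun b hb => by
    have := hu.2 b
    rcases mem_labels.1 hb with h | h <;> tauto
  have hmv : ∀ a ∈ labels v, tail a ∈ v ∧ head a ∈ v := fun b hb => by
    have := hv.2 b
    rcases mem_labels.1 hb with h | h <;> tauto
  have hnu : ∀ a ∈ labels v, tail a ∉ u ∧ head a ∉ u := fun a ha =>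
    ⟨fun h => huv _ h _ (hmv a ha).1 rfl, fun h => huv _ h _ (hmv a ha).1 rfl⟩
  rw [weight_eq y (ι := {a // a ∈ labels u} ⊕ {a // a ∈ labels v}) (w := u ++ v)
    (e := Sum.elim Subtype.val Subtype.val)]
  · rw [show (Finset.univ : Finset ({a // a ∈ labels u} ⊕ {a // a ∈ labels v}))
        = Finset.univ.map Function.Embedding.inl ∪ Finset.univ.map Function.Embedding.inr by
        ext i; cases i <;> simp]
    rw [cycleSum_union, cycleSum_map, cycleSum_map]
    · congr 1
      · refine cycleSum_congr y fun i _ j _ => ?_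
        have := before_append_left (B := v) (hmu i i.2).2 (hmu j j.2).2
        have := before_append_left (B := v) (hmu i i.2).1 (hmu j j.2).2
        simp_all [crossingMatrix]
      · refine cycleSum_congr y fun i _ j _ => ?_
        have := before_append_right (B := v) (hnu i i.2).2 (hnu j j.2).2
        have := before_append_right (B := v) (hnu i i.2).1 (hnu j j.2).2
        simp_all [crossingMatrix]
    · simp only [Finset.mem_map, Finset.mem_univ, true_and]
      rintro _ ⟨i, rfl⟩ _ ⟨j, rfl⟩
      have h1 := before_append_of_mem (B := v) (hmu i i.2).2 (hnu j j.2).2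
      have h2 := before_append_of_mem (B := v) (hmu i i.2).1 (hnu j j.2).2
      have h3 : (i : ℕ) ≠ j := fun h => (hnu j j.2).2 (h ▸ (hmu i i.2).2)
      simp [crossingMatrix, h1, h2, h3]
    · rw [Finset.disjoint_left]
      simp
  · rintro (i | i) (j | j) h
    · exact congrArg Sum.inl (Subtype.ext h)
    · have h : (i : ℕ) = j := h
      exact absurd (h ▸ (hmu i i.2).2) (hnu j j.2).2
    · have h : (i : ℕ) = j := h
      exact absurd (h ▸ (hmu j j.2).2) (hnu i i.2).2
    · exact congrArg Sum.inr (Subtype.ext h)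
  · intro a
    simp [labels]

/-- The weight of an arrow diagram, as a multiplicative map. -/
noncomputable def diagramWeight : ArrowDiagram →* R where
  toFun := Quot.lift (fun w => weight y w.1) fun w w' ⟨f, hf, h⟩ => by
    simp only [h, weight_map y hf]
  map_one' := by
    change weight y [] = 1
    have : IsEmpty {a // a ∈ labels []} := ⟨fun a => by simpa [labels] using a.2⟩
    rw [weight, Finset.univ_eq_empty, cycleSum_empty]
  map_mul' := by
    rintro ⟨u⟩ ⟨v⟩
    change weight y (u.concat v).1 = weight y u.1 * weight y v.1
    rw [ArrowWord.concat, weight_append y ((wf_map evenLabel_injective _).2 u.2)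
      ((wf_map oddLabel_injective _).2 v.2), weight_map y evenLabel_injective,
      weight_map y oddLabel_injective]
    simp only [List.mem_map]
    rintro _ ⟨x, -, rfl⟩ _ ⟨y, -, rfl⟩
    cases x <;> cases y <;> simp [evenLabel, oddLabel] <;> omega

theorem lift_diagram (w : List Leg) (hw : WF w) :
    MonoidAlgebra.lift ℚ R ArrowDiagram (diagramWeight y) (diagram w) = weight y w := by
  rw [diagram, dif_pos hw]
  exact MonoidAlgebra.lift_of _ _

theorem lift_swRel {x x' : Dv} (h : SwRel x x') :
    MonoidAlgebra.lift ℚ R ArrowDiagram (diagramWeight y) x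
      = MonoidAlgebra.lift ℚ R ArrowDiagram (diagramWeight y) x' := by
  have hz : ∀ w, ¬ WF w → diagram w = 0 := fun w hw => by rw [diagram, dif_neg hw]
  cases h with
  | tc P Q a b =>
    have hp : (P ++ [tail a, tail b] ++ Q).Perm (P ++ [tail b, tail a] ++ Q) :=
      ((List.Perm.swap _ _ _).append_left P).append_right Q
    by_cases hw : WF (P ++ [tail a, tail b] ++ Q)
    · rw [lift_diagram y _ hw, lift_diagram y _ ((WF.perm hp).1 hw), weight_tc]
    · rw [hz _ hw, hz _ (mt (WF.perm hp).2 hw)]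
  | ri P Q a =>
    have hp : (P ++ [tail a, head a] ++ Q).Perm (P ++ [head a, tail a] ++ Q) :=
      ((List.Perm.swap _ _ _).append_left P).append_right Q
    by_cases hw : WF (P ++ [tail a, head a] ++ Q)
    · rw [lift_diagram y _ hw, lift_diagram y _ ((WF.perm hp).1 hw), weight_ri]
    · rw [hz _ hw, hz _ (mt (WF.perm hp).2 hw)]
  | fourT P Q R' a c x z hxz =>
    have e0 : (P ++ [head a, x] ++ Q ++ [z] ++ R').Perm (head a :: (P ++ x :: Q ++ z :: R')) := by
      simp only [List.append_assoc, List.cons_append, List.nil_append]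
      exact List.perm_middle
    have e1 : (P ++ [x] ++ Q ++ [head a, z] ++ R').Perm (head a :: (P ++ x :: Q ++ z :: R')) := by
      have : P ++ [x] ++ Q ++ [head a, z] ++ R' = (P ++ x :: Q) ++ head a :: (z :: R') := by simp
      rw [this]
      exact List.perm_middle
    have e2 : (P ++ [x, head a] ++ Q ++ [z] ++ R').Perm (head a :: (P ++ x :: Q ++ z :: R')) := by
      have : P ++ [x, head a] ++ Q ++ [z] ++ R' = (P ++ [x]) ++ head a :: (Q ++ z :: R') := by simp
      rw [this]
      refine List.perm_middle.trans ?_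
      simp
    have e3 : (P ++ [x] ++ Q ++ [z, head a] ++ R').Perm (head a :: (P ++ x :: Q ++ z :: R')) := by
      have : P ++ [x] ++ Q ++ [z, head a] ++ R' = (P ++ x :: Q ++ [z]) ++ head a :: R' := by simp
      rw [this]
      refine List.perm_middle.trans ?_
      simp
    rw [map_add, map_add]
    by_cases hw : WF (head a :: (P ++ x :: Q ++ z :: R'))
    · rw [lift_diagram y _ ((WF.perm e0).2 hw), lift_diagram y _ ((WF.perm e1).2 hw),
        lift_diagram y _ ((WF.perm e2).2 hw), lift_diagram y _ ((WF.perm e3).2 hw)]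
      exact weight_fourT y hxz ((WF.perm e0).2 hw)
    · rw [hz _ (mt (WF.perm e0).1 hw), hz _ (mt (WF.perm e1).1 hw), hz _ (mt (WF.perm e2).1 hw),
        hz _ (mt (WF.perm e3).1 hw)]

/-- The weight system of `𝒜ˢʷ(↑)` with the values `y`. -/
noncomputable def weightSystem : Asw →ₐ[ℚ] R :=
  RingQuot.liftAlgHom ℚ ⟨MonoidAlgebra.lift ℚ R ArrowDiagram (diagramWeight y),
    fun _ _ h => lift_swRel y h⟩

theorem weightSystem_toAsw (x : Dv) :
    weightSystem y (toAsw x) = MonoidAlgebra.lift ℚ R ArrowDiagram (diagramWeight y) x :=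
  RingQuot.liftAlgHom_mkAlgHom_apply ..

theorem weightSystem_cl {w : List Leg} (hw : WF w) : weightSystem y (cl w) = weight y w := by
  rw [cl, weightSystem_toAsw, lift_diagram y w hw]

end WeightSystem

/-! ### The values of the weight systems on the arrow and on the wheels -/

section WheelWeight

/-- The words of the expanded nested commutator: the heads with names in `J` are written, in
decreasing order, after the innermost head, and the others before it. -/
def bracketWord (l : List ℕ) (b : ℕ) (J : Finset ℕ) : List Leg :=
  (l.filter (· ∉ J)).map head ++ [head b] ++ ((l.filter (· ∈ J)).map head).reverse

theorem legWord_mul (u v : List Leg) : legWord u * legWord v = legWord (u ++ v) := by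
  simp [legWord]

theorem nestedBracket_eq_sum {l : List ℕ} (hl : l.Nodup) (b : ℕ) :
    nestedBracket l b
      = ∑ J ∈ l.toFinset.powerset, ((-1 : ℚ) ^ J.card) • legWord (bracketWord l b J) := by
  induction l with
  | nil => simp [nestedBracket, bracketWord]
  | cons a l ih =>
    rw [List.nodup_cons] at hl
    have ha : a ∉ l.toFinset := by simpa using hl.1
    rw [nestedBracket, ih hl.2, List.toFinset_cons, Finset.sum_powerset_insert ha, Ring.lie_def,
      Finset.mul_sum, Finset.sum_mul, sub_eq_add_neg, ← Finset.sum_neg_distrib]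
    congr 1 <;> refine Finset.sum_congr rfl fun J hJ => ?_
    · have haJ : a ∉ J := fun h => ha (Finset.mem_powerset.1 hJ h)
      rw [mul_smul_comm, legWord_mul]
      simp [bracketWord, haJ]
    · have haJ : a ∉ J := fun h => ha (Finset.mem_powerset.1 hJ h)
      have h1 : l.filter (· ∉ insert a J) = l.filter (· ∉ J) := List.filter_congr fun x hx => by
        have : x ≠ a := fun h => hl.1 (h ▸ hx)
        simp [this]
      have h2 : l.filter (· ∈ insert a J) = l.filter (· ∈ J) := List.filter_congr fun x hx => by
        have : x ≠ a := fun h => hl.1 (h ▸ hx)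
        simp [this]
      rw [smul_mul_assoc, legWord_mul, Finset.card_insert_of_notMem haJ, pow_succ, mul_neg_one,
        neg_smul, bracketWord, bracketWord, List.filter_cons, List.filter_cons, h1, h2]
      simp

/-- The order of the legs of a word can be read off from a function that increases along the word. -/
theorem before_iff_key {w : List Leg} {key : Leg → ℕ}
    (h : w.Pairwise fun u v => key u < key v) {u v : Leg} (hu : u ∈ w) (hv : v ∈ w) :
    Before w u v ↔ key u < key v := by
  induction w with
  | nil => simp at hu
  | cons x w ih =>
    rw [List.pairwise_cons] at h
    rw [Before]
    by_cases h1 : u = x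
    · subst h1
      by_cases h2 : v = u
      · simp [h2]
      · have := h.1 v ((List.mem_cons.1 hv).resolve_left h2)
        simp [List.idxOf_cons_ne _ (Ne.symm h2), this]
    · have hu' := (List.mem_cons.1 hu).resolve_left h1
      by_cases h2 : v = x
      · subst h2
        have := h.1 u hu'
        simp [this.le]
      · rw [List.idxOf_cons_ne _ (Ne.symm h1), List.idxOf_cons_ne _ (Ne.symm h2),
          Nat.succ_lt_succ_iff]
        exact ih h.2 hu' ((List.mem_cons.1 hv).resolve_left h2)

/-- The position of a leg in the word of a resolved wheel with `m + 1` spokes, where `q` is the position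
of the last tail. -/
def wheelKey (m q : ℕ) (J : Finset ℕ) : Leg → ℕ
  | tail a => if a = m then q else a
  | head a => if a = m then 2 * m + 1 else if a ∈ J then 3 * m + 1 - a else m + 1 + a

theorem bracketWord_pairwise (m q : ℕ) (J : Finset ℕ) :
    (bracketWord (List.range m) m J).Pairwise fun u v => wheelKey m q J u < wheelKey m q J v := by
  simp only [bracketWord, List.pairwise_append, List.pairwise_map, List.pairwise_reverse]
  refine ⟨⟨?_, by simp, ?_⟩, ?_, ?_⟩
  · rw [List.pairwise_filter]
    refine List.pairwise_lt_range.imp_of_mem fun {a b} ha hb hab h1 h2 => ?_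
    simp only [List.mem_range] at ha hb
    simp at h1 h2
    simp [wheelKey, h1, h2, ha.ne, hb.ne, hab]
  · simp only [List.mem_map, List.mem_filter, List.mem_range, List.mem_singleton]
    rintro _ ⟨a, ⟨ha, h1⟩, rfl⟩ _ rfl
    simp at h1
    simp [wheelKey, h1, ha.ne]
    omega
  · rw [List.pairwise_filter]
    refine List.pairwise_lt_range.imp_of_mem fun {a b} ha hb hab h1 h2 => ?_
    simp only [List.mem_range] at ha hb
    simp at h1 h2
    simp [wheelKey, h1, h2, ha.ne, hb.ne]
    omega
  · simp only [List.mem_append, List.mem_map, List.mem_filter, List.mem_range, List.mem_singleton,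
      List.mem_reverse]
    rintro _ h _ ⟨b, ⟨hb, h2⟩, rfl⟩
    simp at h2
    rcases h with ⟨a, ⟨ha, h1⟩, rfl⟩ | rfl
    · simp at h1
      simp [wheelKey, h1, h2, ha.ne, hb.ne]
      omega
    · simp [wheelKey, h2, hb.ne]
      omega

theorem bracketWord_perm (l : List ℕ) (b : ℕ) (J : Finset ℕ) :
    (bracketWord l b J).Perm ((l ++ [b]).map head) := by
  rw [List.map_append, List.map_singleton, bracketWord]
  refine (List.Perm.append_left _ (List.reverse_perm _)).trans ?_
  rw [List.append_assoc]
  refine (List.Perm.append_left _ List.perm_append_comm).trans ?_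
  rw [← List.append_assoc, ← List.map_append]
  refine List.Perm.append_right _ (List.Perm.map _ ?_)
  refine List.perm_append_comm.trans ?_
  have := List.filter_append_perm (· ∈ J) l
  simpa using this

theorem head_mem_bracketWord {m : ℕ} {J : Finset ℕ} {a : ℕ} :
    head a ∈ bracketWord (List.range m) m J ↔ a ≤ m := by
  rw [(bracketWord_perm _ _ J).mem_iff, ← List.range_succ]
  simp

theorem tail_mem_bracketWord {m : ℕ} {J : Finset ℕ} {a : ℕ} :
    tail a ∉ bracketWord (List.range m) m J := by
  rw [(bracketWord_perm _ _ J).mem_iff, ← List.range_succ]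
  simp

/-- The words of a resolved wheel in which the last tail is at the end. -/
def wheelWordR (m : ℕ) (J : Finset ℕ) : List Leg :=
  (List.range m).map tail ++ (bracketWord (List.range m) m J ++ [tail m])

/-- The words of a resolved wheel in which the last tail comes just after the other tails. -/
def wheelWordL (m : ℕ) (J : Finset ℕ) : List Leg :=
  (List.range m).map tail ++ ([tail m] ++ bracketWord (List.range m) m J)

theorem wheelKey_bracketWord {m q : ℕ} {J : Finset ℕ} {u : Leg}
    (hu : u ∈ bracketWord (List.range m) m J) : m < wheelKey m q J u ∧ wheelKey m q J u < 3 * m + 2 := by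
  cases u with
  | tail a => exact absurd hu tail_mem_bracketWord
  | head a =>
    rw [head_mem_bracketWord] at hu
    simp only [wheelKey]
    split_ifs <;> omega

theorem wheelWordR_pairwise (m : ℕ) (J : Finset ℕ) : (wheelWordR m J).Pairwise fun u v =>
    wheelKey m (3 * m + 2) J u < wheelKey m (3 * m + 2) J v := by
  simp only [wheelWordR, List.pairwise_append, List.pairwise_map]
  refine ⟨?_, ⟨bracketWord_pairwise _ _ _, by simp, ?_⟩, ?_⟩
  · refine List.pairwise_lt_range.imp_of_mem fun {a b} ha hb hab => ?_
    simp only [List.mem_range] at ha hb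
    simp [wheelKey, ha.ne, hb.ne, hab]
  · simp only [List.mem_singleton]
    rintro u hu _ rfl
    exact (wheelKey_bracketWord hu).2.trans_le (by simp [wheelKey])
  · simp only [List.mem_map, List.mem_range, List.mem_append, List.mem_singleton]
    rintro _ ⟨a, ha, rfl⟩ v (hv | rfl)
    · refine lt_trans ?_ (wheelKey_bracketWord hv).1
      simp [wheelKey, ha.ne, ha]
    · simp [wheelKey, ha.ne]; omega

theorem wheelWordL_pairwise (m : ℕ) (J : Finset ℕ) : (wheelWordL m J).Pairwise fun u v =>
    wheelKey m m J u < wheelKey m m J v := by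
  simp only [wheelWordL, List.pairwise_append, List.pairwise_map]
  refine ⟨?_, ⟨by simp, bracketWord_pairwise _ _ _, ?_⟩, ?_⟩
  · refine List.pairwise_lt_range.imp_of_mem fun {a b} ha hb hab => ?_
    simp only [List.mem_range] at ha hb
    simp [wheelKey, ha.ne, hb.ne, hab]
  · simp only [List.mem_singleton]
    rintro _ rfl v hv
    exact lt_of_eq_of_lt (by simp [wheelKey]) (wheelKey_bracketWord hv).1
  · simp only [List.mem_map, List.mem_range, List.mem_append, List.mem_singleton]
    rintro _ ⟨a, ha, rfl⟩ v (rfl | hv)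
    · simp [wheelKey, ha.ne, ha]
    · refine lt_trans ?_ (wheelKey_bracketWord hv).1
      simp [wheelKey, ha.ne, ha]

theorem wheelWordR_perm (m : ℕ) (J : Finset ℕ) :
    (wheelWordR m J).Perm ((List.range (m + 1)).map tail ++ (List.range (m + 1)).map head) := by
  rw [wheelWordR]
  refine (List.Perm.append_left _ List.perm_append_comm).trans ?_
  rw [← List.append_assoc, List.range_succ, List.map_append, List.map_append]
  refine List.Perm.append_left _ ?_
  simpa [List.range_succ] using bracketWord_perm (List.range m) m J

theorem wheelWordL_perm (m : ℕ) (J : Finset ℕ) : (wheelWordL m J).Perm (wheelWordR m J) :=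
  List.Perm.append_left _ List.perm_append_comm

theorem wf_tails_heads (n : ℕ) : WF ((List.range n).map tail ++ (List.range n).map head) := by
  refine ⟨List.nodup_append.2 ⟨List.nodup_range.map fun _ _ h => by injection h,
    List.nodup_range.map fun _ _ h => by injection h, ?_⟩, ?_⟩
  · simp only [List.mem_map]
    rintro _ ⟨a, -, rfl⟩ _ ⟨b, -, rfl⟩ h
    cases h
  · simp

theorem wf_wheelWordR (m : ℕ) (J : Finset ℕ) : WF (wheelWordR m J) :=
  (WF.perm (wheelWordR_perm m J)).2 (wf_tails_heads _)

theorem wf_wheelWordL (m : ℕ) (J : Finset ℕ) : WF (wheelWordL m J) :=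
  (WF.perm (wheelWordL_perm m J)).2 (wf_wheelWordR m J)

theorem labels_wheelWordR (m : ℕ) (J : Finset ℕ) : labels (wheelWordR m J) = Finset.range (m + 1) := by
  rw [labels_perm (wheelWordR_perm m J)]
  ext a
  simp [labels]

/-- The entries of the signed trapping matrix of the words of a resolved wheel. The dependence on `J`
is through one choice for each arrow. -/
def wheelEntry (J : Finset ℕ) (a b : ℕ) : ℚ :=
  if a = b then 1 else if a < b then (if a ∈ J then -1 else 0) else (if b ∈ J then 0 else -1)

theorem crossingMatrix_wheelWordR {m : ℕ} (J : Finset ℕ) {a b : ℕ} (ha : a < m) (hb : b ≤ m) :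
    crossingMatrix (wheelWordR m J) a b = wheelEntry J a b := by
  have hh : ∀ c, c ≤ m → head c ∈ wheelWordR m J := fun c hc => by
    simp [wheelWordR, head_mem_bracketWord, hc]
  have h1 := before_iff_key (wheelWordR_pairwise m J) (hh a ha.le) (hh b hb)
  have h2 := before_iff_key (wheelWordR_pairwise m J) (u := tail a) (by simp [wheelWordR, ha])
    (hh b hb)
  simp only [crossingMatrix, wheelEntry, h1, h2]
  simp only [wheelKey, ha.ne, if_false]
  split_ifs <;> first | rfl | omega | norm_num

theorem crossingMatrix_wheelWordL {m : ℕ} (J : Finset ℕ) {a b : ℕ} (ha : a < m) (hb : b ≤ m) :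
    crossingMatrix (wheelWordL m J) a b = wheelEntry J a b := by
  have hh : ∀ c, c ≤ m → head c ∈ wheelWordL m J := fun c hc => by
    simp [wheelWordL, head_mem_bracketWord, hc]
  have h1 := before_iff_key (wheelWordL_pairwise m J) (hh a ha.le) (hh b hb)
  have h2 := before_iff_key (wheelWordL_pairwise m J) (u := tail a) (by simp [wheelWordL, ha])
    (hh b hb)
  simp only [crossingMatrix, wheelEntry, h1, h2]
  simp only [wheelKey, ha.ne, if_false]
  split_ifs <;> first | rfl | omega | norm_num

/-- Only the row of the last arrow depends on the place of its tail. The difference of the two rows is `1`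
outside the diagonal, because all heads lie between the two places. -/
theorem crossingMatrix_wheelWord_last {m : ℕ} (J : Finset ℕ) {b : ℕ} (hb : b ≤ m) :
    crossingMatrix (wheelWordR m J) m b - crossingMatrix (wheelWordL m J) m b
      = if m = b then 0 else 1 := by
  have hh : ∀ c, c ≤ m → head c ∈ wheelWordL m J := fun c hc => by
    simp [wheelWordL, head_mem_bracketWord, hc]
  have hh' : ∀ c, c ≤ m → head c ∈ wheelWordR m J := fun c hc => by
    simp [wheelWordR, head_mem_bracketWord, hc]
  have h1 := before_iff_key (wheelWordL_pairwise m J) (hh m le_rfl) (hh b hb)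
  have h2 := before_iff_key (wheelWordL_pairwise m J) (u := tail m) (by simp [wheelWordL])
    (hh b hb)
  have h3 := before_iff_key (wheelWordR_pairwise m J) (hh' m le_rfl) (hh' b hb)
  have h4 := before_iff_key (wheelWordR_pairwise m J) (u := tail m) (by simp [wheelWordR])
    (hh' b hb)
  simp only [crossingMatrix, h1, h2, h3, h4]
  simp only [wheelKey, if_true]
  split_ifs <;> first | rfl | omega | norm_num

open Equiv

/-- The signed sum over the words of a resolved wheel vanishes for every permutation other than the
cycle `i ↦ i + 1`: otherwise some arrow `k` either may be moved between `J` and its complement without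
changing the terms, or makes all the terms vanish. -/
theorem sum_wheelEntry_eq_zero {m : ℕ} {π : Perm (Fin (m + 1))} (hm : π (Fin.last m) ≠ Fin.last m)
    (hπ : π ≠ finRotate (m + 1)) :
    ∑ J ∈ (Finset.range m).powerset, ((-1 : ℚ) ^ J.card) *
      ∏ i : Fin m, wheelEntry J i (π i.castSucc) = 0 := by
  -- case (a): the terms do not depend on whether `k ∈ J`
  by_cases hA : ∃ k : Fin m, π k.castSucc ≤ k.castSucc ∧
      (π.symm k.castSucc ≤ k.castSucc ∨ π.symm k.castSucc = Fin.last m)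
  · obtain ⟨k, hk1, hk2⟩ := hA
    have hk : (k : ℕ) ∈ Finset.range m := by simp
    rw [← Finset.insert_erase hk, Finset.sum_powerset_insert (Finset.notMem_erase _ _),
      ← Finset.sum_add_distrib]
    refine Finset.sum_eq_zero fun J hJ => ?_
    have hkJ : (k : ℕ) ∉ J := fun h => Finset.notMem_erase _ _ (Finset.mem_powerset.1 hJ h)
    have : ∀ i : Fin m, wheelEntry (insert (k : ℕ) J) i (π i.castSucc)
        = wheelEntry J i (π i.castSucc) := fun i => by
      unfold wheelEntry
      have h1 : (i : ℕ) < (π i.castSucc : ℕ) → (i : ℕ) ≠ k := fun h he => by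
        have : i = k := Fin.ext he
        subst this
        have := Fin.le_def.1 hk1
        simp at this
        omega
      have h2 : (π i.castSucc : ℕ) < i → (π i.castSucc : ℕ) ≠ k := fun h he => by
        have he' : π i.castSucc = k.castSucc := Fin.ext (by simpa using he)
        have he2 : π.symm k.castSucc = i.castSucc := by rw [← he', Equiv.symm_apply_apply]
        rw [he2] at hk2
        rcases hk2 with h3 | h3
        · have := Fin.le_def.1 h3
          simp at this
          omega
        · have := congrArg Fin.val h3
          simp at this
          omega
      have : ¬ (i : ℕ) = (π i.castSucc : ℕ) → ¬ (i : ℕ) < (π i.castSucc : ℕ) →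
        (π i.castSucc : ℕ) < i := by omega
      split_ifs <;> grind
    rw [Finset.card_insert_of_notMem hkJ, Finset.prod_congr rfl fun i _ => this i]
    ring
  -- case (b): all the terms vanish
  by_cases hB : ∃ k : Fin m, k.castSucc < π k.castSucc ∧
      k.castSucc < π.symm k.castSucc ∧ π.symm k.castSucc ≠ Fin.last m
  · obtain ⟨k, hk1, hk2, hk3⟩ := hB
    refine Finset.sum_eq_zero fun J hJ => ?_
    by_cases hkJ : (k : ℕ) ∈ J
    · obtain ⟨i, hi⟩ := Fin.exists_castSucc_eq.2 hk3
      rw [Finset.prod_eq_zero (Finset.mem_univ i), mul_zero]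
      have h1 : π i.castSucc = k.castSucc := by rw [hi, Equiv.apply_symm_apply]
      rw [← hi] at hk2
      have h2 : (k : ℕ) < i := by simpa using hk2
      rw [h1]
      simp only [wheelEntry, Fin.val_castSucc, hkJ]
      split_ifs <;> first | rfl | omega
    · rw [Finset.prod_eq_zero (Finset.mem_univ k), mul_zero]
      have h2 : (k : ℕ) < π k.castSucc := Fin.lt_def.1 hk1
      rw [wheelEntry, if_neg h2.ne, if_pos h2, if_neg hkJ]
  -- otherwise the permutation is `i ↦ i + 1`
  exfalso
  refine hπ ?_
  push Not at hA hB
  have hA' : ∀ k : Fin m, π k.castSucc ≤ k.castSucc →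
    k.castSucc < π.symm k.castSucc ∧ π.symm k.castSucc ≠ Fin.last m := hA
  -- the successive values are forced, by induction on `n`
  have key : ∀ n, n ≤ m → (0 < m → π (Fin.last m) = 0) ∧
      ∀ i : Fin m, (i : ℕ) < n → π i.castSucc = i.succ := by
    intro n hn
    induction n with
    | zero =>
      refine ⟨fun h0 => ?_, fun i hi => absurd hi (by omega)⟩
      set k : Fin m := ⟨0, h0⟩
      have hk : k.castSucc = 0 := rfl
      by_cases h : π k.castSucc ≤ k.castSucc
      · have h1 : π k.castSucc = k.castSucc := by
          rw [hk] at h ⊢; exact Fin.le_zero_iff.1 h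
        have h2 := (hA' k h).1
        rw [π.symm_apply_eq.2 h1.symm] at h2
        exact absurd h2 (lt_irrefl _)
      · have h2 := hB k (not_le.1 h)
        by_cases h3 : k.castSucc < π.symm k.castSucc
        · rw [← h2 h3, Equiv.apply_symm_apply, hk]
        · have h4 : π.symm k.castSucc = k.castSucc := by
            rw [hk] at h3 ⊢; exact Fin.le_zero_iff.1 (not_lt.1 h3)
          have h5 := π.symm_apply_eq.1 h4
          rw [← h5] at h
          exact absurd le_rfl h
    | succ n ih =>
      obtain ⟨h0, ih⟩ := ih (by omega)
      have h0 := h0 (by omega)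
      refine ⟨fun _ => h0, fun i hi => ?_⟩
      rcases Nat.lt_succ_iff_lt_or_eq.1 hi with hi | hi
      · exact ih i hi
      -- values not exceeding `n` are taken elsewhere
      have hgt : ∀ j : Fin (m + 1), j ≠ Fin.last m → n ≤ (j : ℕ) → n < (π j : ℕ) := by
        intro j hj hjn
        by_contra hc
        rcases Nat.eq_zero_or_pos (π j : ℕ) with h | h
        · exact hj (π.injective (by rw [h0]; exact Fin.ext (by simpa using h)))
        · have h1 := ih ⟨(π j : ℕ) - 1, by omega⟩ (by simp; omega)
          have h2 : (⟨(π j : ℕ) - 1, by omega⟩ : Fin m).succ = π j := Fin.ext (by simp; omega)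
          have h3 := congrArg Fin.val (π.injective (h1.trans h2))
          simp at h3
          omega
      have hi1 := hgt i.castSucc (Fin.castSucc_ne_last i) (by simp; omega)
      by_contra hne
      have hi2 : n + 1 < (π i.castSucc : ℕ) := by
        rcases Nat.lt_or_ge (n + 1) (π i.castSucc : ℕ) with h | h
        · exact h
        · exact absurd (Fin.ext (by simp; omega)) hne
      set k : Fin m := ⟨n + 1, by have := (π i.castSucc).is_lt; omega⟩ with hkdef
      have hkv : (k.castSucc : ℕ) = n + 1 := rfl
      -- the preimage of `n + 1` is not before it
      have hj1 : π.symm k.castSucc ≠ Fin.last m := fun h => by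
        have h2 := π.symm_apply_eq.1 h
        rw [h0] at h2
        have := congrArg Fin.val h2
        simp [hkdef] at this
      have hj2 : k.castSucc ≤ π.symm k.castSucc := by
        by_contra hc
        have hc := Fin.lt_def.1 (not_le.1 hc)
        rw [hkv] at hc
        have hπ' : π (π.symm k.castSucc) = k.castSucc := Equiv.apply_symm_apply ..
        rcases Nat.lt_succ_iff_lt_or_eq.1 hc with h | h
        · have h1 := ih ⟨(π.symm k.castSucc : ℕ), by omega⟩ h
          have h2 : (⟨(π.symm k.castSucc : ℕ), by omega⟩ : Fin m).castSucc = π.symm k.castSucc := rfl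
          rw [h2, hπ'] at h1
          have h3 := congrArg Fin.val h1
          rw [hkv, Fin.val_succ] at h3
          have h4 : n + 1 = (π.symm k.castSucc : ℕ) + 1 := h3
          omega
        · have h2 : π.symm k.castSucc = i.castSucc := Fin.ext (by simp; omega)
          rw [h2] at hπ'
          rw [hπ', hkv] at hi2
          omega
      by_cases hk : π k.castSucc ≤ k.castSucc
      · have h3 := hgt k.castSucc (Fin.castSucc_ne_last k) (by omega)
        have h4 : π k.castSucc = k.castSucc := by
          refine Fin.ext ?_
          have := Fin.le_def.1 hk
          omega
        have h5 := (hA' k hk).1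
        rw [π.symm_apply_eq.2 h4.symm] at h5
        exact absurd h5 (lt_irrefl _)
      · rcases hj2.lt_or_eq with h | h
        · exact hj1 (hB k (not_le.1 hk) h)
        · have h5 := π.symm_apply_eq.1 h.symm
          rw [← h5] at hk
          exact absurd le_rfl hk
  obtain ⟨h0, h1⟩ := key m le_rfl
  ext i
  refine Fin.lastCases ?_ (fun i => ?_) i
  · rw [finRotate_last]
    rcases Nat.eq_zero_or_pos m with h | h
    · subst h
      have := (π (Fin.last 0)).is_lt
      simp
    · rw [h0 h]
  · rw [h1 i i.2, coe_finRotate_of_ne_last (Fin.castSucc_ne_last i)]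
    simp

/-- For the cycle `i ↦ i + 1` only the term with `J = {0, …, m - 1}` is nonzero. -/
theorem sum_wheelEntry_finRotate (m : ℕ) :
    ∑ J ∈ (Finset.range m).powerset, ((-1 : ℚ) ^ J.card) *
      ∏ i : Fin m, wheelEntry J i (finRotate (m + 1) i.castSucc) = 1 := by
  have h : ∀ (J : Finset ℕ) (i : Fin m), wheelEntry J i (finRotate (m + 1) i.castSucc)
      = if (i : ℕ) ∈ J then -1 else 0 := fun J i => by
    rw [coe_finRotate_of_ne_last (Fin.castSucc_ne_last i)]
    simp [wheelEntry]
  simp only [h]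
  rw [Finset.sum_eq_single (Finset.range m)]
  · simp [← mul_pow]
  · intro J hJ hne
    obtain ⟨k, hk, hkJ⟩ : ∃ k ∈ Finset.range m, k ∉ J := by
      by_contra hc
      push Not at hc
      exact hne (Finset.Subset.antisymm (Finset.mem_powerset.1 hJ) hc)
    rw [Finset.prod_eq_zero (Finset.mem_univ ⟨k, Finset.mem_range.1 hk⟩) (by simp [hkJ]), mul_zero]
  · simp

variable {R : Type*} [CommRing R] [Algebra ℚ R] (y : ℕ → R)

theorem weightSystem_D_A : weightSystem y D_A = y 1 := by
  have hw : WF [tail 0, head 0] := by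
    simpa using wf_tails_heads 1
  change weightSystem y (cl _) = _
  rw [weightSystem_cl y hw, weight_eq y (e := fun _ : Unit => 0) (fun _ _ _ => rfl)
    (fun a => by simp [labels, eq_comm])]
  have : permsOn (Finset.univ : Finset Unit) = {1} := by
    ext π
    simp [permsOn, Subsingleton.elim π 1]
  rw [cycleSum, this]
  simp [cycleWeight, crossingMatrix]

theorem close_legWord (w : List Leg) : close (legWord w) = diagram w := by
  simp [close, legWord, MonoidAlgebra.of_apply]

theorem wheelSum_eq_sum (m : ℕ) : wheelSum m = ∑ J ∈ (Finset.range m).powerset,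
    ((-1 : ℚ) ^ J.card) • (diagram (wheelWordR m J) - diagram (wheelWordL m J)) := by
  rw [wheelSum, nestedBracket_eq_sum List.nodup_range, Ring.lie_def, Finset.sum_mul, Finset.mul_sum,
    ← Finset.sum_sub_distrib, Finset.mul_sum, map_sum]
  have : (List.range m).toFinset = Finset.range m := by ext; simp
  rw [this]
  refine Finset.sum_congr rfl fun J _ => ?_
  rw [smul_mul_assoc, mul_smul_comm, ← smul_sub, mul_smul_comm, map_smul, mul_sub, map_sub,
    legWord_mul, legWord_mul, legWord_mul, legWord_mul, close_legWord, close_legWord]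
  rfl

/-- The weight of the `k`-wheel is the weight of a cycle of length `k`: of the permutations of its spokes only
the cycle `i ↦ i + 1` survives the summation over the words of the resolved wheel. -/
theorem weightSystem_wheel {k : ℕ} (hk : 2 ≤ k) : weightSystem y (wheel k) = y k := by
  obtain ⟨m, rfl⟩ : ∃ m, k = m + 1 := ⟨k - 1, by omega⟩
  have hw : ∀ w, WF w → labels w = Finset.range (m + 1) → weight y w
      = ∑ π : Perm (Fin (m + 1)), (∏ i : Fin (m + 1), crossingMatrix w i (π i)) •
        cycleWeight y Finset.univ π :=
    fun w _ hl => by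
      rw [weight_eq y (e := fun i : Fin (m + 1) => (i : ℕ)) Fin.val_injective (fun a => by
        rw [hl, Finset.mem_range]
        exact ⟨fun h => ⟨⟨a, h⟩, rfl⟩, by rintro ⟨i, rfl⟩; exact i.2⟩)]
      exact Finset.sum_congr (by ext; simp [permsOn]) fun _ _ => rfl
  have hle : ∀ (π : Perm (Fin (m + 1))) i, (π i : ℕ) ≤ m := fun π i => by
    have := (π i).is_lt; omega
  -- the difference for the two places of the last tail; the permutations that fix the last arrow cancel
  have hterm : ∀ J, weight y (wheelWordR m J) - weight y (wheelWordL m J)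
      = ∑ π : Perm (Fin (m + 1)), ((∏ i : Fin m, wheelEntry J i (π i.castSucc)) *
        if π (Fin.last m) = Fin.last m then 0 else 1) • cycleWeight y Finset.univ π := fun J => by
    rw [hw _ (wf_wheelWordR m J) (labels_wheelWordR m J), hw _ (wf_wheelWordL m J)
      ((labels_perm (wheelWordL_perm m J)).trans (labels_wheelWordR m J)), ← Finset.sum_sub_distrib]
    refine Finset.sum_congr rfl fun π _ => ?_
    rw [← sub_smul]
    congr 1
    rw [Fin.prod_univ_castSucc, Fin.prod_univ_castSucc]
    have h1 : ∏ i : Fin m, crossingMatrix (wheelWordR m J) i.castSucc (π i.castSucc)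
        = ∏ i : Fin m, wheelEntry J i (π i.castSucc) := Finset.prod_congr rfl fun i _ =>
      crossingMatrix_wheelWordR J i.2 (hle _ _)
    have h2 : ∏ i : Fin m, crossingMatrix (wheelWordL m J) i.castSucc (π i.castSucc)
        = ∏ i : Fin m, wheelEntry J i (π i.castSucc) := Finset.prod_congr rfl fun i _ =>
      crossingMatrix_wheelWordL J i.2 (hle _ _)
    rw [h1, h2, ← mul_sub, Fin.val_last, crossingMatrix_wheelWord_last J (hle _ _)]
    have : (m = (π (Fin.last m) : ℕ)) ↔ π (Fin.last m) = Fin.last m := by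
      rw [Fin.ext_iff, Fin.val_last, eq_comm]
    simp only [this]
  change weightSystem y (toAsw (wheelSum m)) = _
  rw [wheelSum_eq_sum, map_sum, map_sum]
  have hd : ∀ J, weightSystem y (toAsw (((-1 : ℚ) ^ J.card) •
      (diagram (wheelWordR m J) - diagram (wheelWordL m J))))
      = ∑ π : Perm (Fin (m + 1)), (((-1 : ℚ) ^ J.card) *
        ((∏ i : Fin m, wheelEntry J i (π i.castSucc)) *
        if π (Fin.last m) = Fin.last m then 0 else 1)) • cycleWeight y Finset.univ π := fun J => by
    rw [map_smul, map_smul, map_sub, map_sub]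
    change _ • (weightSystem y (cl _) - weightSystem y (cl _)) = _
    rw [weightSystem_cl y (wf_wheelWordR m J), weightSystem_cl y (wf_wheelWordL m J), hterm,
      Finset.smul_sum]
    exact Finset.sum_congr rfl fun _ _ => by rw [smul_smul]
  rw [Finset.sum_congr rfl fun J _ => hd J, Finset.sum_comm]
  simp only [← Finset.sum_smul, ← mul_assoc, ← Finset.sum_mul]
  have hrot : finRotate (m + 1) (Fin.last m) ≠ Fin.last m := by
    rw [finRotate_last]
    intro h
    have := congrArg Fin.val h
    simp at this
    omega
  rw [Finset.sum_eq_single (finRotate (m + 1))]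
  · rw [sum_wheelEntry_finRotate, if_neg hrot, one_mul, one_smul, cycleWeight,
      cycleType_finRotate_of_le hk, support_finRotate_of_le hk]
    simp
  · intro π _ hπ
    by_cases hm : π (Fin.last m) = Fin.last m
    · simp [hm]
    · rw [sum_wheelEntry_eq_zero hm hπ, zero_mul, zero_smul]
  · simp

end WheelWeight

/-! ### Commutators with tails in `𝒜ˢʷ(↑)` -/

/-- The class in `𝒜ˢʷ(↑)` of a combination of words. -/
noncomputable def clMap : LegAlgebra →ₗ[ℚ] Asw := toAsw.toLinearMap ∘ₗ close

theorem clMap_legWord (w : List Leg) : clMap (legWord w) = cl w := by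
  simp [clMap, close_legWord, cl]

/-- A tail as an element of the word algebra. -/
noncomputable abbrev tl (a : ℕ) : LegAlgebra := legWord [tail a]
/-- A head as an element of the word algebra. -/
noncomputable abbrev hd (a : ℕ) : LegAlgebra := legWord [head a]

theorem legAlgebra_induction {p : LegAlgebra → Prop} (word : ∀ w, p (legWord w))
    (add : ∀ x y, p x → p y → p (x + y)) (smul : ∀ (r : ℚ) x, p x → p (r • x)) (x : LegAlgebra) :
    p x :=
  MonoidAlgebra.induction_on x (fun w => word w.toList) add smul

theorem bracket_skew (x y : LegAlgebra) : -⁅y, x⁆ = ⁅x, y⁆ := by simp [Ring.lie_def]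

/-- The Jacobi identity. -/
theorem bracket_bracket (x y z : LegAlgebra) : ⁅⁅x, y⁆, z⁆ = ⁅x, ⁅y, z⁆⁆ - ⁅y, ⁅x, z⁆⁆ := by
  simp only [Ring.lie_def]
  noncomm_ring

/-- A bilinear functional on pairs of word combinations that, like a diagram with two holes, satisfies
the 4T relation for every head that is pushed across the two ends of an arrow of which one end is put
into each hole. -/
structure IsContext (G : LegAlgebra →ₗ[ℚ] LegAlgebra →ₗ[ℚ] Asw) : Prop where
  tail_head : ∀ A B C D a c, G (A * ⁅hd a, tl c⁆ * B) (C * hd c * D)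
    + G (A * tl c * B) (C * ⁅hd a, hd c⁆ * D) = 0
  head_tail : ∀ A B C D a c, G (C * hd c * D) (A * ⁅hd a, tl c⁆ * B)
    + G (C * ⁅hd a, hd c⁆ * D) (A * tl c * B) = 0

namespace IsContext

variable {G H : LegAlgebra →ₗ[ℚ] LegAlgebra →ₗ[ℚ] Asw}

theorem flip (hG : IsContext G) : IsContext G.flip := ⟨hG.2, hG.1⟩

theorem sub (hG : IsContext G) (hH : IsContext H) : IsContext (G - H) := by
  constructor <;> intro A B C D a c
  · have h1 := hG.1 A B C D a c
    have h2 := hH.1 A B C D a c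
    simp only [LinearMap.sub_apply]
    rw [← sub_self (0 : Asw)]
    nth_rewrite 1 [← h1]
    rw [← h2]
    abel
  · have h1 := hG.2 A B C D a c
    have h2 := hH.2 A B C D a c
    simp only [LinearMap.sub_apply]
    rw [← sub_self (0 : Asw)]
    nth_rewrite 1 [← h1]
    rw [← h2]
    abel

theorem mul_left (hG : IsContext G) (X Y : LegAlgebra) :
    IsContext (G.comp (LinearMap.mulLeft ℚ X ∘ₗ LinearMap.mulRight ℚ Y)) := by
  constructor <;> intro A B C D a c
  · have := hG.1 (X * A) (B * Y) C D a c
    simpa [mul_assoc] using this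
  · have := hG.2 A B (X * C) (D * Y) a c
    simpa [mul_assoc] using this

end IsContext

/-- The directed 4T relation, written with commutators. -/
theorem fourT_word (P Q R : List Leg) (a c : ℕ) (x y : Leg)
    (hxy : (x = tail c ∧ y = head c) ∨ (x = head c ∧ y = tail c)) :
    clMap (legWord P * ⁅hd a, legWord [x]⁆ * legWord Q * legWord [y] * legWord R)
      + clMap (legWord P * legWord [x] * legWord Q * ⁅hd a, legWord [y]⁆ * legWord R) = 0 := by
  have h := toAsw_eq (SwRel.fourT P Q R a c x y hxy)
  simp only [map_add] at h
  simp only [Ring.lie_def, mul_sub, sub_mul, map_sub, legWord_mul, clMap_legWord]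
  simp only [List.append_assoc, List.cons_append, List.nil_append] at h ⊢
  change cl _ + cl _ = cl _ + cl _ at h
  rw [← sub_eq_zero] at h
  rw [← h]
  abel

theorem fourT_mul (P Q R : LegAlgebra) (a c : ℕ) (x y : Leg)
    (hxy : (x = tail c ∧ y = head c) ∨ (x = head c ∧ y = tail c)) :
    clMap (P * ⁅hd a, legWord [x]⁆ * Q * legWord [y] * R)
      + clMap (P * legWord [x] * Q * ⁅hd a, legWord [y]⁆ * R) = 0 := by
  induction P using legAlgebra_induction with
  | add u v hu hv =>
    simp only [add_mul, map_add]
    rw [← add_zero (0 : Asw)]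
    nth_rewrite 1 [← hu]
    rw [← hv]
    abel
  | smul r u hu => simp only [smul_mul_assoc, map_smul, ← smul_add, hu, smul_zero]
  | word P =>
  induction R using legAlgebra_induction with
  | add u v hu hv =>
    simp only [mul_add, map_add]
    rw [← add_zero (0 : Asw)]
    nth_rewrite 1 [← hu]
    rw [← hv]
    abel
  | smul r u hu => simp only [mul_smul_comm, map_smul, ← smul_add, hu, smul_zero]
  | word R =>
  induction Q using legAlgebra_induction with
  | add u v hu hv =>
    simp only [mul_add, add_mul, map_add]
    rw [← add_zero (0 : Asw)]
    nth_rewrite 1 [← hu]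
    rw [← hv]
    abel
  | smul r u hu =>
    simp only [mul_smul_comm, smul_mul_assoc, map_smul, ← smul_add, hu, smul_zero]
  | word Q => exact fourT_word P Q R a c x y hxy

/-- The diagrams with two holes. -/
noncomputable def wordContext (P Q R : LegAlgebra) : LegAlgebra →ₗ[ℚ] LegAlgebra →ₗ[ℚ] Asw :=
  LinearMap.mk₂ ℚ (fun y z => clMap (P * y * Q * z * R))
    (fun _ _ _ => by simp only [mul_add, add_mul, map_add])
    (fun _ _ _ => by simp only [mul_smul_comm, smul_mul_assoc, map_smul])
    (fun _ _ _ => by simp only [mul_add, add_mul, map_add])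
    (fun _ _ _ => by simp only [mul_smul_comm, smul_mul_assoc, map_smul])

@[simp] theorem wordContext_apply (P Q R y z : LegAlgebra) :
    wordContext P Q R y z = clMap (P * y * Q * z * R) := rfl

theorem isContext_wordContext (P Q R : LegAlgebra) : IsContext (wordContext P Q R) := by
  constructor <;> intro A B C D a c
  · have := fourT_mul (P * A) (B * Q * C) (D * R) a c _ _ (Or.inl ⟨rfl, rfl⟩)
    simpa only [wordContext_apply, mul_assoc] using this
  · have := fourT_mul (P * C) (D * Q * A) (B * R) a c _ _ (Or.inr ⟨rfl, rfl⟩)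
    rw [add_comm]
    simpa only [wordContext_apply, mul_assoc] using this

/-- The operations on word combinations that may be performed inside of a hole: they turn contexts into
contexts. -/
structure IsInner (f : LegAlgebra →ₗ[ℚ] LegAlgebra) : Prop where
  comp : ∀ G, IsContext G → IsContext (G.comp f)

namespace IsInner

variable {f g : LegAlgebra →ₗ[ℚ] LegAlgebra}

theorem compl₂ (hf : IsInner f) {G : LegAlgebra →ₗ[ℚ] LegAlgebra →ₗ[ℚ] Asw} (hG : IsContext G) :
    IsContext (G.compl₂ f) := (hf.comp _ hG.flip).flip

theorem id : IsInner LinearMap.id := ⟨fun _ hG => hG⟩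

theorem mul (hf : IsInner f) (hg : IsInner g) : IsInner (f ∘ₗ g) :=
  ⟨fun G hG => hg.comp _ (hf.comp G hG)⟩

theorem sub (hf : IsInner f) (hg : IsInner g) : IsInner (f - g) :=
  ⟨fun G hG => by rw [LinearMap.comp_sub]; exact (hf.comp G hG).sub (hg.comp G hG)⟩

theorem neg (hf : IsInner f) : IsInner (-f) := by
  have h0 : IsInner (f - f) := hf.sub hf
  have := h0.sub hf
  simpa using this

theorem mulLeft (x : LegAlgebra) : IsInner (LinearMap.mulLeft ℚ x) :=
  ⟨fun G hG => by simpa using hG.mul_left x 1⟩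

theorem mulRight (x : LegAlgebra) : IsInner (LinearMap.mulRight ℚ x) :=
  ⟨fun G hG => by simpa using hG.mul_left 1 x⟩

end IsInner

/-- The commutator with `x`, as a linear map. -/
noncomputable def adL (x : LegAlgebra) : LegAlgebra →ₗ[ℚ] LegAlgebra :=
  LinearMap.mulLeft ℚ x - LinearMap.mulRight ℚ x

@[simp] theorem adL_apply (x y : LegAlgebra) : adL x y = ⁅x, y⁆ := by
  simp [adL, Ring.lie_def]

theorem isInner_adL (x : LegAlgebra) : IsInner (adL x) := (IsInner.mulLeft x).sub (.mulRight x)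

/-- The elements, like the heads, that may be pushed across the two ends of an arrow. -/
def IsPushable (L : LegAlgebra) : Prop :=
  ∀ G, IsContext G → ∀ c, G ⁅L, tl c⁆ (hd c) = - G (tl c) ⁅L, hd c⁆

theorem isPushable_hd (a : ℕ) : IsPushable (hd a) := fun G hG c => by
  have := hG.1 1 1 1 1 a c
  simp only [one_mul, mul_one] at this
  exact eq_neg_of_add_eq_zero_left this

/-- Commutators of pushable elements are pushable, by the Jacobi identity. -/
theorem IsPushable.lie {L M : LegAlgebra} (hL : IsPushable L) (hM : IsPushable M) :
    IsPushable ⁅L, M⁆ := fun G hG c => by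
  have h1 := hM _ ((isInner_adL L).comp G hG) c
  have h2 := hL _ ((isInner_adL M).compl₂ hG) c
  have h3 := hL _ ((isInner_adL M).comp G hG) c
  have h4 := hM _ ((isInner_adL L).compl₂ hG) c
  simp only [LinearMap.comp_apply, LinearMap.compl₂_apply, adL_apply] at h1 h2 h3 h4
  rw [bracket_bracket L M (tl c), bracket_bracket L M (hd c), map_sub, map_sub,
    LinearMap.sub_apply, h1, h3, h2, h4]
  abel

/-- `x` is an iterated commutator of the heads with labels in `s`, in which each of them occurs once. -/
inductive LieIn : Finset ℕ → LegAlgebra → Prop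
  | head (a : ℕ) : LieIn {a} (hd a)
  | lie {s r : Finset ℕ} {x y : LegAlgebra} (hx : LieIn s x) (hy : LieIn r y) (h : Disjoint s r) :
      LieIn (s ∪ r) ⁅x, y⁆

theorem LieIn.isPushable {s : Finset ℕ} {x : LegAlgebra} (hx : LieIn s x) : IsPushable x := by
  induction hx with
  | head a => exact isPushable_hd a
  | lie _ _ _ h1 h2 => exact h1.lie h2

/-- Pushing `L` across the tail of `c` is, up to a sign, the same as replacing the head of `c` by its
commutator with `L`. -/
theorem LieIn.push {s : Finset ℕ} {x L : LegAlgebra} {c : ℕ} (hx : LieIn s x) (hc : c ∈ s)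
    (hL : IsPushable L) : ∃ x', (∀ r, LieIn r L → Disjoint r s → LieIn (s ∪ r) x') ∧
      ∀ G, IsContext G → G ⁅L, tl c⁆ x = - G (tl c) x' := by
  induction hx with
  | head a =>
    obtain rfl := Finset.mem_singleton.1 hc
    refine ⟨⁅L, hd c⁆, fun r hr hd => ?_, fun G hG => hL G hG c⟩
    rw [Finset.union_comm]
    exact .lie hr (.head c) hd
  | @lie s r x y hx hy hd ihx ihy =>
    rcases Finset.mem_union.1 hc with h | h
    · obtain ⟨x', h1, h2⟩ := ihx h
      refine ⟨⁅x', y⁆, fun q hq hqd => ?_, fun G hG => ?_⟩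
      · rw [Finset.disjoint_union_right] at hqd
        have := LieIn.lie (h1 q hq hqd.1) hy (Finset.disjoint_union_left.2 ⟨hd, hqd.2⟩)
        rwa [Finset.union_right_comm] at this
      · have := h2 _ ((isInner_adL y).neg.compl₂ hG)
        simpa [← bracket_skew y x, ← bracket_skew y x'] using this
    · obtain ⟨y', h1, h2⟩ := ihy h
      refine ⟨⁅x, y'⁆, fun q hq hqd => ?_, fun G hG => ?_⟩
      · rw [Finset.disjoint_union_right] at hqd
        have := LieIn.lie hx (h1 q hq hqd.2) (Finset.disjoint_union_right.2 ⟨hd, hqd.1.symm⟩)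
        rwa [← Finset.union_assoc] at this
      · have := h2 _ ((isInner_adL x).compl₂ hG)
        simpa using this

/-- The commutators around the head of `c` can be moved to the tail of `c`. -/
theorem LieIn.flip {s : Finset ℕ} {x : LegAlgebra} {c : ℕ} (hx : LieIn s x) (hc : c ∈ s) :
    ∃ D, IsInner D ∧ ∀ G, IsContext G → G (tl c) x = G (D (tl c)) (hd c) := by
  have key : ∀ {x y : LegAlgebra}, IsPushable x →
      (∃ D, IsInner D ∧ ∀ G, IsContext G → G (tl c) y = G (D (tl c)) (hd c)) →
      ∃ D, IsInner D ∧ ∀ G, IsContext G → G (tl c) ⁅x, y⁆ = G (D (tl c)) (hd c) := by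
    rintro x y hx ⟨D, hD, h⟩
    refine ⟨-(D ∘ₗ adL x), (hD.mul (isInner_adL x)).neg, fun G hG => ?_⟩
    have h1 := h _ ((isInner_adL x).compl₂ hG)
    have h2 := hx _ (hD.comp G hG) c
    simp only [LinearMap.compl₂_apply, LinearMap.comp_apply, adL_apply] at h1 h2
    simp [h1, h2]
  induction hx with
  | head a =>
    obtain rfl := Finset.mem_singleton.1 hc
    exact ⟨LinearMap.id, IsInner.id, fun _ _ => rfl⟩
  | @lie s r x y hx hy hd ihx ihy =>
    rcases Finset.mem_union.1 hc with h | h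
    · obtain ⟨D, hD, h1⟩ := key hy.isPushable (ihx h)
      refine ⟨-D, hD.neg, fun G hG => ?_⟩
      rw [← bracket_skew, map_neg, h1 G hG]
      simp
    · exact key hx.isPushable (ihy h)

/-- `[[x, t_a], t_b]` vanishes in a context that contains the tail of a further arrow `c` of `x`: the
commutators between the heads of `a` and of `c` can be moved to the tail of `c`, together with the head
of `a`, and then those that are left in front of `t_a` can be moved to the head of `a`. What remains
contains `[t_a, t_b]`. The operation `F` stands for the commutators that surround `x` in a larger Lie
word. -/
theorem LieIn.lie_tail_tail {s : Finset ℕ} {x : LegAlgebra} {a b c : ℕ} (hx : LieIn s x)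
    (ha : a ∈ s) (hc : c ∈ s) (hac : a ≠ c) (F : LegAlgebra →ₗ[ℚ] LegAlgebra) (hF : IsInner F)
    (hF' : ∀ z, IsPushable z → IsPushable (F z)) (G : LegAlgebra →ₗ[ℚ] LegAlgebra →ₗ[ℚ] Asw)
    (hG : IsContext G) (hab : ∀ y, G y ⁅tl a, tl b⁆ = 0) :
    G (tl c) ⁅⁅F x, tl a⁆, tl b⁆ = 0 := by
  have adneg : ∀ u v : LegAlgebra, (-adL u) v = ⁅v, u⁆ := fun u v => by
    rw [LinearMap.neg_apply, adL_apply, bracket_skew]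
  -- the case in which the outermost commutator separates the heads of `c` (in `x`) and of `a` (in `y`)
  have main : ∀ {s r : Finset ℕ} {x y : LegAlgebra}, LieIn s x → LieIn r y → c ∈ s → a ∈ r →
      ∀ F, IsInner F → (∀ z, IsPushable z → IsPushable (F z)) →
        G (tl c) ⁅⁅F ⁅y, x⁆, tl a⁆, tl b⁆ = 0 := by
    intro s r x y hx hy hc ha F hF hF'
    obtain ⟨D, hD, h1⟩ := hx.flip hc
    have hin : IsInner ((-adL (tl b)) ∘ₗ (-adL (tl a)) ∘ₗ F) :=
      ((isInner_adL _).neg).mul (((isInner_adL _).neg).mul hF)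
    have e1 := h1 _ ((hin.mul (isInner_adL y)).compl₂ hG)
    have e2 := hy.isPushable _ (hD.comp _ (hin.compl₂ hG)) c
    obtain ⟨y', -, h3⟩ := hy.push ha (hF' _ (isPushable_hd c))
    have e3 := h3 _ (((hD.mul (isInner_adL (tl c)).neg).comp _
      ((isInner_adL (tl b)).neg.compl₂ hG)).flip)
    simp only [LinearMap.compl₂_apply, LinearMap.comp_apply, LinearMap.flip_apply, adneg,
      adL_apply] at e1 e2 e3
    rw [e1, ← neg_inj, ← e2, e3, hab, neg_zero]
  induction hx generalizing F with
  | head d =>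
    exact absurd ((Finset.mem_singleton.1 ha).trans (Finset.mem_singleton.1 hc).symm) hac
  | @lie s r x y hx hy hd ihx ihy =>
    have hskew : ⁅⁅F ⁅x, y⁆, tl a⁆, tl b⁆ = -⁅⁅F ⁅y, x⁆, tl a⁆, tl b⁆ := by
      rw [← bracket_skew x y, map_neg]
      simp only [Ring.lie_def]
      noncomm_ring
    rcases Finset.mem_union.1 ha with ha | ha <;> rcases Finset.mem_union.1 hc with hc | hc
    · have := ihx ha hc (F ∘ₗ adL y) (hF.mul (isInner_adL y))
        (fun z hz => hF' _ (by rw [adL_apply]; exact hy.isPushable.lie hz))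
      rw [hskew, map_neg, neg_eq_zero]
      simpa using this
    · exact main hy hx hc ha F hF hF'
    · have := main hx hy hc ha F hF hF'
      rwa [hskew, map_neg, neg_eq_zero]
    · have := ihy ha hc (F ∘ₗ adL x) (hF.mul (isInner_adL x))
        (fun z hz => hF' _ (by rw [adL_apply]; exact hx.isPushable.lie hz))
      simpa using this

/-! ### Products and relabellings of diagrams -/

/-- The product of diagrams with disjoint sets of names needs no renaming. -/
theorem cl_append {u v : List Leg} (hu : WF u) (hv : WF v)
    (h : ∀ x ∈ u, ∀ y ∈ v, x.label ≠ y.label) : cl (u ++ v) = cl u * cl v := by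
  have hw : WF (u ++ v) := hu.append hv h
  set g : ℕ → ℕ := fun a => if a ∈ labels u then evenLabel a else oddLabel a
  have hg : Function.Injective g := fun a b hab => by
    simp only [g, evenLabel, oddLabel] at hab
    split_ifs at hab <;> omega
  have hlu : ∀ x ∈ u, x.label ∈ labels u := fun x hx =>
    List.mem_toFinset.2 (List.mem_map_of_mem hx)
  have h1 : u.map (Leg.map g) = u.map (Leg.map evenLabel) := List.map_congr_left fun x hx => by
    have := hlu x hx
    cases x <;> simp_all [g]
  have h2 : v.map (Leg.map g) = v.map (Leg.map oddLabel) := List.map_congr_left fun x hx => by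
    have : x.label ∉ labels u := fun hc => by
      obtain ⟨y, hy, hyx⟩ := List.mem_map.1 (List.mem_toFinset.1 hc)
      exact h y hy x hx hyx
    cases x <;> simp_all [g]
  rw [cl, cl, cl, ← map_mul, diagram, diagram, diagram, dif_pos hw, dif_pos hu, dif_pos hv]
  refine congrArg toAsw (Eq.trans ?_ (map_mul (MonoidAlgebra.of ℚ ArrowDiagram) _ _))
  refine congrArg (MonoidAlgebra.of ℚ ArrowDiagram) (Quot.sound ⟨g, hg, ?_⟩)
  simp only [ArrowWord.concat, List.map_append, h1, h2]

theorem legWord_nil : legWord [] = 1 := map_one (MonoidAlgebra.of ℚ (FreeMonoid Leg))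

theorem legWord_cons (u : Leg) (w : List Leg) : legWord (u :: w) = legWord [u] * legWord w := by
  rw [legWord_mul]; rfl

/-- Renames the arrows in a combination of words. -/
noncomputable def mapLegs (f : ℕ → ℕ) : LegAlgebra →ₐ[ℚ] LegAlgebra :=
  MonoidAlgebra.mapDomainAlgHom ℚ ℚ (FreeMonoid.map (Leg.map f))

theorem mapLegs_legWord (f : ℕ → ℕ) (w : List Leg) :
    mapLegs f (legWord w) = legWord (w.map (Leg.map f)) := by
  simp only [mapLegs, legWord, MonoidAlgebra.of_apply, MonoidAlgebra.mapDomainAlgHom_apply,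
    MonoidAlgebra.mapDomain_single]
  rfl

theorem clMap_mapLegs {f : ℕ → ℕ} (hf : Function.Injective f) (x : LegAlgebra) :
    clMap (mapLegs f x) = clMap x := by
  induction x using legAlgebra_induction with
  | word w => rw [mapLegs_legWord, clMap_legWord, clMap_legWord, cl_map hf]
  | add x y hx hy => simp only [map_add, hx, hy]
  | smul r x hx => simp only [map_smul, hx]

theorem mapLegs_nestedBracket (f : ℕ → ℕ) (l : List ℕ) (b : ℕ) :
    mapLegs f (nestedBracket l b) = nestedBracket (l.map f) (f b) := by
  induction l with
  | nil => simp [nestedBracket, mapLegs_legWord]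
  | cons a l ih =>
    simp only [nestedBracket, List.map_cons, Ring.lie_def, map_sub, map_mul, ih, mapLegs_legWord]
    simp

theorem exists_injective_map_range {l : List ℕ} (hl : l.Nodup) :
    ∃ f : ℕ → ℕ, Function.Injective f ∧ (List.range l.length).map f = l := by
  obtain ⟨N, hN⟩ : ∃ N, ∀ a ∈ l, a < N := ⟨l.sum + 1, fun a ha =>
    Nat.lt_succ_of_le (List.le_sum_of_mem ha)⟩
  refine ⟨fun i => if h : i < l.length then l[i] else N + i, fun i j hij => ?_, ?_⟩
  · simp only at hij
    split_ifs at hij with h1 h2 h2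
    · exact (List.Nodup.getElem_inj_iff hl).1 hij
    · have := hN _ (List.getElem_mem h1); omega
    · have := hN _ (List.getElem_mem h2); omega
    · omega
  · refine List.ext_getElem (by simp) fun i h1 h2 => ?_
    simp [h2]

/-- The heads with labels in a nonempty list, bracketed with the tail of the last one, form a wheel
together with the other tails. -/
theorem clMap_tails_mul_bracket {l : List ℕ} {a : ℕ} (hl : (l ++ [a]).Nodup) :
    clMap (legWord (l.map tail) * ⁅nestedBracket l a, tl a⁆) = wheel (l.length + 1) := by
  obtain ⟨f, hf, h⟩ := exists_injective_map_range hl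
  rw [List.length_append, List.length_singleton, List.range_succ, List.map_append,
    List.map_singleton] at h
  obtain ⟨h1, h2⟩ := List.append_inj' h rfl
  have h2 : f l.length = a := by simpa using h2
  change _ = clMap (legWord ((List.range l.length).map tail) *
    ⁅nestedBracket (List.range l.length) l.length, tl l.length⁆)
  rw [← clMap_mapLegs hf, ← clMap_mapLegs hf (legWord _ * _), clMap_mapLegs hf]
  congr 1
  rw [map_mul, Ring.lie_def, Ring.lie_def, map_sub, map_mul, map_mul, mapLegs_nestedBracket,
    mapLegs_legWord, mapLegs_legWord, h1, h2, List.map_map]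
  have : Leg.map f ∘ tail = tail ∘ f := rfl
  rw [this, ← List.map_map, h1]
  simp [h2]

/-- The relation TC, written with a commutator. -/
theorem clMap_tails_comm (A B : LegAlgebra) (a b : ℕ) : clMap (A * ⁅tl a, tl b⁆ * B) = 0 := by
  induction A using legAlgebra_induction with
  | add u v hu hv => rw [add_mul, add_mul, map_add, hu, hv, add_zero]
  | smul r u hu => rw [smul_mul_assoc, smul_mul_assoc, map_smul, hu, smul_zero]
  | word P =>
  induction B using legAlgebra_induction with
  | add u v hu hv => rw [mul_add, map_add, hu, hv, add_zero]
  | smul r u hu => rw [mul_smul_comm, map_smul, hu, smul_zero]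
  | word Q =>
    rw [Ring.lie_def, mul_sub, sub_mul, map_sub]
    simp only [legWord_mul, clMap_legWord, sub_eq_zero]
    exact toAsw_eq (by simpa using SwRel.tc P Q a b)

/-- The relation RI, written with a commutator. -/
theorem clMap_isolated (A B : LegAlgebra) (a : ℕ) : clMap (A * ⁅hd a, tl a⁆ * B) = 0 := by
  induction A using legAlgebra_induction with
  | add u v hu hv => rw [add_mul, add_mul, map_add, hu, hv, add_zero]
  | smul r u hu => rw [smul_mul_assoc, smul_mul_assoc, map_smul, hu, smul_zero]
  | word P =>
  induction B using legAlgebra_induction with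
  | add u v hu hv => rw [mul_add, map_add, hu, hv, add_zero]
  | smul r u hu => rw [mul_smul_comm, map_smul, hu, smul_zero]
  | word Q =>
    rw [Ring.lie_def, mul_sub, sub_mul, map_sub]
    simp only [legWord_mul, clMap_legWord, sub_eq_zero]
    exact (toAsw_eq (by simpa using SwRel.ri P Q a)).symm

theorem clMap_tails_perm {T T' : List ℕ} (h : T.Perm T') (P : List Leg) (x : LegAlgebra) :
    clMap (legWord P * legWord (T.map tail) * x) = clMap (legWord P * legWord (T'.map tail) * x) := by
  induction x using legAlgebra_induction with
  | word w =>
    simp only [legWord_mul, clMap_legWord]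
    exact cl_tc h P w
  | add x y hx hy => rw [mul_add, mul_add, map_add, map_add, hx, hy]
  | smul r x hx => rw [mul_smul_comm, mul_smul_comm, map_smul, map_smul, hx]

/-! ### Lie words as combinations of right combs -/

/-- The span of the nested commutators of the heads in `s` that end with the head of `a`. -/
noncomputable def combs (a : ℕ) (s : Finset ℕ) : Submodule ℚ LegAlgebra :=
  Submodule.span ℚ
    {x | ∃ l : List ℕ, l.Nodup ∧ a ∉ l ∧ insert a l.toFinset = s ∧ x = nestedBracket l a}

theorem LieIn.lie_mem_combs {r : Finset ℕ} {L : LegAlgebra} (hL : LieIn r L) {s : Finset ℕ} {a : ℕ}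
    (hrs : Disjoint r s) {y : LegAlgebra} (hy : y ∈ combs a s) : ⁅L, y⁆ ∈ combs a (r ∪ s) := by
  induction hL generalizing s y with
  | head b =>
    rw [← adL_apply]
    refine Submodule.span_induction (p := fun y _ => adL (hd b) y ∈ combs a ({b} ∪ s)) ?_ ?_ ?_ ?_ hy
    · rintro _ ⟨l, hl, ha, rfl, rfl⟩
      have hb : b ∉ insert a l.toFinset := Finset.disjoint_singleton_left.1 hrs
      simp only [Finset.mem_insert, List.mem_toFinset, not_or] at hb
      refine Submodule.subset_span ⟨b :: l, List.nodup_cons.2 ⟨hb.2, hl⟩, ?_, ?_, ?_⟩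
      · simp [ha, Ne.symm hb.1]
      · ext; simp
      · simp [nestedBracket]
    · rw [map_zero]; exact zero_mem _
    · intro x y _ _ hx hy
      rw [map_add]; exact add_mem hx hy
    · intro r x _ hx
      rw [map_smul]; exact Submodule.smul_mem _ _ hx
  | @lie r r' L M hL hM hd ih1 ih2 =>
    rw [Finset.disjoint_union_left] at hrs
    rw [bracket_bracket]
    refine sub_mem ?_ ?_
    · have := ih1 (Finset.disjoint_union_right.2 ⟨hd, hrs.1⟩) (ih2 hrs.2 hy)
      rwa [← Finset.union_assoc] at this
    · have := ih2 (Finset.disjoint_union_right.2 ⟨hd.symm, hrs.2⟩) (ih1 hrs.1 hy)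
      rwa [← Finset.union_assoc, Finset.union_comm r'] at this

/-- Any of its heads can be made the innermost one of a Lie word, by antisymmetry and the Jacobi
identity. -/
theorem LieIn.mem_combs {s : Finset ℕ} {x : LegAlgebra} {a : ℕ} (hx : LieIn s x) (ha : a ∈ s) :
    x ∈ combs a s := by
  induction hx with
  | head b =>
    obtain rfl := Finset.mem_singleton.1 ha
    exact Submodule.subset_span ⟨[], by simp [nestedBracket]⟩
  | @lie s r x y hx hy hd ihx ihy =>
    rcases Finset.mem_union.1 ha with h | h
    · rw [← bracket_skew, Finset.union_comm]
      exact neg_mem (hy.lie_mem_combs hd.symm (ihx h))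
    · exact hx.lie_mem_combs hd (ihy h)

theorem lieIn_nestedBracket {l : List ℕ} {a : ℕ} (hl : l.Nodup) (ha : a ∉ l) :
    LieIn (insert a l.toFinset) (nestedBracket l a) := by
  induction l with
  | nil => simpa [nestedBracket] using LieIn.head a
  | cons b l ih =>
    rw [List.nodup_cons] at hl
    rw [List.mem_cons, not_or] at ha
    have := LieIn.lie (LieIn.head b) (ih hl.2 ha.2) (by
      rw [Finset.disjoint_singleton_left]
      simp [hl.1, Ne.symm ha.1])
    rw [List.toFinset_cons, Finset.insert_comm]
    exact this

/-- The span of the words of the heads in `s`, in any order. -/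
noncomputable def headWords (s : Finset ℕ) : Submodule ℚ LegAlgebra :=
  Submodule.span ℚ {x | ∃ l : List ℕ, l.Nodup ∧ l.toFinset = s ∧ x = legWord (l.map head)}

theorem headWords_mul {s r : Finset ℕ} (h : Disjoint s r) {x y : LegAlgebra} (hx : x ∈ headWords s)
    (hy : y ∈ headWords r) : x * y ∈ headWords (s ∪ r) := by
  refine Submodule.span_induction₂ (p := fun x y _ _ => x * y ∈ headWords (s ∪ r))
    ?_ ?_ ?_ ?_ ?_ ?_ ?_ hx hy
  · rintro _ _ ⟨l, hl, rfl, rfl⟩ ⟨l', hl', rfl, rfl⟩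
    refine Submodule.subset_span ⟨l ++ l', ?_, by simp, by rw [legWord_mul, List.map_append]⟩
    rw [List.nodup_append]
    refine ⟨hl, hl', fun a ha b hb hab => ?_⟩
    subst hab
    exact Finset.disjoint_left.1 h (List.mem_toFinset.2 ha) (List.mem_toFinset.2 hb)
  · intro y _; simp
  · intro x _; simp
  · intro x y z _ _ _ h1 h2; rw [add_mul]; exact add_mem h1 h2
  · intro x y z _ _ _ h1 h2; rw [mul_add]; exact add_mem h1 h2
  · intro r x y _ _ h; rw [smul_mul_assoc]; exact Submodule.smul_mem _ _ h
  · intro r x y _ _ h; rw [mul_smul_comm]; exact Submodule.smul_mem _ _ h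

theorem LieIn.mem_headWords {s : Finset ℕ} {x : LegAlgebra} (hx : LieIn s x) : x ∈ headWords s := by
  induction hx with
  | head a => exact Submodule.subset_span ⟨[a], by simp⟩
  | @lie s r x y hx hy hd ihx ihy =>
    rw [Ring.lie_def]
    refine sub_mem (headWords_mul hd ihx ihy) ?_
    rw [Finset.union_comm]
    exact headWords_mul hd.symm ihy ihx

/-! ### Isolated parts of diagrams -/

/-- The sum of the words in which a leg of `w` with label in `S` is replaced by its commutator with the
head of `b`. -/
noncomputable def pushInto (b : ℕ) (S : Finset ℕ) : List Leg → LegAlgebra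
  | [] => 0
  | u :: w => (if u.label ∈ S then ⁅hd b, legWord [u]⁆ else 0) * legWord w
      + legWord [u] * pushInto b S w

theorem pushInto_append (b : ℕ) (S : Finset ℕ) (u v : List Leg) :
    pushInto b S (u ++ v) = pushInto b S u * legWord v + legWord u * pushInto b S v := by
  induction u with
  | nil => simp [pushInto, legWord_nil]
  | cons x u ih =>
    rw [List.cons_append, pushInto, pushInto, ih, legWord_cons x u, ← legWord_mul]
    noncomm_ring

theorem pushInto_eq_zero {b : ℕ} {S : Finset ℕ} {w : List Leg} (h : ∀ u ∈ w, u.label ∉ S) :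
    pushInto b S w = 0 := by
  induction w with
  | nil => rfl
  | cons u w ih =>
    rw [pushInto, ih fun v hv => h v (List.mem_cons_of_mem _ hv), if_neg (h u List.mem_cons_self)]
    simp

theorem pushInto_eq_sum (b : ℕ) (S : Finset ℕ) (w : List Leg) :
    pushInto b S w = ∑ a ∈ S, pushInto b {a} w := by
  induction w with
  | nil => simp [pushInto]
  | cons u w ih =>
    simp only [pushInto, Finset.sum_add_distrib, ← Finset.mul_sum, ← ih, ← Finset.sum_mul,
      Finset.mem_singleton]
    congr 2
    rw [Finset.sum_ite_eq]

theorem pushInto_eq_bracket {b : ℕ} {S : Finset ℕ} {w : List Leg} (h : ∀ u ∈ w, u.label ∈ S) :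
    pushInto b S w = ⁅hd b, legWord w⁆ := by
  induction w with
  | nil =>
    simp [pushInto, Ring.lie_def, legWord_nil]
  | cons u w ih =>
    rw [pushInto, ih fun v hv => h v (List.mem_cons_of_mem _ hv), if_pos (h u List.mem_cons_self),
      legWord_cons u w]
    simp only [Ring.lie_def]
    noncomm_ring

/-- Pushing the head of `b` across both ends of an arrow gives zero; this is the relation 4T. -/
theorem clMap_pushInto_singleton (A B : LegAlgebra) {P Q R : List Leg} {a b : ℕ} {x y : Leg}
    (hw : (P ++ x :: Q ++ y :: R).Nodup)
    (hxy : (x = tail a ∧ y = head a) ∨ (x = head a ∧ y = tail a)) :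
    clMap (A * pushInto b {a} (P ++ x :: Q ++ y :: R) * B) = 0 := by
  have hlab : ∀ u ∈ P ++ Q ++ R, u.label ∉ ({a} : Finset ℕ) := fun u hu hc => by
    rw [Finset.mem_singleton] at hc
    have hn : (x :: y :: (P ++ Q ++ R)).Nodup := by
      refine (List.Perm.nodup_iff ?_).1 hw
      rw [List.append_assoc, List.cons_append]
      refine List.perm_middle.trans (List.Perm.cons _ ?_)
      rw [← List.append_assoc]
      exact List.perm_middle
    simp only [List.nodup_cons, List.mem_cons, not_or] at hn
    rcases hxy with ⟨rfl, rfl⟩ | ⟨rfl, rfl⟩ <;> cases u <;> simp_all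
  have hx : x.label ∈ ({a} : Finset ℕ) := by
    rcases hxy with ⟨rfl, rfl⟩ | ⟨rfl, rfl⟩ <;> simp
  have hy : y.label ∈ ({a} : Finset ℕ) := by
    rcases hxy with ⟨rfl, rfl⟩ | ⟨rfl, rfl⟩ <;> simp
  have h := fourT_mul (A * legWord P) (legWord Q) (legWord R * B) b a x y hxy
  rw [← h, ← map_add]
  congr 1
  rw [pushInto_append, pushInto_append, pushInto, pushInto, if_pos hx, if_pos hy,
    pushInto_eq_zero (w := P) fun u hu => hlab u (by simp [hu]),
    pushInto_eq_zero (w := Q) fun u hu => hlab u (by simp [hu]),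
    pushInto_eq_zero (w := R) fun u hu => hlab u (by simp [hu]), ← legWord_mul, legWord_cons x Q,
    legWord_cons y R]
  noncomm_ring

/-- The heads of other arrows slide over an isolated part of a diagram: the commutator with the part is the
sum, over its arrows, of the commutators with the two ends. -/
theorem clMap_bracket_isolated (A B : LegAlgebra) {w : List Leg} (hw : WF w) (b : ℕ) :
    clMap (A * ⁅hd b, legWord w⁆ * B) = 0 := by
  have hl : ∀ u ∈ w, u.label ∈ labels w := fun u hu => List.mem_toFinset.2 (List.mem_map_of_mem hu)
  rw [← pushInto_eq_bracket hl, pushInto_eq_sum, Finset.mul_sum, Finset.sum_mul, map_sum]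
  refine Finset.sum_eq_zero fun a ha => ?_
  have hta : tail a ∈ w := by
    rcases mem_labels.1 ha with h | h
    · exact h
    · exact (hw.2 a).2 h
  have hha := (hw.2 a).1 hta
  obtain ⟨U, V, rfl⟩ := List.append_of_mem hta
  rcases List.mem_append.1 hha with h | h
  · obtain ⟨P, Q, rfl⟩ := List.append_of_mem h
    exact clMap_pushInto_singleton A B hw.1 (Or.inr ⟨rfl, rfl⟩)
  · obtain ⟨Q, R, rfl⟩ := List.append_of_mem ((List.mem_cons.1 h).resolve_left (by simp))
    have := clMap_pushInto_singleton (b := b) A B (P := U) (x := tail a) (Q := Q) (y := head a) (R := R)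
      (by simpa using hw.1) (Or.inl ⟨rfl, rfl⟩)
    simpa using this

/-- The span of the diagrams whose arrows are those in `S`. -/
noncomputable def diagramWords (S : Finset ℕ) : Submodule ℚ LegAlgebra :=
  Submodule.span ℚ {x | ∃ w, WF w ∧ labels w = S ∧ x = legWord w}

theorem wheel_mem_diagramWords {l : List ℕ} {a : ℕ} (hl : (l ++ [a]).Nodup) :
    legWord (l.map tail) * ⁅nestedBracket l a, tl a⁆ ∈ diagramWords (insert a l.toFinset) := by
  have hp : ∀ w, w.Perm ((l ++ [a]).map tail ++ (l ++ [a]).map head) →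
      legWord w ∈ diagramWords (insert a l.toFinset) := fun w hw => by
    refine Submodule.subset_span ⟨w, (WF.perm hw).2 ⟨?_, ?_⟩, ?_, rfl⟩
    · refine List.nodup_append.2 ⟨hl.map fun _ _ h => by injection h,
        hl.map fun _ _ h => by injection h, ?_⟩
      simp only [List.mem_map]
      rintro _ ⟨a, -, rfl⟩ _ ⟨b, -, rfl⟩ h
      cases h
    · simp
    · rw [labels_perm hw]
      ext b
      simp [labels]
  have hl' : l.Nodup := (List.nodup_append.1 hl).1
  rw [nestedBracket_eq_sum hl', Ring.lie_def, Finset.sum_mul, Finset.mul_sum,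
    ← Finset.sum_sub_distrib, Finset.mul_sum]
  refine Submodule.sum_mem _ fun J _ => ?_
  rw [smul_mul_assoc, mul_smul_comm, ← smul_sub, mul_smul_comm, mul_sub, legWord_mul, legWord_mul,
    legWord_mul, legWord_mul]
  have hb := bracketWord_perm l a J
  refine Submodule.smul_mem _ _ (sub_mem (hp _ ?_) (hp _ ?_))
  · rw [List.map_append (f := tail), List.append_assoc]
    exact List.Perm.append_left _ (List.perm_append_comm.trans (List.Perm.append_left _ hb))
  · rw [List.map_append (f := tail), List.append_assoc]
    exact List.Perm.append_left _ (List.Perm.append_left _ hb)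

theorem clMap_mul_legWord {S : Finset ℕ} {y : LegAlgebra} (hy : y ∈ diagramWords S) {u : List Leg}
    (hu : WF u) (h : ∀ x ∈ u, x.label ∉ S) : clMap (y * legWord u) = clMap y * cl u := by
  refine Submodule.span_induction (p := fun y _ => clMap (y * legWord u) = clMap y * cl u)
    ?_ ?_ ?_ ?_ hy
  · rintro _ ⟨w, hw, rfl, rfl⟩
    rw [legWord_mul, clMap_legWord, clMap_legWord, cl_append hw hu]
    intro x hx y hy hxy
    exact h y hy (hxy ▸ List.mem_toFinset.2 (List.mem_map_of_mem hx))
  · simp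
  · intro x y _ _ hx hy
    rw [add_mul, map_add, map_add, add_mul, hx, hy]
  · intro r x _ hx
    rw [smul_mul_assoc, map_smul, map_smul, smul_mul_assoc, hx]

theorem legWord_mul_clMap {S : Finset ℕ} {y : LegAlgebra} (hy : y ∈ diagramWords S) {u : List Leg}
    (hu : WF u) (h : ∀ x ∈ u, x.label ∉ S) : clMap (legWord u * y) = cl u * clMap y := by
  refine Submodule.span_induction (p := fun y _ => clMap (legWord u * y) = cl u * clMap y)
    ?_ ?_ ?_ ?_ hy
  · rintro _ ⟨w, hw, rfl, rfl⟩
    rw [legWord_mul, clMap_legWord, clMap_legWord, cl_append hu hw]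
    intro x hx y hy hxy
    exact h x hx (hxy ▸ List.mem_toFinset.2 (List.mem_map_of_mem hy))
  · simp
  · intro x y _ _ hx hy
    rw [mul_add, map_add, map_add, mul_add, hx, hy]
  · intro r x _ hx
    rw [mul_smul_comm, map_smul, map_smul, mul_smul_comm, hx]

theorem clMap_bracket_diagramWords (A B : LegAlgebra) {S : Finset ℕ} {y : LegAlgebra}
    (hy : y ∈ diagramWords S) (b : ℕ) : clMap (A * ⁅hd b, y⁆ * B) = 0 := by
  rw [← adL_apply]
  refine Submodule.span_induction (p := fun y _ => clMap (A * adL (hd b) y * B) = 0) ?_ ?_ ?_ ?_ hy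
  · rintro _ ⟨w, hw, -, rfl⟩
    rw [adL_apply]
    exact clMap_bracket_isolated A B hw b
  · rw [map_zero, mul_zero, zero_mul, map_zero]
  · intro x y _ _ hx hy
    rw [map_add, mul_add, add_mul, map_add, hx, hy, add_zero]
  · intro r x _ hx
    rw [map_smul, mul_smul_comm, smul_mul_assoc, map_smul, hx, smul_zero]

/-- The words `R` that contain all legs of a diagram but the tail of `a` and the heads in `s`, where the
diagram has `n` arrows. -/
def Fits (n : ℕ) (s : Finset ℕ) (a : ℕ) (R : List Leg) : Prop :=
  WF (R ++ tail a :: s.toList.map head) ∧ R.length + 1 + s.card = 2 * n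

namespace Fits

variable {n : ℕ} {s : Finset ℕ} {a : ℕ} {R R' : List Leg}

theorem perm (h : Fits n s a R) (hp : R.Perm R') : Fits n s a R' :=
  ⟨(WF.perm (List.Perm.append_right _ hp)).1 h.1, by rw [← hp.length_eq]; exact h.2⟩

theorem nodup (h : Fits n s a R) : R.Nodup := (List.nodup_append.1 h.1.1).1

theorem tail_ne {b : ℕ} (h : Fits n s a R) (hb : tail b ∈ R) : b ≠ a := by
  rintro rfl
  exact (List.nodup_append.1 h.1.1).2.2 _ hb (tail b) (by simp) rfl

theorem head_notMem {b : ℕ} (h : Fits n s a R) (hb : head b ∈ R) : b ∉ s := fun hs =>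
  (List.nodup_append.1 h.1.1).2.2 _ hb (head b) (by simp [hs]) rfl

theorem tail_mem_iff (h : Fits n s a R) (b : ℕ) :
    tail b ∈ R ∨ b = a ↔ head b ∈ R ∨ b ∈ s := by
  have := h.1.2 b
  simpa using this

theorem insert_head {b : ℕ} (h : Fits n s a (head b :: R)) : Fits n (insert b s) a R := by
  have hb : b ∉ s := h.head_notMem (by simp)
  refine ⟨(WF.perm ?_).1 h.1, ?_⟩
  · have := (Finset.toList_insert hb).map head
    refine List.Perm.trans ?_ (List.Perm.append_left _ (List.Perm.cons _ this.symm))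
    rw [List.map_cons, List.cons_append]
    refine List.perm_middle.symm.trans (List.Perm.append_left _ ?_)
    exact List.Perm.swap _ _ _
  · have := h.2
    rw [List.length_cons] at this
    rw [Finset.card_insert_of_notMem hb]
    omega

end Fits

/-- The commutator `[x, t_a]` commutes with tails in a diagram. -/
theorem LieIn.clMap_tail {s : Finset ℕ} {x : LegAlgebra} {a b n : ℕ} (hx : LieIn s x) (ha : a ∈ s)
    {P Q : List Leg} (hw : Fits n s a (P ++ tail b :: Q)) :
    clMap (legWord P * ⁅⁅x, tl a⁆, tl b⁆ * legWord Q) = 0 := by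
  have hba : b ≠ a := hw.tail_ne (by simp)
  have hd_notMem : ∀ c ∈ s, Leg.head c ∉ P ++ Q := fun c hc h =>
    hw.head_notMem (b := c) (by simp at h ⊢; tauto) hc
  -- if `x` involves a third arrow, then its tail lies in `P` or in `Q`; otherwise `x` is the head of `a` or
  -- the commutator of the heads of `a` and `b`
  by_cases h : ∃ c ∈ s, c ≠ a ∧ c ≠ b
  · obtain ⟨c, hc, hca, hcb⟩ := h
    have hm : tail c ∈ P ++ tail b :: Q :=
      ((hw.tail_mem_iff c).2 (Or.inr hc)).resolve_right hca
    simp only [List.mem_append, List.mem_cons] at hm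
    rcases hm with h | h | h
    · obtain ⟨P1, P2, rfl⟩ := List.append_of_mem h
      have := hx.lie_tail_tail (b := b) ha hc hca.symm LinearMap.id IsInner.id (fun _ h => h) _
        (isContext_wordContext (legWord P1) (legWord P2) (legWord Q)) fun y => by
          rw [wordContext_apply]
          exact clMap_tails_comm _ _ _ _
      rw [wordContext_apply, LinearMap.id_apply, legWord_mul, legWord_mul] at this
      simpa using this
    · injection h with h
      exact absurd h hcb
    · obtain ⟨Q1, Q2, rfl⟩ := List.append_of_mem h
      have := hx.lie_tail_tail (b := b) ha hc hca.symm LinearMap.id IsInner.id (fun _ h => h) _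
        (isContext_wordContext (legWord P) (legWord Q1) (legWord Q2)).flip fun y => by
          rw [LinearMap.flip_apply, wordContext_apply]
          have := clMap_tails_comm (legWord P) (legWord Q1 * y * legWord Q2) a b
          simpa only [mul_assoc] using this
      rw [LinearMap.flip_apply, wordContext_apply, LinearMap.id_apply] at this
      rw [← this]
      congr 1
      rw [← legWord_mul, legWord_cons]
      noncomm_ring
  · push Not at h
    refine Submodule.span_induction
      (p := fun x _ => clMap (legWord P * ⁅⁅x, tl a⁆, tl b⁆ * legWord Q) = 0) ?_ ?_ ?_ ?_
      (hx.mem_combs ha)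
    · rintro _ ⟨l, hl, hal, hls, rfl⟩
      have hlb : ∀ c ∈ l, c = b := fun c hc => h c (by rw [← hls]; simp [hc])
        (fun hca => hal (hca ▸ hc))
      cases l with
      | nil =>
        -- the arrow `a` is isolated in all terms
        have h1 := clMap_isolated (legWord P) (tl b * legWord Q) a
        have h2 := clMap_isolated (legWord P * tl b) (legWord Q) a
        rw [nestedBracket, Ring.lie_def ⁅_, _⁆, mul_sub, sub_mul, map_sub, ← mul_assoc, ← mul_assoc,
          h2, mul_assoc _ (tl b), h1, sub_zero]
      | cons c l =>
        obtain rfl := hlb c List.mem_cons_self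
        obtain rfl : l = [] := by
          rw [List.eq_nil_iff_forall_not_mem]
          intro e he
          obtain rfl := hlb e (List.mem_cons_of_mem _ he)
          exact (List.nodup_cons.1 hl).1 he
        -- exchanging the names of the two arrows changes the sign
        have hcs : c ∈ s := by rw [← hls]; simp
        have hfix : ∀ u ∈ P ++ Q, Leg.map (Equiv.swap a c) u = u := fun u hu => by
          have hn := hw.nodup
          have hn' : (tail c :: (P ++ Q)).Nodup := List.perm_middle.nodup_iff.1 hn
          have h1 : ∀ e, u.label = e → e ∈ s → (e = a ∨ e = c) → False := by
            intro e he hes hea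
            cases u with
            | head e' =>
              obtain rfl : e' = e := he
              exact hd_notMem e' hes hu
            | tail e' =>
              obtain rfl : e' = e := he
              rcases hea with rfl | rfl
              · exact hw.tail_ne (b := e') (by simp at hu ⊢; tauto) rfl
              · exact (List.nodup_cons.1 hn').1 hu
          have h2 : u.label ≠ a := fun he => h1 a he ha (Or.inl rfl)
          have h3 : u.label ≠ c := fun he => h1 c he hcs (Or.inr rfl)
          cases u <;> simp_all [Equiv.swap_apply_of_ne_of_ne]
        have hmap : ∀ w : List Leg, (∀ u ∈ w, u ∈ P ++ Q) →
            mapLegs (Equiv.swap a c) (legWord w) = legWord w := fun w hw => by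
          rw [mapLegs_legWord]
          congr 1
          conv_rhs => rw [← List.map_id w]
          exact List.map_congr_left fun u hu => hfix u (hw u hu)
        have e1 := clMap_mapLegs (Equiv.swap a c).injective
          (legWord P * ⁅⁅nestedBracket [c] a, tl a⁆, tl c⁆ * legWord Q)
        have e2 : mapLegs (Equiv.swap a c)
              (legWord P * ⁅⁅nestedBracket [c] a, tl a⁆, tl c⁆ * legWord Q)
            = legWord P * ⁅⁅⁅hd a, hd c⁆, tl c⁆, tl a⁆ * legWord Q := by
          simp only [nestedBracket, map_mul, Ring.lie_def, map_sub, hmap P (by simp; tauto),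
            hmap Q (by simp; tauto), mapLegs_legWord, List.map_cons, List.map_nil, map_tail, map_head,
            Equiv.swap_apply_left, Equiv.swap_apply_right]
        have e3 := clMap_tails_comm (legWord P * ⁅hd a, hd c⁆) (legWord Q) a c
        have e4 := clMap_tails_comm (legWord P) (⁅hd a, hd c⁆ * legWord Q) a c
        have e5 : legWord P * ⁅⁅⁅hd a, hd c⁆, tl c⁆, tl a⁆ * legWord Q
            = -(legWord P * ⁅⁅nestedBracket [c] a, tl a⁆, tl c⁆ * legWord Q)
              - legWord P * ⁅hd a, hd c⁆ * ⁅tl a, tl c⁆ * legWord Q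
              + legWord P * ⁅tl a, tl c⁆ * (⁅hd a, hd c⁆ * legWord Q) := by
          simp only [nestedBracket, Ring.lie_def]
          noncomm_ring
        rw [e2, e5, map_add, map_sub, map_neg, e3, e4, sub_zero, add_zero] at e1
        have h2 : (2 : ℚ) •
            clMap (legWord P * ⁅⁅nestedBracket [c] a, tl a⁆, tl c⁆ * legWord Q) = 0 := by
          rw [two_smul]
          nth_rewrite 1 [← e1]
          exact neg_add_cancel _
        exact (smul_eq_zero.1 h2).resolve_left two_ne_zero
    · simp [Ring.lie_def]
    · intro x y _ _ hx hy
      rw [← add_zero (0 : Asw)]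
      nth_rewrite 1 [← hx]
      rw [← hy, ← map_add]
      congr 1
      simp only [Ring.lie_def]
      noncomm_ring
    · intro r x _ hx
      rw [← smul_zero r, ← hx, ← map_smul]
      congr 1
      simp only [Ring.lie_def, smul_mul_assoc, mul_smul_comm, ← smul_sub]

/-! ### Every diagram is a combination of products of arrows and wheels -/

/-- The products of single arrows `D_A` and of wheels with at least two spokes, of total degree `n`. -/
inductive IsWheelMonomial : ℕ → Asw → Prop
  | one : IsWheelMonomial 0 1
  | arrow {n : ℕ} {x : Asw} (h : IsWheelMonomial n x) : IsWheelMonomial (n + 1) (x * D_A)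
  | wheel {n k : ℕ} {x : Asw} (hk : 2 ≤ k) (h : IsWheelMonomial n x) :
      IsWheelMonomial (n + k) (wheel k * x)

/-- The span of the products of arrows and wheels of degree `n`. -/
noncomputable def wheelSpan (n : ℕ) : Submodule ℚ Asw := Submodule.span ℚ {x | IsWheelMonomial n x}

theorem mul_D_A_mem_wheelSpan {n : ℕ} {x : Asw} (hx : x ∈ wheelSpan n) :
    x * D_A ∈ wheelSpan (n + 1) := by
  refine Submodule.span_induction (p := fun x _ => x * D_A ∈ wheelSpan (n + 1)) ?_ ?_ ?_ ?_ hx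
  · exact fun x hx => Submodule.subset_span (.arrow hx)
  · simp
  · intro x y _ _ hx hy
    rw [add_mul]; exact add_mem hx hy
  · intro r x _ hx
    rw [smul_mul_assoc]; exact Submodule.smul_mem _ _ hx

/-- Resolving the `1`-wheel gives the two directions of an isolated arrow, which are equal by RI. -/
theorem wheel_one : wheel 1 = 0 := by
  have h := clMap_tails_mul_bracket (l := []) (a := 0) (by simp)
  rw [← show wheel ([].length + 1) = wheel 1 from rfl, ← h]
  have := clMap_isolated 1 1 0
  simpa [nestedBracket, legWord_nil] using this

theorem wheel_mul_mem_wheelSpan {n k : ℕ} (hk : k ≠ 0) {x : Asw} (hx : x ∈ wheelSpan n) :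
    wheel k * x ∈ wheelSpan (n + k) := by
  obtain rfl | hk2 : k = 1 ∨ 2 ≤ k := by omega
  · rw [wheel_one, zero_mul]; exact zero_mem _
  refine Submodule.span_induction (p := fun x _ => wheel k * x ∈ wheelSpan (n + k)) ?_ ?_ ?_ ?_ hx
  · exact fun x hx => Submodule.subset_span (.wheel hk2 hx)
  · simp
  · intro x y _ _ hx hy
    rw [mul_add]; exact add_mem hx hy
  · intro r x _ hx
    rw [mul_smul_comm]; exact Submodule.smul_mem _ _ hx

section Bracket

variable {n : ℕ} {s : Finset ℕ} {x : LegAlgebra} {a : ℕ} {N : Submodule ℚ Asw}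

/-- Up to terms in which the bracket has absorbed one more head, the bracket `[x, t_a]` may be moved over
any leg. -/
theorem clMap_move_bracket_one (hx : LieIn s x) (ha : a ∈ s)
    (hN : ∀ b ∉ s, ∀ x' P Q, LieIn (insert b s) x' → Fits n (insert b s) a (P ++ Q) →
      clMap (legWord P * ⁅x', tl a⁆ * legWord Q) ∈ N) {P Q : List Leg} {u : Leg}
    (hw : Fits n s a (P ++ u :: Q)) :
    clMap (legWord P * legWord [u] * ⁅x, tl a⁆ * legWord Q)
      - clMap (legWord P * ⁅x, tl a⁆ * legWord [u] * legWord Q) ∈ N := by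
  rw [← map_sub]
  cases u with
  | tail b =>
    have h := hx.clMap_tail ha hw
    have : legWord P * tl b * ⁅x, tl a⁆ * legWord Q - legWord P * ⁅x, tl a⁆ * tl b * legWord Q
        = -(legWord P * ⁅⁅x, tl a⁆, tl b⁆ * legWord Q) := by
      simp only [Ring.lie_def]
      noncomm_ring
    rw [this, map_neg, h, neg_zero]
    exact zero_mem _
  | head b =>
    have hw' : Fits n s a (Leg.head b :: (P ++ Q)) := hw.perm List.perm_middle
    have hb : b ∉ s := hw'.head_notMem (by simp)
    obtain ⟨x', h1, h2⟩ := hx.push ha (isPushable_hd b)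
    have hx' := h1 {b} (.head b) (Finset.disjoint_singleton_left.2 hb)
    have hx'' := LieIn.lie (.head b) hx (Finset.disjoint_singleton_left.2 hb)
    rw [Finset.union_comm, ← Finset.insert_eq] at hx'
    rw [← Finset.insert_eq] at hx''
    -- the part of the commutator of `b` with `[x, t_a]` in which `b` meets `t_a` is pushed into `x`
    have h3 := h2 _ ((isContext_wordContext (legWord P) 1 (legWord Q)).flip.sub
      (isContext_wordContext (legWord P) 1 (legWord Q)))
    simp only [LinearMap.sub_apply, LinearMap.flip_apply, wordContext_apply, mul_one,
      ← map_sub] at h3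
    have e : legWord P * hd b * ⁅x, tl a⁆ * legWord Q - legWord P * ⁅x, tl a⁆ * hd b * legWord Q
        = legWord P * ⁅⁅hd b, x⁆, tl a⁆ * legWord Q
          + (legWord P * x * ⁅hd b, tl a⁆ * legWord Q - legWord P * ⁅hd b, tl a⁆ * x * legWord Q) := by
      simp only [Ring.lie_def]
      noncomm_ring
    have e' : legWord P * x' * tl a * legWord Q - legWord P * tl a * x' * legWord Q
        = legWord P * ⁅x', tl a⁆ * legWord Q := by
      simp only [Ring.lie_def]
      noncomm_ring
    rw [e, map_add, h3, e']
    exact add_mem (hN b hb _ P Q hx'' hw'.insert_head) (neg_mem (hN b hb _ P Q hx' hw'.insert_head))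

/-- Up to terms in which the bracket has absorbed one more head, the bracket `[x, t_a]` may be moved to the
left end. -/
theorem clMap_move_bracket (hx : LieIn s x) (ha : a ∈ s)
    (hN : ∀ b ∉ s, ∀ x' P Q, LieIn (insert b s) x' → Fits n (insert b s) a (P ++ Q) →
      clMap (legWord P * ⁅x', tl a⁆ * legWord Q) ∈ N) {P Q : List Leg} (hw : Fits n s a (P ++ Q)) :
    clMap (legWord P * ⁅x, tl a⁆ * legWord Q) - clMap (⁅x, tl a⁆ * legWord (P ++ Q)) ∈ N := by
  induction P using List.reverseRecOn generalizing Q with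
  | nil => simp [legWord_nil]
  | append_singleton P u ih =>
    rw [List.append_assoc] at hw
    have h1 := clMap_move_bracket_one hx ha hN hw
    have h2 := ih hw
    rw [List.singleton_append] at h2
    change clMap (legWord P * legWord [u] * ⁅x, tl a⁆ * legWord Q)
      - clMap (legWord P * ⁅x, tl a⁆ * legWord [u] * legWord Q) ∈ N at h1
    rw [mul_assoc _ (legWord [u]) (legWord Q), ← legWord_cons] at h1
    have := add_mem h1 h2
    rw [sub_add_sub_cancel] at this
    rwa [← legWord_mul, List.append_assoc, List.singleton_append]

/-- Up to terms in which the bracket has absorbed one more head, the tails of the arrows of the bracket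
may be moved over any leg. -/
theorem clMap_move_tail (hx : LieIn s x)
    (hN : ∀ b ∉ s, ∀ x' P Q, LieIn (insert b s) x' → Fits n (insert b s) a (P ++ Q) →
      clMap (legWord P * ⁅x', tl a⁆ * legWord Q) ∈ N) {A U B : List Leg} {c : ℕ} (hc : c ∈ s)
    (hw : Fits n s a (A ++ U ++ tail c :: B)) :
    clMap (⁅x, tl a⁆ * legWord (A ++ U ++ tail c :: B))
      - clMap (⁅x, tl a⁆ * legWord (A ++ tail c :: (U ++ B))) ∈ N := by
  induction U using List.reverseRecOn generalizing B with
  | nil => simp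
  | append_singleton U u ih =>
    have h2 := ih (B := u :: B) (hw.perm (by
      simpa using List.Perm.append_left _ (List.Perm.append_left _ (List.Perm.swap _ _ _))))
    have e : U ++ u :: B = U ++ [u] ++ B := by simp
    rw [e] at h2
    refine (Submodule.sub_mem_iff_left N h2).1 ?_
    rw [sub_sub_sub_cancel_right]
    rw [← map_sub]
    have e1 : legWord (A ++ (U ++ [u]) ++ tail c :: B)
        = legWord (A ++ U) * legWord [u] * tl c * legWord B := by simp [legWord_mul]
    have e2 : legWord (A ++ U ++ tail c :: u :: B)
        = legWord (A ++ U) * tl c * legWord [u] * legWord B := by simp [legWord_mul]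
    rw [e1, e2]
    cases u with
    | tail b =>
      have h := clMap_tails_comm (⁅x, tl a⁆ * legWord (A ++ U)) (legWord B) b c
      have e : ⁅x, tl a⁆ * (legWord (A ++ U) * tl b * tl c * legWord B)
          - ⁅x, tl a⁆ * (legWord (A ++ U) * tl c * tl b * legWord B)
          = ⁅x, tl a⁆ * legWord (A ++ U) * ⁅tl b, tl c⁆ * legWord B := by
        rw [Ring.lie_def (tl b)]
        noncomm_ring
      rw [e, h]
      exact zero_mem _
    | head b =>
      have hw' : Fits n s a (Leg.head b :: (A ++ U ++ tail c :: B)) := hw.perm (by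
        rw [← List.append_assoc, List.append_assoc (A ++ U)]
        exact List.perm_middle)
      have hb : b ∉ s := hw'.head_notMem (by simp)
      obtain ⟨x', h1, h2⟩ := hx.push hc (isPushable_hd b)
      have hx' := h1 {b} (.head b) (Finset.disjoint_singleton_left.2 hb)
      rw [Finset.union_comm, ← Finset.insert_eq] at hx'
      -- the head of `b` is pushed across the arrow `c`, whose head is a part of `x`
      have h3 := h2 _ ((isContext_wordContext 1 (tl a * legWord (A ++ U)) (legWord B)).flip.sub
        (isContext_wordContext (tl a) (legWord (A ++ U)) (legWord B)).flip)
      simp only [LinearMap.sub_apply, LinearMap.flip_apply, wordContext_apply, one_mul,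
        ← map_sub] at h3
      have e : ⁅x, tl a⁆ * (legWord (A ++ U) * hd b * tl c * legWord B)
          - ⁅x, tl a⁆ * (legWord (A ++ U) * tl c * hd b * legWord B)
          = x * (tl a * legWord (A ++ U)) * ⁅hd b, tl c⁆ * legWord B
            - tl a * x * legWord (A ++ U) * ⁅hd b, tl c⁆ * legWord B := by
        simp only [Ring.lie_def]
        noncomm_ring
      have e' : x' * (tl a * legWord (A ++ U)) * tl c * legWord B
            - tl a * x' * legWord (A ++ U) * tl c * legWord B
          = legWord [] * ⁅x', tl a⁆ * legWord (A ++ U ++ tail c :: B) := by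
        have : legWord (A ++ U ++ tail c :: B) = legWord (A ++ U) * (tl c * legWord B) := by
          rw [← legWord_cons, legWord_mul]
        rw [this, Ring.lie_def, legWord_nil]
        noncomm_ring
      rw [e, h3, e']
      exact neg_mem (hN b hb _ [] _ hx' hw'.insert_head)

/-- The tails of arrows with labels in `s`. -/
def IsTailIn (s : Finset ℕ) : Leg → Bool
  | tail c => decide (c ∈ s)
  | Leg.head _ => false

/-- Up to terms in which the bracket has absorbed one more head, the tails of all arrows of the bracket may be
moved to the bracket. -/
theorem clMap_sort_tails (hx : LieIn s x)
    (hN : ∀ b ∉ s, ∀ x' P Q, LieIn (insert b s) x' → Fits n (insert b s) a (P ++ Q) →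
      clMap (legWord P * ⁅x', tl a⁆ * legWord Q) ∈ N) {A U R : List Leg}
    (hw : Fits n s a (A ++ U ++ R)) :
    clMap (⁅x, tl a⁆ * legWord (A ++ U ++ R))
      - clMap (⁅x, tl a⁆ *
        legWord (A ++ R.filter (IsTailIn s) ++ (U ++ R.filter (! IsTailIn s ·)))) ∈ N := by
  induction R generalizing A U with
  | nil => simp
  | cons u R ih =>
    by_cases hu : IsTailIn s u = true
    · cases u with
      | head b => cases hu
      | tail c =>
        have hc : c ∈ s := by simpa [IsTailIn] using hu
        have h1 := clMap_move_tail hx hN hc hw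
        have h2 := ih (A := A ++ [tail c]) (U := U) (hw.perm (by
          simpa using List.Perm.append_left A (List.perm_middle)))
        have e : A ++ [tail c] ++ U ++ R = A ++ tail c :: (U ++ R) := by simp
        rw [e] at h2
        have := add_mem h1 h2
        rw [sub_add_sub_cancel] at this
        simpa [List.filter_cons, hu] using this
    · have := ih (A := A) (U := U ++ [u]) (by simpa using hw)
      simpa [List.filter_cons, hu] using this

end Bracket

theorem map_label_tails {F : List Leg} (h : ∀ u ∈ F, ∃ c, u = tail c) :
    (F.map Leg.label).map tail = F := by
  rw [List.map_map]
  conv_rhs => rw [← List.map_id F]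
  refine List.map_congr_left fun u hu => ?_
  obtain ⟨c, rfl⟩ := h u hu
  rfl

/-- The tails in `R` of the arrows of `s` are those of all arrows of `s` but `a`. -/
theorem Fits.exists_tails {n : ℕ} {s : Finset ℕ} {a : ℕ} {R : List Leg} (hw : Fits n s a R)
    (ha : a ∈ s) : ∃ l : List ℕ, (l ++ [a]).Nodup ∧ l.length + 1 = s.card ∧
      insert a l.toFinset = s ∧ R.filter (IsTailIn s) = l.map tail := by
  set F := R.filter (IsTailIn s) with hF
  have hF' : ∀ u ∈ F, ∃ c, u = tail c := fun u hu => by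
    have := (List.mem_filter.1 hu).2
    cases u with
    | tail c => exact ⟨c, rfl⟩
    | head c => cases this
  have hmap := map_label_tails hF'
  have hn : (F.map Leg.label).Nodup := by
    refine List.Nodup.of_map tail ?_
    rw [hmap]
    exact hw.nodup.filter _
  have hm : ∀ c, c ∈ F.map Leg.label ↔ tail c ∈ R ∧ c ∈ s := fun c => by
    have h1 : c ∈ F.map Leg.label ↔ tail c ∈ (F.map Leg.label).map tail :=
      (List.mem_map_of_injective (fun _ _ h => by injection h)).symm
    rw [h1, hmap, hF, List.mem_filter]
    simp [IsTailIn]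
  have hal : a ∉ F.map Leg.label := fun h => hw.tail_ne ((hm a).1 h).1 rfl
  have hs : insert a (F.map Leg.label).toFinset = s := by
    ext c
    rw [Finset.mem_insert, List.mem_toFinset, hm]
    constructor
    · rintro (rfl | h)
      · exact ha
      · exact h.2
    · intro hc
      rcases (hw.tail_mem_iff c).2 (Or.inr hc) with h | h
      · exact Or.inr ⟨h, hc⟩
      · exact Or.inl h
  refine ⟨F.map Leg.label, ?_, ?_, hs, hmap.symm⟩
  · rw [List.nodup_append]
    exact ⟨hn, by simp, fun b hb c hc hbc => hal (by simp at hc; rwa [← hc, ← hbc])⟩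
  · rw [← hs, Finset.card_insert_of_notMem (by simpa using hal), List.toFinset_card_of_nodup hn]

theorem Fits.card_le {n : ℕ} {s : Finset ℕ} {a : ℕ} {R : List Leg} (hw : Fits n s a R)
    (ha : a ∈ s) : s.card ≤ n := by
  obtain ⟨l, -, h1, -, h2⟩ := hw.exists_tails ha
  have h3 := List.length_filter_le (IsTailIn s) R
  rw [h2, List.length_map] at h3
  have := hw.2
  omega

/-- The legs of `R` that do not belong to `s` form a diagram. -/
theorem Fits.wf_rest {n : ℕ} {s : Finset ℕ} {a : ℕ} {R : List Leg} (hw : Fits n s a R)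
    (ha : a ∈ s) : WF (R.filter (! IsTailIn s ·)) ∧
      (R.filter (! IsTailIn s ·)).length = 2 * (n - s.card) ∧
      ∀ u ∈ R.filter (! IsTailIn s ·), u.label ∉ s := by
  have ht : ∀ c, tail c ∈ R.filter (! IsTailIn s ·) ↔ tail c ∈ R ∧ c ∉ s := fun c => by
    simp [List.mem_filter, IsTailIn]
  have hh : ∀ c, Leg.head c ∈ R.filter (! IsTailIn s ·) ↔ Leg.head c ∈ R := fun c => by
    simp [List.mem_filter, IsTailIn]
  refine ⟨⟨hw.nodup.filter _, fun c => ?_⟩, ?_, ?_⟩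
  · rw [ht, hh]
    have h1 := hw.tail_mem_iff c
    have h2 : Leg.head c ∈ R → c ∉ s := fun h => hw.head_notMem h
    have h3 : c = a → c ∈ s := fun h => h ▸ ha
    tauto
  · obtain ⟨l, -, h1, -, h2⟩ := hw.exists_tails ha
    have h3 := List.length_eq_length_filter_add (l := R) (IsTailIn s)
    rw [h2, List.length_map] at h3
    have := hw.2
    omega
  · intro u hu
    cases u with
    | tail c => exact ((ht c).1 hu).2
    | head c => exact hw.head_notMem ((hh c).1 hu)

/-- Tails followed by a bracket of the corresponding heads are a multiple of a wheel, also if the Lie word is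
not a nested commutator. -/
theorem clMap_wheel_mul {l : List ℕ} {a : ℕ} (hl : (l ++ [a]).Nodup) {s : Finset ℕ}
    (hs : insert a l.toFinset = s) {x : LegAlgebra} (hx : LieIn s x) {u : List Leg} (hu : WF u)
    (hus : ∀ v ∈ u, v.label ∉ s) {N : Submodule ℚ Asw} (hN : wheel s.card * cl u ∈ N) :
    clMap (legWord (l.map tail) * ⁅x, tl a⁆ * legWord u) ∈ N := by
  refine Submodule.span_induction
    (p := fun x _ => clMap (legWord (l.map tail) * ⁅x, tl a⁆ * legWord u) ∈ N) ?_ ?_ ?_ ?_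
    (hx.mem_combs (a := a) (by simp [← hs]))
  · rintro _ ⟨l', hl', hal', hs', rfl⟩
    have hla : a ∉ l := fun h => (List.nodup_append.1 hl).2.2 a h a (by simp) rfl
    have hp : l.Perm l' := by
      refine (List.perm_ext_iff_of_nodup (List.nodup_append.1 hl).1 hl').2 fun c => ?_
      have h1 := congrArg (c ∈ ·) (hs.trans hs'.symm)
      simp only [Finset.mem_insert, List.mem_toFinset, eq_iff_iff] at h1
      by_cases hc : c = a
      · subst hc; tauto
      · tauto
    have hn : (l' ++ [a]).Nodup := (List.Perm.nodup_iff (List.Perm.append_right _ hp)).1 hl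
    have h1 := clMap_tails_perm hp [] (⁅nestedBracket l' a, tl a⁆ * legWord u)
    simp only [legWord_nil, one_mul, ← mul_assoc] at h1
    rw [h1, clMap_mul_legWord (wheel_mem_diagramWords hn) hu (by rwa [hs']),
      clMap_tails_mul_bracket hn]
    have : l'.length + 1 = s.card := by
      rw [← hs', Finset.card_insert_of_notMem (by simpa using hal'), List.toFinset_card_of_nodup hl']
    rwa [this]
  · simp [Ring.lie_def]
  · intro x y _ _ hx hy
    have : legWord (l.map tail) * ⁅x + y, tl a⁆ * legWord u
        = legWord (l.map tail) * ⁅x, tl a⁆ * legWord u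
          + legWord (l.map tail) * ⁅y, tl a⁆ * legWord u := by
      simp only [Ring.lie_def]
      noncomm_ring
    rw [this, map_add]
    exact add_mem hx hy
  · intro r x _ hx
    have : legWord (l.map tail) * ⁅r • x, tl a⁆ * legWord u
        = r • (legWord (l.map tail) * ⁅x, tl a⁆ * legWord u) := by
      simp only [Ring.lie_def, smul_mul_assoc, mul_smul_comm, ← smul_sub]
    rw [this, map_smul]
    exact Submodule.smul_mem _ _ hx

/-- A diagram with a bracket `[x, t_a]`, where `x` contains the head of `a`, is a combination of products
of arrows and wheels: moving together the bracket and the tails of its arrows makes it a multiple of a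
wheel. -/
theorem LieIn.bracket_mem_wheelSpan {n : ℕ}
    (IH : ∀ m < n, ∀ w, WF w → w.length = 2 * m → cl w ∈ wheelSpan m) {s : Finset ℕ}
    {x : LegAlgebra} {a : ℕ} {P Q : List Leg} (hx : LieIn s x) (ha : a ∈ s)
    (hw : Fits n s a (P ++ Q)) : clMap (legWord P * ⁅x, tl a⁆ * legWord Q) ∈ wheelSpan n := by
  -- by induction on the number of heads outside of the bracket
  obtain ⟨k, hk⟩ : ∃ k, s.card + k = n := ⟨n - s.card, by have := hw.card_le ha; omega⟩
  induction k using Nat.strong_induction_on generalizing s x P Q with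
  | _ k ih =>
  have hN : ∀ b ∉ s, ∀ x' P Q, LieIn (insert b s) x' → Fits n (insert b s) a (P ++ Q) →
      clMap (legWord P * ⁅x', tl a⁆ * legWord Q) ∈ wheelSpan n := by
    intro b hb x' P' Q' hx' hw'
    have h1 := hw'.card_le (Finset.mem_insert_of_mem ha)
    have h2 := Finset.card_insert_of_notMem hb
    exact ih (k - 1) (by omega) hx' (Finset.mem_insert_of_mem ha) hw' (by omega)
  obtain ⟨l, hl, hls, hs, hR⟩ := hw.exists_tails ha
  obtain ⟨hu, hulen, hus⟩ := hw.wf_rest ha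
  set u := (P ++ Q).filter (! IsTailIn s ·) with hudef
  -- the bracket goes to the left end, then the tails of its arrows come next to it, and finally it is
  -- moved over them
  have h1 := clMap_move_bracket hx ha hN hw
  have h2 := clMap_sort_tails (A := []) (U := []) hx hN hw
  have hw3 : Fits n s a (l.map tail ++ u) := hw.perm (by
    rw [← hR]
    exact (List.filter_append_perm _ _).symm)
  have h3 := clMap_move_bracket hx ha hN hw3
  change clMap (⁅x, tl a⁆ * legWord (P ++ Q)) - clMap (⁅x, tl a⁆ *
    legWord ((P ++ Q).filter (IsTailIn s) ++ (P ++ Q).filter (! IsTailIn s ·))) ∈ _ at h2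
  rw [hR, ← hudef] at h2
  have h4 : clMap (legWord (l.map tail) * ⁅x, tl a⁆ * legWord u) ∈ wheelSpan n := by
    refine clMap_wheel_mul hl hs hx hu hus ?_
    have := wheel_mul_mem_wheelSpan (k := s.card) (by omega) (IH (n - s.card) (by omega) u hu hulen)
    rwa [Nat.sub_add_cancel (by omega)] at this
  have h5 := (Submodule.sub_mem_iff_right _ h4).1 h3
  have h6 := (Submodule.sub_mem_iff_left _ h5).1 h2
  exact (Submodule.sub_mem_iff_left _ h6).1 h1

theorem cl_single (a : ℕ) : cl [tail a, head a] = D_A := by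
  obtain ⟨f, hf, h⟩ := exists_injective_map_range (l := [a]) (by simp)
  have h0 : f 0 = a := by simpa using h
  rw [← h0]
  exact cl_map hf [tail 0, head 0]

theorem wf_nodup_tails_heads {l : List ℕ} (hl : l.Nodup) : WF (l.map tail ++ l.map head) := by
  refine ⟨List.nodup_append.2 ⟨hl.map fun _ _ h => by injection h,
    hl.map fun _ _ h => by injection h, ?_⟩, ?_⟩
  · simp only [List.mem_map]
    rintro _ ⟨a, -, rfl⟩ _ ⟨b, -, rfl⟩ h
    cases h
  · simp

/-- A diagram in which all tails come before all heads is a power of `D_A`. -/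
theorem cl_tails_heads_mem_wheelSpan {T : List ℕ} (hT : T.Nodup) :
    cl (T.map tail ++ T.map head) ∈ wheelSpan T.length := by
  induction T with
  | nil =>
    refine Submodule.subset_span ?_
    have : cl [] = 1 := by
      rw [← clMap_legWord, legWord_nil]
      change toAsw (close (legWord [])) = 1
      rw [close_legWord, diagram, dif_pos WF.nil]
      exact map_one toAsw
    simpa [this] using IsWheelMonomial.one
  | cons a T ih =>
    rw [List.nodup_cons] at hT
    have h1 := cl_tc (T := a :: T) (T' := T ++ [a]) (List.perm_append_singleton a T).symm []
      ((a :: T).map head)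
    have h2 := cl_slide_block T (T.map tail) [] a
    have h3 : cl (T.map tail ++ T.map head ++ [tail a, head a])
        = cl (T.map tail ++ T.map head) * cl [tail a, head a] :=
      cl_append (wf_nodup_tails_heads hT.2) (by simpa using wf_nodup_tails_heads (l := [a]) (by simp))
        (by
          intro x hx y hy
          have hy' : y.label = a := by
            simp only [List.mem_cons, List.not_mem_nil, or_false] at hy
            rcases hy with rfl | rfl <;> rfl
          rw [hy']
          rintro rfl
          simp only [List.mem_append, List.mem_map] at hx
          rcases hx with ⟨b, hb, rfl⟩ | ⟨b, hb, rfl⟩ <;> exact hT.1 hb)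
    have e : cl ((a :: T).map tail ++ (a :: T).map head)
        = cl (T.map tail ++ T.map head) * D_A := by
      rw [← cl_single a, ← h3]
      simp only [List.nil_append, List.append_nil, List.map_append, List.map_cons, List.map_nil,
        List.append_assoc, List.cons_append] at h1 h2 ⊢
      rw [h1, h2]
    rw [e]
    exact mul_D_A_mem_wheelSpan (ih hT.2)

theorem exists_eq_map_head {w : List Leg} (h : tailLabels w = []) : ∃ H : List ℕ, w = H.map head := by
  refine ⟨w.map Leg.label, ?_⟩
  rw [List.map_map]
  conv_lhs => rw [← List.map_id w]
  refine List.map_congr_left fun u hu => ?_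
  cases u with
  | head a => rfl
  | tail a =>
    have := mem_tailLabels.2 hu
    rw [h] at this
    cases this

theorem exists_first_tail {w : List Leg} (h : tailLabels w ≠ []) :
    ∃ (X : List ℕ) (a : ℕ) (V : List Leg), w = X.map head ++ tail a :: V := by
  induction w with
  | nil => exact absurd rfl h
  | cons u w ih =>
    cases u with
    | tail a => exact ⟨[], a, w, rfl⟩
    | head b =>
      obtain ⟨X, a, V, rfl⟩ := ih (by simpa [tailLabels] using h)
      exact ⟨b :: X, a, V, rfl⟩

theorem tailLabels_cons_tail (a : ℕ) (w : List Leg) :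
    tailLabels (tail a :: w) = a :: tailLabels w := rfl

theorem tailLabels_cons_head (a : ℕ) (w : List Leg) : tailLabels (head a :: w) = tailLabels w := rfl

theorem tailLabels_map_head (H : List ℕ) : tailLabels (H.map head) = [] := by
  induction H with
  | nil => rfl
  | cons a H ih => rw [List.map_cons, tailLabels_cons_head, ih]

section Sorting

variable {n k : ℕ}

/-- A tail whose arrow points to the right is moved to the left end. The hypothesis `ih` says that the
result is known for the diagrams with one more tail at the left end. -/
theorem cl_move_tail_left (ih : ∀ (T : List ℕ) (V : List Leg), (tailLabels V).length = k →
      WF (T.map tail ++ V) → (T.map tail ++ V).length = 2 * n → cl (T.map tail ++ V) ∈ wheelSpan n)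
    (T X : List ℕ) (a : ℕ) (V : List Leg) (hV : (tailLabels V).length = k) (ha : head a ∈ V)
    (hw : WF (T.map tail ++ X.map head ++ tail a :: V))
    (hl : (T.map tail ++ X.map head ++ tail a :: V).length = 2 * n) :
    cl (T.map tail ++ X.map head ++ tail a :: V) ∈ wheelSpan n := by
  induction X using List.reverseRecOn generalizing V with
  | nil =>
    have := ih (T ++ [a]) V hV (by simpa using hw) (by simpa using hl)
    simpa using this
  | append_singleton X b ihX =>
    obtain ⟨V1, V2, rfl⟩ := List.append_of_mem ha
    have hp1 : (T.map tail ++ (X ++ [b]).map head ++ tail a :: (V1 ++ head a :: V2)).Perm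
        (T.map tail ++ X.map head ++ tail a :: (head b :: (V1 ++ head a :: V2))) := by
      simpa using List.Perm.append_left _ (List.Perm.append_left _ (List.Perm.swap _ _ _))
    have hp2 : (T.map tail ++ (X ++ [b]).map head ++ tail a :: (V1 ++ head a :: V2)).Perm
        (T.map tail ++ X.map head ++ tail a :: (V1 ++ head b :: head a :: V2)) :=
      hp1.trans (List.Perm.append_left _ (List.Perm.cons _ List.perm_middle.symm))
    have hp3 : (T.map tail ++ (X ++ [b]).map head ++ tail a :: (V1 ++ head a :: V2)).Perm
        (T.map tail ++ X.map head ++ tail a :: (V1 ++ head a :: head b :: V2)) :=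
      hp2.trans (List.Perm.append_left _ (List.Perm.cons _ (List.Perm.append_left _
        (List.Perm.swap _ _ _))))
    have h1 := ihX (head b :: (V1 ++ head a :: V2)) (by simpa [tailLabels_cons_head] using hV)
      (by simp) ((WF.perm hp1).1 hw) (by rw [← hp1.length_eq, hl])
    have h2 := ihX (V1 ++ head b :: head a :: V2)
      (by simpa [tailLabels_cons_head, tailLabels_append] using hV)
      (by simp) ((WF.perm hp2).1 hw) (by rw [← hp2.length_eq, hl])
    have h3 := ihX (V1 ++ head a :: head b :: V2)
      (by simpa [tailLabels_cons_head, tailLabels_append] using hV)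
      (by simp) ((WF.perm hp3).1 hw) (by rw [← hp3.length_eq, hl])
    -- 4T for the head of `b` and the arrow `a`: in the three other terms fewer heads precede `t_a`
    have h4 := cl_fourT (K := fun x y => (T.map tail ++ X.map head) ++ x ++ V1 ++ y ++ V2)
      ⟨_, _, _, Or.inl fun _ _ => rfl⟩ b a
    simp only [List.append_assoc, List.cons_append, List.nil_append, List.map_append,
      List.map_cons, List.map_nil] at h1 h2 h3 h4 ⊢
    have e := sub_mem (add_mem h1 h3) h2
    convert e using 1
    rw [← sub_eq_zero, ← h4]
    abel

/-- A tail whose arrow points to the left, to a head of the Lie word `x`, is moved to the left end. First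
`x` is moved to the tail, absorbing some of the heads in between, and then the tail is moved over `x`. -/
theorem clMap_move_tail_left
    (IH : ∀ m < n, ∀ w, WF w → w.length = 2 * m → cl w ∈ wheelSpan m)
    (ih : ∀ (T : List ℕ) (V : List Leg), (tailLabels V).length = k →
      WF (T.map tail ++ V) → (T.map tail ++ V).length = 2 * n → cl (T.map tail ++ V) ∈ wheelSpan n)
    (T Y Z : List ℕ) {s : Finset ℕ} {x : LegAlgebra} (hx : LieIn s x) {a : ℕ} (ha : a ∈ s)
    (V : List Leg) (hV : (tailLabels V).length = k)
    (hw : Fits n s a (T.map tail ++ Y.map head ++ Z.map head ++ V)) :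
    clMap (legWord (T.map tail ++ Y.map head) * x * legWord (Z.map head) * tl a * legWord V)
      ∈ wheelSpan n := by
  induction Z generalizing Y s x with
  | nil =>
    -- `x t_a = t_a x + [x, t_a]`, and in the terms of `t_a x` the arrow `a` points to the right
    have h1 := hx.bracket_mem_wheelSpan IH ha (P := T.map tail ++ Y.map head) (Q := V)
      (by simpa using hw)
    have h2 : clMap (legWord (T.map tail ++ Y.map head) * (tl a * x) * legWord V) ∈ wheelSpan n := by
      refine Submodule.span_induction (p := fun x _ =>
        clMap (legWord (T.map tail ++ Y.map head) * (tl a * x) * legWord V) ∈ wheelSpan n)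
        ?_ ?_ ?_ ?_ hx.mem_headWords
      · rintro _ ⟨l, hl, rfl, rfl⟩
        simp only [legWord_mul, clMap_legWord]
        have hp : (T.map tail ++ Y.map head ++ V ++ tail a :: l.toFinset.toList.map head).Perm
            (T.map tail ++ Y.map head ++ tail a :: (l.map head ++ V)) := by
          rw [List.append_assoc]
          refine List.Perm.append_left _ (List.perm_middle.trans (List.Perm.cons _ ?_))
          refine List.perm_append_comm.trans (List.Perm.append_right _ (List.Perm.map _ ?_))
          exact List.toFinset_toList hl
        have hw' := hw.1
        simp only [List.map_nil, List.append_nil] at hw'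
        have := cl_move_tail_left ih T Y a (l.map head ++ V)
          (by rw [tailLabels_append, tailLabels_map_head]; exact hV)
          (by simpa using Or.inl (by simpa using ha)) ((WF.perm hp).1 hw') (by
            rw [← hp.length_eq]
            have := hw.2
            simp only [List.length_append, List.length_map, List.length_cons, List.map_nil,
              List.length_nil, Finset.length_toList] at this ⊢
            omega)
        simpa using this
      · simp
      · intro x y _ _ hx hy
        rw [mul_add, mul_add, add_mul, map_add]; exact add_mem hx hy
      · intro r x _ hx
        rw [mul_smul_comm, mul_smul_comm, smul_mul_assoc, map_smul]
        exact Submodule.smul_mem _ _ hx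
    have e : legWord (T.map tail ++ Y.map head) * x * legWord ([].map head) * tl a * legWord V
        = legWord (T.map tail ++ Y.map head) * (tl a * x) * legWord V
          + legWord (T.map tail ++ Y.map head) * ⁅x, tl a⁆ * legWord V := by
      rw [List.map_nil, legWord_nil, Ring.lie_def]
      noncomm_ring
    rw [e, map_add]
    exact add_mem h2 h1
  | cons b Z ihZ =>
    have hw' : Fits n s a (head b :: (T.map tail ++ Y.map head ++ Z.map head ++ V)) := hw.perm (by
      simp only [List.map_cons, List.append_assoc, List.cons_append]
      rw [← List.append_assoc, ← List.append_assoc]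
      exact List.perm_middle)
    have hb : b ∉ s := hw'.head_notMem (by simp)
    -- `x h_b = h_b x + [x, h_b]`
    have h1 := ihZ (Y ++ [b]) hx ha (by simpa using hw)
    have hx' := LieIn.lie hx (.head b) (Finset.disjoint_singleton_right.2 hb)
    rw [Finset.union_comm, ← Finset.insert_eq] at hx'
    have h2 := ihZ Y hx' (Finset.mem_insert_of_mem ha) hw'.insert_head
    have e : legWord (T.map tail ++ Y.map head) * x * legWord ((b :: Z).map head) * tl a * legWord V
        = legWord (T.map tail ++ (Y ++ [b]).map head) * x * legWord (Z.map head) * tl a * legWord V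
          + legWord (T.map tail ++ Y.map head) * ⁅x, hd b⁆ * legWord (Z.map head) * tl a
            * legWord V := by
      have e1 : legWord (T.map tail ++ (Y ++ [b]).map head)
          = legWord (T.map tail ++ Y.map head) * hd b := by
        rw [legWord_mul]; simp
      rw [List.map_cons, legWord_cons, e1, Ring.lie_def]
      noncomm_ring
    rw [e, map_add]
    exact add_mem h1 h2

end Sorting

/-- Every diagram is a combination of products of arrows and wheels. -/
theorem cl_mem_wheelSpan (n : ℕ) {w : List Leg} (hw : WF w) (hl : w.length = 2 * n) :
    cl w ∈ wheelSpan n := by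
  induction n using Nat.strong_induction_on generalizing w with
  | _ n IH =>
  have IH' : ∀ m < n, ∀ w, WF w → w.length = 2 * m → cl w ∈ wheelSpan m :=
    fun m hm w hw hl => IH m hm hw hl
  -- by induction on the number `k` of tails that are not yet at the left end
  suffices h : ∀ (k : ℕ) (T : List ℕ) (V : List Leg), (tailLabels V).length = k →
      WF (T.map tail ++ V) → (T.map tail ++ V).length = 2 * n →
      cl (T.map tail ++ V) ∈ wheelSpan n from h _ [] w rfl hw hl
  intro k
  induction k with
  | zero =>
    intro T V hV hw hl
    obtain ⟨H, rfl⟩ := exists_eq_map_head (List.length_eq_zero_iff.1 hV)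
    have hn := List.nodup_append.1 hw.1
    have hT := hn.1.of_map
    have hp : H.Perm T := by
      refine (List.perm_ext_iff_of_nodup hn.2.1.of_map hT).2 fun a => ?_
      have := hw.2 a
      simpa using this.symm
    -- the heads commute with each other when they follow all the tails
    have h1 := cl_heads (K := fun x y => [] ++ x ++ [] ++ y ++ []) ⟨[], [], [], Or.inl fun _ _ => rfl⟩
      (T := T) (fun x hx => hp.mem_iff.1 hx) hp
    simp only [List.nil_append, List.append_nil] at h1
    rw [h1]
    have h2 := cl_tails_heads_mem_wheelSpan hT
    have h3 : T.length = n := by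
      have := hp.length_eq
      simp at hl
      omega
    rwa [h3] at h2
  | succ k ih =>
    intro T V hV hw hl
    obtain ⟨X, a, V, rfl⟩ := exists_first_tail (w := V) (by rintro h; simp [h] at hV)
    have hV' : (tailLabels V).length = k := by
      rw [tailLabels_append, tailLabels_map_head, tailLabels_cons_tail] at hV
      simpa using hV
    rw [← List.append_assoc] at hw hl ⊢
    have ha : head a ∈ T.map tail ++ X.map head ++ tail a :: V := (hw.2 a).1 (by simp)
    have ha' : a ∈ X ∨ head a ∈ V := by simpa using ha
    rcases ha' with h | h
    · obtain ⟨Y, Z, rfl⟩ := List.append_of_mem h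
      have hp : (T.map tail ++ (Y ++ a :: Z).map head ++ tail a :: V).Perm
          (T.map tail ++ Y.map head ++ Z.map head ++ V ++ [tail a, head a]) := by
        refine List.perm_iff_count.2 fun u => ?_
        simp [List.count_cons]
        omega
      have := clMap_move_tail_left IH' ih T Y Z (.head a) (Finset.mem_singleton_self a) V hV'
        ⟨by simpa using (WF.perm hp).1 hw, by
          have := hp.length_eq
          rw [hl] at this
          simp at this ⊢
          omega⟩
      simpa [legWord_mul, clMap_legWord] using this
    · exact cl_move_tail_left ih T X a V hV' h hw hl

/-! ### `𝒜ˢʷ(↑)` is a polynomial algebra in the arrow and the wheels -/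

theorem WF.length_eq {w : List Leg} (hw : WF w) : w.length = 2 * (labels w).card := by
  have h1 : ∀ w : List Leg, w.length = (tailLabels w).length + (headLabels w).length := fun w => by
    induction w with
    | nil => rfl
    | cons u w ih =>
      cases u <;> simp [tailLabels, headLabels] at ih ⊢ <;> omega
  obtain ⟨ht, hh⟩ := (nodup_legs w).1 hw.1
  have hp : (tailLabels w).Perm (headLabels w) := (List.perm_ext_iff_of_nodup ht hh).2 fun a => by
    rw [mem_tailLabels, mem_headLabels]
    exact hw.2 a
  have hl : labels w = (tailLabels w).toFinset := by
    ext a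
    rw [mem_labels, List.mem_toFinset, mem_tailLabels, ← hw.2 a, or_self]
  rw [hl, List.toFinset_card_of_nodup ht, h1, ← hp.length_eq]
  omega

theorem WF.exists_length {w : List Leg} (hw : WF w) : ∃ n, w.length = 2 * n := ⟨_, hw.length_eq⟩

/-- `𝒜ˢʷ(↑)` is spanned by the diagrams. -/
theorem asw_induction {p : Asw → Prop} (word : ∀ w, WF w → p (cl w))
    (add : ∀ x y, p x → p y → p (x + y)) (smul : ∀ (r : ℚ) x, p x → p (r • x)) (x : Asw) : p x := by
  obtain ⟨d, rfl⟩ := RingQuot.mkAlgHom_surjective ℚ SwRel x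
  change p (toAsw d)
  induction d using MonoidAlgebra.induction_on with
  | of D =>
    induction D using Quot.ind with
    | mk w =>
      have := word w.1 w.2
      rwa [cl, diagram, dif_pos w.2] at this
  | add x y hx hy => rw [map_add]; exact add _ _ hx hy
  | smul r x hx => rw [map_smul]; exact smul _ _ hx

/-- Wheels commute with diagrams: the legs of the diagram can be moved one by one over the wheel. -/
theorem cl_mul_wheel (k : ℕ) {v : List Leg} (hv : WF v) :
    cl v * wheel (k + 1) = wheel (k + 1) * cl v := by
  have hinj : Function.Injective (· + (k + 1)) := fun a b h => Nat.add_right_cancel h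
  rw [← cl_map hinj v]
  set v' := v.map (Leg.map (· + (k + 1))) with hv'def
  have hv' : WF v' := (wf_map hinj v).2 hv
  have hlab : ∀ u ∈ v', k < u.label := fun u hu => by
    obtain ⟨z, -, rfl⟩ := List.mem_map.1 hu
    cases z <;> simp <;> omega
  have hl : (List.range k ++ [k]).Nodup := by rw [← List.range_succ]; exact List.nodup_range
  have hk : k ∉ List.range k := by simp
  have hx := lieIn_nestedBracket (List.nodup_range (n := k)) hk
  have hX := wheel_mem_diagramWords hl
  have hXw := clMap_tails_mul_bracket hl
  rw [List.length_range] at hXw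
  set S := insert k (List.range k).toFinset with hS
  have hSm : ∀ c, c ∈ S ↔ c ≤ k := fun c => by simp [hS]; omega
  have hScard : S.card = k + 1 := by
    rw [hS, Finset.card_insert_of_notMem (by simp), List.toFinset_card_of_nodup List.nodup_range,
      List.length_range]
  have hdis : ∀ u ∈ v', u.label ∉ S := fun u hu h => by
    have := hlab u hu
    have := (hSm _).1 h
    omega
  obtain ⟨n, hn⟩ := hv'.exists_length
  rw [← hXw, ← clMap_mul_legWord hX hv' hdis, ← legWord_mul_clMap hX hv' hdis]
  have hfits : Fits (n + k + 1) S k (v' ++ (List.range k).map tail) := by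
    refine ⟨?_, ?_⟩
    · have hp : (v' ++ (List.range k).map tail ++ tail k :: S.toList.map head).Perm
          (v' ++ ((List.range k ++ [k]).map tail ++ (List.range k ++ [k]).map head)) := by
        rw [List.map_append, List.append_assoc, List.append_assoc]
        refine List.Perm.append_left _ (List.Perm.append_left _ (List.Perm.cons _ ?_))
        refine List.Perm.map _ ((List.perm_ext_iff_of_nodup (Finset.nodup_toList _) hl).2 fun c => ?_)
        rw [Finset.mem_toList, hSm]
        simp
        omega
      refine (WF.perm hp).2 (hv'.append (wf_nodup_tails_heads hl) fun x hx y hy hxy => ?_)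
      have h1 := hlab x hx
      have h2 : y.label ≤ k := by
        simp only [← List.range_succ, List.mem_append, List.mem_map, List.mem_range] at hy
        rcases hy with ⟨c, hc, rfl⟩ | ⟨c, hc, rfl⟩ <;> simp <;> omega
      omega
    · simp [hn, hScard]
      omega
  suffices h : ∀ V1 V2, V1 ++ V2 = v' → clMap (legWord V1 * (legWord ((List.range k).map tail) *
      ⁅nestedBracket (List.range k) k, tl k⁆) * legWord V2)
      = clMap (legWord ((List.range k).map tail) * ⁅nestedBracket (List.range k) k, tl k⁆
        * legWord v') by
    simpa [legWord_nil] using h v' [] (by simp)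
  intro V1
  induction V1 using List.reverseRecOn with
  | nil =>
    rintro V2 rfl
    simp [legWord_nil]
  | append_singleton V1 u ih =>
    intro V2 hV
    have hV' : V1 ++ u :: V2 = v' := by rw [← hV]; simp
    rw [← ih (u :: V2) hV', ← sub_eq_zero, ← map_sub, ← legWord_mul, legWord_cons u V2]
    cases u with
    | head b =>
      -- heads slide over the wheel, as it is an isolated part of the diagram
      have := clMap_bracket_diagramWords (legWord V1) (legWord V2) hX b
      rw [Ring.lie_def (hd b)] at this
      rw [← this]
      congr 1
      noncomm_ring
    | tail b =>
      -- tails commute with the tails of the wheel by TC and with its bracket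
      have h1 := clMap_tails_perm (T := b :: List.range k) (T' := List.range k ++ [b])
        (List.perm_append_singleton b _).symm V1
        (⁅nestedBracket (List.range k) k, tl k⁆ * legWord V2)
      have h2 := hx.clMap_tail (P := V1 ++ (List.range k).map tail) (b := b) (Q := V2)
        (n := n + k + 1) ((hSm k).2 le_rfl) (hfits.perm (by
          rw [← hV', List.append_assoc, List.append_assoc]
          refine List.Perm.append_left _ ?_
          rw [List.cons_append]
          refine (List.Perm.cons _ List.perm_append_comm).trans ?_
          exact List.perm_middle.symm))
      rw [List.map_cons, legWord_cons, List.map_append, ← legWord_mul, List.map_singleton] at h1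
      rw [map_sub, sub_eq_zero]
      rw [← legWord_mul] at h2
      have e1 : legWord V1 * tl b * (legWord ((List.range k).map tail) *
          ⁅nestedBracket (List.range k) k, tl k⁆) * legWord V2
          = legWord V1 * (tl b * legWord ((List.range k).map tail)) *
            (⁅nestedBracket (List.range k) k, tl k⁆ * legWord V2) := by noncomm_ring
      have e2 : legWord V1 * (legWord ((List.range k).map tail) *
          ⁅nestedBracket (List.range k) k, tl k⁆) * (tl b * legWord V2)
          = legWord V1 * (legWord ((List.range k).map tail) * tl b) *
            (⁅nestedBracket (List.range k) k, tl k⁆ * legWord V2)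
            + legWord V1 * legWord ((List.range k).map tail) *
              ⁅⁅nestedBracket (List.range k) k, tl k⁆, tl b⁆ * legWord V2 := by
        rw [Ring.lie_def ⁅_, _⁆]
        noncomm_ring
      rw [e1, e2, map_add, h2, h1, add_zero]

theorem wheel_mem_center (k : ℕ) : wheel k ∈ Subalgebra.center ℚ Asw := by
  rw [Subalgebra.mem_center_iff]
  cases k with
  | zero => intro x; rw [wheel, mul_one, one_mul]
  | succ k =>
    intro x
    induction x using asw_induction with
    | word w hw => exact cl_mul_wheel k hw
    | add x y hx hy => rw [add_mul, mul_add, hx, hy]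
    | smul r x hx => rw [smul_mul_assoc, mul_smul_comm, hx]

/-- The algebra is spanned by products of wheels, which are central, and powers of the arrow. -/
theorem D_A_mem_center : D_A ∈ Subalgebra.center ℚ Asw := by
  rw [Subalgebra.mem_center_iff]
  intro x
  have key : ∀ n x, IsWheelMonomial n x → x * D_A = D_A * x := fun n x hx => by
    induction hx with
    | one => simp
    | arrow _ ih => rw [← mul_assoc, ← ih]
    | @wheel n k x hk _ ih =>
      rw [mul_assoc, ih, ← mul_assoc, ← mul_assoc,
        (Subalgebra.mem_center_iff.1 (wheel_mem_center k) D_A)]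
  induction x using asw_induction with
  | word w hw =>
    obtain ⟨n, hn⟩ := hw.exists_length
    refine Submodule.span_induction (p := fun x _ => x * D_A = D_A * x) ?_ ?_ ?_ ?_
      (cl_mem_wheelSpan n hw hn)
    · exact fun x hx => key n x hx
    · simp
    · intro x y _ _ hx hy; rw [add_mul, mul_add, hx, hy]
    · intro r x _ hx; rw [smul_mul_assoc, mul_smul_comm, hx]
  | add x y hx hy => rw [add_mul, mul_add, hx, hy]
  | smul r x hx => rw [smul_mul_assoc, mul_smul_comm, hx]

/-- The map from polynomials to `𝒜ˢʷ(↑)` that sends the first variable to the arrow and the other ones to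
the wheels. -/
noncomputable def ofPolynomial : MvPolynomial ℕ ℚ →ₐ[ℚ] Asw :=
  (Subalgebra.center ℚ Asw).val.comp (MvPolynomial.aeval fun k =>
    if k = 1 then ⟨D_A, D_A_mem_center⟩ else ⟨wheel k, wheel_mem_center k⟩)

/-- The universal weight system has a left inverse, since an element of `𝒜ˢʷ(↑)` is a polynomial in the arrow
and the wheels. -/
theorem ofPolynomial_weightSystem (x : Asw) : ofPolynomial (weightSystem MvPolynomial.X x) = x := by
  have key : ∀ n x, IsWheelMonomial n x → ofPolynomial (weightSystem MvPolynomial.X x) = x :=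
    fun n x hx => by
    induction hx with
    | one => simp
    | arrow _ ih =>
      rw [map_mul, map_mul, ih, weightSystem_D_A]
      congr 1
      simp [ofPolynomial]
    | @wheel n k x hk _ ih =>
      rw [map_mul, map_mul, ih, weightSystem_wheel _ hk]
      congr 1
      have : k ≠ 1 := by omega
      simp [ofPolynomial, this]
  induction x using asw_induction with
  | word w hw =>
    obtain ⟨n, hn⟩ := hw.exists_length
    refine Submodule.span_induction
      (p := fun x _ => ofPolynomial (weightSystem MvPolynomial.X x) = x) ?_ ?_ ?_ ?_
      (cl_mem_wheelSpan n hw hn)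
    · exact fun x hx => key n x hx
    · simp
    · intro x y _ _ hx hy; rw [map_add, map_add, hx, hy]
    · intro r x _ hx; rw [map_smul, map_smul, hx]
  | add x y hx hy => rw [map_add, map_add, hx, hy]
  | smul r x hx => rw [map_smul, map_smul, hx]

/-- The weight systems separate the elements of `𝒜ˢʷ(↑)`. -/
theorem weightSystem_X_injective :
    Function.Injective (weightSystem (MvPolynomial.X : ℕ → MvPolynomial ℕ ℚ)) :=
  Function.LeftInverse.injective ofPolynomial_weightSystem

/-! ### Sums over bundles of arrows -/

section Bundle

variable {Λ : Type*} {ι κ : Type*}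

/-- The signed trapping matrix of a diagram in which each arrow is replaced by a bundle of parallel arrows,
one for each index that `f` maps to it. An entry depends on the arrows to which its two indices belong,
through `P` if the first index comes first and through `Q` otherwise. -/
def bundleMatrix [LinearOrder ι] (P Q : Λ → Λ → ℚ) (f : ι → Λ) (i j : ι) : ℚ :=
  if i = j then 1 else if i < j then P (f i) (f j) else Q (f i) (f j)

theorem bundleMatrix_comp [LinearOrder ι] [LinearOrder κ] (P Q : Λ → Λ → ℚ) (f : ι → Λ)
    (e : κ ↪o ι) (i j : κ) :
    bundleMatrix P Q f (e i) (e j) = bundleMatrix P Q (f ∘ e) i j := by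
  simp [bundleMatrix]

variable [Fintype Λ] {R : Type*} [CommRing R] [Algebra ℚ R]

/-- `n!` times the degree `n` part of the value of a weight system on the expansion. -/
noncomputable def bundleSum (y : ℕ → R) (P Q : Λ → Λ → ℚ) (v : Λ → ℚ) (n : ℕ) : R :=
  ∑ f : Fin n → Λ, (∏ i, v (f i)) • cycleSum y (bundleMatrix P Q f) Finset.univ

/-- The contribution of a single cycle of length `n` to `bundleSum`. -/
noncomputable def bundleCycle (P Q : Λ → Λ → ℚ) (v : Λ → ℚ) (n : ℕ) : ℚ :=
  ∑ f : Fin n → Λ, (∏ i, v (f i)) * cyclicSum (bundleMatrix P Q f) Finset.univ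

/-- A map on `n` points is a pair of maps, one on `C` and one on its complement. -/
theorem sum_arrow_split {n k m : ℕ} {C : Finset (Fin n)} (hC : C.card = k) (hD : Cᶜ.card = m)
    {M : Type*} [AddCommMonoid M] (F : (Fin k → Λ) → (Fin m → Λ) → M) :
    ∑ f : Fin n → Λ, F (f ∘ C.orderEmbOfFin hC) (f ∘ Cᶜ.orderEmbOfFin hD)
      = ∑ g : Fin k → Λ, ∑ h : Fin m → Λ, F g h := by
  rw [← Fintype.sum_prod_type']
  refine Fintype.sum_equiv ((Equiv.arrowCongr (finSumEquivOfFinset hC hD).symm (Equiv.refl Λ)).trans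
    (Equiv.sumArrowEquivProdArrow _ _ _)) _ _ fun f => ?_
  rfl

theorem bundleSum_zero (y : ℕ → R) (P Q : Λ → Λ → ℚ) (v : Λ → ℚ) : bundleSum y P Q v 0 = 1 := by
  simp [bundleSum, cycleSum_empty]

theorem bundleCycle_one (P Q : Λ → Λ → ℚ) (v : Λ → ℚ) : bundleCycle P Q v 1 = ∑ a, v a := by
  have h : ∀ f : Fin 1 → Λ, cyclicSum (bundleMatrix P Q f) Finset.univ = 1 := fun f => by
    have : cyclesOn (Finset.univ : Finset (Fin 1)) = {1} := by
      ext π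
      rw [mem_cyclesOn, Subsingleton.elim π 1]
      simp [permsOn, Subsingleton.elim _ (0 : Fin 1)]
    rw [cyclicSum, this]
    simp [bundleMatrix]
  simp only [bundleCycle, h, mul_one]
  refine Fintype.sum_equiv (Equiv.funUnique (Fin 1) Λ) _ _ fun f => by simp

/-- A permutation of `n + 1` indices consists of the cycle through the index `0` and of a permutation of the
remaining ones. -/
theorem bundleSum_succ (y : ℕ → R) (P Q : Λ → Λ → ℚ) (v : Λ → ℚ) (n : ℕ) :
    bundleSum y P Q v (n + 1) = ∑ k ∈ Finset.range (n + 1),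
      ((n.choose k : ℚ) * bundleCycle P Q v (k + 1)) • (y (k + 1) * bundleSum y P Q v (n - k)) := by
  classical
  have h1 : ∀ C : Finset (Fin (n + 1)), ∑ f : Fin (n + 1) → Λ, (∏ i, v (f i)) •
      cyclicSum (bundleMatrix P Q f) C • (y C.card * cycleSum y (bundleMatrix P Q f) Cᶜ)
      = bundleCycle P Q v C.card • (y C.card * bundleSum y P Q v (n + 1 - C.card)) := fun C => by
    have hD : Cᶜ.card = n + 1 - C.card := by rw [Finset.card_compl, Fintype.card_fin]
    have hmap : ∀ {m} {S : Finset (Fin (n + 1))} (hS : S.card = m),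
        Finset.univ.map (S.orderEmbOfFin hS).toEmbedding = S := fun hS => by
      ext i
      rw [← Finset.mem_coe, Finset.coe_map, Finset.coe_univ, Set.image_univ]
      simp
    have hcyc : ∀ f : Fin (n + 1) → Λ, cyclicSum (bundleMatrix P Q f) C
        = cyclicSum (bundleMatrix P Q (f ∘ C.orderEmbOfFin rfl)) Finset.univ := fun f => by
      conv_lhs => rw [← hmap (S := C) rfl, cyclicSum_map]
      congr 1
      funext i j
      exact bundleMatrix_comp P Q f (C.orderEmbOfFin rfl) i j
    have hsum : ∀ f : Fin (n + 1) → Λ, cycleSum y (bundleMatrix P Q f) Cᶜ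
        = cycleSum y (bundleMatrix P Q (f ∘ Cᶜ.orderEmbOfFin hD)) Finset.univ := fun f => by
      conv_lhs => rw [← hmap (S := Cᶜ) hD, cycleSum_map]
      congr 1
      funext i j
      exact bundleMatrix_comp P Q f (Cᶜ.orderEmbOfFin hD) i j
    have hprod : ∀ f : Fin (n + 1) → Λ, ∏ i, v (f i)
        = (∏ i, v ((f ∘ C.orderEmbOfFin rfl) i)) * ∏ i, v ((f ∘ Cᶜ.orderEmbOfFin hD) i) := fun f => by
      rw [← Finset.prod_mul_prod_compl C]
      congr 1
      · conv_lhs => rw [← hmap (S := C) rfl, Finset.prod_map]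
        rfl
      · conv_lhs => rw [← hmap (S := Cᶜ) hD, Finset.prod_map]
        rfl
    simp only [hcyc, hsum, hprod]
    rw [sum_arrow_split rfl hD fun g h => ((∏ i, v (g i)) * ∏ i, v (h i)) •
      cyclicSum (bundleMatrix P Q g) Finset.univ •
        (y C.card * cycleSum y (bundleMatrix P Q h) Finset.univ)]
    rw [bundleCycle, bundleSum, Finset.sum_smul]
    refine Finset.sum_congr rfl fun g _ => ?_
    rw [Finset.mul_sum, Finset.smul_sum]
    refine Finset.sum_congr rfl fun h _ => ?_
    simp only [mul_smul_comm, smul_smul]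
    congr 1
    ring
  rw [bundleSum]
  simp only [cycleSum_eq_sum_cycle y _ (Finset.mem_univ (0 : Fin (n + 1))), Finset.smul_sum,
    ← Finset.compl_eq_univ_sdiff]
  rw [Finset.sum_comm]
  simp only [h1]
  -- the cycle through `0` consists of `0` and of a subset of the other indices
  have h2 : ∀ F : ℕ → R, ∑ C ∈ (Finset.univ : Finset (Fin (n + 1))).powerset.filter
      ((0 : Fin (n + 1)) ∈ ·), F C.card = ∑ B ∈ (Finset.univ : Finset (Fin n)).powerset,
        F (B.card + 1) := fun F => by
    symm
    refine Finset.sum_nbij' (fun B => insert 0 (B.map (Fin.succEmb n)))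
      (fun C => Finset.univ.filter fun i => i.succ ∈ C) ?_ ?_ ?_ ?_ ?_
    · simp
    · simp
    · intro B _
      ext i
      simp [Fin.succ_ne_zero]
    · intro C hC
      ext i
      refine Fin.cases ?_ (fun i => ?_) i
      · simpa using hC
      · simp [Fin.succ_ne_zero]
    · intro B _
      rw [Finset.card_insert_of_notMem (by simp [Fin.succ_ne_zero]), Finset.card_map]
  rw [h2 fun k => bundleCycle P Q v k • (y k * bundleSum y P Q v (n + 1 - k))]
  rw [Finset.sum_powerset_apply_card (fun k => bundleCycle P Q v (k + 1) •
    (y (k + 1) * bundleSum y P Q v (n + 1 - (k + 1)))), Finset.card_univ, Fintype.card_fin]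
  refine Finset.sum_congr rfl fun k _ => ?_
  rw [Nat.add_sub_add_right, mul_smul, Nat.cast_smul_eq_nsmul]

end Bundle

/-! ### Weight systems of the expansion -/

theorem pairwise_idxOf {w : List Leg} (hw : w.Nodup) :
    w.Pairwise fun u v => w.idxOf u < w.idxOf v := by
  rw [List.pairwise_iff_getElem]
  intro i j hi hj hij
  rwa [hw.idxOf_getElem, hw.idxOf_getElem]

theorem mem_labels_blowup {w : List Leg} {n : ℕ} {f : Fin n → ℕ} (hf : ∀ i, f i ∈ labels w)
    {a : ℕ} :
    a ∈ labels (blowup f w) ↔ ∃ k : Fin n, (k : ℕ) = a := by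
  simp only [mem_labels, blowup, List.mem_flatMap]
  constructor
  · rintro (⟨u, -, h⟩ | ⟨u, -, h⟩) <;> cases u <;> simp [strands] at h
    all_goals
      obtain ⟨i, -, rfl⟩ := h
      exact ⟨i, rfl⟩
  · rintro ⟨k, rfl⟩
    rcases mem_labels.1 (hf k) with h | h
    · exact Or.inl ⟨_, h, by simpa [strands] using ⟨k, rfl, rfl⟩⟩
    · exact Or.inr ⟨_, h, by simpa [strands] using ⟨k, rfl, rfl⟩⟩

/-- In the diagram with bundles the legs are ordered lexicographically: first by the places of their bundles
and then by their names. As both ends of a bundle are ordered in the same way, two arrows `i < j` of one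
bundle have the head of `j` after that of `i`. -/
theorem crossingMatrix_blowup {w : List Leg} (hw : WF w) {n : ℕ} {f : Fin n → ℕ}
    (hf : ∀ i, f i ∈ labels w) (i j : Fin n) :
    crossingMatrix (blowup f w) i j = bundleMatrix
      (fun a b => (if Before w (head a) (head b) ∨ a = b then 1 else 0)
        - (if Before w (tail a) (head b) then 1 else 0))
      (fun a b => (if Before w (head a) (head b) then 1 else 0)
        - (if Before w (tail a) (head b) then 1 else 0)) f i j := by
  have hmem : ∀ {a x}, x ∈ strands f a ↔ ∃ i, f i = a ∧ (i : ℕ) = x := by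
    simp [strands]
  have htail : ∀ i, tail (f i) ∈ w := fun i => by
    rcases mem_labels.1 (hf i) with h | h
    exacts [h, (hw.2 _).2 h]
  have hhead : ∀ i, head (f i) ∈ w := fun i => (hw.2 _).1 (htail i)
  set f' : ℕ → ℕ := fun x => if h : x < n then f ⟨x, h⟩ else 0 with hf'
  have hf'i : ∀ i : Fin n, f' i = f i := fun i => by simp [hf']
  have hpair : ∀ a, (strands f a).Pairwise (· < ·) := fun a => by
    rw [strands, List.pairwise_map]
    exact (List.pairwise_lt_finRange n).filter _
  -- the position in the lexicographic order
  let key : Leg → ℕ := fun u => w.idxOf (u.map f') * n + u.label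
  have hlt : ∀ p q (i j : Fin n), p * n + i < q * n + j ↔ p < q ∨ (p = q ∧ i < j) := fun p q i j => by
    have hi := i.2
    have hj := j.2
    rcases lt_trichotomy p q with h | h | h
    · have : (p + 1) * n ≤ q * n := Nat.mul_le_mul_right _ h
      rw [add_mul] at this
      simp only [h, true_or, iff_true]
      omega
    · subst h; simp
    · have : (q + 1) * n ≤ p * n := Nat.mul_le_mul_right _ h
      rw [add_mul] at this
      simp only [h.not_gt, h.ne', false_and, or_self, iff_false]
      omega
  have hkey : (blowup f w).Pairwise fun u v => key u < key v := by
    rw [blowup, List.pairwise_flatMap]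
    refine ⟨?_, ?_⟩
    · rintro (a | a) -
      all_goals
        rw [List.pairwise_map]
        refine (hpair a).imp_of_mem fun {x y} hx hy h => ?_
        obtain ⟨i, hi, rfl⟩ := hmem.1 hx
        obtain ⟨j, hj, rfl⟩ := hmem.1 hy
        simp only [key, map_tail, map_head, hf'i, label_tail, label_head, hi, hj, hlt]
        exact Or.inr ⟨trivial, h⟩
    · refine (pairwise_idxOf hw.1).imp fun {u v} h => ?_
      intro x hx y hy
      rcases u with a | a <;> rcases v with b | b
      all_goals
        simp only [List.mem_map] at hx hy
        obtain ⟨x, hx, rfl⟩ := hx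
        obtain ⟨y, hy, rfl⟩ := hy
        obtain ⟨i, hi, rfl⟩ := hmem.1 hx
        obtain ⟨j, hj, rfl⟩ := hmem.1 hy
        simp only [key, map_tail, map_head, hf'i, label_tail, label_head, hi, hj, hlt]
        exact Or.inl h
  have ht : ∀ i : Fin n, tail (i : ℕ) ∈ blowup f w := fun i =>
    List.mem_flatMap.2 ⟨_, htail i, List.mem_map.2 ⟨i, hmem.2 ⟨i, rfl, rfl⟩, rfl⟩⟩
  have hh : ∀ i : Fin n, head (i : ℕ) ∈ blowup f w := fun i =>
    List.mem_flatMap.2 ⟨_, hhead i, List.mem_map.2 ⟨i, hmem.2 ⟨i, rfl, rfl⟩, rfl⟩⟩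
  have hidx : ∀ i j, w.idxOf (head (f i)) = w.idxOf (head (f j)) ↔ f i = f j := fun i j => by
    rw [List.idxOf_inj (hhead i)]
    simp
  have hidx' : ∀ i j, w.idxOf (tail (f i)) ≠ w.idxOf (head (f j)) := fun i j h => by
    rw [List.idxOf_inj (htail i)] at h
    simp at h
  have b1 : Before (blowup f w) (head i) (head j)
      ↔ Before w (head (f i)) (head (f j)) ∨ (f i = f j ∧ i < j) := by
    rw [before_iff_key hkey (hh i) (hh j)]
    simp only [key, map_head, hf'i, label_head, hlt, hidx, Before]
  have b2 : Before (blowup f w) (tail i) (head j) ↔ Before w (tail (f i)) (head (f j)) := by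
    rw [before_iff_key hkey (ht i) (hh j)]
    simp only [key, map_head, map_tail, hf'i, label_head, label_tail, hlt, hidx', Before, false_and,
      or_false]
  simp only [crossingMatrix, bundleMatrix, b1, b2, Fin.val_inj]
  by_cases hij : i = j
  · simp [hij]
  · by_cases h : i < j <;> simp [hij, h]

/-- The values of the weight systems on the expansion of a Gauss diagram are sums over bundles. -/
theorem weightSystem_expansionCoeff {R : Type*} [CommRing R] [Algebra ℚ R] (y : ℕ → R) {w : List Leg}
    (hw : WF w) (s : ℕ → ℤˣ) (n : ℕ) :
    weightSystem y (expansionCoeff w s n) = (n.factorial : ℚ)⁻¹ • bundleSum y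
      (fun a b : {a // a ∈ labels w} => (if Before w (head a) (head b) ∨ a = b then 1 else 0)
        - (if Before w (tail a) (head b) then 1 else 0))
      (fun a b => (if Before w (head a) (head b) then 1 else 0)
        - (if Before w (tail a) (head b) then 1 else 0)) (fun a => ((s a : ℤ) : ℚ)) n := by
  have hb : ∀ f : Fin n → ℕ, (∀ i, f i ∈ labels w) →
      weightSystem y (toAsw (diagram (blowup f w)))
        = cycleSum y (fun i j : Fin n => crossingMatrix (blowup f w) i j) Finset.univ := fun f hf => by
    obtain ⟨h1, h2⟩ := wf_blowup hw hf
    change weightSystem y (cl _) = _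
    rw [weightSystem_cl y h1, weight_eq y (e := Fin.val) Fin.val_injective]
    exact fun a => mem_labels_blowup hf
  rw [expansionCoeff, map_sum, bundleSum, Finset.smul_sum]
  symm
  refine Finset.sum_bij (fun f _ i => (f i : ℕ)) ?_ ?_ ?_ ?_
  · intro f _
    simp
  · intro f _ g _ h
    funext i
    exact Subtype.ext (congrFun h i)
  · intro f hf
    rw [Fintype.mem_piFinset] at hf
    exact ⟨fun i => ⟨f i, hf i⟩, Finset.mem_univ _, rfl⟩
  · intro f _
    rw [map_smul, hb _ fun i => (f i).2, smul_smul]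
    congr 1
    refine cycleSum_congr y fun i _ j _ => ?_
    rw [crossingMatrix_blowup hw fun i => (f i).2]
    simp only [bundleMatrix, Subtype.ext_iff]

/-! ### Exponentials and logarithms of power series -/

section ExpLog

open PowerSeries

variable {R : Type*} [CommRing R] [Algebra ℚ R]

/-- The differential equation `E' = F' E` determines `E` up to its constant coefficient. -/
theorem eq_of_derivative_eq_mul {F E E' : PowerSeries R}
    (hE : derivative R E = derivative R F * E) (hE' : derivative R E' = derivative R F * E')
    (h0 : constantCoeff E = constantCoeff E') : E = E' := by
  ext n
  induction n using Nat.strong_induction_on with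
  | _ n ih =>
    cases n with
    | zero => simpa using h0
    | succ n =>
      have h1 := congrArg (coeff n) hE
      have h2 := congrArg (coeff n) hE'
      rw [coeff_derivative, coeff_mul] at h1 h2
      have h3 : coeff (n + 1) E * ((n : R) + 1) = coeff (n + 1) E' * ((n : R) + 1) := by
        rw [h1, h2]
        refine Finset.sum_congr rfl fun p hp => ?_
        rw [ih p.2 (by have := Finset.HasAntidiagonal.mem_antidiagonal.1 hp; omega)]
      have hu : IsUnit ((n : R) + 1) := by
        have := (isUnit_iff_ne_zero.2 (Nat.cast_add_one_ne_zero (R := ℚ) n)).map (algebraMap ℚ R)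
        simpa using this
      exact hu.mul_right_cancel h3

theorem coeff_pow_eq_zero {R : Type*} [CommRing R] {F : PowerSeries R} (hF : constantCoeff F = 0)
    {n k : ℕ} (h : n < k) : coeff n (F ^ k) = 0 :=
  X_pow_dvd_iff.1 (pow_dvd_pow_of_dvd (X_dvd_iff.2 hF) k) n h

theorem constantCoeff_expSeries (F : PowerSeries R) : constantCoeff (expSeries F) = 1 := by
  rw [← coeff_zero_eq_constantCoeff_apply]
  simp [expSeries]

theorem derivative_expSeries {F : PowerSeries R} (hF : constantCoeff F = 0) :
    derivative R (expSeries F) = derivative R F * expSeries F := by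
  -- a coefficient of the exponential may be computed from any longer partial sum
  have hN : ∀ {n N}, n ≤ N → coeff n (expSeries F)
      = ∑ k ∈ Finset.range (N + 1), (k.factorial : ℚ)⁻¹ • coeff n (F ^ k) := fun {n N} h => by
    rw [expSeries, coeff_mk]
    refine Finset.sum_subset (Finset.range_mono (by omega)) fun k _ hk => ?_
    rw [coeff_pow_eq_zero hF (by simpa using hk), smul_zero]
  ext n
  have h1 : coeff n (derivative R F * expSeries F) = ∑ k ∈ Finset.range (n + 1),
      (k.factorial : ℚ)⁻¹ • coeff n (derivative R F * F ^ k) := by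
    simp only [coeff_mul, Finset.smul_sum]
    rw [Finset.sum_comm]
    refine Finset.sum_congr rfl fun p hp => ?_
    rw [hN (N := n) (by have := Finset.HasAntidiagonal.mem_antidiagonal.1 hp; omega), Finset.mul_sum]
    simp only [mul_smul_comm]
  rw [h1, coeff_derivative, expSeries, coeff_mk, Finset.sum_range_succ']
  simp only [pow_zero, coeff_one, Nat.succ_ne_zero, if_false, smul_zero, add_zero]
  rw [Finset.sum_mul]
  refine Finset.sum_congr rfl fun k _ => ?_
  rw [smul_mul_assoc, ← coeff_derivative, Derivation.leibniz_pow, Nat.add_sub_cancel]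
  simp only [smul_eq_mul, nsmul_eq_mul]
  have hk : ((k.factorial : ℚ))⁻¹ = ((k + 1).factorial : ℚ)⁻¹ * (k + 1 : ℕ) := by
    rw [Nat.factorial_succ]
    have := Nat.factorial_ne_zero k
    push_cast
    field_simp
  rw [hk, mul_smul, mul_comm (F ^ k), Nat.cast_smul_eq_nsmul, ← map_nsmul, nsmul_eq_mul]

theorem expSeries_add {F G : PowerSeries R} (hF : constantCoeff F = 0) (hG : constantCoeff G = 0) :
    expSeries (F + G) = expSeries F * expSeries G := by
  refine eq_of_derivative_eq_mul (derivative_expSeries (by simp [hF, hG])) ?_ ?_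
  · rw [Derivation.leibniz, derivative_expSeries hF, derivative_expSeries hG, map_add]
    simp only [smul_eq_mul]
    ring
  · simp [constantCoeff_expSeries]

theorem map_expSeries {A B : Type*} [Ring A] [Algebra ℚ A] [Ring B] [Algebra ℚ B] (φ : A →ₐ[ℚ] B)
    (F : PowerSeries A) :
    PowerSeries.map φ.toRingHom (expSeries F) = expSeries (PowerSeries.map φ.toRingHom F) := by
  ext n
  rw [coeff_map, expSeries, expSeries, coeff_mk, coeff_mk, map_sum]
  refine Finset.sum_congr rfl fun k _ => ?_
  rw [← map_pow, coeff_map]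
  exact map_smul φ _ _

theorem logOf_expSeries {F : PowerSeries ℚ} (hF : constantCoeff F = 0) :
    logOf (expSeries F) = F := by
  have h0 := constantCoeff_expSeries F
  have hs : HasSubst (expSeries F - 1) := HasSubst.of_constantCoeff_zero' (by simp [h0])
  -- the two sides have the same derivative, as the logarithm has the derivative `1 / (1 + X)`
  have hlog : (1 + X) * derivative ℚ (log ℚ) = 1 := by
    rw [deriv_log]
    ext n
    rw [add_mul, one_mul, map_add]
    cases n with
    | zero => simp
    | succ n => simp [coeff_succ_X_mul, coeff_one, pow_succ]
  have h1 : expSeries F * (derivative ℚ (log ℚ)).subst (expSeries F - 1) = 1 := by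
    have := congrArg (substAlgHom (R := ℚ) hs) hlog
    rw [map_mul, map_add, map_one, coe_substAlgHom, subst_X hs] at this
    rwa [add_sub_cancel] at this
  refine derivative.ext ?_ (by rw [constantCoeff_logOf h0, hF])
  rw [logOf_eq, derivative_subst hs, map_sub, derivative_expSeries hF,
    Derivation.map_one_eq_zero, sub_zero]
  linear_combination (derivative ℚ F) * h1

end ExpLog

/-! ### Determinants of bundles -/

section BundleDet

open Matrix

/-- The determinant of a matrix that is triangular for some order of its indices. -/
theorem det_of_blockTriangular_injective {m α R : Type*} [Fintype m] [DecidableEq m] [LinearOrder α]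
    [CommRing R] {M : Matrix m m R} {b : m → α} (hb : Function.Injective b)
    (hM : M.BlockTriangular b) : M.det = ∏ i, M i i := by
  let _ : LinearOrder m := LinearOrder.lift' b hb
  have h : M.BlockTriangular id := fun i j hij => hM (show b j < b i from hij)
  convert det_of_isUpperTriangular h

variable {Λ : Type*} [Fintype Λ] [DecidableEq Λ]

/-- The determinant of a matrix in which the arrow `a` is replaced by a bundle of parallel arrows only
depends on the matrix `C` of the arrows and on which bundles are not empty. Here `ν a` is minus the
direction of the arrow `a`: two arrows in its bundle contribute `-1` above the diagonal if `ν a = 1`, and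
`1` below the diagonal if `ν a = -1`. -/
theorem det_bundle {n : ℕ} (f : Fin n → Λ) (ν : Λ → ℚ) (hν : ∀ a, ν a = 1 ∨ ν a = -1)
    (C : Matrix Λ Λ ℚ) (hC : ∀ a, C a a = 0) :
    (Matrix.of fun i j => (if f i = f j then
        (if ν (f i) = 1 then (if i < j then -1 else 0) else (if j < i then 1 else 0)) else 0)
        + C (f i) (f j)).det
      = (∏ i, ν (f i)) *
        (Matrix.of fun a b => if b ∈ Set.range f then ν b * C a b else if a = b then 1 else 0).det := by
  classical
  -- adding `ν a` to all the entries of the block of each bundle turns the diagonal blocks into the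
  -- triangular matrix `L`
  let L : Matrix (Fin n) (Fin n) ℚ := Matrix.of fun i j => if f i = f j then
    (if ν (f i) = 1 then (if j ≤ i then 1 else 0) else (if i ≤ j then -1 else 0)) else 0
  -- the incidence matrix of indices and bundles
  let E : Matrix (Fin n) Λ ℚ := Matrix.of fun i a => if f i = a then 1 else 0
  let C' : Matrix Λ Λ ℚ := C - Matrix.diagonal ν
  -- the first or the last index of a bundle
  let Pivot : Fin n → Prop := fun i => ∀ j, f j = f i → if ν (f i) = 1 then i ≤ j else j ≤ i
  -- the column of `L` at the pivot of the bundle of `a` is `ν a` on that bundle, whence `L * V = E`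
  let V : Matrix (Fin n) Λ ℚ := Matrix.of fun i a => if f i = a ∧ Pivot i then ν a else 0
  have hex : ∀ k, ∃ p, f p = f k ∧ Pivot p := fun k => by
    have hne : (Finset.univ.filter fun j => f j = f k).Nonempty := ⟨k, by simp⟩
    by_cases h1 : ν (f k) = 1
    · obtain ⟨p, hp, hmin⟩ := Finset.exists_min_image _ id hne
      have hp' : f p = f k := by simpa using hp
      refine ⟨p, hp', fun j hj => ?_⟩
      rw [if_pos (by rw [hp', h1])]
      exact hmin j (by simp [hj, hp'])
    · obtain ⟨p, hp, hmax⟩ := Finset.exists_max_image _ id hne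
      have hp' : f p = f k := by simpa using hp
      refine ⟨p, hp', fun j hj => ?_⟩
      rw [if_neg (by rwa [hp'])]
      exact hmax j (by simp [hj, hp'])
  have huniq : ∀ i j, f i = f j → Pivot i → Pivot j → i = j := fun i j hij hi hj => by
    have h1 := hi j hij.symm
    have h2 := hj i hij
    rw [← hij] at h2
    split_ifs at h1 h2 <;> omega
  have hN : (Matrix.of fun i j => (if f i = f j then
        (if ν (f i) = 1 then (if i < j then -1 else 0) else (if j < i then 1 else 0)) else 0)
        + C (f i) (f j)) = L + E * C' * Eᵀ := by
    ext i j
    have hE : (E * C' * Eᵀ) i j = C' (f i) (f j) := by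
      simp [Matrix.mul_apply, E]
    rw [Matrix.add_apply, hE]
    simp only [Matrix.of_apply, L, C', Matrix.sub_apply, Matrix.diagonal_apply]
    by_cases hf : f i = f j
    · rw [← hf]
      rcases hν (f i) with h1 | h1
      · simp only [h1, if_true]
        rcases lt_or_ge i j with h | h
        · rw [if_pos h, if_neg h.not_ge]; ring
        · rw [if_neg h.not_gt, if_pos h]; ring
      · have : ¬ ((-1 : ℚ) = 1) := by norm_num
        simp only [h1, this, if_true, if_false]
        rcases lt_or_ge j i with h | h
        · rw [if_pos h, if_neg h.not_ge]; ring
        · rw [if_neg h.not_gt, if_pos h]; ring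
    · simp [hf]
  have hLV : L * V = E := by
    ext i a
    simp only [Matrix.mul_apply, Matrix.of_apply, L, V, E]
    by_cases hf : f i = a
    · subst hf
      obtain ⟨p, hp, hpiv⟩ := hex i
      rw [Finset.sum_eq_single p]
      · have h := hpiv i hp.symm
        rw [hp] at h
        rcases hν (f i) with h1 | h1
        · rw [if_pos h1] at h
          simp [hp, hpiv, h1, h]
        · rw [if_neg (by rw [h1]; norm_num)] at h
          have : ¬ ((-1 : ℚ) = 1) := by norm_num
          simp [hp, hpiv, h1, h, this]
      · intro j _ hj
        rw [if_neg (c := _ ∧ _), mul_zero]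
        rintro ⟨h1, h2⟩
        exact hj (huniq _ _ (h1.trans hp.symm) h2 hpiv)
      · simp
    · rw [if_neg hf]
      refine Finset.sum_eq_zero fun j _ => ?_
      by_cases hj : f j = a
      · rw [if_neg (by rw [hj]; exact hf), zero_mul]
      · rw [if_neg (c := _ ∧ _) (fun h => hj h.1), mul_zero]
  have hEV : Eᵀ * V = Matrix.diagonal fun a => if a ∈ Set.range f then ν a else 0 := by
    ext a b
    simp only [Matrix.mul_apply, Matrix.transpose_apply, Matrix.of_apply, V, E, Matrix.diagonal_apply]
    by_cases hab : a = b
    · subst hab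
      rw [if_pos rfl]
      split_ifs with hr
      · obtain ⟨k, rfl⟩ := hr
        obtain ⟨p, hp, hpiv⟩ := hex k
        rw [Finset.sum_eq_single p]
        · simp [hp, hpiv]
        · intro j _ hj
          rw [if_neg (c := _ ∧ _), mul_zero]
          rintro ⟨h1, h2⟩
          exact hj (huniq _ _ (h1.trans hp.symm) h2 hpiv)
        · simp
      · refine Finset.sum_eq_zero fun j _ => ?_
        rw [if_neg (fun h => hr ⟨j, h⟩), zero_mul]
    · rw [if_neg hab]
      refine Finset.sum_eq_zero fun j _ => ?_
      by_cases hj : f j = a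
      · rw [if_neg (c := _ ∧ _) (fun h => hab (hj.symm.trans h.1)), mul_zero]
      · rw [if_neg hj, zero_mul]
  have hL : L.det = ∏ i, ν (f i) := by
    rw [det_of_blockTriangular_injective
      (b := fun i : Fin n => if ν (f i) = 1 then -1 - (i : ℤ) else (i : ℤ))]
    · refine Finset.prod_congr rfl fun i _ => ?_
      rcases hν (f i) with h1 | h1
      · simp [L, h1]
      · have : ¬ ((-1 : ℚ) = 1) := by norm_num
        simp [L, h1, this]
    · intro i j hij
      apply Fin.ext
      dsimp only at hij
      split_ifs at hij <;> omega
    · intro i j hij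
      simp only [L, Matrix.of_apply]
      dsimp only at hij
      by_cases hf : f i = f j
      · rw [if_pos hf]
        rw [← hf] at hij
        by_cases h1 : ν (f i) = 1
        · simp only [h1, if_true] at hij ⊢
          rw [if_neg (by rw [Fin.le_def]; omega)]
        · simp only [h1, if_false] at hij ⊢
          rw [if_neg (by rw [Fin.le_def]; omega)]
      · rw [if_neg hf]
  have hfac : L + E * C' * Eᵀ = L * (1 + V * (C' * Eᵀ)) := by
    rw [Matrix.mul_add, Matrix.mul_one, ← Matrix.mul_assoc L, hLV, Matrix.mul_assoc]
  -- `det (1 + X Y) = det (1 + Y X)` leads to a determinant that is indexed by the arrows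
  rw [hN, hfac, Matrix.det_mul, hL, Matrix.det_one_add_mul_comm, Matrix.mul_assoc, hEV]
  congr 2
  ext a b
  rw [Matrix.add_apply, Matrix.mul_diagonal, Matrix.of_apply]
  simp only [C', Matrix.sub_apply, Matrix.diagonal_apply, Matrix.one_apply]
  have hsq : ν b * ν b = 1 := by rcases hν b with h | h <;> rw [h] <;> norm_num
  by_cases hab : a = b
  · subst hab
    simp only [if_true, hC]
    split_ifs
    · linear_combination -hsq
    · ring
  · simp only [hab, if_false]
    split_ifs <;> ring

/-- The exponential generating function of the maps onto `S`. -/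
theorem sum_range_eq_prod_exp (v : Λ → ℚ) (S : Finset Λ) :
    (PowerSeries.mk fun n => (n.factorial : ℚ)⁻¹ *
        ∑ f : Fin n → Λ, if Finset.univ.image f = S then ∏ i, v (f i) else 0)
      = ∏ a ∈ S, (PowerSeries.rescale (v a) (PowerSeries.exp ℚ) - 1) := by
  induction S using Finset.strongInduction with
  | H S ih =>
    -- the two sides agree when summed over all subsets of `S`: for the maps into `S` both sums are the
    -- exponential of `∑ a ∈ S, v a`
    have h1 : ∑ B ∈ S.powerset, (PowerSeries.mk fun n => (n.factorial : ℚ)⁻¹ *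
        ∑ f : Fin n → Λ, if Finset.univ.image f = B then ∏ i, v (f i) else 0)
        = ∑ B ∈ S.powerset, ∏ a ∈ B, (PowerSeries.rescale (v a) (PowerSeries.exp ℚ) - 1) := by
      rw [← Finset.prod_one_add]
      simp only [add_sub_cancel]
      have h2 : ∀ B : Finset Λ, ∏ a ∈ B, PowerSeries.rescale (v a) (PowerSeries.exp ℚ)
          = PowerSeries.rescale (∑ a ∈ B, v a) (PowerSeries.exp ℚ) := fun B => by
        induction B using Finset.induction_on with
        | empty => ext n; simp
        | insert a B ha ihB =>
          rw [Finset.prod_insert ha, Finset.sum_insert ha, ihB, PowerSeries.exp_mul_exp_eq_exp_add]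
      rw [h2]
      ext n
      rw [map_sum, PowerSeries.coeff_rescale, PowerSeries.coeff_exp]
      simp only [PowerSeries.coeff_mk]
      have h4 := (Finset.prod_univ_sum (fun _ : Fin n => S) fun _ a => v a)
      rw [Finset.prod_const, Finset.card_univ, Fintype.card_fin] at h4
      rw [← Finset.mul_sum, Finset.sum_comm, h4]
      have h3 : ∀ f : Fin n → Λ,
          (∑ B ∈ S.powerset, if Finset.univ.image f = B then ∏ i, v (f i) else 0)
          = if f ∈ Fintype.piFinset (fun _ : Fin n => S) then ∏ i, v (f i) else 0 := fun f => by
        rw [Finset.sum_ite_eq]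
        congr 1
        simp [Finset.image_subset_iff]
      simp only [h3]
      rw [Finset.sum_ite_mem, Finset.univ_inter]
      simp [mul_comm]
    rw [← Finset.insert_erase (Finset.mem_powerset_self S), Finset.sum_insert (by simp),
      Finset.sum_insert (by simp)] at h1
    rw [Finset.sum_congr rfl fun B hB => ih B ?_] at h1
    · exact add_right_cancel h1
    · rw [Finset.mem_erase, Finset.mem_powerset] at hB
      exact hB.2.ssubset_of_ne hB.1

/-- A determinant is a multilinear function of its columns, and each column of `1 + B diag c` is a sum of
two terms. -/
theorem det_one_add_mul_diagonal {R : Type*} [CommRing R] (B : Matrix Λ Λ R) (c : Λ → R) :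
    (1 + B * Matrix.diagonal c).det = ∑ S : Finset Λ, (∏ a ∈ S, c a) *
      (Matrix.of fun a b => if b ∈ S then B a b else if a = b then 1 else 0).det := by
  have h := (Matrix.detRowAlternating (n := Λ) (R := R)).toMultilinearMap.map_add_univ
    (fun b a => c b * B a b) (fun b a => if a = b then 1 else 0)
  rw [← Matrix.det_transpose]
  refine Eq.trans ?_ (h.trans (Finset.sum_congr rfl fun S _ => ?_))
  · change _ = Matrix.det _
    congr 1
    ext b a
    simp [Matrix.mul_diagonal, Matrix.one_apply, add_comm, mul_comm]
  · have h2 := (Matrix.detRowAlternating (n := Λ) (R := R)).toMultilinearMap.map_piecewise_smul c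
      (fun b a => if b ∈ S then B a b else if a = b then 1 else 0) S
    rw [← Matrix.det_transpose]
    refine Eq.trans ?_ h2
    congr 1
    ext b a
    by_cases hb : b ∈ S <;> simp [Finset.piecewise, hb]

end BundleDet

/-! ### The Alexander polynomial -/

theorem val_unit_exp_zpow {e : ℤ} (he : e = 1 ∨ e = -1) :
    ((PowerSeries.isUnit_exp ℚ).unit ^ e).val = PowerSeries.rescale (e : ℚ) (PowerSeries.exp ℚ) := by
  rcases he with rfl | rfl
  · simp
  · rw [zpow_neg_one]
    refine Units.inv_eq_of_mul_eq_one_right ?_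
    have := PowerSeries.exp_mul_exp_eq_exp_add (A := ℚ) 1 (-1)
    simpa using this

namespace GaussDiagram

variable (G : GaussDiagram)

/-- The entry of the signed trapping matrix at two strands of a pair of bundles, the first of which comes
before the second one. -/
def upperEntry (a b : G.Crossing) : ℚ :=
  (if Before G.word (head a) (head b) ∨ a = b then 1 else 0)
    - (if Before G.word (tail a) (head b) then 1 else 0)

/-- The entry of the signed trapping matrix at two strands of a pair of bundles, the first of which comes
after the second one. -/
def lowerEntry (a b : G.Crossing) : ℚ :=
  (if Before G.word (head a) (head b) then 1 else 0)
    - (if Before G.word (tail a) (head b) then 1 else 0)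

/-- The signs of the crossings. -/
def signs (a : G.Crossing) : ℚ := ((G.sign a : ℤ) : ℚ)

theorem direction_eq (a : ℕ) : G.direction a = 1 ∨ G.direction a = -1 := by
  unfold direction
  split_ifs <;> simp

theorem not_inSpan_self (a : ℕ) : ¬ G.InSpan a a := by
  unfold InSpan
  omega

open Classical in
/-- Outside the diagonal the signed trapping matrix is the trapping matrix, with rows multiplied by minus the
directions of the arrows. -/
theorem lowerEntry_of_ne {a b : G.Crossing} (hab : a ≠ b) :
    G.lowerEntry a b = -(G.direction a : ℚ) * if G.InSpan a b then 1 else 0 := by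
  have hhead : ∀ c : G.Crossing, head (c : ℕ) ∈ G.word := fun c => by
    rcases mem_labels.1 c.2 with h | h
    exacts [(G.wf.2 _).1 h, h]
  have h1 : G.word.idxOf (head (a : ℕ)) ≠ G.word.idxOf (head (b : ℕ)) := fun h => by
    rw [List.idxOf_inj (hhead a)] at h
    exact hab (Subtype.ext (by simpa using h))
  have h2 : G.word.idxOf (tail (a : ℕ)) ≠ G.word.idxOf (head (b : ℕ)) := fun h => by
    rw [List.idxOf_inj ((G.wf.2 _).2 (hhead a))] at h
    simp at h
  unfold lowerEntry direction InSpan Before pos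
  rcases lt_or_ge (G.word.idxOf (tail (a : ℕ))) (G.word.idxOf (head (a : ℕ))) with hpq | hpq <;>
    rcases lt_or_gt_of_ne h1 with hqr | hqr <;>
    rcases lt_or_gt_of_ne h2 with hpr | hpr <;>
    simp [hpq, hqr, hpr, hqr.not_gt, hpr.not_gt, hpq.not_gt, le_of_lt] <;>
    omega

/-- The specialisation of the weight system with weight `-1` for all cycles of length at least `2` turns
the expansion into the Alexander polynomial. -/
theorem alexanderExp_eq : G.alexanderExp = PowerSeries.mk fun n => (n.factorial : ℚ)⁻¹ *
    bundleSum (fun k => if k = 1 then (0 : ℚ) else -1) G.upperEntry G.lowerEntry G.signs n := by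
  classical
  let ν : G.Crossing → ℚ := fun a => -(G.direction a : ℚ)
  have hν : ∀ a, ν a = 1 ∨ ν a = -1 := fun a => by
    rcases G.direction_eq a with h | h <;> simp [ν, h]
  let C : Matrix G.Crossing G.Crossing ℚ :=
    Matrix.of fun a b => if a = b then 0 else -G.lowerEntry a b
  let T : Matrix G.Crossing G.Crossing ℚ := Matrix.of fun a b => if G.InSpan a b then 1 else 0
  have hCT : ∀ a b, C a b = -ν a * T a b := fun a b => by
    by_cases hab : a = b
    · subst hab
      simp [C, T, G.not_inSpan_self]
    · simp only [C, T, ν, Matrix.of_apply, if_neg hab, G.lowerEntry_of_ne hab]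
      ring
  let D : Finset G.Crossing → ℚ := fun S =>
    (Matrix.of fun a b => if b ∈ S then -T a b else if a = b then 1 else 0).det
  have hD : ∀ S : Finset G.Crossing,
      (Matrix.of fun a b => if b ∈ S then ν b * C a b else if a = b then 1 else 0).det = D S :=
    fun S => by
    have hsq : ∀ a, ν a * ν a = 1 := fun a => by rcases hν a with h | h <;> rw [h] <;> norm_num
    -- conjugation by the directions removes the signs
    have h1 : (Matrix.of fun a b => if b ∈ S then ν b * C a b else if a = b then 1 else 0)
        = Matrix.diagonal ν *
          (Matrix.of fun a b => if b ∈ S then -T a b else if a = b then 1 else 0)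
          * Matrix.diagonal ν := by
      ext a b
      rw [Matrix.mul_diagonal, Matrix.diagonal_mul, Matrix.of_apply, Matrix.of_apply]
      split_ifs with h1 h2
      · rw [hCT]; ring
      · rw [h2, mul_one, hsq]
      · ring
    rw [h1, Matrix.det_mul, Matrix.det_mul, Matrix.det_diagonal, mul_right_comm,
      ← Finset.prod_mul_distrib, Finset.prod_congr rfl fun a _ => hsq a, Finset.prod_const_one,
      one_mul]
  -- the value for a map `f` only depends, up to the factors `ν`, on the set of the crossings it meets
  have hdet : ∀ {n} (f : Fin n → G.Crossing),
      cycleSum (fun k => if k = 1 then (0 : ℚ) else -1) (bundleMatrix G.upperEntry G.lowerEntry f)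
        Finset.univ = (∏ i, ν (f i)) * D (Finset.univ.image f) := fun {n} f => by
    rw [cycleSum_eq_det, ← hD]
    have h1 := det_bundle f ν hν C (fun a => by simp [C])
    refine Eq.trans ?_ (h1.trans ?_)
    · congr 1
      ext i j
      simp only [Matrix.of_apply, bundleMatrix]
      by_cases hij : i = j
      · subst hij
        simp [C]
      by_cases hf : f i = f j
      · rw [if_neg hij, if_neg hij, if_pos hf, hf]
        have hC : C (f j) (f j) = 0 := by simp [C]
        rw [hC]
        simp only [ν, direction, upperEntry, lowerEntry, Before, pos]
        by_cases hb : G.word.idxOf (tail (f j : ℕ)) < G.word.idxOf (head (f j : ℕ)) <;>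
          rcases lt_or_gt_of_ne hij with h | h <;> simp [hb, h, h.not_gt]
        all_goals norm_num
      · rw [if_neg hij, if_neg hij, if_neg hf, zero_add]
        have hu : G.upperEntry (f i) (f j) = G.lowerEntry (f i) (f j) := by
          simp [upperEntry, lowerEntry, hf]
        simp [C, hf, hu]
    · congr 3
      ext a b
      simp
  -- the entries of `X ^ (-S)` at `X = e ^ x`
  have hexp : ∀ a : G.Crossing, (LaurentPolynomial.eval₂ (Int.castRingHom (PowerSeries ℚ))
      (PowerSeries.isUnit_exp ℚ).unit (LaurentPolynomial.T (-((G.sign a : ℤ) * G.direction a))))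
      = PowerSeries.rescale (G.signs a * ν a) (PowerSeries.exp ℚ) := fun a => by
    rw [LaurentPolynomial.eval₂_T, val_unit_exp_zpow]
    · congr 2
      simp [signs, ν]
    · rcases Int.units_eq_one_or (G.sign a) with h | h <;> rcases G.direction_eq a with h' | h' <;>
        simp [h, h']
  have hleft : G.alexanderExp = (1 + (-(PowerSeries.C (R := ℚ)).mapMatrix T) *
      Matrix.diagonal fun a =>
        PowerSeries.rescale (G.signs a * ν a) (PowerSeries.exp ℚ) - 1).det := by
    rw [alexanderExp, alexander, RingHom.map_det]
    congr 1
    have h1 : (LaurentPolynomial.eval₂ (Int.castRingHom (PowerSeries ℚ))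
        (PowerSeries.isUnit_exp ℚ).unit).mapMatrix G.spanMatrix
        = (PowerSeries.C (R := ℚ)).mapMatrix T := by
      ext1 a b
      simp only [RingHom.mapMatrix_apply, Matrix.map_apply, spanMatrix, T, Matrix.of_apply]
      split_ifs <;> simp
    rw [map_add, map_one, map_mul, map_sub, map_one, h1]
    simp only [RingHom.mapMatrix_apply, Matrix.diagonal_map (map_zero _), hexp]
    rw [← Matrix.diagonal_one, ← Matrix.diagonal_sub, ← neg_sub, Matrix.mul_neg, Matrix.neg_mul]
  -- both sides are now sums over sets `S` of crossings, with the exponential generating function of the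
  -- maps onto `S`
  rw [hleft, det_one_add_mul_diagonal]
  have hdet' : ∀ S : Finset G.Crossing, (Matrix.of fun a b => if b ∈ S then
      (-(PowerSeries.C (R := ℚ)).mapMatrix T) a b else if a = b then 1 else 0).det
      = PowerSeries.C (D S) := fun S => by
    rw [RingHom.map_det]
    congr 1
    ext1 a b
    simp only [RingHom.mapMatrix_apply, Matrix.map_apply, Matrix.of_apply, Matrix.neg_apply]
    split_ifs <;> simp
  ext n
  rw [map_sum, PowerSeries.coeff_mk]
  simp only [hdet', ← sum_range_eq_prod_exp, PowerSeries.coeff_mul_C, PowerSeries.coeff_mk, bundleSum,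
    hdet, Finset.mul_sum, Finset.sum_mul]
  rw [Finset.sum_comm]
  refine Finset.sum_congr rfl fun f _ => ?_
  rw [Finset.sum_eq_single (Finset.univ.image f)]
  · rw [if_pos rfl, Finset.prod_mul_distrib, smul_eq_mul]
    ring
  · intro S _ hS
    rw [if_neg hS.symm]
    ring
  · simp

end GaussDiagram

/-! ### The expansion in terms of the Alexander polynomial -/

section Series

open PowerSeries

variable {Λ : Type*} [Fintype Λ] {R : Type*} [CommRing R] [Algebra ℚ R]

/-- The contribution of the single cycles to the value of a weight system on the expansion. -/
noncomputable def cycleSeries (y : ℕ → R) (P Q : Λ → Λ → ℚ) (v : Λ → ℚ) : PowerSeries R :=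
  mk fun k => if k = 0 then 0 else ((k.factorial : ℚ)⁻¹ * bundleCycle P Q v k) • y k

/-- A sum over all permutations is the exponential of the sum over the cycles. -/
theorem mk_bundleSum (y : ℕ → R) (P Q : Λ → Λ → ℚ) (v : Λ → ℚ) :
    (mk fun n => (n.factorial : ℚ)⁻¹ • bundleSum y P Q v n) = expSeries (cycleSeries y P Q v) := by
  have h0 : constantCoeff (cycleSeries y P Q v) = 0 := by
    rw [← coeff_zero_eq_constantCoeff_apply]
    simp [cycleSeries]
  -- the recursion for the cycle through one index is the differential equation of the exponential
  refine eq_of_derivative_eq_mul (F := cycleSeries y P Q v) ?_ (derivative_expSeries h0) ?_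
  · have hcast : ∀ (x : R) (n : ℕ), x * ((n : R) + 1) = ((n + 1 : ℕ) : ℚ) • x := fun x n => by
      rw [Nat.cast_smul_eq_nsmul, nsmul_eq_mul, mul_comm]
      push_cast
      rfl
    ext n
    rw [coeff_derivative, coeff_mk, coeff_mul, Finset.Nat.sum_antidiagonal_eq_sum_range_succ_mk,
      hcast, bundleSum_succ, Finset.smul_sum, Finset.smul_sum]
    refine Finset.sum_congr rfl fun k hk => ?_
    rw [coeff_derivative, cycleSeries, coeff_mk, coeff_mk, hcast, if_neg (Nat.succ_ne_zero k)]
    simp only [smul_mul_smul_comm, smul_smul]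
    congr 1
    rw [Nat.cast_choose ℚ (Nat.lt_succ_iff.1 (Finset.mem_range.1 hk)), Nat.factorial_succ,
      Nat.factorial_succ]
    have h1 := Nat.factorial_ne_zero n
    have h2 := Nat.factorial_ne_zero k
    have h3 := Nat.factorial_ne_zero (n - k)
    push_cast
    field_simp
  · rw [constantCoeff_expSeries, ← coeff_zero_eq_constantCoeff_apply]
    simp [bundleSum_zero]

end Series

theorem coeff_wheelSeries (f : PowerSeries ℚ) (n : ℕ) :
    PowerSeries.coeff n (wheelSeries f) = PowerSeries.coeff n f • wheel n := by
  simp [wheelSeries]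

namespace GaussDiagram

variable (G : GaussDiagram)

theorem coeff_expansion_knot (n : ℕ) :
    PowerSeries.coeff n G.knot.expansion = expansionCoeff G.word G.sign n :=
  PowerSeries.coeff_mk n (expansionCoeff G.word G.sign)

/-- Every weight system maps the expansion to an exponential of contributions of single cycles. Their
coefficients are the same for all weight systems. -/
theorem map_weightSystem_expansion {R : Type*} [CommRing R] [Algebra ℚ R] (y : ℕ → R) :
    PowerSeries.map (weightSystem y).toRingHom G.knot.expansion
      = expSeries (cycleSeries y G.upperEntry G.lowerEntry G.signs) := by
  rw [← mk_bundleSum]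
  ext n
  rw [PowerSeries.coeff_map, PowerSeries.coeff_mk, coeff_expansion_knot]
  exact weightSystem_expansionCoeff y G.wf G.sign n

theorem alexanderExp_eq_expSeries : G.alexanderExp = expSeries
    (cycleSeries (fun k => if k = 1 then (0 : ℚ) else -1) G.upperEntry G.lowerEntry G.signs) := by
  rw [alexanderExp_eq, ← mk_bundleSum]
  rfl

/-- The coefficients of the logarithm of the Alexander polynomial are, up to the sign, those of the single
cycles of length at least `2`. -/
theorem coeff_logOf_alexanderExp (k : ℕ) : PowerSeries.coeff k (PowerSeries.logOf G.alexanderExp)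
    = if k < 2 then 0 else
      -((k.factorial : ℚ)⁻¹ * bundleCycle G.upperEntry G.lowerEntry G.signs k) := by
  rw [alexanderExp_eq_expSeries, logOf_expSeries]
  · simp only [cycleSeries, PowerSeries.coeff_mk]
    rcases k with - | - | k <;> simp
  · rw [← PowerSeries.coeff_zero_eq_constantCoeff_apply]
    simp [cycleSeries]

theorem sl_knot : (G.knot.sl : ℚ) = ∑ a, G.signs a := by
  change ((G.writhe : ℤ) : ℚ) = _
  rw [writhe, ← Finset.sum_coe_sort]
  push_cast
  rfl

/-- The formula for the expansion. It suffices to compare the values of the universal weight system, in which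
the arrow and the wheels become independent variables. -/
theorem expansion_knot : G.knot.expansion =
    expSeries ((G.knot.sl : ℚ) • arrowSeries) *
      expSeries (-wheelSeries (PowerSeries.logOf G.alexanderExp)) := by
  have hinj := PowerSeries.map_injective
    (weightSystem (MvPolynomial.X : ℕ → MvPolynomial ℕ ℚ)).toRingHom weightSystem_X_injective
  apply hinj
  have h1 : ∀ k, PowerSeries.coeff k (PowerSeries.map
      (weightSystem (MvPolynomial.X : ℕ → MvPolynomial ℕ ℚ)).toRingHom
      ((G.knot.sl : ℚ) • arrowSeries)) = if k = 1 then (G.knot.sl : ℚ) • MvPolynomial.X 1 else 0 :=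
    fun k => by
      rw [PowerSeries.coeff_map]
      change weightSystem _ (PowerSeries.coeff k _) = _
      rw [PowerSeries.coeff_smul, map_smul, arrowSeries, PowerSeries.coeff_monomial]
      split_ifs
      · rw [weightSystem_D_A]
      · simp
  have h2 : ∀ k, PowerSeries.coeff k (PowerSeries.map
      (weightSystem (MvPolynomial.X : ℕ → MvPolynomial ℕ ℚ)).toRingHom
      (-wheelSeries (PowerSeries.logOf G.alexanderExp))) = if k < 2 then 0 else
        ((k.factorial : ℚ)⁻¹ * bundleCycle G.upperEntry G.lowerEntry G.signs k) • MvPolynomial.X k :=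
    fun k => by
      rw [PowerSeries.coeff_map]
      change weightSystem _ (PowerSeries.coeff k (-wheelSeries _)) = _
      rw [map_neg, map_neg]
      rw [coeff_wheelSeries, map_smul, coeff_logOf_alexanderExp]
      split_ifs with h
      · simp
      · rw [weightSystem_wheel _ (not_lt.1 h), neg_smul, neg_neg]
  rw [map_weightSystem_expansion, map_mul, map_expSeries, map_expSeries, ← expSeries_add]
  · congr 1
    ext1 k
    rw [map_add, h1, h2, cycleSeries, PowerSeries.coeff_mk]
    rcases k with - | - | k
    · simp
    · simp [bundleCycle_one, sl_knot]
    · simp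
  · rw [← PowerSeries.coeff_zero_eq_constantCoeff_apply, h1]; simp
  · rw [← PowerSeries.coeff_zero_eq_constantCoeff_apply, h2]; simp

theorem constantCoeff_alexanderExp : PowerSeries.constantCoeff G.alexanderExp = 1 := by
  rw [alexanderExp_eq_expSeries, constantCoeff_expSeries]

end GaussDiagram

/-! ### The reduced algebra -/

theorem toRed_D_A : toRed D_A = 0 := by
  have := RingQuot.mkAlgHom_rel ℚ RedRel.arrow
  exact this.trans (map_zero _)

theorem toRed_wheel_mul {k l : ℕ} (hk : k ≠ 1) (hl : l ≠ 1) :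
    toRed (wheel k) * toRed (wheel l) = toRed (wheel (k + l)) := by
  rw [← map_mul]
  exact RingQuot.mkAlgHom_rel ℚ (RedRel.wheels k l hk hl)

/-- The weight of all wheels in the reduced algebra is `1`. -/
theorem exists_reducedWeight : ∃ χ : Ared →ₐ[ℚ] ℚ, ∀ k, k ≠ 1 → χ (toRed (wheel k)) = 1 := by
  let y : ℕ → ℚ := fun k => if k = 1 then 0 else 1
  have hy : ∀ k, k ≠ 1 → weightSystem y (wheel k) = 1 := fun k hk => by
    rcases k with - | - | k
    · simp [wheel]
    · simp at hk
    · rw [weightSystem_wheel y (by omega)]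
      simp [y]
  have h : ∀ ⦃a b : Asw⦄, RedRel a b → weightSystem y a = weightSystem y b := fun a b hab => by
    cases hab with
    | arrow => rw [weightSystem_D_A, map_zero]; simp [y]
    | wheels k l hk hl =>
      have hkl : k + l ≠ 1 := by omega
      rw [map_mul, hy k hk, hy l hl, hy _ hkl, mul_one]
  refine ⟨RingQuot.liftAlgHom ℚ ⟨weightSystem y, h⟩, fun k hk => ?_⟩
  rw [← hy k hk]
  exact RingQuot.liftAlgHom_mkAlgHom_apply ..

theorem toRed_wheel_mem_degree (k : ℕ) : toRed (wheel k) ∈ Ared.degree k := by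
  cases k with
  | zero => exact Submodule.subset_span ⟨[], WF.nil, rfl, by
      have h : diagram [] = 1 := by
        rw [diagram, dif_pos WF.nil]
        exact map_one (MonoidAlgebra.of ℚ ArrowDiagram)
      rw [h, map_one, wheel]⟩
  | succ k =>
    have hl : (List.range k ++ [k]).Nodup := by rw [← List.range_succ]; exact List.nodup_range
    have h1 := clMap_tails_mul_bracket hl
    rw [List.length_range] at h1
    have hcard : (insert k (List.range k).toFinset).card = k + 1 := by
      rw [Finset.card_insert_of_notMem (by simp), List.toFinset_card_of_nodup List.nodup_range,
        List.length_range]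
    rw [← h1]
    refine Submodule.span_induction (p := fun x _ => toRed (clMap x) ∈ Ared.degree (k + 1))
      ?_ ?_ ?_ ?_ (wheel_mem_diagramWords hl)
    · rintro _ ⟨w, hw, hlw, rfl⟩
      refine Submodule.subset_span ⟨w, hw, by rw [hw.length_eq, hlw, hcard], ?_⟩
      rw [clMap_legWord, cl]
    · simp
    · intro x y _ _ hx hy
      rw [map_add, map_add]; exact add_mem hx hy
    · intro r x _ hx
      rw [map_smul, map_smul]; exact Submodule.smul_mem _ _ hx

/-- A product of wheels is a wheel in the reduced algebra, and products with arrows vanish. -/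
theorem degree_le_span_wheel (n : ℕ) : Ared.degree n ≤ ℚ ∙ toRed (wheel n) := by
  have key : ∀ n x, IsWheelMonomial n x → toRed x = 0 ∨ toRed x = toRed (wheel n) := fun n x hx => by
    induction hx with
    | one => exact Or.inr rfl
    | arrow _ _ => exact Or.inl (by rw [map_mul, toRed_D_A, mul_zero])
    | @wheel n k x hk _ ih =>
      rcases ih with h | h
      · exact Or.inl (by rw [map_mul, h, mul_zero])
      · by_cases hn : n = 1
        · exact Or.inl (by rw [map_mul, h, hn, wheel_one, map_zero, mul_zero])
        · exact Or.inr (by rw [map_mul, h, toRed_wheel_mul (by omega) hn, add_comm])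
  rw [Ared.degree, Submodule.span_le]
  rintro _ ⟨w, hw, hl, rfl⟩
  refine Submodule.span_induction (p := fun x _ => toRed x ∈ ℚ ∙ toRed (wheel n)) ?_ ?_ ?_ ?_
    (cl_mem_wheelSpan n hw hl)
  · intro x hx
    rcases key n x hx with h | h <;> rw [h]
    · exact zero_mem _
    · exact Submodule.mem_span_singleton_self _
  · simp
  · intro x y _ _ hx hy
    rw [map_add]; exact add_mem hx hy
  · intro r x _ hx
    rw [map_smul]; exact Submodule.smul_mem _ _ hx

theorem coeff_reducedWheels (f : PowerSeries ℚ) (n : ℕ) :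
    PowerSeries.coeff n (reducedWheels f) = PowerSeries.coeff n f • toRed (wheel n) := by
  change PowerSeries.coeff n (PowerSeries.map toRed.toRingHom (wheelSeries f)) = _
  rw [PowerSeries.coeff_map]
  change toRed (PowerSeries.coeff n (wheelSeries f)) = _
  rw [coeff_wheelSeries, map_smul]

theorem reducedWheels_mul {f g : PowerSeries ℚ} (hf : PowerSeries.coeff 1 f = 0)
    (hg : PowerSeries.coeff 1 g = 0) :
    reducedWheels (f * g) = reducedWheels f * reducedWheels g := by
  ext n
  rw [coeff_reducedWheels, PowerSeries.coeff_mul, PowerSeries.coeff_mul, Finset.sum_smul]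
  refine Finset.sum_congr rfl fun p hp => ?_
  rw [coeff_reducedWheels, coeff_reducedWheels, smul_mul_smul_comm]
  by_cases h1 : p.1 = 1
  · rw [h1, hf]; simp
  by_cases h2 : p.2 = 1
  · rw [h2, hg]; simp
  rw [toRed_wheel_mul h1 h2, Finset.HasAntidiagonal.mem_antidiagonal.1 hp]

/-- The wheel `w_n` spans the part of degree `n` of the reduced algebra. It has the weight `1` and so is not
zero if `n ≠ 1`, while `w₁ = 0`. -/
theorem bijOn_reducedWheels : Set.BijOn reducedWheels {f | PowerSeries.coeff 1 f = 0}
    {F | ∀ n, PowerSeries.coeff n F ∈ Ared.degree n} := by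
  refine ⟨?_, ?_, ?_⟩
  · intro f _ n
    rw [coeff_reducedWheels]
    exact Submodule.smul_mem _ _ (toRed_wheel_mem_degree n)
  · intro f hf g hg h
    obtain ⟨χ, hχ⟩ := exists_reducedWeight
    ext n
    by_cases hn : n = 1
    · rw [hn]; exact Eq.trans hf (Eq.symm hg)
    · have := congrArg (fun F => χ (PowerSeries.coeff n F)) h
      simpa [coeff_reducedWheels, hχ n hn] using this
  · intro F hF
    choose c hc using fun n => Submodule.mem_span_singleton.1 (degree_le_span_wheel n (hF n))
    -- the coefficient of degree `1` is irrelevant because `w₁ = 0`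
    refine ⟨PowerSeries.mk fun n => if n = 1 then 0 else c n, by simp, ?_⟩
    ext n
    rw [coeff_reducedWheels, PowerSeries.coeff_mk, ← hc n]
    split_ifs with hn
    · rw [hn, wheel_one, map_zero, smul_zero, smul_zero]
    · rfl

theorem coeff_one_pow {f : PowerSeries ℚ} (hf : PowerSeries.coeff 1 f = 0) (k : ℕ) :
    PowerSeries.coeff 1 (f ^ k) = 0 := by
  induction k with
  | zero => simp [PowerSeries.coeff_one]
  | succ k ih =>
    rw [pow_succ, PowerSeries.coeff_mul]
    simp [Finset.Nat.antidiagonal_succ, hf, ih]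

theorem reducedWheels_one : reducedWheels 1 = 1 := by
  ext n
  rw [coeff_reducedWheels, PowerSeries.coeff_one, PowerSeries.coeff_one]
  split_ifs with h
  · rw [h, wheel, map_one, one_smul]
  · rw [zero_smul]

theorem reducedWheels_pow {f : PowerSeries ℚ} (hf : PowerSeries.coeff 1 f = 0) (k : ℕ) :
    reducedWheels (f ^ k) = reducedWheels f ^ k := by
  induction k with
  | zero => rw [pow_zero, pow_zero, reducedWheels_one]
  | succ k ih => rw [pow_succ, pow_succ, reducedWheels_mul (coeff_one_pow hf k) hf, ih]

theorem reducedWheels_expSeries {f : PowerSeries ℚ} (hf : PowerSeries.coeff 1 f = 0) :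
    reducedWheels (expSeries f) = expSeries (reducedWheels f) := by
  ext n
  rw [coeff_reducedWheels, expSeries, expSeries, PowerSeries.coeff_mk, PowerSeries.coeff_mk,
    Finset.sum_smul]
  refine Finset.sum_congr rfl fun k _ => ?_
  rw [← reducedWheels_pow hf, coeff_reducedWheels, smul_assoc]

theorem expSeries_zero {A : Type*} [Ring A] [Algebra ℚ A] : expSeries (0 : PowerSeries A) = 1 := by
  ext n
  rw [expSeries, PowerSeries.coeff_mk, Finset.sum_eq_single 0]
  · simp
  · intro k _ hk
    simp [hk]
  · simp

namespace GaussDiagram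

variable (G : GaussDiagram)

theorem expSeries_logOf_alexanderExp :
    expSeries (PowerSeries.logOf G.alexanderExp) = G.alexanderExp := by
  have h0 : PowerSeries.constantCoeff (cycleSeries (fun k => if k = 1 then (0 : ℚ) else -1)
      G.upperEntry G.lowerEntry G.signs) = 0 := by
    rw [← PowerSeries.coeff_zero_eq_constantCoeff_apply]
    simp [cycleSeries]
  rw [alexanderExp_eq_expSeries, logOf_expSeries h0]

theorem coeff_one_alexanderExp : PowerSeries.coeff 1 G.alexanderExp = 0 := by
  rw [← expSeries_logOf_alexanderExp, expSeries, PowerSeries.coeff_mk]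
  simp [Finset.sum_range_succ, coeff_logOf_alexanderExp, PowerSeries.coeff_one]

theorem expSeries_neg_logOf_alexanderExp :
    expSeries (-PowerSeries.logOf G.alexanderExp) = G.alexanderExp⁻¹ := by
  have h0 : PowerSeries.constantCoeff (PowerSeries.logOf G.alexanderExp) = 0 :=
    PowerSeries.constantCoeff_logOf G.constantCoeff_alexanderExp
  rw [PowerSeries.eq_inv_iff_mul_eq_one (by rw [G.constantCoeff_alexanderExp]; exact one_ne_zero)]
  conv_lhs => arg 2; rw [← G.expSeries_logOf_alexanderExp]
  rw [← expSeries_add (by rw [map_neg, h0, neg_zero]) h0, neg_add_cancel, expSeries_zero]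

theorem map_toRed_expansion :
    PowerSeries.map toRed.toRingHom G.knot.expansion = reducedWheels (G.alexanderExp)⁻¹ := by
  have h1 : PowerSeries.map toRed.toRingHom ((G.knot.sl : ℚ) • arrowSeries) = 0 := by
    ext n
    rw [PowerSeries.coeff_map]
    change toRed (PowerSeries.coeff n _) = _
    rw [PowerSeries.coeff_smul, map_smul, arrowSeries, PowerSeries.coeff_monomial]
    split_ifs <;> simp [toRed_D_A]
  have h2 : PowerSeries.map toRed.toRingHom (-wheelSeries (PowerSeries.logOf G.alexanderExp))
      = reducedWheels (-PowerSeries.logOf G.alexanderExp) := by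
    rw [← map_neg]
    rfl
  rw [expansion_knot, map_mul, map_expSeries, map_expSeries, h1, h2, expSeries_zero, one_mul,
    ← reducedWheels_expSeries, expSeries_neg_logOf_alexanderExp]
  rw [map_neg, coeff_logOf_alexanderExp]
  simp

end GaussDiagram
end WKnots

theorem mainTheorem1 :
    (∀ (K : WKnots.WKnot) (G : WKnots.GaussDiagram), G.knot = K →
      K.expansion =
        WKnots.expSeries ((K.sl : ℚ) • WKnots.arrowSeries) *
          WKnots.expSeries (-WKnots.wheelSeries (PowerSeries.logOf G.alexanderExp))) ∧
    (Set.BijOn WKnots.reducedWheels {f | PowerSeries.coeff 1 f = 0}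
        {F | ∀ n, PowerSeries.coeff n F ∈ WKnots.Ared.degree n} ∧
      ∀ f g : PowerSeries ℚ, PowerSeries.coeff 1 f = 0 → PowerSeries.coeff 1 g = 0 →
        WKnots.reducedWheels (f * g) = WKnots.reducedWheels f * WKnots.reducedWheels g) ∧
    (∀ (K : WKnots.WKnot) (G : WKnots.GaussDiagram), G.knot = K →
      PowerSeries.constantCoeff G.alexanderExp = 1 ∧
        PowerSeries.coeff 1 G.alexanderExp = 0 ∧
        PowerSeries.map WKnots.toRed.toRingHom K.expansion =
          WKnots.reducedWheels (G.alexanderExp)⁻¹) := by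
  refine ⟨?_, ⟨WKnots.bijOn_reducedWheels, fun f g hf hg => WKnots.reducedWheels_mul hf hg⟩, ?_⟩
  · rintro _ G rfl
    exact G.expansion_knot
  · rintro _ G rfl
    exact ⟨G.constantCoeff_alexanderExp, G.coeff_one_alexanderExp, G.map_toRed_expansion⟩
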